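/- Let $\mathbb F$ be $\mathbb R$ or $\mathbb C$, $V=\mathbb F^n$ with $n\ge 1$, and $d\ge 2$. Identify $\mathbb F[x_1,\dots,x_n]_d$ with $S^d(V^*)$, paired naturally with $S^d(V)\subseteq V^{\otimes d}$. For forms $f_1,\dots,f_p$ of degree $d$ let $X=\{x\in V: f_1(x)=\dots=f_p(x)=0\}$ and $I_d=\operatorname{span}\{f_1,\dots,f_p\}$. A variety is non-degenerate of order $e$ if no non-zero form of degree $e$ vanishes identically on any of its irreducible components (for an irreducible variety: on the variety itself). A property holds for a generic element of a set $Y$ of tuples of vectors if it holds on a subset of $Y$ that is Zariski open and Zariski dense in $Y$. **Algorithm 1.** Input: a basis $u_1,\dots,u_R$ of a subspace $U\subseteq V$, and $f_1,\dots,f_p$. (1) Compute a basis $P_1,\dots,P_k$ of $S^d(U)\cap I_d^\perp$. If $k=0$, output "$U$ trivially intersects $X$". (2) If $k>R$, output "Fail". Otherwise run simultaneous diagonalization on $T=\sum_l e_l\otimes P_l\in\mathbb F^k\otimes V\otimes V^{\otimes(d-1)}$. If it outputs a decomposition of $T$ of the form $\{z_i\otimes y_i^{\otimes d}: 1\le i\le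 k\}$ with $z_1,\dots,z_k\in\mathbb F^k$ linearly independent and $y_1,\dots,y_k\in V$ linearly independent, output "the only elements of $U\cap X$ are $y_1,\dots,y_k$ (up to scale)"; otherwise output "Fail". **Simultaneous diagonalization** of $T\in\mathbb F^k\otimes V_2\otimes V_3$: choose independent random functionals $g,h$ on $\mathbb F^k$ from a law that gives mass $0$ to every proper subspace (such as the uniform spherical measure). Regard $T(g),T(h)$ as $\dim V_2\times\dim V_3$ matrices, let $(\cdot)^+$ be the Moore–Penrose pseudoinverse, and let $r=\operatorname{rank}(T(g)T(h)^+)$. Fail unless $T(g)T(h)^+$ has $r$ distinct non-zero eigenvalues $\lambda_1,\dots,\lambda_r\in\mathbb F$; let $v_a$ be eigenvectors. Fail unless the non-zero eigenvalues of $(T(g)^+T(h))^{\mathsf T}$, with multiplicity, are $\lambda_1^{-1},\dots,\lambda_r^{-1}$; let $w_a$ be corresponding eigenvectors. Choose functionals $h_a$ dual to $v_a\otimes w_a$ and put $x_a=T(h_a)$. Fail if $x_a\in\operatorname{span}\{x_b\}$ for some $a\ne b$; otherwise output $\{x_a\otimes v_a\otimes w_a\}$. Time is measured in the real model of computation: a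 random access machine with exact arithmetic operations and zero tests on elements of $\mathbb F$ at unit cost, and an oracle that diagonalizes matrices (calls on $N\times N$ matrices cost at least $N^2$ steps). **Theorem.** There are a program and constants $C,K$ (depending only on $\mathbb F$) such that the following hold. (a) For all $n\ge 2$, $d\ge 2$, linearly independent forms $f_1,\dots,f_p$ of degree $d$ and linearly independent $u_1,\dots,u_R\in V$, the program executes Algorithm 1 in at most $n^{Cd}$ steps, with at most $K$ oracle calls. (b) Every output of Algorithm 1 other than "Fail" is correct: if it outputs "$U$ trivially intersects $X$", then $U\cap X=\{0\}$; if it outputs $y_1,\dots,y_k$, then these are non-zero, pairwise non-parallel elements of $U\cap X$, and every element of $U\cap X$ is a scalar multiple of one of them. (c) Let $f_1,\dots,f_p$ be linearly independent forms of degree $d$ with $p=\delta\binom{n+d-1}{d}$, $\delta\in(0,1)$, let $R$ be an integer with $$0\le R\le\frac{1}{d!}\,\delta\,(n+d-1),$$ and let $s\in\{0,\dots,R\}$. If $s>0$, suppose that $X$ is non-degenerate of order $d-1$. Then for a generic element $(v_1,\dots,v_R)$ of $X^{s}\times V^{R-s}$ the vectors $v_1,\dots,v_R$ are linearly independent; the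 intersection of $U=\operatorname{span}\{v_1,\dots,v_R\}$ with $X$ consists, up to scalar multiples, of exactly the $s$ pairwise non-parallel elements $v_1,\dots,v_s$ (so $U\cap X=\{0\}$ if $s=0$); and on input $f_1,\dots,f_p$ and any basis of $U$, with probability $1$ over the random choices, Algorithm 1, and the program within $n^{Cd}$ steps and $K$ oracle calls, outputs "$U$ trivially intersects $X$" if $s=0$, and if $s>0$ outputs $v_1,\dots,v_s$ up to order and non-zero scalar factors. -/

import Mathlib

open MeasureTheory Topology

noncomputable section

namespace ConicIntersection

/-! ### The Zariski topology, genericity, non-degeneracy -/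

section AlgebraicGeometry

variable {ι : Type*} {𝕜 : Type*} [Field 𝕜]

/-- The variety in `𝕜^ι` cut out by a set of polynomials. -/
def zeroSet (S : Set (MvPolynomial ι 𝕜)) : Set (ι → 𝕜) :=
  {x | ∀ g ∈ S, MvPolynomial.eval x g = 0}

variable (ι 𝕜) in
/-- The Zariski topology on `𝕜^ι`: the closed sets are the varieties. -/
@[reducible] def zariski : TopologicalSpace (ι → 𝕜) :=
  TopologicalSpace.ofClosed {Z | ∃ S : Set (MvPolynomial ι 𝕜), Z = zeroSet S}
    ⟨{1}, by ext x; simp [zeroSet]⟩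
    (by
      intro A hA
      refine ⟨{g | ∃ Z ∈ A, ∀ x ∈ Z, MvPolynomial.eval x g = 0}, ?_⟩
      ext x
      constructor
      · rintro hx g ⟨Z, hZ, hg⟩
        exact hg x (hx Z hZ)
      · intro hx Z hZ
        obtain ⟨S, rfl⟩ := hA hZ
        intro g hg
        exact hx g ⟨_, hZ, fun y hy => hy g hg⟩)
    (by
      rintro _ ⟨S, rfl⟩ _ ⟨T, rfl⟩
      refine ⟨{g | ∃ a ∈ S, ∃ b ∈ T, g = a * b}, ?_⟩
      ext x
      constructor
      · rintro (hx | hx) _ ⟨a, ha, b, hb, rfl⟩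
        · simp [hx a ha]
        · simp [hx b hb]
      · intro hx
        by_contra hcon
        simp only [Set.mem_union, not_or, zeroSet, Set.mem_ofPred_eq, not_forall] at hcon
        obtain ⟨⟨a, ha, hxa⟩, ⟨b, hb, hxb⟩⟩ := hcon
        have := hx (a * b) ⟨a, ha, b, hb, rfl⟩
        rw [map_mul] at this
        exact (mul_ne_zero hxa hxb) this)

/-- `Z` is an irreducible component of the variety `X`: a maximal irreducible subset of `X`. -/
def IsComponent (X Z : Set (ι → 𝕜)) : Prop :=
  Maximal (fun Z => @IsIrreducible _ (zariski ι 𝕜) Z ∧ Z ⊆ X) Z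

/-- `X` is non-degenerate of order `e`: no non-zero form of degree `e` vanishes identically on an
irreducible component of `X`.  (If `X` is irreducible, its only component is `X`.) -/
def NonDegenerate (e : ℕ) (X : Set (ι → 𝕜)) : Prop :=
  ∀ Z, IsComponent X Z → ∀ g : MvPolynomial ι 𝕜, g.IsHomogeneous e →
    (∀ x ∈ Z, MvPolynomial.eval x g = 0) → g = 0

/-- The property `P` holds for a generically chosen element of a set `Y` of `R`-tuples of vectors
of `𝕜^n`: it holds on a subset of `Y` which is Zariski open and Zariski dense in `Y`.  Tuples are
regarded as points of the affine space `𝕜^(R × n)`. -/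
def Generically {R n : ℕ} (Y : Set (Fin R → Fin n → 𝕜)) (P : (Fin R → Fin n → 𝕜) → Prop) : Prop :=
  ∃ O : Set (Fin R × Fin n → 𝕜),
    IsOpen[zariski (Fin R × Fin n) 𝕜] O ∧
    Function.uncurry '' Y ⊆ closure[zariski (Fin R × Fin n) 𝕜] (Function.uncurry '' Y ∩ O) ∧
    ∀ v ∈ Y, Function.uncurry v ∈ O → P v

/-- The set `X^s × V^(R-s)` of `R`-tuples of vectors whose first `s` entries lie in `X`. -/
def plantedTuples {n : ℕ} (X : Set (Fin n → 𝕜)) (R s : ℕ) : Set (Fin R → Fin n → 𝕜) :=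
  {v | ∀ i : Fin R, (i : ℕ) < s → v i ∈ X}

/-- The elements of `S` other than `0` are, up to scalar multiples, exactly `v 0, …, v (k-1)`, and
these are non-zero and pairwise non-parallel.  For `k = 0` this says `S ⊆ {0}`. -/
def ExactlyUpToScale {V : Type*} [AddCommGroup V] [Module 𝕜 V] {k : ℕ} (S : Set V)
    (v : Fin k → V) : Prop :=
  (∀ i, v i ∈ S ∧ v i ≠ 0) ∧ (∀ i j, i ≠ j → ∀ c : 𝕜, v i ≠ c • v j) ∧
    ∀ x ∈ S, x = 0 ∨ ∃ i, ∃ c : 𝕜, x = c • v i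

end AlgebraicGeometry

/-! ### Symmetric tensors and the space searched by the algorithm -/

section Tensors

variable {𝕜 : Type*} [Field 𝕜] {n d : ℕ}

/-- The tensor `x_1 ⊗ ⋯ ⊗ x_d` in `(𝕜^n)^{⊗d}`, in coordinates. -/
def prodTensor (x : Fin d → Fin n → 𝕜) : (Fin d → Fin n) → 𝕜 := fun a => ∏ k, x k (a k)

variable (𝕜 n d) in
/-- The tensors which are invariant under permutations of the `d` tensor factors. -/
def symmetricTensors : Submodule 𝕜 ((Fin d → Fin n) → 𝕜) where
  carrier := {t | ∀ (π : Equiv.Perm (Fin d)) (a : Fin d → Fin n), t (a ∘ π) = t a}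
  add_mem' := fun hs ht π a => by simp [hs π a, ht π a]
  zero_mem' := fun _ _ => rfl
  smul_mem' := fun c t ht π a => by simp [ht π a]

variable (d) in
/-- The symmetric power `S^d(U)`: the symmetric tensors in `U^{⊗d}`. -/
def symPower (U : Submodule 𝕜 (Fin n → 𝕜)) : Submodule 𝕜 ((Fin d → Fin n) → 𝕜) :=
  Submodule.span 𝕜 {t | ∃ x : Fin d → Fin n → 𝕜, (∀ k, x k ∈ U) ∧ t = prodTensor x} ⊓
    symmetricTensors 𝕜 n d

/-- The exponent vector of the monomial `x_{a_1} ⋯ x_{a_d}`. -/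
def content (a : Fin d → Fin n) : Fin n →₀ ℕ := ∑ k, Finsupp.single (a k) 1

variable (d) in
/-- The symmetric tensor in `S^d(V^*)` that corresponds to a form of degree `d`: the product
`x_{a_1} ⋯ x_{a_d}` corresponds to the symmetrization of `x_{a_1} ⊗ ⋯ ⊗ x_{a_d}`. -/
def formTensor (g : MvPolynomial (Fin n) 𝕜) : (Fin d → Fin n) → 𝕜 := fun a =>
  g.coeff (content a) / ((Finset.univ.filter fun b : Fin d → Fin n => content b = content a).card : 𝕜)

variable (d) in
/-- The natural pairing of a form of degree `d`, as an element of `S^d(V^*)`, with a tensor. -/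
def pairing (g : MvPolynomial (Fin n) 𝕜) (t : (Fin d → Fin n) → 𝕜) : 𝕜 :=
  ∑ a, formTensor d g a * t a

variable (d) in
/-- `I_d^⊥ ⊆ S^d(V)`, where `I_d` is the span of the forms `f_i` of degree `d`. -/
def annihilator {p : ℕ} (f : Fin p → MvPolynomial (Fin n) 𝕜) :
    Submodule 𝕜 ((Fin d → Fin n) → 𝕜) where
  carrier := {t | t ∈ symmetricTensors 𝕜 n d ∧
    ∀ g ∈ Submodule.span 𝕜 (Set.range f), pairing d g t = 0}
  add_mem' := fun hs ht => ⟨add_mem hs.1 ht.1, fun g hg => by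
    have h1 := hs.2 g hg
    have h2 := ht.2 g hg
    simp only [pairing, Pi.add_apply, mul_add, Finset.sum_add_distrib] at h1 h2 ⊢
    rw [h1, h2, add_zero]⟩
  zero_mem' := ⟨zero_mem _, fun g _ => by simp [pairing]⟩
  smul_mem' := fun c t ht => ⟨Submodule.smul_mem _ c ht.1, fun g hg => by
    have h1 := ht.2 g hg
    simp only [pairing, Pi.smul_apply, smul_eq_mul] at h1 ⊢
    simp only [mul_left_comm _ c, ← Finset.mul_sum, h1, mul_zero]⟩

variable (d) in
/-- `S^d(U) ∩ I_d^⊥`, where `U` is spanned by the vectors `u_j`. -/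
def searchSpace {p R : ℕ} (f : Fin p → MvPolynomial (Fin n) 𝕜) (u : Fin R → Fin n → 𝕜) :
    Submodule 𝕜 ((Fin d → Fin n) → 𝕜) :=
  symPower d (Submodule.span 𝕜 (Set.range u)) ⊓ annihilator d f

end Tensors

/-! ### The simultaneous diagonalization algorithm -/

section SimultaneousDiagonalization

variable {𝕜 : Type*} [RCLike 𝕜] {ι κ : Type*} [Fintype ι] [Fintype κ]
  [DecidableEq ι] [DecidableEq κ]

/-- `B` is the Moore–Penrose pseudoinverse of `A`. -/
def IsMoorePenrose (A : Matrix ι κ 𝕜) (B : Matrix κ ι 𝕜) : Prop :=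
  A * B * A = A ∧ B * A * B = B ∧ (A * B).IsHermitian ∧ (B * A).IsHermitian

/-- The contraction `T(f)` of a three-mode tensor, given by its slices, with a functional in the
first mode. -/
def contract {k : ℕ} (T : Fin k → Matrix ι κ 𝕜) (f : Fin k → 𝕜) : Matrix ι κ 𝕜 :=
  ∑ l, f l • T l

/-- The contraction `T(h)` of a three-mode tensor with a functional on the last two modes. -/
def contractRight {k : ℕ} (T : Fin k → Matrix ι κ 𝕜) (h : ι → κ → 𝕜) : Fin k → 𝕜 :=
  fun l => ∑ i, ∑ j, h i j * T l i j

/-- The non-zero eigenvalues of `M`, counted with multiplicity, are the pairwise distinct scalars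
`ev a`, one for each `a < r = rank M`, with eigenvectors `v a`. -/
def IsSimpleEigensystem (M : Matrix ι ι 𝕜) {r : ℕ} (ev : Fin r → 𝕜) (v : Fin r → ι → 𝕜) : Prop :=
  M.rank = r ∧ Function.Injective ev ∧
    ∀ a, ev a ≠ 0 ∧ v a ≠ 0 ∧ M.mulVec (v a) = ev a • v a

variable (𝕜 ι κ) in
/-- Output of the simultaneous diagonalization algorithm: failure, or vectors `x a, v a, w a`
(`a < r`) standing for the decomposition into the terms `x a ⊗ v a ⊗ w a`. -/
inductive SimDiagOutput (k : ℕ) : Type _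
  | fail : SimDiagOutput k
  | decomposition (r : ℕ) (x : Fin r → Fin k → 𝕜) (v : Fin r → ι → 𝕜) (w : Fin r → κ → 𝕜) :
      SimDiagOutput k

/-- The possible outputs of the simultaneous diagonalization algorithm on `T ∈ 𝕜^k ⊗ 𝕜^ι ⊗ 𝕜^κ`
when the functionals chosen in its first step are `f` and `g`.  The eigenvectors and the dual
functionals `h` may be chosen arbitrarily. -/
inductive SimDiag {k : ℕ} (T : Fin k → Matrix ι κ 𝕜) (f g : Fin k → 𝕜) :
    SimDiagOutput 𝕜 ι κ k → Prop
  | noEigensystem (G : Matrix κ ι 𝕜) (hG : IsMoorePenrose (contract T g) G)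
      (hM : ∀ (r : ℕ) (ev : Fin r → 𝕜) (v : Fin r → ι → 𝕜),
        ¬ IsSimpleEigensystem (contract T f * G) ev v) :
      SimDiag T f g .fail
  | notReciprocal (F G : Matrix κ ι 𝕜) (hF : IsMoorePenrose (contract T f) F)
      (hG : IsMoorePenrose (contract T g) G) (r : ℕ) (ev : Fin r → 𝕜) (v : Fin r → ι → 𝕜)
      (hM : IsSimpleEigensystem (contract T f * G) ev v)
      (hN : ∀ w : Fin r → κ → 𝕜,
        ¬ IsSimpleEigensystem (F * contract T g).transpose (fun a => (ev a)⁻¹) w) :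
      SimDiag T f g .fail
  | parallel (F G : Matrix κ ι 𝕜) (hF : IsMoorePenrose (contract T f) F)
      (hG : IsMoorePenrose (contract T g) G) (r : ℕ) (ev : Fin r → 𝕜) (v : Fin r → ι → 𝕜)
      (w : Fin r → κ → 𝕜)
      (hM : IsSimpleEigensystem (contract T f * G) ev v)
      (hN : IsSimpleEigensystem (F * contract T g).transpose (fun a => (ev a)⁻¹) w)
      (h : Fin r → ι → κ → 𝕜)
      (hdual : ∀ a b, ∑ i, ∑ j, h a i j * (v b i * w b j) = if a = b then 1 else 0)
      (a b : Fin r) (hab : a ≠ b)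
      (hpar : contractRight T (h a) ∈ Submodule.span 𝕜 {contractRight T (h b)}) :
      SimDiag T f g .fail
  | success (F G : Matrix κ ι 𝕜) (hF : IsMoorePenrose (contract T f) F)
      (hG : IsMoorePenrose (contract T g) G) (r : ℕ) (ev : Fin r → 𝕜) (v : Fin r → ι → 𝕜)
      (w : Fin r → κ → 𝕜)
      (hM : IsSimpleEigensystem (contract T f * G) ev v)
      (hN : IsSimpleEigensystem (F * contract T g).transpose (fun a => (ev a)⁻¹) w)
      (h : Fin r → ι → κ → 𝕜)
      (hdual : ∀ a b, ∑ i, ∑ j, h a i j * (v b i * w b j) = if a = b then 1 else 0)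
      (hpar : ∀ a b, a ≠ b →
        contractRight T (h a) ∉ Submodule.span 𝕜 {contractRight T (h b)}) :
      SimDiag T f g (.decomposition r (fun a => contractRight T (h a)) v w)

end SimultaneousDiagonalization

/-! ### The algorithm for computing `U ∩ X` -/

section Algorithm

variable {𝕜 : Type*} [RCLike 𝕜] {n d : ℕ}

/-- The outputs "`U` trivially intersects `X`", "the only elements of `U ∩ X` are
`v 0, …, v (k-1)` (up to scale)", and "Fail". -/
inductive Output (𝕜 : Type*) (n : ℕ) : Type _
  | trivial : Output 𝕜 n
  | points (k : ℕ) (v : Fin k → Fin n → 𝕜) : Output 𝕜 n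
  | fail : Output 𝕜 n

/-- `∑ e_l ⊗ P_l ∈ 𝕜^k ⊗ V^{⊗d}`, regarded as a tensor in `𝕜^k ⊗ V ⊗ V^{⊗(d-1)}`. -/
def flatten {k : ℕ} (P : Fin k → (Fin d → Fin n) → 𝕜) :
    Fin k → Matrix (Fin n) (Fin (d - 1) → Fin n) 𝕜 :=
  fun l => Matrix.of fun a b =>
    P l fun i => if h : (i : ℕ) = 0 then a else b ⟨(i : ℕ) - 1, by omega⟩

/-- The output `o` is a decomposition of `T = ∑ e_l ⊗ P_l` of the form `{z_a ⊗ y_a^{⊗d} : a < k}`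
with linearly independent `z_a ∈ 𝕜^k` and linearly independent `y_a ∈ V`. -/
def IsPowerDecomposition {k : ℕ} (P : Fin k → (Fin d → Fin n) → 𝕜)
    (o : SimDiagOutput 𝕜 (Fin n) (Fin (d - 1) → Fin n) k) (y : Fin k → Fin n → 𝕜) : Prop :=
  ∃ (x : Fin k → Fin k → 𝕜) (v : Fin k → Fin n → 𝕜) (w : Fin k → (Fin (d - 1) → Fin n) → 𝕜),
    o = .decomposition k x v w ∧
    (∀ l a b, flatten P l a b = ∑ i, x i l * v i a * w i b) ∧
    ∃ z : Fin k → Fin k → 𝕜, LinearIndependent 𝕜 z ∧ LinearIndependent 𝕜 y ∧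
      ∀ i l a b, x i l * v i a * w i b =
        flatten (fun l' : Fin k => z i l' • prodTensor fun _ : Fin d => y i) l a b

/-- The random choices of the algorithm: for every `k` a pair of vectors of `𝕜^k`, of which the
algorithm uses the one with `k = dim (S^d(U) ∩ I_d^⊥)` as the pair `f, g` of functionals. -/
abbrev RandomTape (𝕜 : Type*) := ∀ k : ℕ, (Fin k → 𝕜) × (Fin k → 𝕜)

/-- `P` is a basis of `S^d(U) ∩ I_d^⊥`. -/
def IsSearchBasis {p R k : ℕ} (f : Fin p → MvPolynomial (Fin n) 𝕜) (u : Fin R → Fin n → 𝕜)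
    (P : Fin k → (Fin d → Fin n) → 𝕜) : Prop :=
  LinearIndependent 𝕜 P ∧ Submodule.span 𝕜 (Set.range P) = searchSpace d f u

/-- The possible outputs of the algorithm on an `R`-dimensional subspace `U`, when `P` is the basis
of `S^d(U) ∩ I_d^⊥` that it has computed and `rnd` are its random choices.  (The basis is chosen
before, and independently of, the random functionals.) -/
inductive Algorithm1 (R : ℕ) {k : ℕ} (P : Fin k → (Fin d → Fin n) → 𝕜) (rnd : RandomTape 𝕜) :
    Output 𝕜 n → Prop
  | trivial (hk : k = 0) : Algorithm1 R P rnd .trivial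
  | tooLarge (hkR : R < k) : Algorithm1 R P rnd .fail
  | points (hk : 0 < k) (hkR : k ≤ R) (o : SimDiagOutput 𝕜 (Fin n) (Fin (d - 1) → Fin n) k)
      (ho : SimDiag (flatten P) (rnd k).1 (rnd k).2 o)
      (y : Fin k → Fin n → 𝕜) (hy : IsPowerDecomposition P o y) :
      Algorithm1 R P rnd (.points k y)
  | noDecomposition (hk : 0 < k) (hkR : k ≤ R)
      (o : SimDiagOutput 𝕜 (Fin n) (Fin (d - 1) → Fin n) k)
      (ho : SimDiag (flatten P) (rnd k).1 (rnd k).2 o)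
      (hy : ∀ y : Fin k → Fin n → 𝕜, ¬ IsPowerDecomposition P o y) :
      Algorithm1 R P rnd .fail

/-- What a run that does not fail claims about `U ∩ X` is true. -/
def Output.Sound (S : Set (Fin n → 𝕜)) : Output 𝕜 n → Prop
  | .trivial => S = {0}
  | .points _ v => ExactlyUpToScale (𝕜 := 𝕜) S v
  | .fail => True

/-- The output is "`U` trivially intersects `X`" if `s = 0`, and otherwise it is the list of the
points `v 0, …, v (s-1)`, in some order and up to non-zero scalar factors. -/
def Output.Recovers {s : ℕ} (v : Fin s → Fin n → 𝕜) (o : Output 𝕜 n) : Prop :=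
  (s = 0 ∧ o = .trivial) ∨
  (0 < s ∧ ∃ y : Fin s → Fin n → 𝕜, o = .points s y ∧
    ∃ π : Equiv.Perm (Fin s), ∀ i, ∃ c : 𝕜, c ≠ 0 ∧ y i = c • v (π i))

end Algorithm

/-! ### The real model of computation

A random access machine, programmed in a language of while programs, whose memory consists of
registers and two-dimensional tables of natural numbers (for indices and control), and of
two-dimensional tables of scalars, on which it performs exact field operations and tests for zero
at unit cost.  Natural numbers are only added and subtracted, so that they cannot be used to pack
information.  The machine has access to an oracle which diagonalizes matrices. -/

section Machine

/-- Expressions with values in the natural numbers; `sub` is truncated subtraction. -/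
inductive IExpr : Type
  | const (c : ℕ)
  | reg (x : ℕ)
  | cell (tab : ℕ) (i j : IExpr)
  | add (a b : IExpr)
  | sub (a b : IExpr)

/-- Expressions with scalar values. -/
inductive SExpr : Type
  | zero
  | one
  | cell (tab : ℕ) (i j : IExpr)
  | add (a b : SExpr)
  | sub (a b : SExpr)
  | mul (a b : SExpr)
  | div (a b : SExpr)
  | conj (a : SExpr)

/-- Programs.  `diag A E V flag N` calls the oracle on the `N × N` matrix stored in table `A`; if
the matrix is diagonalizable, eigenvalues are written to row `0` of table `E`, a matrix whose columns
are corresponding eigenvectors to table `V`, and `1` to register `flag`; otherwise `0` is written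
to register `flag`. -/
inductive Program : Type
  | skip
  | seq (P Q : Program)
  | setReg (x : ℕ) (e : IExpr)
  | setICell (tab : ℕ) (i j e : IExpr)
  | setSCell (tab : ℕ) (i j : IExpr) (e : SExpr)
  | ifLt (a b : IExpr) (P Q : Program)
  | ifZero (e : SExpr) (P Q : Program)
  | whileLt (a b : IExpr) (P : Program)
  | diag (A E V flag : ℕ) (N : IExpr)

variable {𝕜 : Type*} [RCLike 𝕜]

/-- The memory of the machine. -/
@[ext]
structure Memory (𝕜 : Type*) where
  reg : ℕ → ℕ
  icell : ℕ → ℕ → ℕ → ℕ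
  scell : ℕ → ℕ → ℕ → 𝕜

/-- Value of an expression. -/
def IExpr.eval (m : Memory 𝕜) : IExpr → ℕ
  | .const c => c
  | .reg x => m.reg x
  | .cell tab i j => m.icell tab (i.eval m) (j.eval m)
  | .add a b => a.eval m + b.eval m
  | .sub a b => a.eval m - b.eval m

/-- Number of operations in the evaluation of an expression. -/
def IExpr.size : IExpr → ℕ
  | .const _ => 1
  | .reg _ => 1
  | .cell _ i j => i.size + j.size + 1
  | .add a b => a.size + b.size + 1
  | .sub a b => a.size + b.size + 1

/-- Value of an expression. -/
def SExpr.eval (m : Memory 𝕜) : SExpr → 𝕜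
  | .zero => 0
  | .one => 1
  | .cell tab i j => m.scell tab (i.eval m) (j.eval m)
  | .add a b => a.eval m + b.eval m
  | .sub a b => a.eval m - b.eval m
  | .mul a b => a.eval m * b.eval m
  | .div a b => a.eval m / b.eval m
  | .conj a => star (a.eval m)

/-- Number of operations in the evaluation of an expression. -/
def SExpr.size : SExpr → ℕ
  | .zero => 1
  | .one => 1
  | .cell _ i j => i.size + j.size + 1
  | .add a b => a.size + b.size + 1
  | .sub a b => a.size + b.size + 1
  | .mul a b => a.size + b.size + 1
  | .div a b => a.size + b.size + 1
  | .conj a => a.size + 1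

/-- Overwrite a register. -/
def Memory.setReg (m : Memory 𝕜) (x v : ℕ) : Memory 𝕜 :=
  { m with reg := Function.update m.reg x v }

/-- Overwrite a cell of a table of natural numbers. -/
def Memory.setICell (m : Memory 𝕜) (tab i j v : ℕ) : Memory 𝕜 :=
  { m with icell := fun t a b => if t = tab ∧ a = i ∧ b = j then v else m.icell t a b }

/-- Overwrite a cell of a table of scalars. -/
def Memory.setSCell (m : Memory 𝕜) (tab i j : ℕ) (v : 𝕜) : Memory 𝕜 :=
  { m with scell := fun t a b => if t = tab ∧ a = i ∧ b = j then v else m.scell t a b }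

/-- Overwrite the upper left block of a table of scalars by a matrix. -/
def Memory.setBlock {r c : ℕ} (m : Memory 𝕜) (tab : ℕ) (M : Matrix (Fin r) (Fin c) 𝕜) : Memory 𝕜 :=
  { m with
    scell := fun t a b =>
      if h : t = tab ∧ a < r ∧ b < c then M ⟨a, h.2.1⟩ ⟨b, h.2.2⟩ else m.scell t a b }

/-- The upper left `N × N` block of a table of scalars. -/
def Memory.block (m : Memory 𝕜) (tab N : ℕ) : Matrix (Fin N) (Fin N) 𝕜 :=
  Matrix.of fun i j => m.scell tab i j

/-- An oracle that answers the question for a diagonalization of a matrix. -/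
abbrev DiagOracle (𝕜 : Type*) :=
  ∀ N : ℕ, Matrix (Fin N) (Fin N) 𝕜 → Option ((Fin N → 𝕜) × Matrix (Fin N) (Fin N) 𝕜)

/-- The answers are correct: a matrix that is diagonalizable over `𝕜` is diagonalized, all other
matrices are refused. -/
def DiagOracle.Valid (O : DiagOracle 𝕜) : Prop :=
  ∀ (N : ℕ) (A : Matrix (Fin N) (Fin N) 𝕜),
    match O N A with
    | some (ev, V) => IsUnit V ∧ A * V = V * Matrix.diagonal ev
    | none => ¬ ∃ (ev : Fin N → 𝕜) (V : Matrix (Fin N) (Fin N) 𝕜),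
        IsUnit V ∧ A * V = V * Matrix.diagonal ev

/-- The effect of an oracle call. -/
def Memory.diag (O : DiagOracle 𝕜) (m : Memory 𝕜) (A E V flag N : ℕ) : Memory 𝕜 :=
  match O N (m.block A N) with
  | some (ev, W) =>
      ((m.setBlock E (Matrix.of fun (_ : Fin 1) j => ev j)).setBlock V W).setReg flag 1
  | none => m.setReg flag 0

/-- `Exec O P m m' t q`: with oracle `O`, program `P` started in memory `m` halts in memory `m'`
after `t` steps and `q` oracle calls.  An oracle call on an `N × N` matrix counts as at least
`N * N` steps, so that a bound on the time also bounds the size of the matrices. -/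
inductive Exec (O : DiagOracle 𝕜) : Program → Memory 𝕜 → Memory 𝕜 → ℕ → ℕ → Prop
  | skip (m) : Exec O .skip m m 1 0
  | seq {P Q m₁ m₂ m₃ t₁ t₂ q₁ q₂} (h₁ : Exec O P m₁ m₂ t₁ q₁) (h₂ : Exec O Q m₂ m₃ t₂ q₂) :
      Exec O (.seq P Q) m₁ m₃ (t₁ + t₂) (q₁ + q₂)
  | setReg (x e m) : Exec O (.setReg x e) m (m.setReg x (e.eval m)) (e.size + 1) 0
  | setICell (tab i j e m) :
      Exec O (.setICell tab i j e) m (m.setICell tab (i.eval m) (j.eval m) (e.eval m))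
        (i.size + j.size + e.size + 1) 0
  | setSCell (tab i j e m) :
      Exec O (.setSCell tab i j e) m (m.setSCell tab (i.eval m) (j.eval m) (e.eval m))
        (i.size + j.size + e.size + 1) 0
  | ifLtTrue {a b P Q m m' t q} (h : a.eval m < b.eval m) (hP : Exec O P m m' t q) :
      Exec O (.ifLt a b P Q) m m' (a.size + b.size + 1 + t) q
  | ifLtFalse {a b P Q m m' t q} (h : ¬ a.eval m < b.eval m) (hQ : Exec O Q m m' t q) :
      Exec O (.ifLt a b P Q) m m' (a.size + b.size + 1 + t) q
  | ifZeroTrue {e P Q m m' t q} (h : e.eval m = 0) (hP : Exec O P m m' t q) :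
      Exec O (.ifZero e P Q) m m' (e.size + 1 + t) q
  | ifZeroFalse {e P Q m m' t q} (h : e.eval m ≠ 0) (hQ : Exec O Q m m' t q) :
      Exec O (.ifZero e P Q) m m' (e.size + 1 + t) q
  | whileDone {a b P m} (h : ¬ a.eval m < b.eval m) :
      Exec O (.whileLt a b P) m m (a.size + b.size + 1) 0
  | whileStep {a b P m₁ m₂ m₃ t₁ t₂ q₁ q₂} (h : a.eval m₁ < b.eval m₁)
      (h₁ : Exec O P m₁ m₂ t₁ q₁) (h₂ : Exec O (.whileLt a b P) m₂ m₃ t₂ q₂) :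
      Exec O (.whileLt a b P) m₁ m₃ (a.size + b.size + 1 + t₁ + t₂) (q₁ + q₂)
  | diag (A E V flag N m) :
      Exec O (.diag A E V flag N) m (m.diag O A E V flag (N.eval m))
        (N.size + N.eval m * N.eval m + 1) 1

/-- The initial memory.  Registers `0, 1, 2, 3` hold `n, d, p, R`.  In table `0` of scalars, the
entry in row `i` and column `∑ a_k n^k` is the coefficient of `x_{a_1} ⋯ x_{a_d}` in `f_i`; row `j`
of table `1` holds `u_j`; row `k` of tables `2` and `3` holds the random vectors of length `k`.
All other cells hold zero. -/
def initialMemory {n : ℕ} (d : ℕ) {p R : ℕ} (f : Fin p → MvPolynomial (Fin n) 𝕜)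
    (u : Fin R → Fin n → 𝕜) (rnd : RandomTape 𝕜) : Memory 𝕜 where
  reg := fun x =>
    if x = 0 then n else if x = 1 then d else if x = 2 then p else if x = 3 then R else 0
  icell := fun _ _ _ => 0
  scell := fun tab i j =>
    if tab = 0 then
      if h : i < p ∧ j < n ^ d then
        (f ⟨i, h.1⟩).coeff (content (finFunctionFinEquiv.symm ⟨j, h.2⟩)) else 0
    else if tab = 1 then if h : i < R ∧ j < n then u ⟨i, h.1⟩ ⟨j, h.2⟩ else 0
    else if tab = 2 then if h : j < i then (rnd i).1 ⟨j, h⟩ else 0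
    else if tab = 3 then if h : j < i then (rnd i).2 ⟨j, h⟩ else 0
    else 0

/-- The output is read off from the final memory: register `0` holds `0` for "trivial", `1` for a
list of points, whose number is in register `1` and whose coordinates are in the rows of table
`0` of scalars, and any other number for "Fail". -/
def Memory.output (n : ℕ) (m : Memory 𝕜) : Output 𝕜 n :=
  if m.reg 0 = 0 then .trivial
  else if m.reg 0 = 1 then .points (m.reg 1) fun i j => m.scell 0 i j
  else .fail

/-- With oracle `O`, the program halts on the given input within `t` steps and `q` oracle calls,
with an output that satisfies `Q`. -/
def HaltsWithin (O : DiagOracle 𝕜) (prog : Program) (t q : ℕ) {n : ℕ} (d : ℕ) {p R : ℕ}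
    (f : Fin p → MvPolynomial (Fin n) 𝕜) (u : Fin R → Fin n → 𝕜) (rnd : RandomTape 𝕜)
    (Q : Output 𝕜 n → Prop) : Prop :=
  ∃ (m : Memory 𝕜) (t' q' : ℕ), Exec O prog (initialMemory d f u rnd) m t' q' ∧
    t' ≤ t ∧ q' ≤ q ∧ Q (m.output n)

end Machine

/-- The law of the random choices if, for every `k`, the two vectors in `𝕜^k` are drawn
independently of each other from `σ k`. -/
def tapeLaw {𝕜 : Type*} [MeasurableSpace 𝕜] (σ : ∀ k : ℕ, Measure (Fin k → 𝕜))
    [∀ k, IsProbabilityMeasure (σ k)] : Measure (RandomTape 𝕜) :=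
  Measure.infinitePi fun k => (σ k).prod (σ k)

end ConicIntersection

end

open ConicIntersection

set_option linter.unusedSectionVars false

noncomputable section

namespace ConicIntersection

section

/-! ### Counted loops -/

/-! Reduction to powers. Pairing a form with `x^{⊗d}` evaluates it at `x` (`eval_eq_pairing`), so
`x` lies in `U ∩ X` if and only if `x^{⊗d}` lies in the search space `S^d(U) ∩ I_d^⊥`
(`power_mem_searchSpace`). If that space is spanned by the powers of linearly independent vectors
`y_i`, then the only powers in it are those of multiples of the `y_i`
(`parallel_of_power_mem_span`), and `U ∩ X` is known. For a basis `P_l = ∑ z_i(l) y_i^{⊗d}`, the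
slices `T(f)` and `T(g)` factor as `Y D_f W` and `Y D_g W`, so `T(f) T(g)^+` has the eigenvectors
`y_i` with eigenvalues `(f·z_i)/(g·z_i)`. `IsPowerPencil` records this situation together with the
genericity of `f` and `g`. It forces every run to output the `y_i` (`IsPowerPencil.eq_points`), and
conversely every successful run exhibits it (`exists_isPowerPencil`). This gives soundness
(`algorithm1_sound`) and, since the bad `f` and `g` lie in proper subspaces, success with
probability one (`ae_generic`, `ae_recovers`).

Genericity. Symmetric tensors are translated into forms, with `v^{⊗d}` becoming the power `ℓ^d` of
the linear form `ℓ = linForm v`. Let `K` be the space of forms orthogonal to all `f_j`; its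
codimension among the forms of degree `d` is at least `p ≥ R n^{d-1}` (`le_dimMod_orthogonalForms`,
`mul_pow_le_of_le`). The claim (`exists_avoids`) is that for a general tuple a form of degree `d` in
the `ℓ_i` lies in `K` only if it is a combination of the planted powers `ℓ_i^d`. The induction is on
`R`. Expand the form as `∑ ℓ^e c_e` in the first linear form `ℓ`, with `c_e` in the others.
Comparing lowest terms puts `c_e` into the space `residual`, consisting of the `g` with `ℓ^e g ∈ K +
ℓ^{e+1} S_{d-e-1}`, where `S_m` denotes the forms of degree `m`. So it is enough that the remaining
vectors avoid these spaces (`avoids_cons`), and the induction hypothesis needs them to have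
codimension at least `R n^{d-e-1}`. This is an averaging argument (`exists_le_dimMod`): if no
non-zero form of degree `e` vanishes on `Z`, then at most `n^e` powers `ℓ_x^e` with `x ∈ Z` span
`S_e`, hence `S_d` is the sum of at most `n^e` spaces `ℓ_x^e S_{d-e}`, one of which has dimension at
least `(R+1) n^{d-1-e}` modulo `K`; passing to `K + ℓ^{e+1} S_{d-e-1}` costs at most `n^{d-e-1}`.
Only `e ≤ d-1` occurs for planted vectors, which is why non-degeneracy of order `d-1` is enough. All
conditions are non-vanishing of determinants on a product of irreducible sets
(`holdsOff_linearIndependent`, `polyIrreducible_tupleProduct`), so one good tuple per condition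
yields a generic property (`generically_of_holdsOff`).

The program. Orthogonalization without normalization needs only field operations and conjugation.
Applied twice, it yields a basis of the search space (`searchTables_isSearchBasis`). Applied to the
columns of `T(g)`, with those of `T(f)` carried along, it yields a `k × k` matrix `M` which, for a
power pencil, is similar to the diagonal matrix of the quotients `(f·z_i)/(g·z_i)`
(`IsPencilMatrix.exists_similar`). One oracle call diagonalizes `M`. The resulting vectors are
accepted if the eigenvalues are distinct and non-zero and the powers lie in the search space, which
happens precisely for power pencils (`IsPowerPencil.check`, `exists_isPowerPencil_of_check`), so
whatever the program answers is an admissible output of the algorithm. Running times come from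
syntactic bounds for counted loops (`Loop.exec_toProgram`, `Loop.exists_cost_le`). -/

/-- Oracle-free programs all of whose loops are counted: `loop i b P` runs `P` with register `i` set
to `0, …, b - 1`, where `b` is the content of register `b`. -/
inductive Loop : Type
  | skip
  | seq (P Q : Loop)
  | setReg (x : ℕ) (e : IExpr)
  | setICell (tab : ℕ) (i j e : IExpr)
  | setSCell (tab : ℕ) (i j : IExpr) (e : SExpr)
  | ifLt (a b : IExpr) (P Q : Loop)
  | ifZero (e : SExpr) (P Q : Loop)
  | loop (i b : ℕ) (P : Loop)

namespace Loop

/-- Translation into the language of the machine. -/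
def toProgram : Loop → Program
  | .skip => .skip
  | .seq P Q => .seq P.toProgram Q.toProgram
  | .setReg x e => .setReg x e
  | .setICell tab i j e => .setICell tab i j e
  | .setSCell tab i j e => .setSCell tab i j e
  | .ifLt a b P Q => .ifLt a b P.toProgram Q.toProgram
  | .ifZero e P Q => .ifZero e P.toProgram Q.toProgram
  | .loop i b P => .seq (.setReg i (.const 0))
      (.whileLt (.reg i) (.reg b) (.seq P.toProgram (.setReg i (.add (.reg i) (.const 1)))))

variable {𝕜 : Type*} [RCLike 𝕜]

open Classical in
/-- The effect of a program on the memory. -/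
def run : Loop → Memory 𝕜 → Memory 𝕜
  | .skip, m => m
  | .seq P Q, m => Q.run (P.run m)
  | .setReg x e, m => m.setReg x (e.eval m)
  | .setICell tab i j e, m => m.setICell tab (i.eval m) (j.eval m) (e.eval m)
  | .setSCell tab i j e, m => m.setSCell tab (i.eval m) (j.eval m) (e.eval m)
  | .ifLt a b P Q, m => if a.eval m < b.eval m then P.run m else Q.run m
  | .ifZero e P Q, m => if e.eval m = 0 then P.run m else Q.run m
  -- The number of rounds is read once, and the counter ends at the bound. This matches the while
  -- loop only if the body writes neither to the counter nor to the bound; `wf` and the set `S` in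
  -- `exec_toProgram` take care of that.
  | .loop i b P, m =>
      (Nat.rec m (fun j s => P.run (s.setReg i j)) (m.reg b) : Memory 𝕜).setReg i (m.reg b)

/-- Does the program write to register `x`? -/
def wreg : Loop → ℕ → Bool
  | .seq P Q, x => P.wreg x || Q.wreg x
  | .setReg y _, x => x == y
  | .ifLt _ _ P Q, x => P.wreg x || Q.wreg x
  | .ifZero _ P Q, x => P.wreg x || Q.wreg x
  | .loop i _ P, x => x == i || P.wreg x
  | _, _ => false

/-- Does the program write to table `t` of natural numbers? -/
def wi : Loop → ℕ → Bool
  | .seq P Q, x => P.wi x || Q.wi x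
  | .setICell t _ _ _, x => x == t
  | .ifLt _ _ P Q, x => P.wi x || Q.wi x
  | .ifZero _ P Q, x => P.wi x || Q.wi x
  | .loop _ _ P, x => P.wi x
  | _, _ => false

/-- Does the program write to table `t` of scalars? -/
def ws : Loop → ℕ → Bool
  | .seq P Q, x => P.ws x || Q.ws x
  | .setSCell t _ _ _, x => x == t
  | .ifLt _ _ P Q, x => P.ws x || Q.ws x
  | .ifZero _ P Q, x => P.ws x || Q.ws x
  | .loop _ _ P, x => P.ws x
  | _, _ => false

/-- The registers that bound the loops of the program. -/
def bounds : Loop → List ℕ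
  | .seq P Q => P.bounds ++ Q.bounds
  | .ifLt _ _ P Q => P.bounds ++ Q.bounds
  | .ifZero _ P Q => P.bounds ++ Q.bounds
  | .loop _ b P => b :: P.bounds
  | _ => []

/-- No loop body writes to the counter of its loop. -/
def wf : Loop → Bool
  | .seq P Q => P.wf && Q.wf
  | .ifLt _ _ P Q => P.wf && Q.wf
  | .ifZero _ P Q => P.wf && Q.wf
  | .loop i _ P => !P.wreg i && P.wf
  | _ => true

/-- A bound for the running time if all loops run for at most `B` rounds. -/
def cost (B : ℕ) : Loop → ℕ
  | .skip => 1
  | .seq P Q => P.cost B + Q.cost B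
  | .setReg _ e => e.size + 1
  | .setICell _ i j e => i.size + j.size + e.size + 1
  | .setSCell _ i j e => i.size + j.size + e.size + 1
  | .ifLt a b P Q => a.size + b.size + 1 + (P.cost B + Q.cost B)
  | .ifZero e P Q => e.size + 1 + (P.cost B + Q.cost B)
  -- Each round pays 3 for the test and 4 for incrementing the counter; the initialization costs 2
  -- and the final test 3.
  | .loop _ _ P => B * (P.cost B + 7) + 5

/-- The memory `s` agrees with `m` except where `Q` may write. -/
structure Agree (Q : Loop) (m s : Memory 𝕜) : Prop where
  reg : ∀ x, Q.wreg x = false → s.reg x = m.reg x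
  icell : ∀ t, Q.wi t = false → s.icell t = m.icell t
  scell : ∀ t, Q.ws t = false → s.scell t = m.scell t

theorem Agree.refl (Q : Loop) (m : Memory 𝕜) : Agree Q m m := ⟨fun _ _ => rfl, fun _ _ => rfl, fun _ _ => rfl⟩

theorem Agree.trans {Q : Loop} {m s u : Memory 𝕜} (h : Agree Q m s) (h' : Agree Q s u) :
    Agree Q m u :=
  ⟨fun x hx => (h'.reg x hx).trans (h.reg x hx), fun x hx => (h'.icell x hx).trans (h.icell x hx),
    fun x hx => (h'.scell x hx).trans (h.scell x hx)⟩

theorem Agree.mono {P Q : Loop} {m s : Memory 𝕜} (h : Agree P m s)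
    (hr : ∀ x, Q.wreg x = false → P.wreg x = false) (hi : ∀ x, Q.wi x = false → P.wi x = false)
    (hs : ∀ x, Q.ws x = false → P.ws x = false) : Agree Q m s :=
  ⟨fun x hx => h.reg x (hr x hx), fun x hx => h.icell x (hi x hx), fun x hx => h.scell x (hs x hx)⟩

theorem Agree.setReg {Q : Loop} {m s : Memory 𝕜} (h : Agree Q m s) {i v : ℕ}
    (hi : Q.wreg i = true) : Agree Q m (s.setReg i v) :=
  ⟨fun x hx => by
    have : x ≠ i := by rintro rfl; simp_all
    simpa [Memory.setReg, Function.update_of_ne this] using h.reg x hx, h.icell, h.scell⟩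

theorem Agree.seqLeft {P Q : Loop} {m s : Memory 𝕜} (h : Agree P m s) : Agree (P.seq Q) m s :=
  h.mono (by simp +contextual [wreg]) (by simp +contextual [wi]) (by simp +contextual [ws])

theorem Agree.seqRight {P Q : Loop} {m s : Memory 𝕜} (h : Agree Q m s) : Agree (P.seq Q) m s :=
  h.mono (by simp +contextual [wreg]) (by simp +contextual [wi]) (by simp +contextual [ws])

theorem Agree.loop {P : Loop} {m s : Memory 𝕜} {i b : ℕ} (h : Agree P m s) :
    Agree (.loop i b P) m s :=
  h.mono (by simp +contextual [wreg]) (by simp +contextual [wi]) (by simp +contextual [ws])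

theorem run_agree (Q : Loop) (m : Memory 𝕜) : Agree Q m (Q.run m) := by
  induction Q generalizing m with
  | skip => exact Agree.refl _ _
  | seq P Q hP hQ => exact (hP m).seqLeft.trans (hQ _).seqRight
  | setReg x e => exact (Agree.refl _ _).setReg (by simp [wreg])
  | setICell t i j e =>
    refine ⟨fun _ _ => rfl, fun x hx => ?_, fun _ _ => rfl⟩
    simp only [wi, beq_eq_false_iff_ne] at hx
    funext a b
    simp [run, Memory.setICell, hx]
  | setSCell t i j e =>
    refine ⟨fun _ _ => rfl, fun _ _ => rfl, fun x hx => ?_⟩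
    simp only [ws, beq_eq_false_iff_ne] at hx
    funext a b
    simp [run, Memory.setSCell, hx]
  | ifLt a b P Q hP hQ =>
    simp only [run]
    split
    · exact (hP m).mono (by simp +contextual [wreg]) (by simp +contextual [wi])
        (by simp +contextual [ws])
    · exact (hQ m).mono (by simp +contextual [wreg]) (by simp +contextual [wi])
        (by simp +contextual [ws])
  | ifZero e P Q hP hQ =>
    simp only [run]
    split
    · exact (hP m).mono (by simp +contextual [wreg]) (by simp +contextual [wi])
        (by simp +contextual [ws])
    · exact (hQ m).mono (by simp +contextual [wreg]) (by simp +contextual [wi])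
        (by simp +contextual [ws])
  | loop i b P hP =>
    refine Agree.setReg ?_ (by simp [wreg])
    generalize m.reg b = B
    induction B with
    | zero => exact Agree.refl _ _
    | succ B ih =>
      have h1 : Agree (.loop i b P) m
          ((Nat.rec m (fun j s => P.run (s.setReg i j)) B : Memory 𝕜).setReg i B) :=
        ih.setReg (by simp [wreg])
      exact h1.trans (hP _).loop

/-- Invariant rule for loops. -/
theorem run_for {P : Loop} {i b : ℕ} {m : Memory 𝕜} (Inv : ℕ → Memory 𝕜 → Prop) (h0 : Inv 0 m)
    (hs : ∀ j < m.reg b, ∀ s, Agree (.loop i b P) m s → Inv j s → Inv (j + 1) (P.run (s.setReg i j))) :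
    ∃ s, Agree (.loop i b P) m s ∧ Inv (m.reg b) s ∧ (Loop.loop i b P).run m = s.setReg i (m.reg b) := by
  suffices H : ∀ B ≤ m.reg b, Agree (.loop i b P) m
      (Nat.rec m (fun j s => P.run (s.setReg i j)) B : Memory 𝕜) ∧
      Inv B (Nat.rec m (fun j s => P.run (s.setReg i j)) B : Memory 𝕜) by
    exact ⟨_, (H _ le_rfl).1, (H _ le_rfl).2, rfl⟩
  intro B
  induction B with
  | zero => exact fun _ => ⟨Agree.refl _ _, h0⟩
  | succ B ih =>
    intro hB
    have h := ih (by omega)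
    exact ⟨(h.1.setReg (by simp [wreg])).trans (run_agree P _).loop, hs B (by omega) _ h.1 h.2⟩

/-- The set `S` collects registers that bound loops. As the program never writes to them, the bound
`B` for their initial contents remains valid in every intermediate memory, and the cost can be
computed from the syntax alone. -/
theorem exec_toProgram (O : DiagOracle 𝕜) (B : ℕ) (S : Set ℕ) (P : Loop) (hwf : P.wf = true)
    (hb : ∀ b ∈ P.bounds, b ∈ S) (hS : ∀ x ∈ S, P.wreg x = false) (m : Memory 𝕜)
    (hm : ∀ x ∈ S, m.reg x ≤ B) :
    ∃ t ≤ P.cost B, Exec O P.toProgram m (P.run m) t 0 := by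
  induction P generalizing m with
  | skip => exact ⟨_, le_rfl, .skip m⟩
  | seq P Q hP hQ =>
    simp only [wf, Bool.and_eq_true] at hwf
    simp only [bounds, List.mem_append] at hb
    simp only [wreg, Bool.or_eq_false_iff] at hS
    obtain ⟨t, ht, h⟩ := hP hwf.1 (fun b h => hb b (.inl h)) (fun x hx => (hS x hx).1) m hm
    obtain ⟨t', ht', h'⟩ := hQ hwf.2 (fun b h => hb b (.inr h)) (fun x hx => (hS x hx).2) (P.run m)
      (fun x hx => by rw [(run_agree P m).reg x (hS x hx).1]; exact hm x hx)
    exact ⟨t + t', add_le_add ht ht', .seq h h'⟩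
  | setReg x e => exact ⟨_, le_rfl, .setReg x e m⟩
  | setICell t i j e => exact ⟨_, le_rfl, .setICell t i j e m⟩
  | setSCell t i j e => exact ⟨_, le_rfl, .setSCell t i j e m⟩
  | ifLt a b P Q hP hQ =>
    simp only [wf, Bool.and_eq_true] at hwf
    simp only [bounds, List.mem_append] at hb
    simp only [wreg, Bool.or_eq_false_iff] at hS
    simp only [run, cost]
    split
    · obtain ⟨t, ht, h⟩ := hP hwf.1 (fun b h => hb b (.inl h)) (fun x hx => (hS x hx).1) m hm
      exact ⟨_, by omega, .ifLtTrue ‹_› h⟩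
    · obtain ⟨t, ht, h⟩ := hQ hwf.2 (fun b h => hb b (.inr h)) (fun x hx => (hS x hx).2) m hm
      exact ⟨_, by omega, .ifLtFalse ‹_› h⟩
  | ifZero e P Q hP hQ =>
    simp only [wf, Bool.and_eq_true] at hwf
    simp only [bounds, List.mem_append] at hb
    simp only [wreg, Bool.or_eq_false_iff] at hS
    simp only [run, cost]
    split
    · obtain ⟨t, ht, h⟩ := hP hwf.1 (fun b h => hb b (.inl h)) (fun x hx => (hS x hx).1) m hm
      exact ⟨_, by omega, .ifZeroTrue ‹_› h⟩
    · obtain ⟨t, ht, h⟩ := hQ hwf.2 (fun b h => hb b (.inr h)) (fun x hx => (hS x hx).2) m hm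
      exact ⟨_, by omega, .ifZeroFalse ‹_› h⟩
  | loop i b P hP =>
    simp only [wf, Bool.and_eq_true, Bool.not_eq_true'] at hwf
    simp only [bounds, List.mem_cons] at hb
    have hbS : b ∈ S := hb b (.inl rfl)
    have hS' : ∀ x ∈ S, x ≠ i ∧ P.wreg x = false := by
      intro x hx
      simpa [wreg] using hS x hx
    set st : ℕ → Memory 𝕜 := fun c => Nat.rec m (fun j s => P.run (s.setReg i j)) c with hst
    have hagree : ∀ c, Agree (.loop i b P) m (st c) := by
      intro c
      induction c with
      | zero => exact Agree.refl _ _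
      | succ c ih => exact (ih.setReg (by simp [wreg])).trans (run_agree P _).loop
    have hreg : ∀ c, ∀ x ∈ S, (st c).reg x = m.reg x := fun c x hx => (hagree c).reg x (hS x hx)
    -- Induction on the number `c` of remaining rounds, because a run of a while loop is built from
    -- its last round backwards.
    have key : ∀ c, c ≤ m.reg b → ∃ t ≤ c * (P.cost B + 7) + 3,
        Exec O (.whileLt (.reg i) (.reg b) (.seq P.toProgram (.setReg i (.add (.reg i) (.const 1)))))
          ((st (m.reg b - c)).setReg i (m.reg b - c)) ((st (m.reg b)).setReg i (m.reg b)) t 0 := by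
      intro c
      induction c with
      | zero =>
        intro _
        refine ⟨3, by simp, ?_⟩
        have := Exec.whileDone (O := O) (a := .reg i) (b := .reg b)
          (P := .seq P.toProgram (.setReg i (.add (.reg i) (.const 1))))
          (m := (st (m.reg b)).setReg i (m.reg b)) (by
            simp [IExpr.eval, Memory.setReg, Function.update_of_ne (hS' b hbS).1, hreg _ b hbS])
        simpa [IExpr.size] using this
      | succ c ih =>
        intro hc
        obtain ⟨t, ht, h⟩ := ih (by omega)
        set j := m.reg b - (c + 1) with hj
        have hj1 : m.reg b - c = j + 1 := by omega
        rw [hj1] at h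
        obtain ⟨t', ht', h'⟩ := hP hwf.2 (fun b h => hb b (.inr h)) (fun x hx => (hS' x hx).2)
          ((st j).setReg i j) (fun x hx => by
            simp only [Memory.setReg, Function.update_of_ne (hS' x hx).1, hreg _ x hx]
            exact hm x hx)
        have hstep : P.run ((st j).setReg i j) = st (j + 1) := rfl
        have hi : (st (j + 1)).reg i = j := by
          rw [← hstep, (run_agree P _).reg i hwf.1]
          simp [Memory.setReg]
        have hset : Exec O (.setReg i (.add (.reg i) (.const 1))) (st (j + 1))
            ((st (j + 1)).setReg i (j + 1)) 4 0 := by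
          have := Exec.setReg (O := O) i (.add (.reg i) (.const 1)) (st (j + 1))
          simpa [IExpr.eval, IExpr.size, hi] using this
        rw [hstep] at h'
        have hw := Exec.whileStep (a := .reg i) (b := .reg b) (by
            simp only [IExpr.eval, Memory.setReg, Function.update_self,
              Function.update_of_ne (hS' b hbS).1, hreg _ b hbS]
            omega) (.seq h' hset) h
        refine ⟨_, ?_, hw⟩
        simp only [IExpr.size]
        have : (c + 1) * (P.cost B + 7) = c * (P.cost B + 7) + (P.cost B + 7) := by ring
        omega
    obtain ⟨t, ht, h⟩ := key (m.reg b) le_rfl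
    simp only [Nat.sub_self] at h
    refine ⟨_, ?_, Exec.seq (.setReg i (.const 0) m) h⟩
    simp only [IExpr.size, cost]
    have := Nat.mul_le_mul_right (P.cost B + 7) (hm b hbS)
    omega

/-- The cost is bounded by a power of the loop bound. -/
theorem exists_cost_le (P : Loop) : ∃ c : ℕ, ∀ B, 2 ≤ B → P.cost B ≤ B ^ c := by
  -- Constants are absorbed by `k ≤ 2 ^ k ≤ B ^ k`, and a sum of two powers by one further factor `B
  -- ≥ 2`.
  have hconst : ∀ k B : ℕ, 2 ≤ B → k ≤ B ^ k := fun k B hB =>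
    (Nat.lt_two_pow_self (n := k)).le.trans (Nat.pow_le_pow_left hB k)
  have hadd : ∀ {f g : ℕ → ℕ}, (∃ c : ℕ, ∀ B, 2 ≤ B → f B ≤ B ^ c) →
      (∃ c : ℕ, ∀ B, 2 ≤ B → g B ≤ B ^ c) → ∃ c : ℕ, ∀ B, 2 ≤ B → f B + g B ≤ B ^ c := by
    rintro f g ⟨a, ha⟩ ⟨b, hb⟩
    refine ⟨a + b + 1, fun B hB => ?_⟩
    have h1 : B ^ a ≤ B ^ (a + b) := Nat.pow_le_pow_right (by omega) (by omega)
    have h2 : B ^ b ≤ B ^ (a + b) := Nat.pow_le_pow_right (by omega) (by omega)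
    calc f B + g B ≤ B ^ (a + b) + B ^ (a + b) := add_le_add ((ha B hB).trans h1) ((hb B hB).trans h2)
      _ = B ^ (a + b) * 2 := by ring
      _ ≤ B ^ (a + b) * B := Nat.mul_le_mul_left _ hB
      _ = B ^ (a + b + 1) := (pow_succ _ _).symm
  induction P with
  | skip => exact ⟨1, fun B hB => hconst 1 B hB⟩
  | seq P Q hP hQ => exact hadd hP hQ
  | setReg x e => exact ⟨_, hconst _⟩
  | setICell t i j e => exact ⟨_, hconst _⟩
  | setSCell t i j e => exact ⟨_, hconst _⟩
  | ifLt a b P Q hP hQ => exact hadd ⟨_, hconst _⟩ (hadd hP hQ)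
  | ifZero e P Q hP hQ => exact hadd ⟨_, hconst _⟩ (hadd hP hQ)
  | loop i b P hP =>
    refine hadd (f := fun B => B * (P.cost B + 7)) ?_ ⟨_, hconst 5⟩
    obtain ⟨c, hc⟩ := hadd hP ⟨_, hconst 7⟩
    refine ⟨c + 1, fun B hB => ?_⟩
    rw [pow_succ']
    exact Nat.mul_le_mul_left _ (hc B hB)

/-! ### Independence of unread tables -/

/-- Does the expression read only those tables of scalars which satisfy `S`? -/
def _root_.ConicIntersection.SExpr.reads (S : ℕ → Bool) : SExpr → Bool
  | .zero => true
  | .one => true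
  | .cell t _ _ => S t
  | .add a b => a.reads S && b.reads S
  | .sub a b => a.reads S && b.reads S
  | .mul a b => a.reads S && b.reads S
  | .div a b => a.reads S && b.reads S
  | .conj a => a.reads S

/-- Does the program read only those tables of scalars which satisfy `S`? -/
def reads (S : ℕ → Bool) : Loop → Bool
  | .seq P Q => P.reads S && Q.reads S
  | .setSCell _ _ _ e => e.reads S
  | .ifLt _ _ P Q => P.reads S && Q.reads S
  | .ifZero e P Q => e.reads S && (P.reads S && Q.reads S)
  | .loop _ _ P => P.reads S
  | _ => true

/-- The two memories agree except for the tables of scalars which do not satisfy `S`. -/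
structure Same (S : ℕ → Bool) (m s : Memory 𝕜) : Prop where
  reg : m.reg = s.reg
  icell : m.icell = s.icell
  scell : ∀ t, S t = true → m.scell t = s.scell t

theorem Same.ieval {S : ℕ → Bool} {m s : Memory 𝕜} (h : Same S m s) (e : IExpr) :
    e.eval m = e.eval s := by
  induction e with
  | const c => rfl
  | reg x => simp [IExpr.eval, h.reg]
  | cell t i j hi hj => simp [IExpr.eval, h.icell, hi, hj]
  | add a b ha hb => simp [IExpr.eval, ha, hb]
  | sub a b ha hb => simp [IExpr.eval, ha, hb]

theorem Same.seval {S : ℕ → Bool} {m s : Memory 𝕜} (h : Same S m s) (e : SExpr)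
    (he : e.reads S = true) : e.eval m = e.eval s := by
  induction e with
  | zero => rfl
  | one => rfl
  | cell t i j => simp [SExpr.eval, h.scell t he, h.ieval]
  | add a b ha hb =>
    simp only [SExpr.reads, Bool.and_eq_true] at he; simp [SExpr.eval, ha he.1, hb he.2]
  | sub a b ha hb =>
    simp only [SExpr.reads, Bool.and_eq_true] at he; simp [SExpr.eval, ha he.1, hb he.2]
  | mul a b ha hb =>
    simp only [SExpr.reads, Bool.and_eq_true] at he; simp [SExpr.eval, ha he.1, hb he.2]
  | div a b ha hb =>
    simp only [SExpr.reads, Bool.and_eq_true] at he; simp [SExpr.eval, ha he.1, hb he.2]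
  | conj a ha => simp [SExpr.eval, ha he]

theorem Same.setReg {S : ℕ → Bool} {m s : Memory 𝕜} (h : Same S m s) (x v : ℕ) :
    Same S (m.setReg x v) (s.setReg x v) :=
  ⟨by simp [Memory.setReg, h.reg], h.icell, h.scell⟩

/-- Index expressions contain no scalars and every scalar expression is restricted to the tables in
`S`, so control flow and written values coincide. Applied to the search stage, this shows that the
computed basis does not depend on the random tables, as it has to be fixed before the random
choices. -/
theorem Same.run {S : ℕ → Bool} (P : Loop) (hP : P.reads S = true) {m s : Memory 𝕜}
    (h : Same S m s) : Same S (P.run m) (P.run s) := by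
  induction P generalizing m s with
  | skip => exact h
  | seq P Q ihP ihQ =>
    simp only [reads, Bool.and_eq_true] at hP
    exact ihQ hP.2 (ihP hP.1 h)
  | setReg x e =>
    simp only [Loop.run, h.ieval]
    exact h.setReg _ _
  | setICell t i j e =>
    simp only [Loop.run, h.ieval]
    exact ⟨h.reg, by simp [Memory.setICell, h.icell], h.scell⟩
  | setSCell t i j e =>
    simp only [Loop.run, h.ieval, h.seval e hP]
    refine ⟨h.reg, h.icell, fun x hx => ?_⟩
    simp [Memory.setSCell, h.scell x hx]
  | ifLt a b P Q ihP ihQ =>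
    simp only [reads, Bool.and_eq_true] at hP
    simp only [Loop.run, h.ieval]
    split
    · exact ihP hP.1 h
    · exact ihQ hP.2 h
  | ifZero e P Q ihP ihQ =>
    simp only [reads, Bool.and_eq_true] at hP
    simp only [Loop.run, h.seval e hP.1]
    split
    · exact ihP hP.2.1 h
    · exact ihQ hP.2.2 h
  | loop i b P ihP =>
    simp only [Loop.run, h.reg]
    refine Same.setReg ?_ _ _
    generalize s.reg b = B
    induction B with
    | zero => exact h
    | succ B ih => exact ihP hP (ih.setReg _ _)

end Loop

end

section

namespace Loop

variable {𝕜 : Type*} [RCLike 𝕜]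

/-! ### Memory after a single assignment -/

@[simp] theorem reg_setReg (m : Memory 𝕜) (x v y : ℕ) :
    (m.setReg x v).reg y = if y = x then v else m.reg y := by
  simp [Memory.setReg, Function.update_apply]

@[simp] theorem scell_setReg (m : Memory 𝕜) (x v : ℕ) : (m.setReg x v).scell = m.scell := rfl

@[simp] theorem icell_setReg (m : Memory 𝕜) (x v : ℕ) : (m.setReg x v).icell = m.icell := rfl

@[simp] theorem reg_setSCell (m : Memory 𝕜) (t i j : ℕ) (v : 𝕜) :
    (m.setSCell t i j v).reg = m.reg := rfl

@[simp] theorem icell_setSCell (m : Memory 𝕜) (t i j : ℕ) (v : 𝕜) :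
    (m.setSCell t i j v).icell = m.icell := rfl

@[simp] theorem scell_setSCell (m : Memory 𝕜) (t i j : ℕ) (v : 𝕜) (t' a b : ℕ) :
    (m.setSCell t i j v).scell t' a b = if t' = t ∧ a = i ∧ b = j then v else m.scell t' a b := rfl

@[simp] theorem reg_setICell (m : Memory 𝕜) (t i j v : ℕ) :
    (m.setICell t i j v).reg = m.reg := rfl

@[simp] theorem icell_setICell (m : Memory 𝕜) (t i j v : ℕ) (t' a b : ℕ) :
    (m.setICell t i j v).icell t' a b = if t' = t ∧ a = i ∧ b = j then v else m.icell t' a b := rfl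

/-! ### Loops that fill tables -/

/-- Set the cell `(i, j)` of table `T` to the sum of the values of `e` over `k < b`. -/
def sumCell (T : ℕ) (i j : IExpr) (k b : ℕ) (e : SExpr) : Loop :=
  .seq (.setSCell T i j .zero) (.loop k b (.setSCell T i j (.add (.cell T i j) e)))

/-- Set the cell `(i, j)` of table `T` to the product of the values of `e` over `k < b`. -/
def prodCell (T : ℕ) (i j : IExpr) (k b : ℕ) (e : SExpr) : Loop :=
  .seq (.setSCell T i j .one) (.loop k b (.setSCell T i j (.mul (.cell T i j) e)))

/-- The hypotheses are required in all memories that differ from `m` only where the loop may write.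
In effect the addresses and the summand must not depend on table `T`, and this can be checked once
for all rounds. -/
theorem sumCell_run {T : ℕ} {i j : IExpr} {k b : ℕ} {e : SExpr} {m : Memory 𝕜} {x y B : ℕ}
    {val : ℕ → 𝕜} (hB : m.reg b = B)
    (hi : ∀ s, Agree (sumCell T i j k b e) m s → i.eval s = x)
    (hj : ∀ s, Agree (sumCell T i j k b e) m s → j.eval s = y)
    (he : ∀ c < B, ∀ s, Agree (sumCell T i j k b e) m s → s.reg k = c → e.eval s = val c) :
    ((sumCell T i j k b e).run m).scell T =
      fun a c => if a = x ∧ c = y then ∑ c ∈ Finset.range B, val c else m.scell T a c := by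
  subst hB
  set m₁ := m.setSCell T x y 0 with hm₁
  have hrun : (sumCell T i j k b e).run m =
      (Loop.loop k b (.setSCell T i j (.add (.cell T i j) e))).run m₁ := by
    simp [sumCell, run, hi m (Agree.refl _ _), hj m (Agree.refl _ _), SExpr.eval, hm₁]
  have hag : Agree (sumCell T i j k b e) m m₁ := by
    refine ⟨fun _ _ => rfl, fun _ _ => rfl, fun t ht => ?_⟩
    have : t ≠ T := by rintro rfl; simp [sumCell, ws] at ht
    funext a c
    simp [hm₁, this]
  obtain ⟨s, -, hinv, hs⟩ := run_for (P := .setSCell T i j (.add (.cell T i j) e)) (i := k) (b := b)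
    (m := m₁) (fun c s => s.scell T =
      fun a d => if a = x ∧ d = y then ∑ c ∈ Finset.range c, val c else m.scell T a d)
    (by funext a c; simp [hm₁]) (by
      intro c hc s hs hinv
      have hs' : Agree (sumCell T i j k b e) m (s.setReg k c) :=
        hag.trans (hs.seqRight.setReg (by simp [wreg]))
      funext a d
      simp only [run, hi _ hs', hj _ hs', SExpr.eval, he c hc _ hs' (by simp), scell_setSCell,
        true_and, scell_setReg, hinv]
      by_cases h : a = x ∧ d = y
      · simp [h, Finset.sum_range_succ]
      · simp [h])
  rw [hrun, hs, scell_setReg, hinv]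
  simp [hm₁]

theorem prodCell_run {T : ℕ} {i j : IExpr} {k b : ℕ} {e : SExpr} {m : Memory 𝕜} {x y B : ℕ}
    {val : ℕ → 𝕜} (hB : m.reg b = B)
    (hi : ∀ s, Agree (prodCell T i j k b e) m s → i.eval s = x)
    (hj : ∀ s, Agree (prodCell T i j k b e) m s → j.eval s = y)
    (he : ∀ c < B, ∀ s, Agree (prodCell T i j k b e) m s → s.reg k = c → e.eval s = val c) :
    ((prodCell T i j k b e).run m).scell T =
      fun a c => if a = x ∧ c = y then ∏ c ∈ Finset.range B, val c else m.scell T a c := by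
  subst hB
  set m₁ := m.setSCell T x y 1 with hm₁
  have hrun : (prodCell T i j k b e).run m =
      (Loop.loop k b (.setSCell T i j (.mul (.cell T i j) e))).run m₁ := by
    simp [prodCell, run, hi m (Agree.refl _ _), hj m (Agree.refl _ _), SExpr.eval, hm₁]
  have hag : Agree (prodCell T i j k b e) m m₁ := by
    refine ⟨fun _ _ => rfl, fun _ _ => rfl, fun t ht => ?_⟩
    have : t ≠ T := by rintro rfl; simp [prodCell, ws] at ht
    funext a c
    simp [hm₁, this]
  obtain ⟨s, -, hinv, hs⟩ := run_for (P := .setSCell T i j (.mul (.cell T i j) e)) (i := k) (b := b)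
    (m := m₁) (fun c s => s.scell T =
      fun a d => if a = x ∧ d = y then ∏ c ∈ Finset.range c, val c else m.scell T a d)
    (by funext a c; simp [hm₁]) (by
      intro c hc s hs hinv
      have hs' : Agree (prodCell T i j k b e) m (s.setReg k c) :=
        hag.trans (hs.seqRight.setReg (by simp [wreg]))
      funext a d
      simp only [run, hi _ hs', hj _ hs', SExpr.eval, he c hc _ hs' (by simp), scell_setSCell,
        true_and, scell_setReg, hinv]
      by_cases h : a = x ∧ d = y
      · simp [h, Finset.prod_range_succ]
      · simp [h])
  rw [hrun, hs, scell_setReg, hinv]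
  simp [hm₁]

/-- Two nested loops. -/
def for₂ (i a j b : ℕ) (P : Loop) : Loop := .loop i a (.loop j b P)

/-- Different rounds write to different cells, so that entries survive once written. The offsets `o`
and `o'` make it possible to fill a block inside a larger table while the rest is left alone. -/
theorem for₂_run {T i a j b : ℕ} {P : Loop} {m : Memory 𝕜} {A B o o' : ℕ} {val : ℕ → ℕ → 𝕜}
    (hA : m.reg a = A) (hB : m.reg b = B) (hwf : (for₂ i a j b P).wf = true)
    (hb : (for₂ i a j b P).wreg b = false)
    (hP : ∀ x < A, ∀ y < B, ∀ s, Agree (for₂ i a j b P) m s → s.reg i = x → s.reg j = y →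
      (P.run s).scell T =
        fun x' y' => if x' = o + x ∧ y' = o' + y then val x y else s.scell T x' y') :
    (∀ x < A, ∀ y < B, ((for₂ i a j b P).run m).scell T (o + x) (o' + y) = val x y) ∧
    ∀ x' y', (∀ x < A, ∀ y < B, ¬ (x' = o + x ∧ y' = o' + y)) →
      ((for₂ i a j b P).run m).scell T x' y' = m.scell T x' y' := by
  subst hA
  obtain ⟨s, -, hinv, hs⟩ := run_for (P := .loop j b P) (i := i) (b := a) (m := m)
    (fun c s => (∀ x < c, ∀ y < B, s.scell T (o + x) (o' + y) = val x y) ∧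
      ∀ x' y', (∀ x < c, ∀ y < B, ¬ (x' = o + x ∧ y' = o' + y)) → s.scell T x' y' = m.scell T x' y')
    ⟨by simp, by simp⟩ (by
      rintro x hx s hs ⟨i1, i2⟩
      have hs' : Agree (for₂ i a j b P) m (s.setReg i x) := hs.setReg (by simp [wreg])
      have hb' : (s.setReg i x).reg b = B := by rw [hs'.reg b hb, hB]
      obtain ⟨s₁, -, hinv₁, hs₁⟩ := run_for (P := P) (i := j) (b := b) (m := s.setReg i x)
        (fun d s₁ => (∀ y < d, s₁.scell T (o + x) (o' + y) = val x y) ∧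
          ∀ x' y', (∀ y < d, ¬ (x' = o + x ∧ y' = o' + y)) → s₁.scell T x' y' = s.scell T x' y')
        ⟨by simp, by simp⟩ (by
          rintro y hy s₁ hs₁ ⟨j1, j2⟩
          have hs₂ : Agree (for₂ i a j b P) m (s₁.setReg j y) :=
            hs'.trans (hs₁.loop.setReg (by simp [wreg]))
          have hi : (s₁.setReg j y).reg i = x := by
            have : Agree (.loop j b P) (s.setReg i x) (s₁.setReg j y) :=
              hs₁.setReg (by simp [wreg])
            rw [this.reg i (by simp [for₂, wf, wreg] at hwf; simp [wreg, hwf])]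
            simp
          rw [hP x hx y (hb' ▸ hy) _ hs₂ hi (by simp), scell_setReg]
          beta_reduce
          refine ⟨fun y' hy' => ?_, fun x' y' h => ?_⟩
          · by_cases h : y' = y
            · simp [h]
            · rw [if_neg (by omega), j1 y' (by omega)]
          · rw [if_neg (h y (by omega)), j2 x' y' fun z hz => h z (by omega)])
      rw [hs₁, scell_setReg]
      rw [hb'] at hinv₁
      refine ⟨fun x' hx' y hy => ?_, fun x' y' h => ?_⟩
      · by_cases h : x' = x
        · subst h; exact hinv₁.1 y hy
        · rw [hinv₁.2 _ _ (by omega), i1 x' (by omega) y hy]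
      · rw [hinv₁.2 _ _ (fun y hy => h x (by omega) y hy),
          i2 _ _ (fun z hz => h z (by omega))])
  rw [for₂, hs, scell_setReg]
  exact hinv

theorem for₂_sumCell {T i a j b k c : ℕ} {I J : IExpr} {e : SExpr} {m : Memory 𝕜}
    {A B D : ℕ} (o o' : ℕ) (val : ℕ → ℕ → ℕ → 𝕜) (hA : m.reg a = A) (hB : m.reg b = B)
    (hD : m.reg c = D) (hwf : (for₂ i a j b (sumCell T I J k c e)).wf = true)
    (hb : (for₂ i a j b (sumCell T I J k c e)).wreg b = false)
    (hc : (for₂ i a j b (sumCell T I J k c e)).wreg c = false)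
    (hI : ∀ s, Agree (for₂ i a j b (sumCell T I J k c e)) m s → I.eval s = o + s.reg i)
    (hJ : ∀ s, Agree (for₂ i a j b (sumCell T I J k c e)) m s → J.eval s = o' + s.reg j)
    (he : ∀ x < A, ∀ y < B, ∀ z < D, ∀ s, Agree (for₂ i a j b (sumCell T I J k c e)) m s →
      s.reg i = x → s.reg j = y → s.reg k = z → e.eval s = val x y z) :
    (∀ x < A, ∀ y < B, ((for₂ i a j b (sumCell T I J k c e)).run m).scell T (o + x) (o' + y) =
      ∑ z ∈ Finset.range D, val x y z) ∧
    ∀ x' y', (∀ x < A, ∀ y < B, ¬ (x' = o + x ∧ y' = o' + y)) →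
      ((for₂ i a j b (sumCell T I J k c e)).run m).scell T x' y' = m.scell T x' y' := by
  refine for₂_run hA hB hwf hb fun x hx y hy s hs hi hj => ?_
  have hw : (sumCell T I J k c e).wreg i = false ∧ (sumCell T I J k c e).wreg j = false := by
    simp [for₂, wf, wreg] at hwf; exact ⟨hwf.1.2, hwf.2.1⟩
  have hu : ∀ u, Agree (sumCell T I J k c e) s u →
      Agree (for₂ i a j b (sumCell T I J k c e)) m u ∧ u.reg i = x ∧ u.reg j = y := fun u hu =>
    ⟨hs.trans hu.loop.loop, (hu.reg i hw.1).trans hi, (hu.reg j hw.2).trans hj⟩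
  refine sumCell_run ((hs.reg c hc).trans hD) (fun u h => ?_) (fun u h => ?_)
    fun z hz u h hk => he x hx y hy z hz u (hu u h).1 (hu u h).2.1 (hu u h).2.2 hk
  · rw [hI u (hu u h).1, (hu u h).2.1]
  · rw [hJ u (hu u h).1, (hu u h).2.2]

theorem for₂_prodCell {T i a j b k c : ℕ} {I J : IExpr} {e : SExpr} {m : Memory 𝕜}
    {A B D : ℕ} (o o' : ℕ) (val : ℕ → ℕ → ℕ → 𝕜) (hA : m.reg a = A) (hB : m.reg b = B)
    (hD : m.reg c = D) (hwf : (for₂ i a j b (prodCell T I J k c e)).wf = true)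
    (hb : (for₂ i a j b (prodCell T I J k c e)).wreg b = false)
    (hc : (for₂ i a j b (prodCell T I J k c e)).wreg c = false)
    (hI : ∀ s, Agree (for₂ i a j b (prodCell T I J k c e)) m s → I.eval s = o + s.reg i)
    (hJ : ∀ s, Agree (for₂ i a j b (prodCell T I J k c e)) m s → J.eval s = o' + s.reg j)
    (he : ∀ x < A, ∀ y < B, ∀ z < D, ∀ s, Agree (for₂ i a j b (prodCell T I J k c e)) m s →
      s.reg i = x → s.reg j = y → s.reg k = z → e.eval s = val x y z) :
    (∀ x < A, ∀ y < B, ((for₂ i a j b (prodCell T I J k c e)).run m).scell T (o + x) (o' + y) =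
      ∏ z ∈ Finset.range D, val x y z) ∧
    ∀ x' y', (∀ x < A, ∀ y < B, ¬ (x' = o + x ∧ y' = o' + y)) →
      ((for₂ i a j b (prodCell T I J k c e)).run m).scell T x' y' = m.scell T x' y' := by
  refine for₂_run hA hB hwf hb fun x hx y hy s hs hi hj => ?_
  have hw : (prodCell T I J k c e).wreg i = false ∧ (prodCell T I J k c e).wreg j = false := by
    simp [for₂, wf, wreg] at hwf; exact ⟨hwf.1.2, hwf.2.1⟩
  have hu : ∀ u, Agree (prodCell T I J k c e) s u →
      Agree (for₂ i a j b (prodCell T I J k c e)) m u ∧ u.reg i = x ∧ u.reg j = y := fun u hu =>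
    ⟨hs.trans hu.loop.loop, (hu.reg i hw.1).trans hi, (hu.reg j hw.2).trans hj⟩
  refine prodCell_run ((hs.reg c hc).trans hD) (fun u h => ?_) (fun u h => ?_)
    fun z hz u h hk => he x hx y hy z hz u (hu u h).1 (hu u h).2.1 (hu u h).2.2 hk
  · rw [hI u (hu u h).1, (hu u h).2.1]
  · rw [hJ u (hu u h).1, (hu u h).2.2]

theorem for₂_setSCell {T i a j b : ℕ} {I J : IExpr} {e : SExpr} {m : Memory 𝕜}
    {A B : ℕ} (o o' : ℕ) (val : ℕ → ℕ → 𝕜) (hA : m.reg a = A) (hB : m.reg b = B)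
    (hwf : (for₂ i a j b (.setSCell T I J e)).wf = true)
    (hb : (for₂ i a j b (.setSCell T I J e)).wreg b = false)
    (hI : ∀ s, Agree (for₂ i a j b (.setSCell T I J e)) m s → I.eval s = o + s.reg i)
    (hJ : ∀ s, Agree (for₂ i a j b (.setSCell T I J e)) m s → J.eval s = o' + s.reg j)
    (he : ∀ x < A, ∀ y < B, ∀ s, Agree (for₂ i a j b (.setSCell T I J e)) m s →
      s.reg i = x → s.reg j = y → e.eval s = val x y) :
    (∀ x < A, ∀ y < B, ((for₂ i a j b (.setSCell T I J e)).run m).scell T (o + x) (o' + y) =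
      val x y) ∧
    ∀ x' y', (∀ x < A, ∀ y < B, ¬ (x' = o + x ∧ y' = o' + y)) →
      ((for₂ i a j b (.setSCell T I J e)).run m).scell T x' y' = m.scell T x' y' := by
  refine for₂_run hA hB hwf hb fun x hx y hy s hs hi hj => ?_
  funext x' y'
  simp [run, hI s hs, hJ s hs, hi, hj, he x hx y hy s hs hi hj]

/-- Two nested loops that check a condition, and set register `f` to `1` where it is violated. -/
theorem for₂_check {i a j b f : ℕ} {P : Loop} {m : Memory 𝕜} {A B : ℕ} {bad : ℕ → ℕ → Prop}
    (hA : m.reg a = A) (hB : m.reg b = B) (hwf : (for₂ i a j b P).wf = true)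
    (hb : (for₂ i a j b P).wreg b = false) (hfi : f ≠ i) (hfj : f ≠ j)
    (hP : ∀ x < A, ∀ y < B, ∀ s, Agree (for₂ i a j b P) m s → s.reg i = x → s.reg j = y →
      ((P.run s).reg f = 0 ↔ s.reg f = 0 ∧ ¬ bad x y)) :
    ((for₂ i a j b P).run m).reg f = 0 ↔ m.reg f = 0 ∧ ∀ x < A, ∀ y < B, ¬ bad x y := by
  subst hA
  obtain ⟨s, -, hinv, hs⟩ := run_for (P := .loop j b P) (i := i) (b := a) (m := m)
    (fun c s => s.reg f = 0 ↔ m.reg f = 0 ∧ ∀ x < c, ∀ y < B, ¬ bad x y) (by simp) (by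
      rintro x hx s hs hi1
      have hs' : Agree (for₂ i a j b P) m (s.setReg i x) := hs.setReg (by simp [wreg])
      have hb' : (s.setReg i x).reg b = B := by rw [hs'.reg b hb, hB]
      obtain ⟨s₁, -, hinv₁, hs₁⟩ := run_for (P := P) (i := j) (b := b) (m := s.setReg i x)
        (fun d s₁ => s₁.reg f = 0 ↔ s.reg f = 0 ∧ ∀ y < d, ¬ bad x y) (by simp [hfi]) (by
          rintro y hy s₁ hs₁ hj1
          have hs₂ : Agree (for₂ i a j b P) m (s₁.setReg j y) :=
            hs'.trans (hs₁.loop.setReg (by simp [wreg]))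
          have hi : (s₁.setReg j y).reg i = x := by
            have : Agree (.loop j b P) (s.setReg i x) (s₁.setReg j y) :=
              hs₁.setReg (by simp [wreg])
            rw [this.reg i (by simp [for₂, wf, wreg] at hwf; simp [wreg, hwf])]
            simp
          rw [hP x hx y (hb' ▸ hy) _ hs₂ hi (by simp), reg_setReg, if_neg hfj, hj1, and_assoc]
          refine and_congr_right fun _ => ⟨fun h y' hy' => ?_, fun h => ⟨fun y' hy' => h y' (by omega),
            h y (by omega)⟩⟩
          rcases Nat.lt_succ_iff_lt_or_eq.1 hy' with h' | rfl
          exacts [h.1 y' h', h.2])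
      rw [hs₁, reg_setReg, if_neg hfj, hinv₁, hi1, hb', and_assoc]
      refine and_congr_right fun _ => ⟨fun h x' hx' => ?_, fun h => ⟨fun x' hx' => h x' (by omega),
        h x (by omega)⟩⟩
      rcases Nat.lt_succ_iff_lt_or_eq.1 hx' with h' | rfl
      exacts [h.1 x' h', h.2])
  rw [for₂, hs, reg_setReg, if_neg hfi]
  exact hinv

/-! ### Gram–Schmidt orthogonalization -/

/-- The inner product of the first `C` entries of two rows. -/
def ip (C : ℕ) (x y : ℕ → 𝕜) : 𝕜 := ∑ c ∈ Finset.range C, star (x c) * y c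

theorem ip_sub_mul (C : ℕ) (x y z : ℕ → 𝕜) (μ : 𝕜) :
    ip C x (fun c => y c - μ * z c) = ip C x y - μ * ip C x z := by
  simp only [ip, mul_sub, Finset.sum_sub_distrib, Finset.mul_sum]
  congr 1
  exact Finset.sum_congr rfl fun _ _ => by ring

theorem ip_congr {C C' : ℕ} (hC : C ≤ C') {x x' y y' : ℕ → 𝕜} (hx : ∀ c < C', x c = x' c)
    (hy : ∀ c < C', y c = y' c) : ip C x y = ip C x' y' :=
  Finset.sum_congr rfl fun c hc => by
    have := Finset.mem_range.1 hc
    rw [hx c (by omega), hy c (by omega)]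

theorem eq_zero_of_ip_self {C : ℕ} {x : ℕ → 𝕜} (h : ip C x x = 0) : ∀ c < C, x c = 0 := by
  have h1 : ∑ c ∈ Finset.range C, ‖x c‖ ^ 2 = 0 := by
    have : ((∑ c ∈ Finset.range C, ‖x c‖ ^ 2 : ℝ) : 𝕜) = 0 := by
      rw [← h, ip]
      push_cast
      exact Finset.sum_congr rfl fun c _ => (RCLike.conj_mul _).symm
    exact_mod_cast this
  intro c hc
  have := (Finset.sum_eq_zero_iff_of_nonneg (fun _ _ => by positivity)).1 h1 c
    (Finset.mem_range.2 hc)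
  simpa using this

theorem ip_eq_zero_of_left {C : ℕ} {x y : ℕ → 𝕜} (h : ip C x x = 0) : ip C x y = 0 :=
  Finset.sum_eq_zero fun c hc => by
    rw [eq_zero_of_ip_self h c (Finset.mem_range.1 hc)]; simp

/-- The first `C` entries of a row, as a vector. -/
def trunc (C : ℕ) (x : ℕ → 𝕜) : Fin C → 𝕜 := fun c => x c

/-- `G` is obtained from `G₀` by orthogonalizing the first `r` rows, of length `C'`, with respect to
the inner product of the first `C` entries. -/
structure IsGramSchmidt (C C' r : ℕ) (G₀ G : ℕ → ℕ → 𝕜) : Prop where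
  orthogonal : ∀ j < r, ∀ i < j, ip C (G i) (G j) = 0
  sub_mem : ∀ j < r, trunc C' (G j) - trunc C' (G₀ j) ∈
    Submodule.span 𝕜 ((fun i => trunc C' (G₀ i)) '' Set.Iio j)

/-- Subtract from row `j` of table `T` its projection to row `i`, where `i, j` are the contents of
registers `20` and `21`. -/
def project (T C C' : ℕ) : Loop :=
  .seq (sumCell 100 (.const 0) (.const 0) 22 C
    (.mul (.conj (.cell T (.reg 20) (.reg 22))) (.cell T (.reg 21) (.reg 22)))) <|
  .seq (sumCell 100 (.const 0) (.const 1) 22 C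
    (.mul (.conj (.cell T (.reg 20) (.reg 22))) (.cell T (.reg 20) (.reg 22)))) <|
  .loop 22 C' (.setSCell T (.reg 21) (.reg 22) (.sub (.cell T (.reg 21) (.reg 22))
    (.mul (.div (.cell 100 (.const 0) (.const 0)) (.cell 100 (.const 0) (.const 1)))
      (.cell T (.reg 20) (.reg 22)))))

/-- Gram–Schmidt orthogonalization. -/
def gramSchmidtLoop (T r C C' : ℕ) : Loop :=
  .loop 21 r (.loop 20 r (.ifLt (.reg 20) (.reg 21) (project T C C') .skip))

theorem project_run {T C C' : ℕ} (hT : T ≠ 100) {m : Memory 𝕜} {x y cC cC' : ℕ}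
    (hx : m.reg 20 = x) (hy : m.reg 21 = y) (hxy : x ≠ y)
    (hC : m.reg C = cC) (hC' : m.reg C' = cC') (hC22 : C ≠ 22) (hC'22 : C' ≠ 22) :
    ((project T C C').run m).scell T = fun a c => if a = y ∧ c < cC' then
      m.scell T y c - ip cC (m.scell T x) (m.scell T y) / ip cC (m.scell T x) (m.scell T x) *
        m.scell T x c else m.scell T a c := by
  set P₁ := sumCell 100 (.const 0) (.const 0) 22 C
    (.mul (.conj (.cell T (.reg 20) (.reg 22))) (.cell T (.reg 21) (.reg 22))) with hP₁
  set P₂ := sumCell 100 (.const 0) (.const 1) 22 C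
    (.mul (.conj (.cell T (.reg 20) (.reg 22))) (.cell T (.reg 20) (.reg 22))) with hP₂
  set m₁ := P₁.run m with hm₁
  set m₂ := P₂.run m₁ with hm₂
  have ag₁ : Agree P₁ m m₁ := run_agree _ _
  have ag₂ : Agree P₂ m₁ m₂ := run_agree _ _
  have w₁ : ∀ x, x ≠ 22 → P₁.wreg x = false := by simp [hP₁, sumCell, wreg]
  have w₂ : ∀ x, x ≠ 22 → P₂.wreg x = false := by simp [hP₂, sumCell, wreg]
  have t₁ : P₁.ws T = false := by simp [hP₁, sumCell, ws, hT]
  have t₂ : P₂.ws T = false := by simp [hP₂, sumCell, ws, hT]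
  have v₁ := sumCell_run (T := 100) (i := .const 0) (j := .const 0) (k := 22) (b := C)
    (e := .mul (.conj (.cell T (.reg 20) (.reg 22))) (.cell T (.reg 21) (.reg 22))) (m := m)
    (x := 0) (y := 0) (val := fun c => star (m.scell T x c) * m.scell T y c) hC
    (fun _ _ => rfl) (fun _ _ => rfl) (by
      intro c hc s hs hk
      simp [SExpr.eval, IExpr.eval, hk, hs.scell T t₁, hs.reg 20 (w₁ 20 (by norm_num)),
        hs.reg 21 (w₁ 21 (by norm_num)), hx, hy])
  have v₂ := sumCell_run (T := 100) (i := .const 0) (j := .const 1) (k := 22) (b := C)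
    (e := .mul (.conj (.cell T (.reg 20) (.reg 22))) (.cell T (.reg 20) (.reg 22))) (m := m₁)
    (x := 0) (y := 1) (val := fun c => star (m.scell T x c) * m.scell T x c)
    ((ag₁.reg C (w₁ C hC22)).trans hC)
    (fun _ _ => rfl) (fun _ _ => rfl) (by
      intro c hc s hs hk
      simp [SExpr.eval, IExpr.eval, hk, hs.scell T t₂, hs.reg 20 (w₂ 20 (by norm_num)),
        ag₁.scell T t₁, ag₁.reg 20 (w₁ 20 (by norm_num)), hx])
  rw [← hP₁, ← hm₁] at v₁
  rw [← hP₂, ← hm₂, v₁] at v₂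
  have e₂ : m₂.scell T = m.scell T := (ag₂.scell T t₂).trans (ag₁.scell T t₁)
  have r₂ : ∀ x, x ≠ 22 → m₂.reg x = m.reg x := fun x hx =>
    (ag₂.reg x (w₂ x hx)).trans (ag₁.reg x (w₁ x hx))
  obtain ⟨s, -, hinv, hs⟩ := run_for (i := 22) (b := C')
    (P := .setSCell T (.reg 21) (.reg 22) (.sub (.cell T (.reg 21) (.reg 22))
      (.mul (.div (.cell 100 (.const 0) (.const 0)) (.cell 100 (.const 0) (.const 1)))
      (.cell T (.reg 20) (.reg 22))))) (m := m₂) (fun d s => s.scell T =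
      fun a c => if a = y ∧ c < d then m.scell T y c - ip cC (m.scell T x) (m.scell T y) /
        ip cC (m.scell T x) (m.scell T x) * m.scell T x c else m.scell T a c)
    (by simp [e₂]) (by
      intro d hd s hs hinv
      have s100 : s.scell 100 = m₂.scell 100 := hs.scell 100 (by simp [ws, hT.symm])
      have s20 : s.reg 20 = x := by rw [hs.reg 20 (by simp [wreg]), r₂ 20 (by norm_num), hx]
      have s21 : s.reg 21 = y := by rw [hs.reg 21 (by simp [wreg]), r₂ 21 (by norm_num), hy]
      funext a c
      simp only [run, SExpr.eval, IExpr.eval, scell_setSCell, reg_setReg, scell_setReg, s100, s20,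
        s21, hinv, v₂]
      by_cases h : a = y
      · subst h
        by_cases h' : c = d
        · subst h'; simp [hxy, ip]
        · simp [h', show c < d + 1 ↔ c < d by omega]
      · simp [h])
  have : (project T C C').run m = (Loop.loop 22 C' (.setSCell T (.reg 21) (.reg 22)
    (.sub (.cell T (.reg 21) (.reg 22))
      (.mul (.div (.cell 100 (.const 0) (.const 0)) (.cell 100 (.const 0) (.const 1)))
      (.cell T (.reg 20) (.reg 22)))))).run m₂ := rfl
  rw [this, hs, scell_setReg, hinv, r₂ C' hC'22, hC']

/-- The row operations are determined by the first `C` entries but act on `C'` entries, so that a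
second vector can be carried along with each row. The rows are not normalized, since square roots
are not among the operations of the machine. -/
theorem gramSchmidtLoop_run {T r C C' : ℕ} (hT : T ≠ 100) {m : Memory 𝕜} {cr cC cC' : ℕ}
    (hr : m.reg r = cr) (hC : m.reg C = cC) (hC' : m.reg C' = cC') (hle : cC ≤ cC')
    (hreg : ∀ x ∈ [r, C, C'], x ≠ 20 ∧ x ≠ 21 ∧ x ≠ 22) :
    IsGramSchmidt cC cC' cr (m.scell T) (((gramSchmidtLoop T r C C').run m).scell T) := by
  have wr : ∀ x, x ≠ 20 → x ≠ 21 → x ≠ 22 → (gramSchmidtLoop T r C C').wreg x = false := by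
    intro x h0 h1 h2
    simp [gramSchmidtLoop, project, sumCell, wreg, h0, h1, h2]
  simp only [List.mem_cons, List.not_mem_nil, or_false, forall_eq_or_imp, forall_eq] at hreg
  obtain ⟨⟨r0, r1, r2⟩, ⟨C0, C1, C2⟩, C0', C1', C2'⟩ := hreg
  set G₀ := m.scell T with hG₀
  let Sp : ℕ → Submodule 𝕜 (Fin cC' → 𝕜) := fun j =>
    Submodule.span 𝕜 ((fun i => trunc cC' (G₀ i)) '' Set.Iio j)
  have mono : ∀ {i j}, i ≤ j → Sp i ≤ Sp j := fun h =>
    Submodule.span_mono (Set.image_mono fun _ hx => lt_of_lt_of_le hx h)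
  obtain ⟨s, -, hinv, hs⟩ := run_for (P := .loop 20 r (.ifLt (.reg 20) (.reg 21) (project T C C') .skip))
    (i := 21) (b := r) (m := m) (fun j s =>
      (∀ b < j, ∀ a < b, ip cC (s.scell T a) (s.scell T b) = 0) ∧
      (∀ b < j, trunc cC' (s.scell T b) - trunc cC' (G₀ b) ∈ Sp b) ∧
      ∀ b, j ≤ b → s.scell T b = G₀ b)
    (by simp [hG₀]) (by
      rintro j hj s hs ⟨i1, i2, i3⟩
      have hsr : ∀ x, x ≠ 20 → x ≠ 21 → x ≠ 22 → s.reg x = m.reg x := fun x h0 h1 h2 =>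
        hs.reg x (wr x h0 h1 h2)
      -- While row `j` is processed, the earlier rows are finished, row `j` is already orthogonal to
      -- the rows below `i`, and the later rows are the original ones.
      obtain ⟨u, -, hinv, hu⟩ := run_for (P := .ifLt (.reg 20) (.reg 21) (project T C C') .skip)
        (i := 20) (b := r) (m := s.setReg 21 j) (fun i u =>
          (∀ b < j, u.scell T b = s.scell T b) ∧
          (∀ a < i, a < j → ip cC (u.scell T a) (u.scell T j) = 0) ∧
          (trunc cC' (u.scell T j) - trunc cC' (G₀ j) ∈ Sp j) ∧
          ∀ b, j < b → u.scell T b = G₀ b)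
        ⟨fun _ _ => rfl, by simp, by simp [i3 j le_rfl], fun b hb => i3 b hb.le⟩ (by
          rintro i hi u hu ⟨k1, k2, k3, k4⟩
          have u21 : (u.setReg 20 i).reg 21 = j := by
            rw [reg_setReg, if_neg (by norm_num), hu.reg 21 (by simp [project, sumCell, wreg])]
            simp
          by_cases hij : i < j
          swap
          · simp only [run, IExpr.eval, u21, reg_setReg, if_true, if_neg hij]
            exact ⟨k1, fun a ha haj => k2 a (by omega) haj, k3, k4⟩
          have ur : ∀ x, x ≠ 20 → x ≠ 21 → x ≠ 22 → (u.setReg 20 i).reg x = m.reg x := by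
            intro x h0 h1 h2
            rw [reg_setReg, if_neg h0, hu.reg x (by simp [project, sumCell, wreg, h0, h2]),
              reg_setReg, if_neg h1, hsr x h0 h1 h2]
          have hp := project_run hT (C := C) (C' := C') (m := u.setReg 20 i) (x := i) (by simp) u21
            hij.ne ((ur C C0 C1 C2).trans hC) ((ur C' C0' C1' C2').trans hC') C2 C2'
          have hrun : (Loop.ifLt (.reg 20) (.reg 21) (project T C C') .skip).run (u.setReg 20 i) =
              (project T C C').run (u.setReg 20 i) := by
            simp only [run, IExpr.eval, u21]
            simp [hij]
          rw [hrun, hp, scell_setReg]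
          set μ := ip cC (u.scell T i) (u.scell T j) / ip cC (u.scell T i) (u.scell T i) with hμ
          have hne : ∀ a, a ≠ j → (fun c => if a = j ∧ c < cC' then u.scell T j c -
              μ * u.scell T i c else u.scell T a c) = u.scell T a := by
            intro a ha; funext c; simp [ha]
          have hj' : ∀ c < cC', (if j = j ∧ c < cC' then u.scell T j c -
              μ * u.scell T i c else u.scell T j c) = u.scell T j c - μ * u.scell T i c := by
            intro c hc; simp [hc]
          refine ⟨fun b hb => (hne b hb.ne).trans (k1 b hb), fun a ha haj => ?_, ?_,
            fun b hb => (hne b hb.ne').trans (k4 b hb)⟩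
          · beta_reduce
            rw [hne a haj.ne, ip_congr hle (fun _ _ => rfl) hj', ip_sub_mul]
            rcases (Nat.lt_succ_iff_lt_or_eq.1 ha) with h | rfl
            · rw [k2 a h haj, k1 a haj, k1 i hij, i1 i hij a h]
              simp
            -- If row `a` vanishes, the quotient is `0 / 0 = 0`, and orthogonality to row `a` is
            -- automatic.
            · by_cases h0 : ip cC (u.scell T a) (u.scell T a) = 0
              · simp [h0, ip_eq_zero_of_left h0]
              · rw [hμ, div_mul_cancel₀ _ h0, sub_self]
          · have : trunc cC' (fun c => if j = j ∧ c < cC' then u.scell T j c -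
              μ * u.scell T i c else u.scell T j c) =
              trunc cC' (u.scell T j) - μ • trunc cC' (u.scell T i) := by
              funext c
              exact hj' c c.2
            rw [this, sub_right_comm]
            refine Submodule.sub_mem _ k3 (Submodule.smul_mem _ _ ?_)
            rw [k1 i hij, ← sub_add_cancel (trunc cC' (s.scell T i)) (trunc cC' (G₀ i))]
            exact Submodule.add_mem _ (mono hij.le (i2 i hij)) (Submodule.subset_span ⟨i, hij, rfl⟩))
      have hB : (s.setReg 21 j).reg r = cr := by
        rw [reg_setReg, if_neg r1, hsr r r0 r1 r2, hr]
      rw [hu, scell_setReg]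
      obtain ⟨k1, k2, k3, k4⟩ := hinv
      rw [hB] at k2
      rw [hr] at hj
      refine ⟨fun b hb a hab => ?_, fun b hb => ?_, fun b hb => k4 b hb⟩
      · rcases (Nat.lt_succ_iff_lt_or_eq.1 hb) with h | rfl
        · rw [k1 b h, k1 a (hab.trans h), i1 b h a hab]
        · exact k2 a (by omega) hab
      · rcases (Nat.lt_succ_iff_lt_or_eq.1 hb) with h | rfl
        · rw [k1 b h]; exact i2 b h
        · exact k3)
  rw [gramSchmidtLoop, hs, scell_setReg, ← hr]
  exact ⟨hinv.1, hinv.2.1⟩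

/-! ### Removal of zero rows -/

/-- Copy those of the rows `off, …, off + r - 1` of table `S` whose first `C` entries are not all
zero to the first rows of table `T`, and count them in register `k`. -/
def compact (S T : ℕ) (off : IExpr) (r C C' k : ℕ) : Loop :=
  .seq (.setReg k (.const 0)) <| .loop 20 r <|
    .seq (sumCell 100 (.const 0) (.const 0) 22 C
      (.mul (.conj (.cell S (.add off (.reg 20)) (.reg 22)))
        (.cell S (.add off (.reg 20)) (.reg 22)))) <|
    .ifZero (.cell 100 (.const 0) (.const 0)) .skip <|
    .seq (.loop 22 C' (.setSCell T (.reg k) (.reg 22) (.cell S (.add off (.reg 20)) (.reg 22))))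
      (.setReg k (.add (.reg k) (.const 1)))

/-- The first `k` rows of `P` are the non-zero rows among the first `r` rows of `G`. -/
structure IsCompaction (C C' r k : ℕ) (G P : ℕ → ℕ → 𝕜) (e : ℕ → ℕ) : Prop where
  lt : ∀ l < k, e l < r
  strictMono : ∀ l < k, ∀ l' < l, e l' < e l
  ne_zero : ∀ l < k, ip C (G (e l)) (G (e l)) ≠ 0
  eq : ∀ l < k, ∀ c < C', P l c = G (e l) c
  surj : ∀ a < r, ip C (G a) (G a) ≠ 0 → ∃ l < k, e l = a

/-- A row is kept if its inner product with itself is non-zero. For an orthogonal family this leaves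
a linearly independent one with the same span, whose size, the dimension of that span, ends up in
register `k`. -/
theorem compact_run {S T : ℕ} {off : IExpr} {r C C' k : ℕ} {m : Memory 𝕜} {o cr cC cC' : ℕ}
    (hS : S ≠ 100) (hT : T ≠ 100) (hST : S ≠ T)
    (hoff : ∀ s, Agree (compact S T off r C C' k) m s → off.eval s = o)
    (hr : m.reg r = cr) (hC : m.reg C = cC) (hC' : m.reg C' = cC')
    (hreg : ∀ x ∈ [r, C, C'], x ≠ 20 ∧ x ≠ 22 ∧ x ≠ k) (hk : k ≠ 20 ∧ k ≠ 22) :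
    ∃ e, IsCompaction cC cC' cr (((compact S T off r C C' k).run m).reg k)
      (fun a => m.scell S (o + a)) (((compact S T off r C C' k).run m).scell T) e := by
  simp only [List.mem_cons, List.not_mem_nil, or_false, forall_eq_or_imp, forall_eq] at hreg
  obtain ⟨⟨r0, r1, r2⟩, ⟨C0, C1, C2⟩, C0', C1', C2'⟩ := hreg
  obtain ⟨k0, k2⟩ := hk
  set Q := compact S T off r C C' k with hQ
  have hwr : ∀ x, x ≠ 20 → x ≠ 22 → x ≠ k → Q.wreg x = false := by
    intro x h0 h1 h2; simp [hQ, compact, sumCell, wreg, h0, h1, h2]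
  have hws : ∀ t, t ≠ T → t ≠ 100 → Q.ws t = false := by
    intro t h0 h1; simp [hQ, compact, sumCell, ws, h0, h1]
  have hwk : Q.wreg k = true := by simp [hQ, compact, wreg]
  have hw20 : Q.wreg 20 = true := by simp [hQ, compact, wreg]
  have ag0 : Agree Q m (m.setReg k 0) := (Agree.refl Q m).setReg hwk
  set G : ℕ → ℕ → 𝕜 := fun a => m.scell S (o + a) with hG
  set body : Loop := .seq (sumCell 100 (.const 0) (.const 0) 22 C
      (.mul (.conj (.cell S (.add off (.reg 20)) (.reg 22)))
        (.cell S (.add off (.reg 20)) (.reg 22)))) <|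
    .ifZero (.cell 100 (.const 0) (.const 0)) .skip <|
    .seq (.loop 22 C' (.setSCell T (.reg k) (.reg 22) (.cell S (.add off (.reg 20)) (.reg 22))))
      (.setReg k (.add (.reg k) (.const 1))) with hbody
  have hQb : Q = .seq (.setReg k (.const 0)) (.loop 20 r body) := rfl
  obtain ⟨s, -, ⟨e, hinv⟩, hs⟩ := run_for (P := body) (i := 20) (b := r) (m := m.setReg k 0)
    (fun i s => ∃ e, IsCompaction cC cC' i (s.reg k) G (s.scell T) e) ⟨id, by
      constructor <;> simp⟩ (by
      rintro i hi s hs ⟨e, he⟩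
      have hag : Agree Q m (s.setReg 20 i) := (ag0.trans hs.seqRight).setReg hw20
      set s₀ := s.setReg 20 i with hs₀
      have body1 : ∀ u, Agree body s₀ u → Agree Q m u ∧ u.reg 20 = i := by
        intro u hu
        refine ⟨hag.trans hu.loop.seqRight, ?_⟩
        rw [hu.reg 20 (by simp [hbody, sumCell, wreg, k0.symm])]
        simp [hs₀]
      set P₁ := sumCell 100 (.const 0) (.const 0) 22 C
        (.mul (.conj (.cell S (.add off (.reg 20)) (.reg 22)))
        (.cell S (.add off (.reg 20)) (.reg 22))) with hP₁
      have v₁ := sumCell_run (T := 100) (i := .const 0) (j := .const 0) (k := 22) (b := C)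
        (e := (.mul (.conj (.cell S (.add off (.reg 20)) (.reg 22)))
          (.cell S (.add off (.reg 20)) (.reg 22)))) (m := s₀)
        (x := 0) (y := 0) (val := fun c => star (G i c) * G i c)
        ((hag.reg C (hwr C C0 C1 C2)).trans hC)
        (fun _ _ => rfl) (fun _ _ => rfl) (by
          intro c hc u hu hk
          obtain ⟨h1, h2⟩ := body1 u hu.seqLeft
          simp [SExpr.eval, IExpr.eval, hoff u h1, hk, h2, h1.scell S (hws S hST hS), hG])
      rw [← hP₁] at v₁
      set s₁ := P₁.run s₀ with hs₁
      have ag₁ : Agree P₁ s₀ s₁ := run_agree _ _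
      have kk₁ : s₁.reg k = s.reg k := by
        rw [ag₁.reg k (by simp [hP₁, sumCell, wreg, k2])]
        simp [hs₀, k0]
      have tt₁ : s₁.scell T = s.scell T := by
        rw [ag₁.scell T (by simp [hP₁, sumCell, ws, hT])]
        simp [hs₀]
      have c0 : s₁.scell 100 0 0 = ip cC (G i) (G i) := by
        rw [v₁]; simp [ip]
      by_cases hz : ip cC (G i) (G i) = 0
      · have : body.run s₀ = s₁ := by
          simp [hbody, run, SExpr.eval, IExpr.eval, ← hs₁, c0, hz]
        rw [this, kk₁, tt₁]
        refine ⟨e, ⟨fun l hl => (he.lt l hl).trans (Nat.lt_succ_self i), he.strictMono, he.ne_zero,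
          he.eq, fun a ha hna => ?_⟩⟩
        rcases (Nat.lt_succ_iff_lt_or_eq.1 ha) with h | rfl
        · exact he.surj a h hna
        · exact absurd hz hna
      · set P₂ : Loop := .loop 22 C' (.setSCell T (.reg k) (.reg 22)
            (.cell S (.add off (.reg 20)) (.reg 22))) with hP₂
        obtain ⟨u, hu, huinv, hurun⟩ := run_for (i := 22) (b := C')
          (P := .setSCell T (.reg k) (.reg 22) (.cell S (.add off (.reg 20)) (.reg 22))) (m := s₁)
          (fun d u => u.scell T = fun a c => if a = s.reg k ∧ c < d then G i c else s.scell T a c)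
          (by simp [tt₁]) (by
            intro c hc u hu huinv
            have hb : Agree body s₀ (u.setReg 22 c) := ag₁.seqLeft.trans (by
              refine Agree.setReg ?_ (by simp [wreg])
              refine hu.mono ?_ ?_ ?_ <;> simp +contextual [wreg, wi, ws])
            obtain ⟨h1, h2⟩ := body1 _ hb
            have h3 : (u.setReg 22 c).reg k = s.reg k := by
              rw [reg_setReg, if_neg k2, hu.reg k (by simp [wreg, k2]), kk₁]
            funext a d
            simp only [run, SExpr.eval, IExpr.eval, scell_setSCell, hoff _ h1, h2, h3, true_and,
              h1.scell S (hws S hST hS), reg_setReg, if_true, scell_setReg, huinv]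
            by_cases h : a = s.reg k
            · by_cases h' : d = c
              · simp [h, h', hG]
              · simp [h, h', show d < c + 1 ↔ d < c by omega]
            · simp [h])
        have hC'' : s₁.reg C' = cC' := by
          rw [ag₁.reg C' (by simp [hP₁, sumCell, wreg, C1']), hag.reg C' (hwr C' C0' C1' C2'), hC']
        have hk' : (P₂.run s₁).reg k = s.reg k := by
          rw [(run_agree P₂ s₁).reg k (by simp [hP₂, wreg, k2]), kk₁]
        have hrun : body.run s₀ = (P₂.run s₁).setReg k (s.reg k + 1) := by
          simp [hbody, run, SExpr.eval, IExpr.eval, ← hs₁, c0, hz, ← hk', hP₂]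
        have hTt : (P₂.run s₁).scell T =
            fun a c => if a = s.reg k ∧ c < cC' then G i c else s.scell T a c := by
          rw [hP₂, hurun, scell_setReg, huinv, hC'']
        rw [hrun, scell_setReg, reg_setReg, if_pos rfl, hTt]
        -- The row just copied gets the next free position, which is the current content of the
        -- counter.
        refine ⟨fun l => if l = s.reg k then i else e l, ⟨fun l hl => ?_, fun l hl l' hl' => ?_,
          fun l hl => ?_, fun l hl c hc => ?_, fun a ha hna => ?_⟩⟩
        · rcases (Nat.lt_succ_iff_lt_or_eq.1 hl) with h | rfl
          · simp only [h.ne, if_false]; exact (he.lt l h).trans (Nat.lt_succ_self i)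
          · simp
        · rcases (Nat.lt_succ_iff_lt_or_eq.1 hl) with h | rfl
          · simp only [h.ne, (hl'.trans h).ne, if_false]; exact he.strictMono l h l' hl'
          · simp only [hl'.ne, if_false, if_true]; exact he.lt l' hl'
        · rcases (Nat.lt_succ_iff_lt_or_eq.1 hl) with h | rfl
          · simp only [h.ne, if_false]; exact he.ne_zero l h
          · simpa using hz
        · rcases (Nat.lt_succ_iff_lt_or_eq.1 hl) with h | rfl
          · simp only [h.ne, if_false, false_and]; exact he.eq l h c hc
          · simp [hc]
        · rcases (Nat.lt_succ_iff_lt_or_eq.1 ha) with h | rfl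
          · obtain ⟨l, hl, rfl⟩ := he.surj a h hna
            exact ⟨l, by omega, by simp [hl.ne]⟩
          · exact ⟨s.reg k, by omega, by simp⟩)
  have hB : (m.setReg k 0).reg r = cr := by rw [reg_setReg, if_neg r2, hr]
  have hrun : Q.run m = s.setReg 20 cr := by
    rw [hQb]
    simp only [run, IExpr.eval] at hs ⊢
    rw [hs, hB]
  rw [hrun, scell_setReg, reg_setReg, if_neg k0]
  exact ⟨e, hB ▸ hinv⟩

end Loop

end

section

namespace Loop

variable {𝕜 : Type*} [RCLike 𝕜]

/-! ### Array sizes -/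

/-- Multiply register `4` by register `0`. The result is in register `23`. -/
def times : Loop :=
  .seq (.setReg 23 (.const 0)) (.loop 21 0 (.setReg 23 (.add (.reg 23) (.reg 4))))

theorem times_run (m : Memory 𝕜) : (times.run m).reg 23 = m.reg 0 * m.reg 4 := by
  obtain ⟨s, -, hinv, hs⟩ := run_for (P := .setReg 23 (.add (.reg 23) (.reg 4))) (i := 21) (b := 0)
    (m := m.setReg 23 0) (fun j s => s.reg 23 = j * m.reg 4) (by simp) (by
      intro j hj s hs hinv
      have h4 : s.reg 4 = m.reg 4 := by rw [hs.reg 4 rfl]; simp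
      simp [run, IExpr.eval, h4, hinv, add_mul])
  have : times.run m = (Loop.loop 21 0 (.setReg 23 (.add (.reg 23) (.reg 4)))).run (m.setReg 23 0) :=
    rfl
  rw [this, hs]
  simpa using hinv

/-- Registers `0, …, 3` contain the sizes of the input, and registers `4, …, 10` the sizes of the
arrays of the computation. -/
structure Sizes (n d p R : ℕ) (m : Memory 𝕜) : Prop where
  r0 : m.reg 0 = n
  r1 : m.reg 1 = d
  r2 : m.reg 2 = p
  r3 : m.reg 3 = R
  r4 : m.reg 4 = n ^ (d - 1)
  r5 : m.reg 5 = n ^ d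
  r6 : m.reg 6 = d - 1
  r7 : m.reg 7 = n ^ d + n ^ d
  r8 : m.reg 8 = n ^ d + p + n ^ d
  r9 : m.reg 9 = n ^ d + p
  r10 : m.reg 10 = n + n

theorem Sizes.agree {n d p R : ℕ} {m s : Memory 𝕜} (h : Sizes n d p R m) {Q : Loop}
    (hs : Agree Q m s) (hQ : ∀ x < 11, Q.wreg x = false) : Sizes n d p R s := by
  constructor <;> rw [hs.reg _ (hQ _ (by norm_num))]
  exacts [h.r0, h.r1, h.r2, h.r3, h.r4, h.r5, h.r6, h.r7, h.r8, h.r9, h.r10]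

/-- The number of factors but one. -/
def predStage : Loop := .setReg 6 (.sub (.reg 1) (.const 1))

/-- Computation of the array sizes. -/
def sizeStage : Loop :=
  .seq (.setReg 4 (.const 1)) <|
  .seq (.loop 20 6 (.seq times (.setReg 4 (.reg 23)))) <|
  .seq times <|
  .seq (.setReg 5 (.reg 23)) <|
  .seq (.setReg 7 (.add (.reg 5) (.reg 5))) <|
  .seq (.setReg 9 (.add (.reg 5) (.reg 2))) <|
  .seq (.setReg 8 (.add (.reg 9) (.reg 5))) <|
  .setReg 10 (.add (.reg 0) (.reg 0))

/-- Numbers can only be added, so powers are computed by repeated addition. The number `d - 1` is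
computed in a stage of its own because register `6` bounds a loop of `sizeStage`, and a stage must
not write to its bounds. -/
theorem sizeStage_run {n d p R : ℕ} (hd : 1 ≤ d) {m : Memory 𝕜} (h0 : m.reg 0 = n)
    (h1 : m.reg 1 = d) (h2 : m.reg 2 = p) (h3 : m.reg 3 = R) :
    Sizes n d p R (sizeStage.run (predStage.run m)) := by
  set m₁ := (predStage.run m).setReg 4 1 with hm₁
  have e0 : m₁.reg 0 = n := by simp [hm₁, predStage, run, h0]
  have e1 : m₁.reg 1 = d := by simp [hm₁, predStage, run, h1]
  have e2 : m₁.reg 2 = p := by simp [hm₁, predStage, run, h2]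
  have e3 : m₁.reg 3 = R := by simp [hm₁, predStage, run, h3]
  have e6 : m₁.reg 6 = d - 1 := by simp [hm₁, predStage, run, IExpr.eval, h1]
  obtain ⟨s, hs, hinv, hrun⟩ := run_for (P := .seq times (.setReg 4 (.reg 23))) (i := 20) (b := 6)
    (m := m₁) (fun j s => s.reg 4 = n ^ j) (by simp [hm₁]) (by
      intro j hj s hs hinv
      have h0 : s.reg 0 = n := by rw [hs.reg 0 rfl, e0]
      simp [run, IExpr.eval, times_run, h0, hinv, pow_succ'])
  rw [e6] at hinv hrun
  set m₂ := s.setReg 20 (d - 1) with hm₂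
  have f0 : m₂.reg 0 = n := by simp [hm₂, hs.reg 0 rfl, e0]
  have f1 : m₂.reg 1 = d := by simp [hm₂, hs.reg 1 rfl, e1]
  have f2 : m₂.reg 2 = p := by simp [hm₂, hs.reg 2 rfl, e2]
  have f3 : m₂.reg 3 = R := by simp [hm₂, hs.reg 3 rfl, e3]
  have f4 : m₂.reg 4 = n ^ (d - 1) := by simp [hm₂, hinv]
  have f6 : m₂.reg 6 = d - 1 := by simp [hm₂, hs.reg 6 rfl, e6]
  set m₃ := times.run m₂ with hm₃
  have ag : Agree times m₂ m₃ := run_agree _ _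
  have g23 : m₃.reg 23 = n ^ d := by
    rw [hm₃, times_run, f0, f4, ← pow_succ', Nat.sub_add_cancel hd]
  have hfin : sizeStage.run (predStage.run m) =
      (((((m₃.setReg 5 (n ^ d)).setReg 7 (n ^ d + n ^ d)).setReg 9 (n ^ d + p)).setReg 8
        (n ^ d + p + n ^ d)).setReg 10 (n + n)) := by
    have : sizeStage.run (predStage.run m) = (Loop.seq (.setReg 5 (.reg 23)) <|
      .seq (.setReg 7 (.add (.reg 5) (.reg 5))) <|
      .seq (.setReg 9 (.add (.reg 5) (.reg 2))) <|
      .seq (.setReg 8 (.add (.reg 9) (.reg 5))) <|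
      .setReg 10 (.add (.reg 0) (.reg 0))).run m₃ := by
        rw [hm₃, ← hrun]; rfl
    rw [this]
    simp [run, IExpr.eval, g23, ag.reg 2 rfl, f2, ag.reg 0 rfl, f0]
  rw [hfin]
  constructor <;> simp [ag.reg 0 rfl, ag.reg 1 rfl, ag.reg 2 rfl, ag.reg 3 rfl, ag.reg 4 rfl,
    ag.reg 6 rfl, f0, f1, f2, f3, f4, f6]

/-! ### Digits -/

/-- Digit `k` of `m` in base `n`. -/
def dig (n m k : ℕ) : ℕ := m / n ^ k % n

/-- Table `0` receives the digits of the numbers below `n ^ d`, table `1` the multiples of `n`. -/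
def digitStage : Loop :=
  .seq (.setReg 23 (.const 0)) <| .loop 20 4 <|
  .seq (.setICell 1 (.const 0) (.reg 20) (.reg 23)) <| .loop 21 0 <|
  .seq (.setICell 0 (.reg 23) (.const 0) (.reg 21)) <|
  .seq (.loop 22 6 (.setICell 0 (.reg 23) (.add (.reg 22) (.const 1))
    (.cell 0 (.reg 20) (.reg 22)))) <|
  .setReg 23 (.add (.reg 23) (.const 1))

/-- Table `0` contains the digits of the numbers below `n ^ d`, table `1` the multiples of `n`. -/
structure Digits (n d : ℕ) (m : Memory 𝕜) : Prop where
  digit : ∀ x < n ^ d, ∀ k < d, m.icell 0 x k = dig n x k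
  mul : ∀ b < n ^ (d - 1), m.icell 1 0 b = n * b

theorem Digits.agree {n d : ℕ} {m s : Memory 𝕜} (h : Digits n d m) {Q : Loop}
    (hs : Agree Q m s) (hQ : ∀ x < 2, Q.wi x = false) : Digits n d s := by
  refine ⟨?_, ?_⟩
  · rw [hs.icell _ (hQ _ (by norm_num))]; exact h.digit
  · rw [hs.icell _ (hQ _ (by norm_num))]; exact h.mul

theorem dig_zero (n b : ℕ) {a : ℕ} (ha : a < n) : dig n (n * b + a) 0 = a := by
  simp [dig, Nat.add_mod, Nat.mod_eq_of_lt ha]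

theorem dig_succ (n b k : ℕ) {a : ℕ} (ha : a < n) : dig n (n * b + a) (k + 1) = dig n b k := by
  rw [dig, pow_succ', ← Nat.div_div_eq_div_mul, Nat.mul_add_div (by omega), Nat.div_eq_of_lt ha,
    add_zero, dig]

/-- No division is needed: the lowest digit of `n * b + a` is `a`, and the others are the digits of
`b`, which have already been tabulated. -/
theorem digitStage_run {n d p R : ℕ} (hn : 2 ≤ n) (hd : 1 ≤ d) {m : Memory 𝕜}
    (hm : Sizes n d p R m) : Digits n d (digitStage.run m) := by
  set inner : Loop := .seq (.setICell 0 (.reg 23) (.const 0) (.reg 21)) <|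
    .seq (.loop 22 6 (.setICell 0 (.reg 23) (.add (.reg 22) (.const 1))
    (.cell 0 (.reg 20) (.reg 22)))) <| .setReg 23 (.add (.reg 23) (.const 1)) with hinner
  obtain ⟨s, -, ⟨i1, i2, i3⟩, hrun⟩ := run_for
    (P := .seq (.setICell 1 (.const 0) (.reg 20) (.reg 23)) (.loop 21 0 inner)) (i := 20) (b := 4)
    (m := m.setReg 23 0) (fun b s => s.reg 23 = n * b ∧
      (∀ x < n * b, ∀ k < d, s.icell 0 x k = dig n x k) ∧ ∀ b' < b, s.icell 1 0 b' = n * b')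
    ⟨by simp, by simp, by simp⟩ (by
      rintro b hb s hs ⟨i1, i2, i3⟩
      set s₁ := (s.setReg 20 b).setICell 1 0 b (n * b) with hs₁
      have hrun₁ : (Loop.seq (.setICell 1 (.const 0) (.reg 20) (.reg 23)) (.loop 21 0 inner)).run
          (s.setReg 20 b) = (Loop.loop 21 0 inner).run s₁ := by
        simp [run, IExpr.eval, hs₁, i1]
      have s₁0 : s₁.reg 0 = n := by
        simp [hs₁, hs.reg 0 rfl, hm.r0]
      obtain ⟨u, hu, ⟨j1, j2⟩, hrun⟩ := run_for (P := inner) (i := 21) (b := 0) (m := s₁)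
        (fun a u => u.reg 23 = n * b + a ∧ ∀ x < n * b + a, ∀ k < d, u.icell 0 x k = dig n x k)
        ⟨by simp [hs₁, i1], by simpa [hs₁] using i2⟩ (by
          rintro a ha u hu ⟨j1, j2⟩
          rw [s₁0] at ha
          set u₁ := (u.setReg 21 a).setICell 0 (n * b + a) 0 a with hu₁
          have u20 : u.reg 20 = b := by rw [hu.reg 20 rfl]; simp [hs₁]
          have u6 : u₁.reg 6 = d - 1 := by
            simp [hu₁, hu.reg 6 rfl, hs₁, hs.reg 6 rfl, hm.r6]
          obtain ⟨w, hw, ⟨k1, k2⟩, hrun⟩ := run_for (i := 22) (b := 6) (m := u₁)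
            (P := .setICell 0 (.reg 23) (.add (.reg 22) (.const 1)) (.cell 0 (.reg 20) (.reg 22)))
            (fun e w => (∀ x < n * b + a, ∀ k < d, w.icell 0 x k = dig n x k) ∧
              ∀ k < e + 1, w.icell 0 (n * b + a) k = dig n (n * b + a) k)
            ⟨fun x hx k hk => by simpa [hu₁, hx.ne] using j2 x hx k hk, fun k hk => by
              obtain rfl : k = 0 := by omega
              simp [hu₁, dig_zero n b ha]⟩ (by
              rintro e he w hw ⟨k1, k2⟩
              rw [u6] at he
              have w23 : w.reg 23 = n * b + a := by rw [hw.reg 23 rfl]; simp [hu₁, j1]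
              have w20 : w.reg 20 = b := by rw [hw.reg 20 rfl]; simp [hu₁, u20]
              -- Row `b` precedes the current row except when `a = b = 0`; then it is the current
              -- row itself, whose digits up to position `e` have been written.
              have hval : w.icell 0 b e = dig n b e := by
                rcases Nat.eq_zero_or_pos (n * b + a) with h | h
                · have hb0 : b = 0 := by
                    by_contra hb0
                    have := Nat.mul_pos (show 0 < n by omega) (Nat.pos_of_ne_zero hb0)
                    omega
                  have := k2 e (by omega)
                  rw [h] at this
                  rw [hb0]; exact this
                · refine k1 b ?_ e (by omega)
                  rcases Nat.eq_zero_or_pos b with h' | h'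
                  · omega
                  · nlinarith
              simp only [run, IExpr.eval, reg_setReg, icell_setReg]
              simp only [w23, w20, icell_setICell, true_and, if_true, icell_setReg,
                show (23 : ℕ) ≠ 22 by norm_num, show (20 : ℕ) ≠ 22 by norm_num, if_false, hval]
              refine ⟨fun x hx k hk => ?_, fun k hk => ?_⟩
              · rw [if_neg (by omega), k1 x hx k hk]
              · by_cases h : k = e + 1
                · subst h; simp [dig_succ n b e ha]
                · rw [if_neg (by omega), k2 k (by omega)])
          have hfin : inner.run (u.setReg 21 a) = (w.setReg 22 (d - 1)).setReg 23 (n * b + a + 1) := by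
            have : inner.run (u.setReg 21 a) = (Loop.seq (.loop 22 6 (.setICell 0 (.reg 23)
                (.add (.reg 22) (.const 1)) (.cell 0 (.reg 20) (.reg 22))))
                (.setReg 23 (.add (.reg 23) (.const 1)))).run u₁ := by
              simp [hinner, run, IExpr.eval, hu₁, j1]
            rw [this, run, hrun, u6]
            simp [run, IExpr.eval, hw.reg 23 rfl, hu₁, j1]
          rw [hfin]
          refine ⟨by simp; ring, fun x hx k hk => ?_⟩
          simp only [icell_setReg]
          rw [u6] at k2
          rcases Nat.lt_succ_iff_lt_or_eq.1 (show x < n * b + a + 1 by omega) with h | rfl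
          · exact k1 x h k hk
          · exact k2 k (by omega))
      rw [hrun₁, hrun, s₁0]
      rw [s₁0] at j1 j2
      refine ⟨by simp [j1]; ring, by simpa [Nat.mul_succ] using j2, fun b' hb' => ?_⟩
      simp only [icell_setReg, hu.icell 1 rfl]
      by_cases h : b' = b
      · subst h; simp [hs₁]
      · simp [hs₁, h, i3 b' (by omega)])
  have hb : (m.setReg 23 0).reg 4 = n ^ (d - 1) := by simp [hm.r4]
  rw [hb] at i2 i3
  have hfin : digitStage.run m = s.setReg 20 (n ^ (d - 1)) := by
    rw [← hb, ← hrun]; rfl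
  rw [hfin]
  refine ⟨?_, i3⟩
  rw [← pow_succ', Nat.sub_add_cancel hd] at i2
  exact i2

/-! ### Symmetrization -/

/-- The number of occurrences of the digit `i` in `x`. -/
def digCount (n d x i : ℕ) : ℕ := ((Finset.range d).filter fun k => dig n x k = i).card

/-- Table `2` receives the numbers of occurrences of digits; it has to be zero at the beginning. -/
def countStage : Loop :=
  for₂ 20 5 21 1 (.setICell 2 (.reg 20) (.cell 0 (.reg 20) (.reg 21))
    (.add (.cell 2 (.reg 20) (.cell 0 (.reg 20) (.reg 21))) (.const 1)))

theorem countStage_run {n d p R : ℕ} {m : Memory 𝕜} (hm : Sizes n d p R m) (hD : Digits n d m)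
    (h2 : ∀ x i, m.icell 2 x i = 0) :
    ∀ x < n ^ d, ∀ i, (countStage.run m).icell 2 x i = digCount n d x i := by
  set inner : Loop := .setICell 2 (.reg 20) (.cell 0 (.reg 20) (.reg 21))
    (.add (.cell 2 (.reg 20) (.cell 0 (.reg 20) (.reg 21))) (.const 1)) with hinner
  obtain ⟨s, -, ⟨i1, -⟩, hrun⟩ := run_for (P := .loop 21 1 inner) (i := 20) (b := 5)
    (m := m) (fun c s => (∀ x < c, ∀ i, s.icell 2 x i = digCount n d x i) ∧
      ∀ x, c ≤ x → ∀ i, s.icell 2 x i = 0) ⟨by simp, fun x _ i => h2 x i⟩ (by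
      rintro c hc s hs ⟨i1, i2⟩
      rw [hm.r5] at hc
      obtain ⟨u, hu, ⟨j1, j2⟩, hrun⟩ := run_for (P := inner) (i := 21) (b := 1) (m := s.setReg 20 c)
        (fun k u => (∀ i, u.icell 2 c i = ((Finset.range k).filter fun k => dig n c k = i).card) ∧
          ∀ x, x ≠ c → ∀ i, u.icell 2 x i = s.icell 2 x i)
        ⟨by simp [i2 c le_rfl], by simp⟩ (by
          rintro k hk u hu ⟨j1, j2⟩
          have hk' : k < d := by simpa [hs.reg 1 rfl, hm.r1] using hk
          have u20 : u.reg 20 = c := by rw [hu.reg 20 rfl]; simp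
          have u0 : u.icell 0 c k = dig n c k := by
            rw [hu.icell 0 rfl, icell_setReg, hs.icell 0 rfl, hD.digit c hc k hk']
          simp only [hinner, run, IExpr.eval, icell_setICell, icell_setReg, reg_setReg, if_true, u20,
            show (20 : ℕ) ≠ 21 by norm_num, if_false, u0, true_and]
          refine ⟨fun i => ?_, fun x hx i => ?_⟩
          · rw [Finset.range_add_one, Finset.filter_insert]
            by_cases h : dig n c k = i
            · subst h; simp [j1]
            · rw [if_neg (fun h' => h h'.symm), if_neg h, j1]
          · rw [if_neg (by tauto), j2 x hx])
      rw [hrun]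
      have hd : (s.setReg 20 c).reg 1 = d := by simp [hs.reg 1 rfl, hm.r1]
      rw [hd] at j1
      refine ⟨fun x hx i => ?_, fun x hx i => ?_⟩
      · rw [icell_setReg]
        rcases Nat.lt_succ_iff_lt_or_eq.1 hx with h | rfl
        · rw [j2 x h.ne, i1 x h]
        · exact j1 i
      · rw [icell_setReg, j2 x (by omega), i2 x (by omega)])
  have : countStage.run m = s.setReg 20 (m.reg 5) := hrun
  rw [this, icell_setReg]
  rw [hm.r5] at i1
  exact i1

open Classical in
/-- `1` if `x` and `y` have the same digits up to order, and `0` otherwise. -/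
def eqDigits (𝕜 : Type*) [RCLike 𝕜] (n d x y : ℕ) : 𝕜 :=
  if ∀ i < n, digCount n d x i = digCount n d y i then 1 else 0

/-- Table `4` receives the values of `eqDigits`. -/
def eqStage : Loop :=
  for₂ 20 5 21 5 <| .seq (.setSCell 4 (.reg 20) (.reg 21) .one) <| .loop 22 0 <|
    .ifLt (.cell 2 (.reg 20) (.reg 22)) (.cell 2 (.reg 21) (.reg 22))
      (.setSCell 4 (.reg 20) (.reg 21) .zero) <|
    .ifLt (.cell 2 (.reg 21) (.reg 22)) (.cell 2 (.reg 20) (.reg 22))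
      (.setSCell 4 (.reg 20) (.reg 21) .zero) .skip

theorem eqStage_run {n d p R : ℕ} {m : Memory 𝕜} (hm : Sizes n d p R m)
    (hc : ∀ x < n ^ d, ∀ i, m.icell 2 x i = digCount n d x i) :
    ∀ x < n ^ d, ∀ y < n ^ d, (eqStage.run m).scell 4 x y = eqDigits 𝕜 n d x y := by
  classical
  have := for₂_run (T := 4) (i := 20) (a := 5) (j := 21) (b := 5) (m := m) (o := 0) (o' := 0)
    (P := .seq (.setSCell 4 (.reg 20) (.reg 21) .one) <| .loop 22 0 <|
    .ifLt (.cell 2 (.reg 20) (.reg 22)) (.cell 2 (.reg 21) (.reg 22))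
      (.setSCell 4 (.reg 20) (.reg 21) .zero) <|
    .ifLt (.cell 2 (.reg 21) (.reg 22)) (.cell 2 (.reg 20) (.reg 22))
      (.setSCell 4 (.reg 20) (.reg 21) .zero) .skip) (val := eqDigits 𝕜 n d) hm.r5 hm.r5 rfl rfl (by
    intro x hx y hy s hs h20 h21
    obtain ⟨u, -, hinv, hrun⟩ := run_for (i := 22) (b := 0) (m := s.setSCell 4 x y 1)
      (P := .ifLt (.cell 2 (.reg 20) (.reg 22)) (.cell 2 (.reg 21) (.reg 22))
        (.setSCell 4 (.reg 20) (.reg 21) .zero) <|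
        .ifLt (.cell 2 (.reg 21) (.reg 22)) (.cell 2 (.reg 20) (.reg 22))
        (.setSCell 4 (.reg 20) (.reg 21) .zero) .skip)
      (fun c u => u.scell 4 = fun x' y' => if x' = x ∧ y' = y then
        if ∀ i < c, digCount n d x i = digCount n d y i then 1 else 0 else s.scell 4 x' y')
      (by funext x' y'; simp) (by
        intro c hc' u hu hinv
        have h1 : (u.setReg 22 c).icell 2 = m.icell 2 := by
          rw [icell_setReg, hu.icell 2 rfl, icell_setSCell, hs.icell 2 rfl]
        have h2 : (u.setReg 22 c).reg 20 = x := by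
          rw [reg_setReg, if_neg (by norm_num), hu.reg 20 rfl, reg_setSCell, h20]
        have h3 : (u.setReg 22 c).reg 21 = y := by
          rw [reg_setReg, if_neg (by norm_num), hu.reg 21 rfl, reg_setSCell, h21]
        have h4 : (u.setReg 22 c).reg 22 = c := by simp
        have hiff : (∀ i < c + 1, digCount n d x i = digCount n d y i) ↔
            (∀ i < c, digCount n d x i = digCount n d y i) ∧ digCount n d x c = digCount n d y c := by
          refine ⟨fun h => ⟨fun i hi => h i (by omega), h c (by omega)⟩, fun h i hi => ?_⟩
          rcases Nat.lt_succ_iff_lt_or_eq.1 hi with h' | rfl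
          exacts [h.1 i h', h.2]
        simp only [hiff]
        simp only [run, IExpr.eval, SExpr.eval, h1, h2, h3, h4, hc x hx, hc y hy]
        rcases lt_trichotomy (digCount n d x c) (digCount n d y c) with h | h | h
        · funext x' y'
          by_cases ha : x' = x ∧ y' = y <;> simp [ha, h, h.ne, hinv]
        · funext x' y'
          simp [h, hinv]
        · funext x' y'
          by_cases ha : x' = x ∧ y' = y <;> simp [ha, h, h.ne', h.not_gt, hinv])
    have e0 : (s.setSCell 4 x y (1 : 𝕜)).reg 0 = n := by
      rw [reg_setSCell, hs.reg 0 rfl, hm.r0]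
    rw [e0] at hrun hinv
    have e1 : s.setSCell 4 (IExpr.eval s (.reg 20)) (IExpr.eval s (.reg 21)) (SExpr.eval s .one) =
      s.setSCell 4 x y 1 := by simp [IExpr.eval, SExpr.eval, h20, h21]
    rw [run, run, e1, hrun, scell_setReg, hinv]
    funext x' y'
    simp [eqDigits])
  intro x hx y hy
  have h := this.1 x hx y hy
  rw [zero_add, zero_add] at h
  exact h

end Loop

end

/-! ### Linear algebra of the search stage -/

section

namespace Loop

variable {𝕜 : Type*} [RCLike 𝕜]

/-- Write the identity matrix of size `n ^ d` to table `T`, starting from the row whose number is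
in register `o`. -/
def unitStage (T o : ℕ) : Loop :=
  for₂ 20 5 21 5 <| .seq (.setSCell T (.add (.reg o) (.reg 20)) (.reg 21) .zero) <|
    .ifLt (.reg 20) (.reg 21) .skip <| .ifLt (.reg 21) (.reg 20) .skip <|
    .setSCell T (.add (.reg o) (.reg 20)) (.reg 21) .one

theorem unitStage_run {n d p R T o c : ℕ} {m : Memory 𝕜} (hm : Sizes n d p R m)
    (ho : m.reg o = c) (h20 : o ≠ 20) (h21 : o ≠ 21) :
    (∀ x < n ^ d, ∀ y < n ^ d, ((unitStage T o).run m).scell T (c + x) y = if x = y then 1 else 0) ∧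
    ∀ x < c, ∀ y, ((unitStage T o).run m).scell T x y = m.scell T x y := by
  have := for₂_run (T := T) (i := 20) (a := 5) (j := 21) (b := 5) (m := m) (o := c) (o' := 0)
    (P := .seq (.setSCell T (.add (.reg o) (.reg 20)) (.reg 21) .zero) <|
    .ifLt (.reg 20) (.reg 21) .skip <| .ifLt (.reg 21) (.reg 20) .skip <|
    .setSCell T (.add (.reg o) (.reg 20)) (.reg 21) .one) (val := fun x y => if x = y then 1 else 0)
    hm.r5 hm.r5 rfl rfl (by
      intro x hx y hy s hs hi hj
      have hos : s.reg o = c := by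
        rw [hs.reg o (by simp [for₂, wreg, h20, h21]), ho]
      funext x' y'
      rcases lt_trichotomy x y with h | rfl | h
      · simp [run, IExpr.eval, SExpr.eval, hi, hj, hos, h, h.ne]
      · simp only [run, IExpr.eval, SExpr.eval, hi, hj, hos, reg_setSCell, lt_irrefl, if_false,
          scell_setSCell, true_and, if_true, zero_add]
        split <;> rfl
      · simp [run, IExpr.eval, SExpr.eval, hi, hj, hos, h, h.ne', h.not_gt])
  refine ⟨fun x hx y hy => ?_, fun x hx y => this.2 x y (by omega)⟩
  have h := this.1 x hx y hy
  rw [zero_add] at h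
  exact h

/-- The number of `y < n ^ d` with the same digits as `x`, up to order. -/
def digMult (𝕜 : Type*) [RCLike 𝕜] (n d x : ℕ) : 𝕜 :=
  ∑ y ∈ Finset.range (n ^ d), eqDigits 𝕜 n d x y

/-- Coordinate `y` of the symmetrization of `⨂ u_{x_k}`, where `x_k` are the digits of `x`. -/
def symCoord (n d : ℕ) (us : ℕ → ℕ → 𝕜) (x y : ℕ) : 𝕜 :=
  ∑ z ∈ Finset.range (n ^ d), eqDigits 𝕜 n d y z / digMult 𝕜 n d y *
    ∏ k ∈ Finset.range d, us (dig n x k) (dig n z k)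

/-- Table `5` receives the values of `digMult`. -/
def multStage : Loop := for₂ 20 5 21 5 (sumCell 5 (.reg 20) (.reg 21) 22 5 (.cell 4 (.reg 20) (.reg 22)))

/-- Table `6` receives the Kronecker power of table `1`. -/
def kroneckerStage : Loop := for₂ 20 5 21 5 (prodCell 6 (.reg 20) (.reg 21) 22 1
  (.cell 1 (.cell 0 (.reg 20) (.reg 22)) (.cell 0 (.reg 21) (.reg 22))))

/-- Table `8` receives generators of the symmetric power of `U`. -/
def symStage : Loop := for₂ 20 5 21 5 (sumCell 8 (.reg 20) (.reg 21) 22 5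
  (.mul (.div (.cell 4 (.reg 21) (.reg 22)) (.cell 5 (.reg 21) (.const 0)))
    (.cell 6 (.reg 20) (.reg 22))))

/-- The first rows of table `9`: the orthogonal complement of the symmetric power of `U`. -/
def complementStage : Loop := for₂ 20 5 21 5 (.setSCell 9 (.reg 20) (.reg 21)
  (.cell 8 (.add (.reg 5) (.reg 20)) (.reg 21)))

/-- The next rows of table `9`: the given forms. -/
def formStage : Loop := for₂ 20 2 21 5 (.setSCell 9 (.add (.reg 5) (.reg 20)) (.reg 21)
  (.conj (.div (.cell 0 (.reg 20) (.reg 21)) (.cell 5 (.reg 21) (.const 0)))))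

/-- Computation of a basis of the search space. -/
def searchStage : Loop :=
  .seq digitStage <| .seq countStage <| .seq eqStage <| .seq multStage <| .seq kroneckerStage <|
  .seq symStage <| .seq (unitStage 8 5) <| .seq (gramSchmidtLoop 8 7 5 5) <|
  .seq complementStage <| .seq formStage <| .seq (unitStage 9 9) <|
  .seq (gramSchmidtLoop 9 8 5 5) <| compact 9 10 (.reg 9) 5 5 5 11

/-- The tables of the search stage: `A` consists of generators of `S^d(U)` and the standard basis,
`B` is obtained from it by orthogonalization, `A'` consists of the orthogonal complement of
`S^d(U)`, the forms `f_i`, and the standard basis, `B'` is obtained from it by orthogonalization,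
and `P` consists of the last non-zero rows of `B'`. -/
structure SearchTables (n d p k : ℕ) (co us A B A' B' P : ℕ → ℕ → 𝕜) (e : ℕ → ℕ) : Prop where
  sym : ∀ x < n ^ d, ∀ y < n ^ d, A x y = symCoord n d us x y
  unit : ∀ x < n ^ d, ∀ y < n ^ d, A (n ^ d + x) y = if x = y then 1 else 0
  gs : IsGramSchmidt (n ^ d) (n ^ d) (n ^ d + n ^ d) A B
  compl : ∀ x < n ^ d, ∀ y < n ^ d, A' x y = B (n ^ d + x) y
  form : ∀ x < p, ∀ y < n ^ d, A' (n ^ d + x) y = star (co x y / digMult 𝕜 n d y)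
  unit' : ∀ x < n ^ d, ∀ y < n ^ d, A' (n ^ d + p + x) y = if x = y then 1 else 0
  gs' : IsGramSchmidt (n ^ d) (n ^ d) (n ^ d + p + n ^ d) A' B'
  compact : IsCompaction (n ^ d) (n ^ d) (n ^ d) k (fun a => B' (n ^ d + p + a)) P e

/-- Intersections are obtained from orthogonal complements. Orthogonalizing generators of `S^d(U)`
followed by the standard basis makes the last `n ^ d` rows span the complement of `S^d(U)`. These
rows, the conjugated forms and again the standard basis are orthogonalized, and the last `n ^ d`
rows then span the search space. -/
theorem searchStage_run {n d p R : ℕ} (hn : 2 ≤ n) (hd : 1 ≤ d) {m : Memory 𝕜}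
    (hm : Sizes n d p R m) (h2 : ∀ x i, m.icell 2 x i = 0) :
    Sizes n d p R (searchStage.run m) ∧ Digits n d (searchStage.run m) ∧
    ∃ A B A' e, SearchTables n d p ((searchStage.run m).reg 11) (m.scell 0) (m.scell 1) A B A'
      ((searchStage.run m).scell 9) ((searchStage.run m).scell 10) e := by
  have hN : 0 < n ^ d := Nat.pow_pos (by omega)
  set m₁ := digitStage.run m with hm₁
  have a₁ : Agree digitStage m m₁ := run_agree _ _
  have s₁ := hm.agree a₁ (by decide)
  have d₁ : Digits n d m₁ := digitStage_run hn hd hm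
  set m₂ := countStage.run m₁ with hm₂
  have a₂ : Agree countStage m₁ m₂ := run_agree _ _
  have s₂ := s₁.agree a₂ (by decide)
  have d₂ := d₁.agree a₂ (by decide)
  have c₂ : ∀ x < n ^ d, ∀ i, m₂.icell 2 x i = digCount n d x i :=
    countStage_run s₁ d₁ (by rw [a₁.icell 2 rfl]; exact h2)
  set m₃ := eqStage.run m₂ with hm₃
  have a₃ : Agree eqStage m₂ m₃ := run_agree _ _
  have s₃ := s₂.agree a₃ (by decide)
  have d₃ := d₂.agree a₃ (by decide)
  have e₃ : ∀ x < n ^ d, ∀ y < n ^ d, m₃.scell 4 x y = eqDigits 𝕜 n d x y := eqStage_run s₂ c₂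
  set m₄ := multStage.run m₃ with hm₄
  have a₄ : Agree multStage m₃ m₄ := run_agree _ _
  have s₄ := s₃.agree a₄ (by decide)
  have d₄ := d₃.agree a₄ (by decide)
  have e₄ : ∀ x < n ^ d, ∀ y < n ^ d, m₄.scell 5 x y = digMult 𝕜 n d x := by
    have := for₂_sumCell (T := 5) (i := 20) (a := 5) (j := 21) (b := 5) (k := 22) (c := 5)
      (I := .reg 20) (J := .reg 21) (e := .cell 4 (.reg 20) (.reg 22)) (m := m₃) 0 0
      (fun x _ z => eqDigits 𝕜 n d x z) s₃.r5 s₃.r5 s₃.r5 rfl rfl rfl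
      (fun s _ => (zero_add _).symm) (fun s _ => (zero_add _).symm) (by
        intro x hx y hy z hz s hs hi hj hk
        simp only [SExpr.eval, IExpr.eval, hi, hk]
        rw [hs.scell 4 rfl, e₃ x hx z hz])
    simp only [zero_add] at this
    exact this.1
  have e₄' : ∀ x < n ^ d, ∀ y < n ^ d, m₄.scell 4 x y = eqDigits 𝕜 n d x y := by
    rw [a₄.scell 4 rfl]; exact e₃
  set m₅ := kroneckerStage.run m₄ with hm₅
  have a₅ : Agree kroneckerStage m₄ m₅ := run_agree _ _
  have s₅ := s₄.agree a₅ (by decide)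
  have d₅ := d₄.agree a₅ (by decide)
  have u₄ : m₄.scell 1 = m.scell 1 := by
    rw [a₄.scell 1 rfl, a₃.scell 1 rfl, a₂.scell 1 rfl, a₁.scell 1 rfl]
  have e₅ : ∀ x < n ^ d, ∀ y < n ^ d, m₅.scell 6 x y =
      ∏ k ∈ Finset.range d, m.scell 1 (dig n x k) (dig n y k) := by
    have := for₂_prodCell (T := 6) (i := 20) (a := 5) (j := 21) (b := 5) (k := 22) (c := 1)
      (I := .reg 20) (J := .reg 21)
      (e := .cell 1 (.cell 0 (.reg 20) (.reg 22)) (.cell 0 (.reg 21) (.reg 22))) (m := m₄) 0 0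
      (fun x y k => m.scell 1 (dig n x k) (dig n y k)) s₄.r5 s₄.r5 s₄.r1 rfl rfl rfl
      (fun s _ => (zero_add _).symm) (fun s _ => (zero_add _).symm) (by
        intro x hx y hy z hz s hs hi hj hk
        simp only [SExpr.eval, IExpr.eval, hi, hj, hk]
        rw [hs.scell 1 rfl, hs.icell 0 rfl, u₄, d₄.digit x hx z hz, d₄.digit y hy z hz])
    simp only [zero_add] at this
    exact this.1
  set m₆ := symStage.run m₅ with hm₆
  have a₆ : Agree symStage m₅ m₆ := run_agree _ _
  have s₆ := s₅.agree a₆ (by decide)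
  have d₆ := d₅.agree a₆ (by decide)
  have e₆ : ∀ x < n ^ d, ∀ y < n ^ d, m₆.scell 8 x y = symCoord n d (m.scell 1) x y := by
    have := for₂_sumCell (T := 8) (i := 20) (a := 5) (j := 21) (b := 5) (k := 22) (c := 5)
      (I := .reg 20) (J := .reg 21) (e := .mul (.div (.cell 4 (.reg 21) (.reg 22))
        (.cell 5 (.reg 21) (.const 0))) (.cell 6 (.reg 20) (.reg 22))) (m := m₅) 0 0
      (fun x y z => eqDigits 𝕜 n d y z / digMult 𝕜 n d y *
        ∏ k ∈ Finset.range d, m.scell 1 (dig n x k) (dig n z k)) s₅.r5 s₅.r5 s₅.r5 rfl rfl rfl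
      (fun s _ => (zero_add _).symm) (fun s _ => (zero_add _).symm) (by
        intro x hx y hy z hz s hs hi hj hk
        simp only [SExpr.eval, IExpr.eval, hi, hj, hk]
        rw [hs.scell 4 rfl, hs.scell 5 rfl, hs.scell 6 rfl, a₅.scell 4 rfl, a₅.scell 5 rfl,
          e₄' y hy z hz, e₄ y hy 0 hN, e₅ x hx z hz])
    simp only [zero_add] at this
    exact this.1
  set m₇ := (unitStage 8 5).run m₆ with hm₇
  have a₇ : Agree (unitStage 8 5) m₆ m₇ := run_agree _ _
  have s₇ := s₆.agree a₇ (by decide)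
  have d₇ := d₆.agree a₇ (by decide)
  obtain ⟨e₇, e₇'⟩ := unitStage_run (T := 8) s₆ s₆.r5 (by norm_num) (by norm_num)
  rw [← hm₇] at e₇ e₇'
  set m₈ := (gramSchmidtLoop 8 7 5 5).run m₇ with hm₈
  have a₈ : Agree (gramSchmidtLoop 8 7 5 5) m₇ m₈ := run_agree _ _
  have s₈ := s₇.agree a₈ (by decide)
  have d₈ := d₇.agree a₈ (by decide)
  have e₈ := gramSchmidtLoop_run (T := 8) (r := 7) (C := 5) (C' := 5) (by norm_num) s₇.r7 s₇.r5 s₇.r5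
    le_rfl (by decide)
  rw [← hm₈] at e₈
  set m₉ := complementStage.run m₈ with hm₉
  have a₉ : Agree complementStage m₈ m₉ := run_agree _ _
  have s₉ := s₈.agree a₉ (by decide)
  have d₉ := d₈.agree a₉ (by decide)
  have e₉ : ∀ x < n ^ d, ∀ y < n ^ d, m₉.scell 9 x y = m₈.scell 8 (n ^ d + x) y := by
    have := for₂_setSCell (T := 9) (i := 20) (a := 5) (j := 21) (b := 5)
      (I := .reg 20) (J := .reg 21) (e := .cell 8 (.add (.reg 5) (.reg 20)) (.reg 21)) (m := m₈) 0 0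
      (fun x y => m₈.scell 8 (n ^ d + x) y) s₈.r5 s₈.r5 rfl rfl
      (fun s _ => (zero_add _).symm) (fun s _ => (zero_add _).symm) (by
        intro x hx y hy s hs hi hj
        simp only [SExpr.eval, IExpr.eval, hi, hj]
        rw [hs.scell 8 rfl, hs.reg 5 rfl, s₈.r5])
    simp only [zero_add] at this
    exact this.1
  set m₁₀ := formStage.run m₉ with hm₁₀
  have a₁₀ : Agree formStage m₉ m₁₀ := run_agree _ _
  have s₁₀ := s₉.agree a₁₀ (by decide)
  have d₁₀ := d₉.agree a₁₀ (by decide)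
  have u₉ : m₉.scell 0 = m.scell 0 := by
    rw [a₉.scell 0 rfl, a₈.scell 0 rfl, a₇.scell 0 rfl, a₆.scell 0 rfl, a₅.scell 0 rfl,
      a₄.scell 0 rfl, a₃.scell 0 rfl, a₂.scell 0 rfl, a₁.scell 0 rfl]
  have u₉' : m₉.scell 5 = m₄.scell 5 := by
    rw [a₉.scell 5 rfl, a₈.scell 5 rfl, a₇.scell 5 rfl, a₆.scell 5 rfl, a₅.scell 5 rfl]
  have e₁₀ := for₂_setSCell (T := 9) (i := 20) (a := 2) (j := 21) (b := 5)
    (I := .add (.reg 5) (.reg 20)) (J := .reg 21)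
    (e := .conj (.div (.cell 0 (.reg 20) (.reg 21)) (.cell 5 (.reg 21) (.const 0)))) (m := m₉)
    (n ^ d) 0 (fun x y => star (m.scell 0 x y / digMult 𝕜 n d y)) s₉.r2 s₉.r5 rfl rfl
    (fun s hs => by simp only [IExpr.eval]; rw [hs.reg 5 rfl, s₉.r5])
    (fun s _ => (zero_add _).symm) (by
      intro x hx y hy s hs hi hj
      simp only [SExpr.eval, IExpr.eval, hi, hj]
      rw [hs.scell 0 rfl, hs.scell 5 rfl, u₉, u₉', e₄ y hy 0 hN])
  simp only [zero_add] at e₁₀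
  change (∀ x < p, ∀ y < n ^ d, m₁₀.scell 9 (n ^ d + x) y = _) ∧
    ∀ x' y', _ → m₁₀.scell 9 x' y' = _ at e₁₀
  set m₁₁ := (unitStage 9 9).run m₁₀ with hm₁₁
  have a₁₁ : Agree (unitStage 9 9) m₁₀ m₁₁ := run_agree _ _
  have s₁₁ := s₁₀.agree a₁₁ (by decide)
  have d₁₁ := d₁₀.agree a₁₁ (by decide)
  obtain ⟨e₁₁, e₁₁'⟩ := unitStage_run (T := 9) s₁₀ s₁₀.r9 (by norm_num) (by norm_num)
  rw [← hm₁₁] at e₁₁ e₁₁'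
  set m₁₂ := (gramSchmidtLoop 9 8 5 5).run m₁₁ with hm₁₂
  have a₁₂ : Agree (gramSchmidtLoop 9 8 5 5) m₁₁ m₁₂ := run_agree _ _
  have s₁₂ := s₁₁.agree a₁₂ (by decide)
  have d₁₂ := d₁₁.agree a₁₂ (by decide)
  have e₁₂ := gramSchmidtLoop_run (T := 9) (r := 8) (C := 5) (C' := 5) (by norm_num) s₁₁.r8 s₁₁.r5
    s₁₁.r5 le_rfl (by decide)
  rw [← hm₁₂] at e₁₂
  have hrun : searchStage.run m = (compact 9 10 (.reg 9) 5 5 5 11).run m₁₂ := rfl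
  have a₁₃ : Agree (compact 9 10 (.reg 9) 5 5 5 11) m₁₂ (searchStage.run m) := by
    rw [hrun]; exact run_agree _ _
  obtain ⟨e, he⟩ := compact_run (S := 9) (T := 10) (off := .reg 9) (r := 5) (C := 5) (C' := 5)
    (k := 11) (m := m₁₂) (o := n ^ d + p) (by norm_num) (by norm_num) (by norm_num)
    (fun s hs => by simp only [IExpr.eval]; rw [hs.reg 9 rfl, s₁₂.r9]) s₁₂.r5 s₁₂.r5 s₁₂.r5
    (by decide) (by decide)
  rw [← hrun, ← a₁₃.scell 9 rfl] at he
  rw [← a₁₃.scell 9 rfl] at e₁₂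
  refine ⟨s₁₂.agree a₁₃ (by decide), d₁₂.agree a₁₃ (by decide), m₇.scell 8, m₈.scell 8, m₁₁.scell 9,
    e, ⟨fun x hx y hy => ?_, e₇, e₈, fun x hx y hy => ?_, fun x hx y hy => ?_, e₁₁, e₁₂, he⟩⟩
  · rw [e₇' x hx y, e₆ x hx y hy]
  · rw [e₁₁' x (by omega) y, e₁₀.2 x y (by omega), e₉ x hx y hy]
  · rw [e₁₁' _ (by omega) y, e₁₀.1 x hx y hy]

/-! ### The pencil of the algorithm -/

/-- Tables `11` and `12` receive, in each row, the combinations of the rows of table `10` with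
the random coefficients. -/
def combineStage (S T : ℕ) : Loop := for₂ 20 5 21 5 (sumCell T (.reg 20) (.reg 21) 22 11
  (.mul (.cell S (.reg 11) (.reg 22)) (.cell 10 (.reg 22) (.reg 21))))

/-- The columns of the `n × n ^ (d - 1)` matrices that are stored in tables `11` and `12`. -/
def columnStage : Loop :=
  .seq (for₂ 20 4 21 0 (.setSCell 13 (.reg 20) (.reg 21)
    (.cell 11 (.const 0) (.add (.cell 1 (.const 0) (.reg 20)) (.reg 21))))) <|
  for₂ 20 4 21 0 (.setSCell 13 (.reg 20) (.add (.reg 0) (.reg 21))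
    (.cell 12 (.const 0) (.add (.cell 1 (.const 0) (.reg 20)) (.reg 21))))

/-- Table `17` receives the matrix to be diagonalized. -/
def quotientStage : Loop :=
  .seq (for₂ 20 11 21 11 (sumCell 15 (.reg 20) (.reg 21) 22 0
    (.mul (.conj (.cell 14 (.reg 20) (.reg 22))) (.cell 14 (.reg 21) (.add (.reg 0) (.reg 22)))))) <|
  .seq (for₂ 20 11 21 11 (sumCell 16 (.reg 20) (.reg 21) 22 0
    (.mul (.conj (.cell 14 (.reg 20) (.reg 22))) (.cell 14 (.reg 20) (.reg 22))))) <|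
  for₂ 20 11 21 11 (.setSCell 17 (.reg 20) (.reg 21)
    (.div (.cell 15 (.reg 20) (.reg 21)) (.cell 16 (.reg 20) (.reg 21))))

/-- Computation of the matrix to be diagonalized. -/
def pencilStage : Loop :=
  .seq (combineStage 3 11) <| .seq (combineStage 2 12) <| .seq columnStage <|
  .seq (gramSchmidtLoop 13 4 0 10) <| .seq (compact 13 14 (.const 0) 4 0 10 12) quotientStage

/-- The tables of the pencil stage: `G` consists of the columns of `T(g)` and `T(f)`, `H` is obtained
from it by orthogonalization, `Q` consists of the non-zero rows of `H`, and `M` is a matrix of the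
linear map that takes the columns of `T(g)` to those of `T(f)`. -/
structure PencilTables (n d k k' : ℕ) (f g : ℕ → 𝕜) (P G H Q M : ℕ → ℕ → 𝕜) (e : ℕ → ℕ) :
    Prop where
  left : ∀ b < n ^ (d - 1), ∀ a < n, G b a = ∑ l ∈ Finset.range k, g l * P l (n * b + a)
  right : ∀ b < n ^ (d - 1), ∀ a < n, G b (n + a) = ∑ l ∈ Finset.range k, f l * P l (n * b + a)
  gs : IsGramSchmidt n (n + n) (n ^ (d - 1)) G H
  compact : IsCompaction n (n + n) (n ^ (d - 1)) k' H Q e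
  quot : ∀ i < k, ∀ j < k, M i j = ip n (Q i) (fun c => Q j (n + c)) / ip n (Q i) (Q i)

/-- Column `b` of `T(g)` and column `b` of `T(f)` are joined to one row of length `2n`.
Orthogonalization with respect to the first `n` entries performs the same column operations on both
matrices, so every row of the result is a pair `(T(g) c, T(f) c)`. -/
theorem pencilStage_run {n d p R k : ℕ} (hn : 2 ≤ n) (hd : 1 ≤ d) {m : Memory 𝕜}
    (hm : Sizes n d p R m) (hD : Digits n d m) (hk : m.reg 11 = k) :
    Sizes n d p R (pencilStage.run m) ∧
    ∃ G H e, PencilTables n d k ((pencilStage.run m).reg 12) (m.scell 2 k) (m.scell 3 k)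
      (m.scell 10) G H ((pencilStage.run m).scell 14) ((pencilStage.run m).scell 17) e := by
  have hN : 0 < n ^ d := Nat.pow_pos (by omega)
  have hlt : ∀ b < n ^ (d - 1), ∀ a < n, n * b + a < n ^ d := by
    intro b hb a ha
    have : n ^ d = n * n ^ (d - 1) := by rw [← pow_succ', Nat.sub_add_cancel hd]
    rw [this]
    calc n * b + a < n * b + n := by omega
      _ = n * (b + 1) := by ring
      _ ≤ _ := Nat.mul_le_mul_left _ hb
  -- The same combination is written to every row of the table; only row `0` is read later.
  have comb : ∀ S T, T ≠ S → T ≠ 10 → ∀ m : Memory 𝕜, Sizes n d p R m → m.reg 11 = k →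
      ∀ y < n ^ d, ((combineStage S T).run m).scell T 0 y =
        ∑ l ∈ Finset.range k, m.scell S k l * m.scell 10 l y := by
    intro S T hTS hT m hm hk
    have := for₂_sumCell (T := T) (i := 20) (a := 5) (j := 21) (b := 5) (k := 22) (c := 11)
      (I := .reg 20) (J := .reg 21)
      (e := .mul (.cell S (.reg 11) (.reg 22)) (.cell 10 (.reg 22) (.reg 21))) (m := m) 0 0
      (fun _ y z => m.scell S k z * m.scell 10 z y) hm.r5 hm.r5 hk rfl rfl rfl
      (fun s _ => (zero_add _).symm) (fun s _ => (zero_add _).symm) (by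
        intro x hx y hy z hz s hs hi hj hk'
        simp only [SExpr.eval, IExpr.eval, hj, hk']
        rw [hs.scell S (by simp [for₂, sumCell, ws, hTS.symm]),
          hs.scell 10 (by simp [for₂, sumCell, ws, hT.symm]), hs.reg 11 rfl, hk])
    simp only [zero_add] at this
    exact this.1 0 hN
  set m₁ := (combineStage 3 11).run m with hm₁
  have a₁ : Agree (combineStage 3 11) m m₁ := run_agree _ _
  have s₁ := hm.agree a₁ (by decide)
  have k₁ : m₁.reg 11 = k := by rw [a₁.reg 11 rfl, hk]
  have e₁ := comb 3 11 (by norm_num) (by norm_num) m hm hk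
  set m₂ := (combineStage 2 12).run m₁ with hm₂
  have a₂ : Agree (combineStage 2 12) m₁ m₂ := run_agree _ _
  have s₂ := s₁.agree a₂ (by decide)
  have k₂ : m₂.reg 11 = k := by rw [a₂.reg 11 rfl, k₁]
  have e₂ := comb 2 12 (by norm_num) (by norm_num) m₁ s₁ k₁
  rw [a₁.scell 2 rfl, a₁.scell 10 rfl] at e₂
  have e₂' : m₂.scell 11 = m₁.scell 11 := a₂.scell 11 rfl
  have d₂ := (hD.agree a₁ (by decide)).agree a₂ (by decide)
  rw [← hm₁, ← e₂'] at e₁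
  rw [← hm₂] at e₂
  set Q₁ := for₂ 20 4 21 0 (.setSCell 13 (.reg 20) (.reg 21)
    (.cell 11 (.const 0) (.add (.cell 1 (.const 0) (.reg 20)) (.reg 21)))) with hQ₁
  set Q₂ := for₂ 20 4 21 0 (.setSCell 13 (.reg 20) (.add (.reg 0) (.reg 21))
    (.cell 12 (.const 0) (.add (.cell 1 (.const 0) (.reg 20)) (.reg 21)))) with hQ₂
  set m₃ := Q₁.run m₂ with hm₃
  have a₃ : Agree Q₁ m₂ m₃ := run_agree _ _
  have s₃ := s₂.agree a₃ (by decide)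
  have d₃ := d₂.agree a₃ (by decide)
  have e₃ := for₂_setSCell (T := 13) (i := 20) (a := 4) (j := 21) (b := 0)
    (I := .reg 20) (J := .reg 21)
    (e := .cell 11 (.const 0) (.add (.cell 1 (.const 0) (.reg 20)) (.reg 21))) (m := m₂)
    0 0 (fun b a => ∑ l ∈ Finset.range k, m.scell 3 k l * m.scell 10 l (n * b + a)) s₂.r4 s₂.r0
    rfl rfl (fun s hs => (zero_add _).symm) (fun s _ => (zero_add _).symm) (by
      intro x hx y hy s hs hi hj
      simp only [SExpr.eval, IExpr.eval, hi, hj]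
      rw [hs.scell 11 rfl, hs.icell 1 rfl, d₂.mul x hx, e₁ _ (hlt x hx y hy)])
  simp only [zero_add] at e₃
  replace e₃ : ∀ b < n ^ (d - 1), ∀ a < n, m₃.scell 13 b a = _ := e₃.1
  set m₄ := Q₂.run m₃ with hm₄
  have a₄ : Agree Q₂ m₃ m₄ := run_agree _ _
  have s₄ := s₃.agree a₄ (by decide)
  have e₄ := for₂_setSCell (T := 13) (i := 20) (a := 4) (j := 21) (b := 0)
    (I := .reg 20) (J := .add (.reg 0) (.reg 21))
    (e := .cell 12 (.const 0) (.add (.cell 1 (.const 0) (.reg 20)) (.reg 21))) (m := m₃)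
    0 n (fun b a => ∑ l ∈ Finset.range k, m.scell 2 k l * m.scell 10 l (n * b + a)) s₃.r4 s₃.r0
    rfl rfl (fun s hs => (zero_add _).symm)
    (fun s hs => by simp only [IExpr.eval]; rw [hs.reg 0 rfl, s₃.r0]) (by
      intro x hx y hy s hs hi hj
      simp only [SExpr.eval, IExpr.eval, hi, hj]
      rw [hs.scell 12 rfl, hs.icell 1 rfl, d₃.mul x hx, a₃.scell 12 rfl, e₂ _ (hlt x hx y hy)])
  simp only [zero_add] at e₄
  change (∀ b < n ^ (d - 1), ∀ a < n, m₄.scell 13 b (n + a) = _) ∧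
    ∀ x' y', _ → m₄.scell 13 x' y' = _ at e₄
  set m₅ := (gramSchmidtLoop 13 4 0 10).run m₄ with hm₅
  have a₅ : Agree (gramSchmidtLoop 13 4 0 10) m₄ m₅ := run_agree _ _
  have s₅ := s₄.agree a₅ (by decide)
  have e₅ := gramSchmidtLoop_run (T := 13) (r := 4) (C := 0) (C' := 10) (by norm_num) s₄.r4 s₄.r0
    s₄.r10 (by omega) (by decide)
  rw [← hm₅] at e₅
  set m₆ := (compact 13 14 (.const 0) 4 0 10 12).run m₅ with hm₆
  have a₆ : Agree (compact 13 14 (.const 0) 4 0 10 12) m₅ m₆ := run_agree _ _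
  have s₆ := s₅.agree a₆ (by decide)
  have k₆ : m₆.reg 11 = k := by
    rw [a₆.reg 11 rfl, a₅.reg 11 rfl, a₄.reg 11 rfl, a₃.reg 11 rfl, k₂]
  obtain ⟨e, he⟩ := compact_run (S := 13) (T := 14) (off := .const 0) (r := 4) (C := 0) (C' := 10)
    (k := 12) (m := m₅) (o := 0) (by norm_num) (by norm_num) (by norm_num)
    (fun s hs => rfl) s₅.r4 s₅.r0 s₅.r10 (by decide) (by decide)
  rw [← hm₆] at he
  simp only [zero_add] at he
  set R₁ := for₂ 20 11 21 11 (sumCell 15 (.reg 20) (.reg 21) 22 0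
    (.mul (.conj (.cell 14 (.reg 20) (.reg 22))) (.cell 14 (.reg 21) (.add (.reg 0) (.reg 22)))))
    with hR₁
  set R₂ := for₂ 20 11 21 11 (sumCell 16 (.reg 20) (.reg 21) 22 0
    (.mul (.conj (.cell 14 (.reg 20) (.reg 22))) (.cell 14 (.reg 20) (.reg 22)))) with hR₂
  set R₃ := for₂ 20 11 21 11 (.setSCell 17 (.reg 20) (.reg 21)
    (.div (.cell 15 (.reg 20) (.reg 21)) (.cell 16 (.reg 20) (.reg 21)))) with hR₃
  set m₇ := R₁.run m₆ with hm₇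
  have a₇ : Agree R₁ m₆ m₇ := run_agree _ _
  have s₇ := s₆.agree a₇ (by decide)
  have k₇ : m₇.reg 11 = k := by rw [a₇.reg 11 rfl, k₆]
  have e₇ := for₂_sumCell (T := 15) (i := 20) (a := 11) (j := 21) (b := 11) (k := 22) (c := 0)
      (I := .reg 20) (J := .reg 21)
      (e := .mul (.conj (.cell 14 (.reg 20) (.reg 22)))
        (.cell 14 (.reg 21) (.add (.reg 0) (.reg 22)))) (m := m₆) 0 0
      (fun x y z => star (m₆.scell 14 x z) * m₆.scell 14 y (n + z)) k₆ k₆ s₆.r0 rfl rfl rfl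
      (fun s _ => (zero_add _).symm) (fun s _ => (zero_add _).symm) (by
        intro x hx y hy z hz s hs hi hj hk'
        simp only [SExpr.eval, IExpr.eval, hi, hj, hk']
        rw [hs.scell 14 rfl, hs.reg 0 rfl, s₆.r0])
  simp only [zero_add] at e₇
  replace e₇ : ∀ x < k, ∀ y < k, m₇.scell 15 x y = _ := e₇.1
  set m₈ := R₂.run m₇ with hm₈
  have a₈ : Agree R₂ m₇ m₈ := run_agree _ _
  have s₈ := s₇.agree a₈ (by decide)
  have k₈ : m₈.reg 11 = k := by rw [a₈.reg 11 rfl, k₇]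
  have e₈ := for₂_sumCell (T := 16) (i := 20) (a := 11) (j := 21) (b := 11) (k := 22) (c := 0)
      (I := .reg 20) (J := .reg 21)
      (e := .mul (.conj (.cell 14 (.reg 20) (.reg 22))) (.cell 14 (.reg 20) (.reg 22))) (m := m₇) 0 0
      (fun x _ z => star (m₆.scell 14 x z) * m₆.scell 14 x z) k₇ k₇ s₇.r0 rfl rfl rfl
      (fun s _ => (zero_add _).symm) (fun s _ => (zero_add _).symm) (by
        intro x hx y hy z hz s hs hi hj hk'
        simp only [SExpr.eval, IExpr.eval, hi, hk']
        rw [hs.scell 14 rfl, a₇.scell 14 rfl])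
  simp only [zero_add] at e₈
  replace e₈ : ∀ x < k, ∀ y < k, m₈.scell 16 x y = _ := e₈.1
  have hrun : pencilStage.run m = R₃.run m₈ := rfl
  have a₉ : Agree R₃ m₈ (pencilStage.run m) := by rw [hrun]; exact run_agree _ _
  have e₉ := for₂_setSCell (T := 17) (i := 20) (a := 11) (j := 21) (b := 11)
    (I := .reg 20) (J := .reg 21)
    (e := .div (.cell 15 (.reg 20) (.reg 21)) (.cell 16 (.reg 20) (.reg 21))) (m := m₈)
    0 0 (fun i j => ip n (m₆.scell 14 i) (fun c => m₆.scell 14 j (n + c)) /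
      ip n (m₆.scell 14 i) (m₆.scell 14 i)) k₈ k₈
    rfl rfl (fun s hs => (zero_add _).symm) (fun s _ => (zero_add _).symm) (by
      intro x hx y hy s hs hi hj
      simp only [SExpr.eval, IExpr.eval, hi, hj]
      rw [hs.scell 15 rfl, hs.scell 16 rfl, a₈.scell 15 rfl, e₇ x hx y hy, e₈ x hx y hy]
      rfl)
  simp only [zero_add] at e₉
  replace e₉ : ∀ x < k, ∀ y < k, (pencilStage.run m).scell 17 x y = _ := e₉.1
  have q : (pencilStage.run m).scell 14 = m₆.scell 14 := by
    rw [a₉.scell 14 rfl, a₈.scell 14 rfl, a₇.scell 14 rfl]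
  have q' : (pencilStage.run m).reg 12 = m₆.reg 12 := by
    rw [a₉.reg 12 rfl, a₈.reg 12 rfl, a₇.reg 12 rfl]
  refine ⟨s₈.agree a₉ (by decide), m₄.scell 13, m₅.scell 13, e,
    ⟨fun b hb a ha => ?_, e₄.1, e₅, ?_, ?_⟩⟩
  · rw [e₄.2 b a (by omega), e₃ b hb a ha]
  · rw [q, q']; exact he
  · rw [q]; exact e₉

/-! ### Verification -/

/-- Table `21` receives the candidates for the elements of `U ∩ X`, table `22` their powers, and
register `13` is set to `0` if and only if the candidates pass the test. -/
def verifyStage : Loop :=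
  .seq (for₂ 20 11 21 0 (sumCell 21 (.reg 20) (.reg 21) 22 11
    (.mul (.cell 19 (.reg 22) (.reg 20)) (.cell 14 (.reg 22) (.reg 21))))) <|
  .seq (for₂ 20 11 21 5 (prodCell 22 (.reg 20) (.reg 21) 22 1
    (.cell 21 (.reg 20) (.cell 0 (.reg 21) (.reg 22))))) <|
  .seq (for₂ 20 11 21 9 (sumCell 23 (.reg 20) (.reg 21) 22 5
    (.mul (.conj (.cell 9 (.reg 21) (.reg 22))) (.cell 22 (.reg 20) (.reg 22))))) <|
  .seq (.setReg 13 (.const 0)) <|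
  .seq (for₂ 20 11 21 11 (.ifZero (.cell 18 (.const 0) (.reg 20)) (.setReg 13 (.const 1))
    (.ifLt (.reg 20) (.reg 21) (.ifZero (.sub (.cell 18 (.const 0) (.reg 20))
      (.cell 18 (.const 0) (.reg 21))) (.setReg 13 (.const 1)) .skip) .skip))) <|
  .seq (for₂ 20 11 21 9 (.ifZero (.cell 23 (.reg 20) (.reg 21)) .skip (.setReg 13 (.const 1)))) <|
  for₂ 20 11 21 0 (.setSCell 0 (.reg 20) (.reg 21) (.cell 21 (.reg 20) (.reg 21)))

/-- Orthogonality of the power of a candidate to the first `n ^ d + p` rows of table `9` is the test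
for membership in the search space. Table `0` may be overwritten by the candidates because the forms
are not read any more. -/
theorem verifyStage_run {n d p R k : ℕ} {m : Memory 𝕜}
    (hm : Sizes n d p R m) (hD : Digits n d m) (hk : m.reg 11 = k) {Y : ℕ → ℕ → 𝕜}
    (hY : ∀ i < k, ∀ a < n, Y i a = ∑ l ∈ Finset.range k, m.scell 19 l i * m.scell 14 l a)
    (hn : 2 ≤ n) :
    (verifyStage.run m).reg 11 = k ∧
    (∀ i < k, ∀ a < n, (verifyStage.run m).scell 0 i a = Y i a) ∧
    ((verifyStage.run m).reg 13 = 0 ↔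
      (∀ i < k, m.scell 18 0 i ≠ 0) ∧ (∀ i < k, ∀ j < k, i < j → m.scell 18 0 i ≠ m.scell 18 0 j) ∧
      ∀ i < k, ∀ r < n ^ d + p, ∑ x ∈ Finset.range (n ^ d), star (m.scell 9 r x) *
        ∏ t ∈ Finset.range d, Y i (dig n x t) = 0) := by
  set Q₁ := for₂ 20 11 21 0 (sumCell 21 (.reg 20) (.reg 21) 22 11
    (.mul (.cell 19 (.reg 22) (.reg 20)) (.cell 14 (.reg 22) (.reg 21)))) with hQ₁
  set Q₂ := for₂ 20 11 21 5 (prodCell 22 (.reg 20) (.reg 21) 22 1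
    (.cell 21 (.reg 20) (.cell 0 (.reg 21) (.reg 22)))) with hQ₂
  set Q₃ := for₂ 20 11 21 9 (sumCell 23 (.reg 20) (.reg 21) 22 5
    (.mul (.conj (.cell 9 (.reg 21) (.reg 22))) (.cell 22 (.reg 20) (.reg 22)))) with hQ₃
  set Q₄ := for₂ 20 11 21 11 (.ifZero (.cell 18 (.const 0) (.reg 20)) (.setReg 13 (.const 1))
    (.ifLt (.reg 20) (.reg 21) (.ifZero (.sub (.cell 18 (.const 0) (.reg 20))
      (.cell 18 (.const 0) (.reg 21))) (.setReg 13 (.const 1)) .skip) .skip)) with hQ₄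
  set Q₅ := for₂ 20 11 21 9 (.ifZero (.cell 23 (.reg 20) (.reg 21)) .skip (.setReg 13 (.const 1)))
    with hQ₅
  set Q₆ := for₂ 20 11 21 0 (.setSCell 0 (.reg 20) (.reg 21) (.cell 21 (.reg 20) (.reg 21)))
    with hQ₆
  set m₁ := Q₁.run m with hm₁
  have a₁ : Agree Q₁ m m₁ := run_agree _ _
  have s₁ := hm.agree a₁ (by decide)
  have d₁ := hD.agree a₁ (by decide)
  have k₁ : m₁.reg 11 = k := by rw [a₁.reg 11 rfl, hk]
  have e₁ := for₂_sumCell (T := 21) (i := 20) (a := 11) (j := 21) (b := 0) (k := 22) (c := 11)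
    (I := .reg 20) (J := .reg 21)
    (e := .mul (.cell 19 (.reg 22) (.reg 20)) (.cell 14 (.reg 22) (.reg 21))) (m := m) 0 0
    (fun x y z => m.scell 19 z x * m.scell 14 z y) hk hm.r0 hk rfl rfl rfl
    (fun s _ => (zero_add _).symm) (fun s _ => (zero_add _).symm) (by
      intro x hx y hy z hz s hs hi hj hk'
      simp only [SExpr.eval, IExpr.eval, hi, hj, hk']
      rw [hs.scell 19 rfl, hs.scell 14 rfl])
  simp only [zero_add] at e₁
  replace e₁ : ∀ i < k, ∀ a < n, m₁.scell 21 i a = Y i a := fun i hi a ha =>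
    (e₁.1 i hi a ha).trans (hY i hi a ha).symm
  set m₂ := Q₂.run m₁ with hm₂
  have a₂ : Agree Q₂ m₁ m₂ := run_agree _ _
  have s₂ := s₁.agree a₂ (by decide)
  have k₂ : m₂.reg 11 = k := by rw [a₂.reg 11 rfl, k₁]
  have e₂ := for₂_prodCell (T := 22) (i := 20) (a := 11) (j := 21) (b := 5) (k := 22) (c := 1)
    (I := .reg 20) (J := .reg 21)
    (e := .cell 21 (.reg 20) (.cell 0 (.reg 21) (.reg 22))) (m := m₁) 0 0
    (fun x y z => Y x (dig n y z)) k₁ s₁.r5 s₁.r1 rfl rfl rfl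
    (fun s _ => (zero_add _).symm) (fun s _ => (zero_add _).symm) (by
      intro x hx y hy z hz s hs hi hj hk'
      simp only [SExpr.eval, IExpr.eval, hi, hj, hk']
      rw [hs.scell 21 rfl, hs.icell 0 rfl, d₁.digit y hy z hz]
      exact e₁ x hx _ (Nat.mod_lt _ (by omega)))
  simp only [zero_add] at e₂
  replace e₂ : ∀ i < k, ∀ x < n ^ d, m₂.scell 22 i x = _ := e₂.1
  set m₃ := Q₃.run m₂ with hm₃
  have a₃ : Agree Q₃ m₂ m₃ := run_agree _ _
  have s₃ := s₂.agree a₃ (by decide)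
  have k₃ : m₃.reg 11 = k := by rw [a₃.reg 11 rfl, k₂]
  have e₃ := for₂_sumCell (T := 23) (i := 20) (a := 11) (j := 21) (b := 9) (k := 22) (c := 5)
    (I := .reg 20) (J := .reg 21)
    (e := .mul (.conj (.cell 9 (.reg 21) (.reg 22))) (.cell 22 (.reg 20) (.reg 22))) (m := m₂) 0 0
    (fun i r x => star (m.scell 9 r x) * ∏ t ∈ Finset.range d, Y i (dig n x t))
    k₂ s₂.r9 s₂.r5 rfl rfl rfl
    (fun s _ => (zero_add _).symm) (fun s _ => (zero_add _).symm) (by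
      intro x hx y hy z hz s hs hi hj hk'
      simp only [SExpr.eval, IExpr.eval, hi, hj, hk']
      rw [hs.scell 9 rfl, hs.scell 22 rfl, a₂.scell 9 rfl, a₁.scell 9 rfl, e₂ x hx z hz])
  simp only [zero_add] at e₃
  replace e₃ : ∀ i < k, ∀ r < n ^ d + p, m₃.scell 23 i r = _ := e₃.1
  set m₄ := m₃.setReg 13 0 with hm₄
  have k₄ : m₄.reg 11 = k := by simp [hm₄, k₃]
  set m₅ := Q₄.run m₄ with hm₅
  have a₅ : Agree Q₄ m₄ m₅ := run_agree _ _
  have k₅ : m₅.reg 11 = k := by rw [a₅.reg 11 rfl, k₄]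
  have u₄ : m₄.scell 18 = m.scell 18 := by
    rw [hm₄, scell_setReg, a₃.scell 18 rfl, a₂.scell 18 rfl, a₁.scell 18 rfl]
  have r₅ : m₅.reg 9 = n ^ d + p := by rw [a₅.reg 9 rfl, hm₄]; simp [s₃.r9]
  have e₅ := for₂_check (i := 20) (a := 11) (j := 21) (b := 11) (f := 13) (m := m₄)
    (P := .ifZero (.cell 18 (.const 0) (.reg 20)) (.setReg 13 (.const 1))
    (.ifLt (.reg 20) (.reg 21) (.ifZero (.sub (.cell 18 (.const 0) (.reg 20))
      (.cell 18 (.const 0) (.reg 21))) (.setReg 13 (.const 1)) .skip) .skip))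
    (bad := fun i j => m.scell 18 0 i = 0 ∨ i < j ∧ m.scell 18 0 i = m.scell 18 0 j) k₄ k₄ rfl rfl
    (by norm_num) (by norm_num) (by
      intro x hx y hy s hs hi hj
      have hs18 : s.scell 18 = m.scell 18 := by rw [hs.scell 18 rfl, u₄]
      simp only [run, SExpr.eval, IExpr.eval, hi, hj, hs18, sub_eq_zero]
      by_cases h1 : m.scell 18 0 x = 0
      · simp [h1]
      · by_cases h2 : x < y
        · by_cases h3 : m.scell 18 0 x = m.scell 18 0 y
          · rw [if_neg h1, if_pos h2, if_pos h3]; simp [h2, h3]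
          · simp [h1, h2, h3]
        · simp [h1, h2])
  change m₅.reg 13 = 0 ↔ _ at e₅
  set m₆ := Q₅.run m₅ with hm₆
  have a₆ : Agree Q₅ m₅ m₆ := run_agree _ _
  have e₆ := for₂_check (i := 20) (a := 11) (j := 21) (b := 9) (f := 13) (m := m₅)
    (P := .ifZero (.cell 23 (.reg 20) (.reg 21)) .skip (.setReg 13 (.const 1)))
    (bad := fun i r => ¬ m₃.scell 23 i r = 0) k₅ r₅ rfl rfl
    (by norm_num) (by norm_num) (by
      intro x hx y hy s hs hi hj
      have hs23 : s.scell 23 = m₃.scell 23 := by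
        rw [hs.scell 23 rfl, a₅.scell 23 rfl, hm₄, scell_setReg]
      simp only [run, SExpr.eval, IExpr.eval, hi, hj, hs23]
      by_cases h1 : m₃.scell 23 x y = 0 <;> simp [h1])
  change m₆.reg 13 = 0 ↔ _ at e₆
  have k₆ : m₆.reg 11 = k := by rw [a₆.reg 11 rfl, k₅]
  have r₆ : m₆.reg 0 = n := by rw [a₆.reg 0 rfl, a₅.reg 0 rfl, hm₄]; simp [s₃.r0]
  have hrun : verifyStage.run m = Q₆.run m₆ := rfl
  have a₇ : Agree Q₆ m₆ (verifyStage.run m) := by rw [hrun]; exact run_agree _ _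
  have e₇ := for₂_setSCell (T := 0) (i := 20) (a := 11) (j := 21) (b := 0)
    (I := .reg 20) (J := .reg 21) (e := .cell 21 (.reg 20) (.reg 21)) (m := m₆)
    0 0 Y k₆ r₆ rfl rfl (fun s hs => (zero_add _).symm) (fun s _ => (zero_add _).symm) (by
      intro x hx y hy s hs hi hj
      simp only [SExpr.eval, IExpr.eval, hi, hj]
      rw [hs.scell 21 rfl, a₆.scell 21 rfl, a₅.scell 21 rfl, hm₄, scell_setReg, a₃.scell 21 rfl,
        a₂.scell 21 rfl, e₁ x hx y hy])
  simp only [zero_add] at e₇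
  refine ⟨by rw [a₇.reg 11 rfl, k₆], e₇.1, ?_⟩
  rw [a₇.reg 13 rfl, e₆, e₅]
  simp only [hm₄, reg_setReg, if_true, true_and, not_or, not_and, not_not]
  constructor
  · rintro ⟨h1, h2⟩
    exact ⟨fun i hi => (h1 i hi i hi).1, fun i hi j hj => (h1 i hi j hj).2,
      fun i hi r hr => (e₃ i hi r hr).symm.trans (h2 i hi r hr)⟩
  · rintro ⟨h1, h2, h3⟩
    exact ⟨fun i hi j hj => ⟨h1 i hi, h2 i hi j hj⟩,
      fun i hi r hr => (e₃ i hi r hr).trans (h3 i hi r hr)⟩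

end Loop

end

section

/-! ### Symmetric tensors -/

section Symmetrization

variable {𝕜 : Type*} [Field 𝕜] {n d : ℕ}

theorem content_apply (a : Fin d → Fin n) (i : Fin n) :
    content a i = (Finset.univ.filter fun k => a k = i).card := by
  classical
  simp only [content, Finsupp.finsetSum_apply, Finsupp.single_apply]
  rw [Finset.card_filter]

theorem content_comp_perm (a : Fin d → Fin n) (π : Equiv.Perm (Fin d)) :
    content (a ∘ π) = content a :=
  Equiv.sum_comp π fun k => Finsupp.single (a k) 1

/-- If every value is taken equally often by `a` and `b`, then their fibres are in bijection, and
the bijections glue to a permutation. -/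
theorem content_eq_iff {a b : Fin d → Fin n} :
    content a = content b ↔ ∃ π : Equiv.Perm (Fin d), a ∘ π = b := by
  refine ⟨fun h => ?_, ?_⟩
  · have hc : ∀ i, Nonempty ({k // b k = i} ≃ {k // a k = i}) := by
      intro i
      refine Fintype.card_eq.1 ?_
      have := DFunLike.congr_fun h i
      rw [content_apply, content_apply] at this
      rw [Fintype.card_subtype, Fintype.card_subtype, this]
    let e := fun i => (hc i).some
    refine ⟨((Equiv.sigmaFiberEquiv b).symm.trans (Equiv.sigmaCongrRight e)).trans
      (Equiv.sigmaFiberEquiv a), funext fun k => ?_⟩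
    exact (e (b k) ⟨k, rfl⟩).2
  · rintro ⟨π, rfl⟩
    exact (content_comp_perm a π).symm

open Classical in
/-- The number of rearrangements of `a`. -/
def contentMult (a : Fin d → Fin n) : ℕ :=
  (Finset.univ.filter fun b : Fin d → Fin n => content b = content a).card

theorem contentMult_pos (a : Fin d → Fin n) : 0 < contentMult a :=
  Finset.card_pos.2 ⟨a, by simp⟩

open Classical in
variable (𝕜 n d) in
/-- The projection to the symmetric tensors. -/
def symmetrize : ((Fin d → Fin n) → 𝕜) →ₗ[𝕜] ((Fin d → Fin n) → 𝕜) where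
  toFun t a := ∑ b, (if content a = content b then 1 else 0) / (contentMult a : 𝕜) * t b
  map_add' s t := by funext a; simp [mul_add, Finset.sum_add_distrib]
  map_smul' c t := by
    funext a
    simp only [Pi.smul_apply, smul_eq_mul, RingHom.id_apply, Finset.mul_sum]
    exact Finset.sum_congr rfl fun _ _ => by ring

theorem contentMult_comp_perm (a : Fin d → Fin n) (π : Equiv.Perm (Fin d)) :
    contentMult (a ∘ π) = contentMult a := by
  simp only [contentMult, content_comp_perm]

theorem symmetrize_mem (t : (Fin d → Fin n) → 𝕜) :
    symmetrize 𝕜 n d t ∈ symmetricTensors 𝕜 n d := fun π a => by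
  simp only [symmetrize, LinearMap.coe_mk, AddHom.coe_mk, content_comp_perm, contentMult_comp_perm]

theorem symmetrize_of_mem [CharZero 𝕜] {t : (Fin d → Fin n) → 𝕜}
    (ht : t ∈ symmetricTensors 𝕜 n d) : symmetrize 𝕜 n d t = t := by
  classical
  funext a
  have h : ∀ b, (if content a = content b then (1 : 𝕜) else 0) / (contentMult a : 𝕜) * t b =
      if content b = content a then t a / contentMult a else 0 := by
    intro b
    by_cases hab : content a = content b
    · obtain ⟨π, rfl⟩ := content_eq_iff.1 hab
      rw [if_pos hab, if_pos hab.symm, ht π a]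
      ring
    · rw [if_neg hab, if_neg (fun h => hab h.symm)]
      simp
  simp only [symmetrize, LinearMap.coe_mk, AddHom.coe_mk, h]
  rw [← Finset.sum_filter, Finset.sum_const, nsmul_eq_mul]
  have : (contentMult a : 𝕜) ≠ 0 := by exact_mod_cast (contentMult_pos a).ne'
  change (contentMult a : 𝕜) * _ = _
  field_simp

theorem symmetrize_comp (t : (Fin d → Fin n) → 𝕜) (π : Equiv.Perm (Fin d)) :
    symmetrize 𝕜 n d (fun a => t (a ∘ π)) = symmetrize 𝕜 n d t := by
  funext a
  simp only [symmetrize, LinearMap.coe_mk, AddHom.coe_mk]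
  rw [← Equiv.sum_comp (Equiv.arrowCongr π (Equiv.refl (Fin n)))]
  refine Finset.sum_congr rfl fun b _ => ?_
  have : (Equiv.arrowCongr π (Equiv.refl (Fin n))) b = b ∘ π.symm := rfl
  rw [this, content_comp_perm]
  congr 2
  funext k
  simp

/-- The average over permutations is symmetric, hence fixed by `symmetrize`, which on the other hand
takes the same value on all terms of the average. The coefficient formula is the one that the
machine evaluates; the average shows that symmetrization does not leave `U^{⊗d}`. -/
theorem symmetrize_eq_sum [CharZero 𝕜] (t : (Fin d → Fin n) → 𝕜) :
    symmetrize 𝕜 n d t = (Fintype.card (Equiv.Perm (Fin d)) : 𝕜)⁻¹ •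
      ∑ π : Equiv.Perm (Fin d), fun a => t (a ∘ π) := by
  have hcard : (Fintype.card (Equiv.Perm (Fin d)) : 𝕜) ≠ 0 := by
    exact_mod_cast Fintype.card_ne_zero
  set s := (Fintype.card (Equiv.Perm (Fin d)) : 𝕜)⁻¹ •
      ∑ π : Equiv.Perm (Fin d), fun a => t (a ∘ π) with hs
  have hmem : s ∈ symmetricTensors 𝕜 n d := by
    intro π a
    simp only [hs, Pi.smul_apply, Finset.sum_apply]
    congr 1
    exact Equiv.sum_comp (Equiv.mulLeft π) fun c : Equiv.Perm (Fin d) => t (a ∘ c)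
  rw [← symmetrize_of_mem hmem, hs, map_smul, map_sum]
  simp only [symmetrize_comp, Finset.sum_const, Finset.card_univ, ← Nat.cast_smul_eq_nsmul 𝕜]
  rw [smul_smul, inv_mul_cancel₀ hcard, one_smul]

theorem prodTensor_comp_perm (x : Fin d → Fin n → 𝕜) (π : Equiv.Perm (Fin d)) :
    (fun a => prodTensor x (a ∘ π)) = prodTensor (x ∘ π.symm) := by
  funext a
  simp only [prodTensor, Function.comp_apply]
  rw [← Equiv.prod_comp π fun k => x (π.symm k) (a k)]
  simp

theorem prodTensor_mem_span {ι : Type*} [Fintype ι] (u : ι → Fin n → 𝕜) {x : Fin d → Fin n → 𝕜}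
    (hx : ∀ k, x k ∈ Submodule.span 𝕜 (Set.range u)) :
    prodTensor x ∈ Submodule.span 𝕜 (Set.range fun b : Fin d → ι => prodTensor (u ∘ b)) := by
  classical
  choose c hc using fun k => (Submodule.mem_span_range_iff_exists_fun 𝕜).1 (hx k)
  have : prodTensor x = ∑ b : Fin d → ι, (∏ k, c k (b k)) • prodTensor (u ∘ b) := by
    funext a
    simp only [prodTensor, ← hc, Finset.sum_apply, Pi.smul_apply, smul_eq_mul, Function.comp_apply]
    rw [Finset.prod_univ_sum, Fintype.piFinset_univ]
    exact Finset.sum_congr rfl fun b _ => Finset.prod_mul_distrib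
  rw [this]
  exact Submodule.sum_mem _ fun b _ => Submodule.smul_mem _ _ (Submodule.subset_span ⟨b, rfl⟩)

/-- A symmetric tensor is its own symmetrization, so expanding it in products of generators and
symmetrizing gives one inclusion. The family `u` need not be independent: the program uses the given
basis padded with zero vectors. -/
theorem symPower_eq_span [CharZero 𝕜] {ι : Type*} [Fintype ι] (u : ι → Fin n → 𝕜) :
    symPower d (Submodule.span 𝕜 (Set.range u)) =
      Submodule.span 𝕜 (Set.range fun b : Fin d → ι => symmetrize 𝕜 n d (prodTensor (u ∘ b))) := by
  apply le_antisymm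
  · rintro t ⟨h1, h2⟩
    rw [← symmetrize_of_mem h2]
    have h3 : t ∈ Submodule.span 𝕜 (Set.range fun b : Fin d → ι => prodTensor (u ∘ b)) := by
      refine Submodule.span_le.2 ?_ h1
      rintro _ ⟨x, hx, rfl⟩
      exact prodTensor_mem_span u hx
    have := Submodule.mem_map_of_mem (f := symmetrize 𝕜 n d) h3
    rwa [Submodule.map_span, ← Set.range_comp] at this
  · rw [Submodule.span_le]
    rintro _ ⟨b, rfl⟩
    refine ⟨?_, symmetrize_mem _⟩
    simp only [symmetrize_eq_sum, prodTensor_comp_perm]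
    refine Submodule.smul_mem _ _ (Submodule.sum_mem _ fun π _ => Submodule.subset_span ⟨_, ?_, rfl⟩)
    exact fun k => Submodule.subset_span ⟨_, rfl⟩

theorem pairing_eq (g : MvPolynomial (Fin n) 𝕜) (t : (Fin d → Fin n) → 𝕜) :
    pairing d g t = ∑ a, g.coeff (content a) / (contentMult a : 𝕜) * t a := by
  simp only [pairing, formTensor, contentMult]

theorem mem_annihilator {p : ℕ} {f : Fin p → MvPolynomial (Fin n) 𝕜} {t : (Fin d → Fin n) → 𝕜} :
    t ∈ annihilator d f ↔ t ∈ symmetricTensors 𝕜 n d ∧ ∀ j, pairing d (f j) t = 0 := by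
  refine and_congr_right fun _ => ⟨fun h j => h _ (Submodule.subset_span ⟨j, rfl⟩), fun h g hg => ?_⟩
  induction hg using Submodule.span_induction with
  | mem x hx => obtain ⟨j, rfl⟩ := hx; exact h j
  | zero => simp [pairing_eq]
  | add x y _ _ hx hy =>
    rw [pairing_eq] at *
    simp only [MvPolynomial.coeff_add, add_div, add_mul, Finset.sum_add_distrib, hx, hy, add_zero]
  | smul c x _ hx =>
    rw [pairing_eq] at *
    have : ∀ a, (c • x).coeff (content a) / (contentMult a : 𝕜) * t a =
        c * (x.coeff (content a) / (contentMult a : 𝕜) * t a) := by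
      intro a; rw [MvPolynomial.coeff_smul, smul_eq_mul]; ring
    simp only [this, ← Finset.mul_sum, hx, mul_zero]

theorem mem_searchSpace {p R : ℕ} {f : Fin p → MvPolynomial (Fin n) 𝕜} {u : Fin R → Fin n → 𝕜}
    {t : (Fin d → Fin n) → 𝕜} :
    t ∈ searchSpace d f u ↔ t ∈ symPower d (Submodule.span 𝕜 (Set.range u)) ∧
      ∀ j, pairing d (f j) t = 0 := by
  rw [searchSpace, Submodule.mem_inf, mem_annihilator]
  exact ⟨fun h => ⟨h.1, h.2.2⟩, fun h => ⟨h.1, h.1.2, h.2⟩⟩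

/-- The exponent vectors of degree `d` are the contents. -/
theorem exists_content_eq {α : Fin n →₀ ℕ} (hdeg : α.degree = d) :
    ∃ a : Fin d → Fin n, content a = α := by
  obtain ⟨l, hl⟩ := Quot.exists_rep (Finsupp.toMultiset α)
  have hlen : l.length = d := by
    have : (Finsupp.toMultiset α).card = d := by rw [Finsupp.card_toMultiset]; exact hdeg
    rw [← hl] at this
    exact this
  subst hlen
  refine ⟨l.get, ?_⟩
  apply Multiset.toFinsupp.symm.injective
  change Finsupp.toMultiset _ = Finsupp.toMultiset _
  rw [← hl, content, map_sum]
  simp only [Finsupp.toMultiset_single, one_smul]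
  have h2 : ∀ l : List (Fin n), ∑ k : Fin l.length, ({l.get k} : Multiset (Fin n)) = (l : Multiset (Fin n)) := by
    intro l
    induction l with
    | nil => rfl
    | cons a l ih =>
      rw [← Multiset.cons_coe, ← ih]
      exact (Fin.sum_univ_succ (n := l.length) _).trans (by
        exact Multiset.singleton_add a _)
  exact h2 l

theorem degree_of_mem_support {g : MvPolynomial (Fin n) 𝕜} (hg : g.IsHomogeneous d)
    {α : Fin n →₀ ℕ} (hα : g.coeff α ≠ 0) : α.degree = d := by
  rw [Finsupp.degree_eq_weight_one]
  exact hg hα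

/-- The division by the number of rearrangements in `formTensor` is undone on grouping the index
tuples by content: each class contributes that many equal terms, which add up to one monomial of the
form. -/
theorem eval_eq_pairing [CharZero 𝕜] {g : MvPolynomial (Fin n) 𝕜} (hg : g.IsHomogeneous d)
    (x : Fin n → 𝕜) : pairing d g (prodTensor fun _ => x) = MvPolynomial.eval x g := by
  classical
  have hc : ∀ α ∈ g.support, ∃ a : Fin d → Fin n, content a = α := fun α hα =>
    exists_content_eq (degree_of_mem_support hg (MvPolynomial.mem_support_iff.1 hα))
  rw [pairing_eq, MvPolynomial.eval_eq']
  have hfib := Finset.sum_fiberwise_of_maps_to (s := Finset.univ) (t := Finset.univ.image (content (n := n) (d := d)))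
    (g := content) (fun a _ => Finset.mem_image_of_mem _ (Finset.mem_univ a))
    (f := fun a => g.coeff (content a) / (contentMult a : 𝕜) * prodTensor (fun _ => x) a)
  rw [← hfib]
  have hmono : ∀ a : Fin d → Fin n, prodTensor (fun _ => x) a = ∏ i, x i ^ content a i := by
    intro a
    simp only [prodTensor, content_apply]
    rw [← Finset.prod_fiberwise_of_maps_to (s := Finset.univ) (t := Finset.univ) (g := a)
      (fun _ _ => Finset.mem_univ _)]
    refine Finset.prod_congr rfl fun i _ => ?_
    rw [Finset.prod_congr rfl (g := fun _ => x i), Finset.prod_const]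
    intro k hk
    rw [(Finset.mem_filter.1 hk).2]
  have hterm : ∀ α ∈ Finset.univ.image (content (n := n) (d := d)),
      ∑ a ∈ Finset.univ.filter (fun a : Fin d → Fin n => content a = α),
        g.coeff (content a) / (contentMult a : 𝕜) * prodTensor (fun _ => x) a =
      g.coeff α * ∏ i, x i ^ α i := by
    intro α hα
    obtain ⟨a, -, rfl⟩ := Finset.mem_image.1 hα
    rw [Finset.sum_congr rfl (g := fun _ => g.coeff (content a) / (contentMult a : 𝕜) *
      ∏ i, x i ^ content a i)]
    · rw [Finset.sum_const, nsmul_eq_mul]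
      have : (contentMult a : 𝕜) ≠ 0 := by exact_mod_cast (contentMult_pos a).ne'
      change (contentMult a : 𝕜) * _ = _
      field_simp
    · intro b hb
      have hb' := (Finset.mem_filter.1 hb).2
      rw [hmono, hb', contentMult, contentMult, hb']
  rw [Finset.sum_congr rfl hterm]
  symm
  refine Finset.sum_subset (fun α hα => ?_) fun α _ hα => ?_
  · obtain ⟨a, rfl⟩ := hc α hα
    exact Finset.mem_image_of_mem _ (Finset.mem_univ a)
  · rw [MvPolynomial.notMem_support_iff.1 hα, zero_mul]

end Symmetrization

/-! ### Orthogonal families -/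

section Orthogonal

variable {𝕜 : Type*} [RCLike 𝕜]

namespace Loop

theorem ip_eq_dotProduct (C : ℕ) (x y : ℕ → 𝕜) : ip C x y = star (trunc C x) ⬝ᵥ trunc C y := by
  simp [ip, dotProduct, trunc, Finset.sum_range]

/-- Each new row is the old one plus a combination of earlier old ones. The change of rows is
unitriangular and preserves the spans of all initial segments. -/
theorem IsGramSchmidt.span_eq {C C' r : ℕ} {G₀ G : ℕ → ℕ → 𝕜} (h : IsGramSchmidt C C' r G₀ G)
    {j : ℕ} (hj : j ≤ r) : Submodule.span 𝕜 ((fun i => trunc C' (G i)) '' Set.Iio j) =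
      Submodule.span 𝕜 ((fun i => trunc C' (G₀ i)) '' Set.Iio j) := by
  induction j with
  | zero =>
    have : Set.Iio 0 = (∅ : Set ℕ) := by ext; simp
    simp
  | succ j ih =>
    have hI : Set.Iio (j + 1) = insert j (Set.Iio j) := by
      ext x; simp only [Set.mem_Iio, Set.mem_insert_iff]; omega
    have h1 := h.sub_mem j hj
    rw [hI, Set.image_insert_eq, Set.image_insert_eq, Submodule.span_insert, Submodule.span_insert,
      ih (by omega)]
    apply le_antisymm
    · refine sup_le ?_ le_sup_right
      rw [Submodule.span_singleton_le_iff_mem, ← sub_add_cancel (trunc C' (G j)) (trunc C' (G₀ j))]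
      exact Submodule.add_mem _ (Submodule.mem_sup_right h1)
        (Submodule.mem_sup_left (Submodule.mem_span_singleton_self _))
    · refine sup_le ?_ le_sup_right
      rw [Submodule.span_singleton_le_iff_mem, ← sub_sub_self (trunc C' (G j)) (trunc C' (G₀ j))]
      exact Submodule.sub_mem _ (Submodule.mem_sup_left (Submodule.mem_span_singleton_self _))
        (Submodule.mem_sup_right h1)

theorem IsGramSchmidt.orthogonal' {C C' r : ℕ} {G₀ G : ℕ → ℕ → 𝕜} (h : IsGramSchmidt C C' r G₀ G)
    {i j : ℕ} (hi : i < r) (hj : j < r) (hij : i ≠ j) : ip C (G i) (G j) = 0 := by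
  rcases lt_or_gt_of_ne hij with h' | h'
  · exact h.orthogonal j hj i h'
  · have := h.orthogonal i hi j h'
    have h2 : ip C (G i) (G j) = star (ip C (G j) (G i)) := by
      simp [ip, mul_comm]
    rw [h2, this, star_zero]

/-- A vector lies in the span of some members of an orthogonal generating system if and only if it
is orthogonal to the other members. -/
theorem IsGramSchmidt.mem_span_iff {C r : ℕ} {G₀ G : ℕ → ℕ → 𝕜} (h : IsGramSchmidt C C r G₀ G)
    (htop : Submodule.span 𝕜 ((fun i => trunc C (G₀ i)) '' Set.Iio r) = ⊤) {S : Set ℕ}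
    (hS : S ⊆ Set.Iio r) (t : Fin C → 𝕜) :
    t ∈ Submodule.span 𝕜 ((fun i => trunc C (G i)) '' S) ↔
      ∀ i < r, i ∉ S → star (trunc C (G i)) ⬝ᵥ t = 0 := by
  constructor
  · intro ht i hi hiS
    induction ht using Submodule.span_induction with
    | mem x hx =>
      obtain ⟨j, hj, rfl⟩ := hx
      rw [← ip_eq_dotProduct]
      exact h.orthogonal' hi (hS hj) (by rintro rfl; exact hiS hj)
    | zero => simp
    | add x y _ _ hx hy => rw [dotProduct_add, hx, hy, add_zero]
    | smul c x _ hx => rw [dotProduct_smul, hx, smul_zero]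
  · intro ht
    have hmem : t ∈ Submodule.span 𝕜 (Set.range fun i : Fin r => trunc C (G i)) := by
      have : (Set.range fun i : Fin r => trunc C (G i)) = (fun i => trunc C (G i)) '' Set.Iio r := by
        ext y
        constructor
        · rintro ⟨i, rfl⟩; exact ⟨i, i.2, rfl⟩
        · rintro ⟨i, hi, rfl⟩; exact ⟨⟨i, hi⟩, rfl⟩
      rw [this, h.span_eq le_rfl, htop]
      exact Submodule.mem_top
    obtain ⟨c, hc⟩ := (Submodule.mem_span_range_iff_exists_fun 𝕜).1 hmem
    rw [← hc]
    refine Submodule.sum_mem _ fun i _ => ?_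
    by_cases hi : (i : ℕ) ∈ S
    · exact Submodule.smul_mem _ _ (Submodule.subset_span ⟨i, hi, rfl⟩)
    -- Pairing with row `i` leaves the coefficient of row `i` times its squared length. Zero rows
    -- are allowed in the family, so it may be the row and not the coefficient that vanishes.
    · have h1 := ht i i.2 hi
      rw [← hc, dotProduct_sum, Finset.sum_eq_single i] at h1
      · rw [dotProduct_smul, ← ip_eq_dotProduct, smul_eq_mul, mul_eq_zero] at h1
        rcases h1 with h1 | h1
        · rw [h1, zero_smul]; exact zero_mem _
        · have : trunc C (G i) = 0 := funext fun x => eq_zero_of_ip_self h1 x x.2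
          rw [this, smul_zero]; exact zero_mem _
      · intro j _ hji
        rw [dotProduct_smul, ← ip_eq_dotProduct, h.orthogonal' i.2 j.2 (by
          intro h'; exact hji (Fin.ext h'.symm)), smul_zero]
      · simp

theorem linearIndependent_of_ip {C k : ℕ} {Q : Fin k → ℕ → 𝕜}
    (h : ∀ i j, i ≠ j → ip C (Q i) (Q j) = 0) (h0 : ∀ i, ip C (Q i) (Q i) ≠ 0) :
    LinearIndependent 𝕜 fun i => trunc C (Q i) := by
  rw [Fintype.linearIndependent_iff]
  intro c hc i
  have := congrArg (fun t => star (trunc C (Q i)) ⬝ᵥ t) hc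
  simp only [dotProduct_sum, dotProduct_smul, ← ip_eq_dotProduct, dotProduct_zero] at this
  rw [Finset.sum_eq_single i] at this
  · simpa [h0 i] using this
  · intro j _ hji
    rw [h i j hji.symm, smul_zero]
  · simp

end Loop

end Orthogonal

end

section

variable {𝕜 : Type*} [RCLike 𝕜] {n d : ℕ}

/-! ### The search stage computes a basis of the search space -/

/-- The tensor whose coordinates are the first `n ^ d` entries of a row. -/
def tensorOfRow (n d : ℕ) (x : ℕ → 𝕜) : (Fin d → Fin n) → 𝕜 := fun a => x (finFunctionFinEquiv a)

variable (𝕜 n d) in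
/-- Identification of the rows of length `n ^ d` with tensors. -/
def rowEquiv : (Fin (n ^ d) → 𝕜) ≃ₗ[𝕜] ((Fin d → Fin n) → 𝕜) :=
  LinearEquiv.funCongrLeft 𝕜 𝕜 finFunctionFinEquiv

theorem rowEquiv_trunc (x : ℕ → 𝕜) : rowEquiv 𝕜 n d (Loop.trunc (n ^ d) x) = tensorOfRow n d x := rfl

theorem dig_finFunctionFinEquiv (a : Fin d → Fin n) (k : Fin d) :
    Loop.dig n (finFunctionFinEquiv a) k = a k := by
  have := congrFun (finFunctionFinEquiv.symm_apply_apply a) k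
  conv_rhs => rw [← this]
  rfl

theorem digCount_finFunctionFinEquiv (a : Fin d → Fin n) (i : Fin n) :
    Loop.digCount n d (finFunctionFinEquiv a) i = content a i := by
  rw [content_apply, Loop.digCount, Finset.card_filter, Finset.card_filter, Finset.sum_range]
  refine Finset.sum_congr rfl fun k _ => ?_
  rw [dig_finFunctionFinEquiv]
  simp [Fin.ext_iff]

open Classical in
theorem eqDigits_finFunctionFinEquiv (a b : Fin d → Fin n) :
    Loop.eqDigits 𝕜 n d (finFunctionFinEquiv a) (finFunctionFinEquiv b) =
      if content a = content b then 1 else 0 := by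
  have : (∀ i < n, Loop.digCount n d (finFunctionFinEquiv a) i =
      Loop.digCount n d (finFunctionFinEquiv b) i) ↔ content a = content b := by
    constructor
    · intro h
      ext i
      rw [← digCount_finFunctionFinEquiv, ← digCount_finFunctionFinEquiv]
      exact h i i.2
    · intro h i hi
      have := DFunLike.congr_fun h ⟨i, hi⟩
      rwa [← digCount_finFunctionFinEquiv, ← digCount_finFunctionFinEquiv] at this
  rw [Loop.eqDigits]
  simp only [this]

theorem sum_range_eq_sum_digits {M : Type*} [AddCommMonoid M] (F : ℕ → M) :
    ∑ x ∈ Finset.range (n ^ d), F x = ∑ a : Fin d → Fin n, F (finFunctionFinEquiv a) := by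
  rw [Finset.sum_range, ← Equiv.sum_comp finFunctionFinEquiv]

theorem digMult_finFunctionFinEquiv (a : Fin d → Fin n) :
    Loop.digMult 𝕜 n d (finFunctionFinEquiv a) = (contentMult a : 𝕜) := by
  classical
  rw [Loop.digMult, sum_range_eq_sum_digits]
  simp only [eqDigits_finFunctionFinEquiv, contentMult, Finset.card_filter]
  push_cast
  refine Finset.sum_congr rfl fun b _ => ?_
  simp only [eq_comm]

theorem prod_range_dig (u : ℕ → 𝕜) (a : Fin d → Fin n) :
    ∏ k ∈ Finset.range d, u (Loop.dig n (finFunctionFinEquiv a) k) = ∏ k, u (a k) := by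
  rw [Finset.prod_range]
  exact Finset.prod_congr rfl fun k _ => by rw [dig_finFunctionFinEquiv]

theorem symCoord_finFunctionFinEquiv (us : ℕ → ℕ → 𝕜) (a b : Fin d → Fin n) :
    Loop.symCoord n d us (finFunctionFinEquiv b) (finFunctionFinEquiv a) =
      symmetrize 𝕜 n d (prodTensor fun k => fun j : Fin n => us (b k) j) a := by
  classical
  rw [Loop.symCoord, sum_range_eq_sum_digits]
  simp only [symmetrize, LinearMap.coe_mk, AddHom.coe_mk]
  refine Finset.sum_congr rfl fun c _ => ?_
  rw [eqDigits_finFunctionFinEquiv, digMult_finFunctionFinEquiv, Finset.prod_range]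
  congr 1
  exact Finset.prod_congr rfl fun k _ => by rw [dig_finFunctionFinEquiv, dig_finFunctionFinEquiv]

theorem star_trunc_dotProduct (x : ℕ → 𝕜) (t : Fin (n ^ d) → 𝕜) :
    star (Loop.trunc (n ^ d) x) ⬝ᵥ t =
      ∑ a, star (x (finFunctionFinEquiv a)) * rowEquiv 𝕜 n d t a := by
  rw [dotProduct, ← Equiv.sum_comp finFunctionFinEquiv]
  rfl

section

variable {p R k : ℕ} {f : Fin p → MvPolynomial (Fin n) 𝕜} {u : Fin R → Fin n → 𝕜}
  {co us A B A' B' P : ℕ → ℕ → 𝕜} {e : ℕ → ℕ}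

theorem span_unit_eq_top {N r : ℕ} {A : ℕ → ℕ → 𝕜} {o : ℕ} (ho : o + N ≤ r)
    (h : ∀ x < N, ∀ y < N, A (o + x) y = if x = y then 1 else 0) :
    Submodule.span 𝕜 ((fun i => Loop.trunc N (A i)) '' Set.Iio r) = ⊤ := by
  rw [eq_top_iff, ← (Pi.basisFun 𝕜 (Fin N)).span_eq, Submodule.span_le]
  rintro _ ⟨i, rfl⟩
  refine Submodule.subset_span ⟨o + i, by simp only [Set.mem_Iio]; omega, ?_⟩
  funext j
  simp only [Loop.trunc, h i i.2 j j.2, Pi.basisFun_apply, Pi.single_apply]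
  simp [Fin.ext_iff, eq_comm]

/-- A vector is orthogonal to the generators computed in the search stage if and only if it belongs
to the search space. -/
theorem searchTables_mem_iff (h : Loop.SearchTables n d p k co us A B A' B' P e) (hR : R ≤ n)
    (hco : ∀ j : Fin p, ∀ a : Fin d → Fin n, co j (finFunctionFinEquiv a) = (f j).coeff (content a))
    (hus : ∀ i j : Fin n, us i j = if hi : (i : ℕ) < R then u ⟨i, hi⟩ j else 0)
    (t : Fin (n ^ d) → 𝕜) :
    (∀ i < n ^ d + p, star (Loop.trunc (n ^ d) (B' i)) ⬝ᵥ t = 0) ↔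
      rowEquiv 𝕜 n d t ∈ searchSpace d f u := by
  have hspan : ∀ (G : ℕ → ℕ → 𝕜) (c : ℕ), (∀ i < c, star (Loop.trunc (n ^ d) (G i)) ⬝ᵥ t = 0) ↔
      ∀ x ∈ Submodule.span 𝕜 ((fun i => Loop.trunc (n ^ d) (G i)) '' Set.Iio c),
        star x ⬝ᵥ t = 0 := by
    intro G c
    refine ⟨fun h x hx => ?_, fun h i hi => h _ (Submodule.subset_span ⟨i, hi, rfl⟩)⟩
    induction hx using Submodule.span_induction with
    | mem x hx => obtain ⟨i, hi, rfl⟩ := hx; exact h i hi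
    | zero => simp
    | add x y _ _ hx hy => rw [star_add, add_dotProduct, hx, hy, add_zero]
    | smul c x _ hx => rw [star_smul, smul_dotProduct, hx, smul_zero]
  -- Orthogonality depends on the span only, so the original rows may be used in place of the
  -- orthogonalized ones.
  rw [hspan, h.gs'.span_eq (by omega), ← hspan]
  have hsplit : (∀ i < n ^ d + p, star (Loop.trunc (n ^ d) (A' i)) ⬝ᵥ t = 0) ↔
      (∀ i < n ^ d, star (Loop.trunc (n ^ d) (A' i)) ⬝ᵥ t = 0) ∧
      ∀ j < p, star (Loop.trunc (n ^ d) (A' (n ^ d + j))) ⬝ᵥ t = 0 := by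
    refine ⟨fun h => ⟨fun i hi => h i (by omega), fun j hj => h _ (by omega)⟩, fun h i hi => ?_⟩
    rcases lt_or_ge i (n ^ d) with h' | h'
    · exact h.1 i h'
    · obtain ⟨j, rfl⟩ := Nat.exists_eq_add_of_le h'
      exact h.2 j (by omega)
  rw [hsplit, mem_searchSpace]
  refine and_congr ?_ ?_
  · have h1 : ∀ i < n ^ d, Loop.trunc (n ^ d) (A' i) = Loop.trunc (n ^ d) (B (n ^ d + i)) :=
      fun i hi => funext fun y => h.compl i hi y y.2
    -- These rows are the members of `B` outside its first block. As `B` is an orthogonal generating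
    -- system, being orthogonal to them means lying in the span of the first block, which is
    -- `S^d(U)`.
    have h2 : (∀ i < n ^ d, star (Loop.trunc (n ^ d) (A' i)) ⬝ᵥ t = 0) ↔
        ∀ i < n ^ d + n ^ d, i ∉ Set.Iio (n ^ d) → star (Loop.trunc (n ^ d) (B i)) ⬝ᵥ t = 0 := by
      constructor
      · intro h i hi hi'
        simp only [Set.mem_Iio, not_lt] at hi'
        obtain ⟨j, rfl⟩ := Nat.exists_eq_add_of_le hi'
        rw [← h1 j (by omega)]
        exact h j (by omega)
      · intro h i hi
        rw [h1 i hi]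
        exact h _ (by omega) (by simp)
    rw [h2, ← h.gs.mem_span_iff (span_unit_eq_top le_rfl h.unit) (by
      intro x hx; simp only [Set.mem_Iio] at *; omega), h.gs.span_eq (by omega)]
    -- All `n` digits are used as row indices of table `1`; the rows from `R` on are zero and do not
    -- change the span.
    have h3 : Submodule.span 𝕜 (Set.range u) =
        Submodule.span 𝕜 (Set.range fun i j : Fin n => us i j) := by
      apply le_antisymm <;> rw [Submodule.span_le]
      · rintro _ ⟨i, rfl⟩
        refine Submodule.subset_span ⟨Fin.castLE hR i, funext fun j => ?_⟩
        change us (Fin.castLE hR i) j = _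
        rw [hus, dif_pos (by simp)]
        rfl
      · rintro _ ⟨i, rfl⟩
        by_cases hi : (i : ℕ) < R
        · refine Submodule.subset_span ⟨⟨i, hi⟩, funext fun j => ?_⟩
          change _ = us i j
          rw [hus, dif_pos hi]
        · have : (fun j : Fin n => us i j) = 0 := funext fun j => by rw [hus, dif_neg hi]; rfl
          simp only [this]
          exact zero_mem _
    have h4 : (Set.range fun b : Fin d → Fin n => symmetrize 𝕜 n d
        (prodTensor ((fun i j : Fin n => us i j) ∘ b))) = (rowEquiv 𝕜 n d).toLinearMap ''
          ((fun i => Loop.trunc (n ^ d) (A i)) '' Set.Iio (n ^ d)) := by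
      ext x
      simp only [Set.mem_image, Set.mem_range, exists_exists_and_eq_and, Set.mem_Iio]
      constructor
      · rintro ⟨b, rfl⟩
        refine ⟨finFunctionFinEquiv b, Fin.is_lt _, ?_⟩
        rw [LinearEquiv.coe_coe, rowEquiv_trunc]
        funext a
        rw [tensorOfRow, h.sym _ (Fin.is_lt _) _ (Fin.is_lt _), symCoord_finFunctionFinEquiv]
        rfl
      · rintro ⟨i, hi, rfl⟩
        refine ⟨finFunctionFinEquiv.symm ⟨i, hi⟩, ?_⟩
        rw [LinearEquiv.coe_coe, rowEquiv_trunc]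
        funext a
        have := symCoord_finFunctionFinEquiv us a (finFunctionFinEquiv.symm ⟨i, hi⟩)
        rw [Equiv.apply_symm_apply] at this
        rw [tensorOfRow, h.sym i hi _ (Fin.is_lt _), this]
        rfl
    rw [h3, symPower_eq_span, h4]
    exact (Submodule.apply_mem_span_image_iff_mem_span (rowEquiv 𝕜 n d).injective).symm
  -- The rows store conjugates, so that Hermitian orthogonality to them becomes the vanishing of the
  -- bilinear pairing.
  · have h1 : ∀ j : Fin p, star (Loop.trunc (n ^ d) (A' (n ^ d + j))) ⬝ᵥ t =
        pairing d (f j) (rowEquiv 𝕜 n d t) := by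
      intro j
      rw [star_trunc_dotProduct, pairing_eq]
      refine Finset.sum_congr rfl fun a _ => ?_
      rw [h.form j j.2 _ (Fin.is_lt _), star_star, hco, digMult_finFunctionFinEquiv]
    exact ⟨fun h j => (h1 j).symm.trans (h j j.2), fun h j hj => (h1 ⟨j, hj⟩).trans (h ⟨j, hj⟩)⟩

/-- Because of the appended standard basis, the rows of `B'` form an orthogonal generating system of
the whole space. Hence the vectors orthogonal to the first `n ^ d + p` rows are spanned by the
remaining ones, and deleting zero rows leaves a basis. -/
theorem searchTables_isSearchBasis (h : Loop.SearchTables n d p k co us A B A' B' P e) (hR : R ≤ n)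
    (hco : ∀ j : Fin p, ∀ a : Fin d → Fin n, co j (finFunctionFinEquiv a) = (f j).coeff (content a))
    (hus : ∀ i j : Fin n, us i j = if hi : (i : ℕ) < R then u ⟨i, hi⟩ j else 0) :
    IsSearchBasis f u fun l : Fin k => tensorOfRow n d (P l) := by
  have hP : ∀ l < k, Loop.trunc (n ^ d) (P l) = Loop.trunc (n ^ d) (B' (n ^ d + p + e l)) :=
    fun l hl => funext fun c => h.compact.eq l hl c c.2
  have hne : ∀ l l' : Fin k, l ≠ l' → e l ≠ e l' := by
    intro l l' hll
    rcases lt_or_gt_of_ne hll with h' | h'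
    · exact (h.compact.strictMono l' l'.2 l h').ne
    · exact (h.compact.strictMono l l.2 l' h').ne'
  constructor
  · have hind := Loop.linearIndependent_of_ip (C := n ^ d)
      (Q := fun l : Fin k => B' (n ^ d + p + e l)) (by
        intro i j hij
        have := h.compact.lt i i.2
        have := h.compact.lt j j.2
        exact h.gs'.orthogonal' (by omega) (by omega) (by have := hne i j hij; omega))
      fun i => h.compact.ne_zero i i.2
    have := hind.map' (rowEquiv 𝕜 n d).toLinearMap (rowEquiv 𝕜 n d).ker
    have hfun : (fun l : Fin k => tensorOfRow n d (P l)) = (rowEquiv 𝕜 n d).toLinearMap ∘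
        fun l : Fin k => Loop.trunc (n ^ d) (B' (n ^ d + p + e l)) := by
      funext l
      rw [Function.comp_apply, ← hP l l.2]
      rfl
    rw [hfun]
    exact this
  · ext t
    obtain ⟨v, rfl⟩ := (rowEquiv 𝕜 n d).surjective t
    rw [← searchTables_mem_iff h hR hco hus]
    have h1 : (∀ i < n ^ d + p, star (Loop.trunc (n ^ d) (B' i)) ⬝ᵥ v = 0) ↔
        ∀ i < n ^ d + p + n ^ d, i ∉ Set.Ico (n ^ d + p) (n ^ d + p + n ^ d) →
          star (Loop.trunc (n ^ d) (B' i)) ⬝ᵥ v = 0 :=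
      ⟨fun h i hi hi' => h i (by simp only [Set.mem_Ico] at hi'; omega),
        fun h i hi => h i (by omega) (by simp only [Set.mem_Ico]; omega)⟩
    rw [h1, ← h.gs'.mem_span_iff (span_unit_eq_top le_rfl h.unit')
      (fun x hx => by simp only [Set.mem_Ico, Set.mem_Iio] at *; omega)]
    have h2 : Set.range (fun l : Fin k => tensorOfRow n d (P l)) =
        (rowEquiv 𝕜 n d).toLinearMap '' Set.range fun l : Fin k => Loop.trunc (n ^ d) (P l) := by
      rw [← Set.range_comp]; rfl
    rw [h2]
    refine (Submodule.apply_mem_span_image_iff_mem_span (rowEquiv 𝕜 n d).injective).trans ?_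
    suffices hs : Submodule.span 𝕜 (Set.range fun l : Fin k => Loop.trunc (n ^ d) (P l)) =
        Submodule.span 𝕜 ((fun i => Loop.trunc (n ^ d) (B' i)) ''
          Set.Ico (n ^ d + p) (n ^ d + p + n ^ d)) by rw [hs]
    apply le_antisymm <;> rw [Submodule.span_le]
    · rintro _ ⟨l, rfl⟩
      refine Submodule.subset_span ⟨n ^ d + p + e l, ?_, (hP l l.2).symm⟩
      have := h.compact.lt l l.2
      simp only [Set.mem_Ico]; omega
    · rintro _ ⟨i, hi, rfl⟩
      simp only [Set.mem_Ico] at hi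
      obtain ⟨j, rfl⟩ := Nat.exists_eq_add_of_le hi.1
      by_cases hz : Loop.ip (n ^ d) (B' (n ^ d + p + j)) (B' (n ^ d + p + j)) = 0
      · have : Loop.trunc (n ^ d) (B' (n ^ d + p + j)) = 0 :=
          funext fun c => Loop.eq_zero_of_ip_self hz c c.2
        simp only [this]
        exact zero_mem _
      · obtain ⟨l, hl, rfl⟩ := h.compact.surj j (by omega) hz
        exact Submodule.subset_span ⟨⟨l, hl⟩, hP l hl⟩

end

end

section

/-! ### Dual families and powers of linearly independent vectors -/

section DualFamilies

variable {𝕜 : Type*} [Field 𝕜] {ι κ : Type*} [Fintype ι] [Fintype κ]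

/-- A linearly independent family has a dual family. -/
theorem exists_dual_family [DecidableEq κ] [DecidableEq ι] {y : κ → ι → 𝕜} (hy : LinearIndependent 𝕜 y) :
    ∃ L : κ → ι → 𝕜, ∀ i j, L i ⬝ᵥ y j = if i = j then 1 else 0 := by
  obtain ⟨g, hg⟩ := LinearMap.exists_leftInverse_of_injective (Fintype.linearCombination 𝕜 y)
    (LinearMap.ker_eq_bot.2 hy.fintypeLinearCombination_injective)
  refine ⟨fun i => LinearMap.toMatrix' g i, fun i j => ?_⟩
  have h1 := congrFun (LinearMap.congr_fun hg (Pi.single j 1)) i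
  rw [LinearMap.comp_apply, Fintype.linearCombination_apply_single, one_smul,
    ← LinearMap.toMatrix'_mulVec] at h1
  rw [show LinearMap.toMatrix' g i ⬝ᵥ y j = (LinearMap.toMatrix' g).mulVec (y j) i from rfl, h1]
  simp [Pi.single_apply]

theorem linearIndependent_of_dual_family [DecidableEq κ] {y L : κ → ι → 𝕜}
    (h : ∀ i j, L i ⬝ᵥ y j = if i = j then 1 else 0) : LinearIndependent 𝕜 y := by
  rw [Fintype.linearIndependent_iff]
  intro c hc i
  have := congrArg (L i ⬝ᵥ ·) hc
  simpa [dotProduct_sum, h] using this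

theorem prodTensor_dotProduct_prodTensor {n d : ℕ} (x y : Fin d → Fin n → 𝕜) :
    prodTensor x ⬝ᵥ prodTensor y = ∏ k, x k ⬝ᵥ y k := by
  simp only [dotProduct, prodTensor, ← Finset.prod_mul_distrib, Finset.prod_univ_sum,
    Fintype.piFinset_univ]

/-- The pairing of two powers is the `d`-th power of the pairing; `d ≥ 1` is needed for `0 ^ d = 0`.
-/
theorem prodTensor_const_dual {n d : ℕ} [DecidableEq κ] (hd : 1 ≤ d) {y L : κ → Fin n → 𝕜}
    (h : ∀ i j, L i ⬝ᵥ y j = if i = j then 1 else 0) (i j : κ) :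
    prodTensor (fun _ : Fin d => L i) ⬝ᵥ prodTensor (fun _ : Fin d => y j) =
      if i = j then 1 else 0 := by
  rw [prodTensor_dotProduct_prodTensor, Finset.prod_const, h]
  split_ifs <;> simp
  omega

theorem linearIndependent_prodTensor {n d : ℕ} [DecidableEq κ] (hd : 1 ≤ d) {y : κ → Fin n → 𝕜}
    (h : LinearIndependent 𝕜 y) : LinearIndependent 𝕜 fun i => prodTensor fun _ : Fin d => y i := by
  obtain ⟨L, hL⟩ := exists_dual_family h
  exact linearIndependent_of_dual_family (prodTensor_const_dual hd hL)

/-- The only powers in the span of the powers of linearly independent vectors are those of their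
multiples. -/
theorem parallel_of_power_mem_span {n d : ℕ} [DecidableEq κ] (hd : 2 ≤ d) {y : κ → Fin n → 𝕜}
    (hy : LinearIndependent 𝕜 y) {x : Fin n → 𝕜}
    (hx : (prodTensor fun _ : Fin d => x) ∈
      Submodule.span 𝕜 (Set.range fun i => prodTensor fun _ : Fin d => y i)) :
    x = 0 ∨ ∃ i, ∃ c : 𝕜, x = c • y i := by
  rw [or_iff_not_imp_left]
  intro hx0
  obtain ⟨L, hL⟩ := exists_dual_family hy
  obtain ⟨c, hc⟩ := (Submodule.mem_span_range_iff_exists_fun 𝕜).1 hx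
  obtain ⟨e, rfl⟩ : ∃ e, d = e + 2 := ⟨d - 2, by omega⟩
  -- The identity `x^{⊗d} = ∑ c_i y_i^{⊗d}` is contracted with `ψ ⊗ φ^{⊗(d-1)}`.
  have key : ∀ ψ φ : Fin n → 𝕜, (ψ ⬝ᵥ x) * (φ ⬝ᵥ x) ^ (e + 1) =
      ∑ i, c i * ((ψ ⬝ᵥ y i) * (φ ⬝ᵥ y i) ^ (e + 1)) := by
    intro ψ φ
    have h := congrArg (prodTensor (Fin.cons ψ fun _ : Fin (e + 1) => φ) ⬝ᵥ ·) hc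
    simp only [dotProduct_sum, dotProduct_smul, prodTensor_dotProduct_prodTensor,
      Fin.prod_univ_succ (n := e + 1), Fin.cons_zero, Fin.cons_succ, Finset.prod_const,
      Finset.card_univ, Fintype.card_fin, smul_eq_mul] at h
    exact h.symm
  obtain ⟨a₀, ha₀⟩ := Function.ne_iff.1 hx0
  -- With `φ` a coordinate in which `x` does not vanish and `ψ` running over all coordinates, the
  -- contracted identity can be solved for `x`.
  have hspan : ∃ b : κ → 𝕜, x = ∑ i, b i • y i := by
    refine ⟨fun i => (x a₀ ^ (e + 1))⁻¹ * (c i * y i a₀ ^ (e + 1)), ?_⟩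
    funext a
    have h := key (Pi.single a 1) (Pi.single a₀ 1)
    simp only [single_one_dotProduct] at h
    have h0 : x a₀ ^ (e + 1) ≠ 0 := pow_ne_zero _ ha₀
    rw [Finset.sum_apply]
    simp only [Pi.smul_apply, smul_eq_mul]
    rw [← mul_right_inj' h0, mul_comm, h, Finset.mul_sum]
    refine Finset.sum_congr rfl fun i _ => ?_
    field_simp
  obtain ⟨b, hb⟩ := hspan
  have hLx : ∀ i, L i ⬝ᵥ x = b i := by
    intro i
    rw [hb, dotProduct_sum]
    simp [hL]
  -- The functionals dual to two different `y` annihilate every term on the right. As `d ≥ 2`, both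
  -- of them occur in the contraction, so no two coefficients of `x` are non-zero simultaneously.
  have hprod : ∀ i j, i ≠ j → b i * b j ^ (e + 1) = 0 := by
    intro i j hij
    have := key (L i) (L j)
    rw [hLx, hLx] at this
    rw [this]
    refine Finset.sum_eq_zero fun l _ => ?_
    rw [hL, hL]
    by_cases h1 : i = l
    · subst h1; simp [hij.symm]
    · simp [h1]
  obtain ⟨j, hj⟩ : ∃ j, b j ≠ 0 := by
    by_contra hcon
    push Not at hcon
    apply hx0
    rw [hb]
    simp [hcon]
  refine ⟨j, b j, ?_⟩
  conv_lhs => rw [hb]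
  refine Finset.sum_eq_single j (fun i _ hij => ?_) (by simp)
  rw [(mul_eq_zero.1 (hprod i j hij)).resolve_right (pow_ne_zero _ hj), zero_smul]

end DualFamilies

/-! ### Existence of the Moore–Penrose pseudoinverse -/

section MoorePenrose

variable {𝕜 : Type*} [RCLike 𝕜] {ι κ : Type*} [Fintype ι] [Fintype κ]
  [DecidableEq ι] [DecidableEq κ]

-- With `A^* A = U D U^*` for a unitary `U` and a real diagonal `D`, the pseudoinverse is `U D⁻¹ U^*
-- A^*`, where `0⁻¹ = 0`. Existence guarantees that simultaneous diagonalization always has a run.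
open scoped ComplexOrder in
theorem exists_isMoorePenrose (A : Matrix ι κ 𝕜) : ∃ B, IsMoorePenrose A B := by
  obtain ⟨U, D, hU, hU', hD, hA⟩ : ∃ (U : Matrix κ κ 𝕜) (D : κ → 𝕜), U * U.conjTranspose = 1 ∧
      U.conjTranspose * U = 1 ∧ star D = D ∧
      A.conjTranspose * A = U * Matrix.diagonal D * U.conjTranspose := by
    have hH := Matrix.isHermitian_conjTranspose_mul_self A
    refine ⟨hH.eigenvectorUnitary, RCLike.ofReal ∘ hH.eigenvalues,
      Unitary.mul_star_self_of_mem hH.eigenvectorUnitary.2,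
      Unitary.star_mul_self_of_mem hH.eigenvectorUnitary.2, ?_, ?_⟩
    · funext i
      simp
    · have := hH.spectral_theorem
      rwa [Unitary.conjStarAlgAut_apply] at this
  have hD' : star D⁻¹ = D⁻¹ := by
    funext i
    rw [Pi.star_apply, Pi.inv_apply, star_inv₀, ← Pi.star_apply, hD]
  have hA' : U.conjTranspose * (A.conjTranspose * (A * U)) = Matrix.diagonal D := by
    rw [← Matrix.mul_assoc A.conjTranspose, hA]
    simp only [Matrix.mul_assoc, hU', Matrix.mul_one]
    rw [← Matrix.mul_assoc, hU', Matrix.one_mul]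
  -- The squared lengths of the columns of `A * U` are the entries of `D`, so the columns at which
  -- `D` vanishes are zero.
  have hAU : A * U * Matrix.diagonal (D⁻¹ * D) = A * U := by
    have h0 : A * U * Matrix.diagonal (1 - D⁻¹ * D) = 0 := by
      rw [← Matrix.conjTranspose_mul_self_eq_zero]
      simp only [Matrix.conjTranspose_mul, Matrix.diagonal_conjTranspose, Matrix.mul_assoc]
      rw [← Matrix.mul_assoc A, ← Matrix.mul_assoc A.conjTranspose,
        ← Matrix.mul_assoc U.conjTranspose, hA', ← Matrix.mul_assoc, Matrix.diagonal_mul_diagonal,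
        Matrix.diagonal_mul_diagonal, ← Matrix.diagonal_zero]
      congr 1
      funext i
      by_cases hi : D i = 0 <;> simp [hi]
    have h1 : Matrix.diagonal (1 - D⁻¹ * D) = 1 - Matrix.diagonal (D⁻¹ * D) := by
      rw [← Matrix.diagonal_one, Matrix.diagonal_sub]
      rfl
    rw [h1, Matrix.mul_sub, Matrix.mul_one, sub_eq_zero] at h0
    exact h0.symm
  refine ⟨U * Matrix.diagonal D⁻¹ * U.conjTranspose * A.conjTranspose, ?_, ?_, ?_, ?_⟩
  · calc A * (U * Matrix.diagonal D⁻¹ * U.conjTranspose * A.conjTranspose) * A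
        = A * U * Matrix.diagonal D⁻¹ * (U.conjTranspose * (A.conjTranspose * (A * U))) *
            U.conjTranspose := by simp only [Matrix.mul_assoc, hU, Matrix.mul_one]
      _ = A := by
        rw [hA', Matrix.mul_assoc (A * U), Matrix.diagonal_mul_diagonal]
        rw [show (fun i => D⁻¹ i * D i) = D⁻¹ * D from rfl, hAU, Matrix.mul_assoc, hU,
          Matrix.mul_one]
  · calc U * Matrix.diagonal D⁻¹ * U.conjTranspose * A.conjTranspose * A *
          (U * Matrix.diagonal D⁻¹ * U.conjTranspose * A.conjTranspose)
        = U * (Matrix.diagonal D⁻¹ * (U.conjTranspose * (A.conjTranspose * (A * U))) *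
            Matrix.diagonal D⁻¹) * U.conjTranspose * A.conjTranspose := by
          simp only [Matrix.mul_assoc]
      _ = _ := by
        rw [hA', Matrix.diagonal_mul_diagonal, Matrix.diagonal_mul_diagonal]
        congr 4
        funext i
        by_cases hi : D i = 0 <;> simp [hi]
  · rw [Matrix.IsHermitian]
    simp only [Matrix.conjTranspose_mul, Matrix.conjTranspose_conjTranspose,
      Matrix.diagonal_conjTranspose, hD', Matrix.mul_assoc]
  · have : U * Matrix.diagonal D⁻¹ * U.conjTranspose * A.conjTranspose * A =
        U * Matrix.diagonal (D⁻¹ * D) * U.conjTranspose := by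
      rw [Matrix.mul_assoc _ A.conjTranspose, hA]
      simp only [Matrix.mul_assoc]
      rw [← Matrix.mul_assoc U.conjTranspose U, hU', Matrix.one_mul,
        ← Matrix.mul_assoc (Matrix.diagonal D⁻¹), Matrix.diagonal_mul_diagonal]
      rfl
    rw [this, Matrix.IsHermitian]
    simp only [Matrix.conjTranspose_mul, Matrix.conjTranspose_conjTranspose,
      Matrix.diagonal_conjTranspose, star_mul', hD', hD, Matrix.mul_assoc]

end MoorePenrose

/-! ### Eigensystems of quotients of slices -/

section SimpleEigensystems

variable {𝕜 : Type*} [RCLike 𝕜] {ι κ : Type*} [Fintype ι] [Fintype κ]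
  [DecidableEq ι] [DecidableEq κ]

theorem IsSimpleEigensystem.linearIndependent {M : Matrix ι ι 𝕜} {r : ℕ} {ev : Fin r → 𝕜}
    {v : Fin r → ι → 𝕜} (h : IsSimpleEigensystem M ev v) : LinearIndependent 𝕜 v := by
  refine Module.End.eigenvectors_linearIndependent' (Matrix.toLin' M) ev h.2.1 v fun a => ?_
  rw [Module.End.hasEigenvector_iff, Module.End.mem_eigenspace_iff, Matrix.toLin'_apply]
  exact ⟨(h.2.2 a).2.2, (h.2.2 a).2.1⟩

/-- The tensor `T = ∑ z_i ⊗ y_i ⊗ w_i` with linearly independent families `y` and `w` satisfies the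
genericity conditions under which simultaneous diagonalization along `f` and `g` recovers the
terms. -/
structure Diagonalizes {k r : ℕ} (T : Fin k → Matrix ι κ 𝕜) (f g : Fin k → 𝕜)
    (z : Fin r → Fin k → 𝕜) (y : Fin r → ι → 𝕜) (w : Fin r → κ → 𝕜) : Prop where
  decomp : ∀ l a b, T l a b = ∑ i, z i l * y i a * w i b
  left : LinearIndependent 𝕜 y
  right : LinearIndependent 𝕜 w
  ne_zero : ∀ i, f ⬝ᵥ z i ≠ 0
  ne_zero' : ∀ i, g ⬝ᵥ z i ≠ 0
  injective : Function.Injective fun i => f ⬝ᵥ z i / g ⬝ᵥ z i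

theorem contract_eq_of_decomp {k r : ℕ} {T : Fin k → Matrix ι κ 𝕜} {z : Fin r → Fin k → 𝕜}
    {y : Fin r → ι → 𝕜} {w : Fin r → κ → 𝕜} (h : ∀ l a b, T l a b = ∑ i, z i l * y i a * w i b)
    (f : Fin k → 𝕜) : contract T f =
      (Matrix.of y).transpose * Matrix.diagonal (fun i => f ⬝ᵥ z i) * Matrix.of w := by
  ext a b
  rw [contract, Matrix.sum_apply, Matrix.mul_apply]
  simp only [Matrix.smul_apply, h, smul_eq_mul, Finset.mul_sum, Matrix.mul_diagonal,
    Matrix.transpose_apply, Matrix.of_apply, dotProduct, Finset.sum_mul]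
  rw [Finset.sum_comm]
  exact Finset.sum_congr rfl fun i _ => Finset.sum_congr rfl fun l _ => by ring

/-- A generalized inverse of `Y D W` inverts `D`. -/
theorem mul_mul_eq_diagonal_inv {r : ℕ} {y : Fin r → ι → 𝕜} {w : Fin r → κ → 𝕜} {D : Fin r → 𝕜}
    (hy : LinearIndependent 𝕜 y) (hw : LinearIndependent 𝕜 w) (hD : ∀ i, D i ≠ 0)
    {A : Matrix ι κ 𝕜} {G : Matrix κ ι 𝕜}
    (hA : A = (Matrix.of y).transpose * Matrix.diagonal D * Matrix.of w) (hG : A * G * A = A) :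
    Matrix.of w * G * (Matrix.of y).transpose = Matrix.diagonal D⁻¹ := by
  obtain ⟨L, hL⟩ := exists_dual_family hy
  obtain ⟨L', hL'⟩ := exists_dual_family hw
  have h1 : Matrix.of L * (Matrix.of y).transpose = 1 := by
    ext i j
    exact (hL i j).trans (Matrix.one_apply).symm
  have h2 : Matrix.of w * (Matrix.of L').transpose = 1 := by
    ext i j
    refine (dotProduct_comm _ _).trans ((hL' j i).trans ?_)
    simp [Matrix.one_apply, eq_comm]
  have hDD : Matrix.diagonal D⁻¹ * Matrix.diagonal D = 1 := by
    rw [Matrix.diagonal_mul_diagonal, ← Matrix.diagonal_one]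
    congr 1; funext i; exact inv_mul_cancel₀ (hD i)
  have hDD' : Matrix.diagonal D * Matrix.diagonal D⁻¹ = 1 := by
    rw [Matrix.diagonal_mul_diagonal, ← Matrix.diagonal_one]
    congr 1; funext i; exact mul_inv_cancel₀ (hD i)
  have h3 : Matrix.diagonal D⁻¹ * Matrix.of L * A = Matrix.of w := by
    rw [hA, Matrix.mul_assoc, ← Matrix.mul_assoc (Matrix.of L), ← Matrix.mul_assoc (Matrix.of L), h1,
      Matrix.one_mul, ← Matrix.mul_assoc, hDD, Matrix.one_mul]
  have h4 : A * (Matrix.of L').transpose * Matrix.diagonal D⁻¹ = (Matrix.of y).transpose := by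
    rw [hA, Matrix.mul_assoc _ (Matrix.of w), h2, Matrix.mul_one, Matrix.mul_assoc, hDD',
      Matrix.mul_one]
  calc Matrix.of w * G * (Matrix.of y).transpose
      = Matrix.diagonal D⁻¹ * Matrix.of L * (A * G * A) * (Matrix.of L').transpose *
          Matrix.diagonal D⁻¹ := by
        rw [← h3, ← h4]; simp only [Matrix.mul_assoc]
    _ = _ := by
        rw [hG, h3, h2, Matrix.one_mul]

/-- The factor `X` with `r` rows bounds the rank from above; the `r` independent eigenvectors with
non-zero eigenvalues lie in the range and bound it from below. -/
theorem rank_eq_of_mul_eq {r : ℕ} {y : Fin r → ι → 𝕜} {M : Matrix ι ι 𝕜} {X : Matrix (Fin r) ι 𝕜}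
    {μ : Fin r → 𝕜} (hy : LinearIndependent 𝕜 y) (hμ : ∀ i, μ i ≠ 0)
    (hM : M = (Matrix.of y).transpose * X)
    (hMy : ∀ i, M.mulVec (y i) = μ i • y i) : M.rank = r := by
  apply le_antisymm
  · rw [hM]
    exact (Matrix.rank_mul_le_right _ _).trans (by simpa using X.rank_le_card_height)
  · have hle : Submodule.span 𝕜 (Set.range y) ≤ LinearMap.range M.mulVecLin := by
      rw [Submodule.span_le]
      rintro _ ⟨i, rfl⟩
      refine ⟨(μ i)⁻¹ • y i, ?_⟩
      rw [Matrix.mulVecLin_apply, Matrix.mulVec_smul, hMy, smul_smul, inv_mul_cancel₀ (hμ i),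
        one_smul]
    have := Submodule.finrank_mono hle
    rw [finrank_span_eq_card hy, Fintype.card_fin] at this
    exact this

/-- The simple eigensystems of a matrix `M` of rank `k` that has the independent eigenvectors `y i`
are the rescaled permutations of the given one. -/
theorem IsSimpleEigensystem.eq_perm {k r : ℕ} {y : Fin k → ι → 𝕜} {M : Matrix ι ι 𝕜}
    {X : Matrix (Fin k) ι 𝕜} {μ : Fin k → 𝕜} (hy : LinearIndependent 𝕜 y) (hμ : ∀ i, μ i ≠ 0)
    (hinj : Function.Injective μ) (hM : M = (Matrix.of y).transpose * X)
    (hMy : ∀ i, M.mulVec (y i) = μ i • y i) {ev : Fin r → 𝕜} {v : Fin r → ι → 𝕜}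
    (h : IsSimpleEigensystem M ev v) :
    r = k ∧ ∃ π : Fin r → Fin k, Function.Injective π ∧ ∀ a, ev a = μ (π a) ∧
      ∃ c : 𝕜, c ≠ 0 ∧ v a = c • y (π a) := by
  have hr : r = k := h.1.symm.trans (rank_eq_of_mul_eq hy hμ hM hMy)
  refine ⟨hr, ?_⟩
  have key : ∀ a, ∃ i, ev a = μ i ∧ ∃ c : 𝕜, c ≠ 0 ∧ v a = c • y i := by
    intro a
    obtain ⟨h1, h2, h3⟩ := h.2.2 a
    have hlin : ∀ b : Fin k → 𝕜, (Matrix.of y).transpose.mulVec b = ∑ i, b i • y i := by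
      intro b
      funext j
      simp [Matrix.mulVec, dotProduct, mul_comm]
    -- An eigenvector with non-zero eigenvalue lies in the range of `M`, hence in the span of the `y
    -- i`.
    obtain ⟨b, hb⟩ : ∃ b : Fin k → 𝕜, v a = ∑ i, b i • y i := by
      refine ⟨(ev a)⁻¹ • X.mulVec (v a), ?_⟩
      rw [← hlin, Matrix.mulVec_smul, Matrix.mulVec_mulVec, ← hM, h3, smul_smul,
        inv_mul_cancel₀ h1, one_smul]
    -- Comparison of coefficients in the eigenvector equation. As the `μ i` are distinct, only one
    -- `b i` can be non-zero.
    have hb' : ∀ i, b i * μ i = ev a * b i := by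
      have h4 : ∑ i, (b i * μ i) • y i = ∑ i, (ev a * b i) • y i := by
        simp only [mul_smul (ev a), ← Finset.smul_sum]
        rw [← hb, ← h3, hb, Matrix.mulVec_sum]
        exact Finset.sum_congr rfl fun i _ => by rw [Matrix.mulVec_smul, hMy, smul_smul]
      intro i
      have h5 : ∑ i, (b i * μ i - ev a * b i) • y i = 0 := by
        simp only [sub_smul, Finset.sum_sub_distrib, h4, sub_self]
      exact sub_eq_zero.1 ((Fintype.linearIndependent_iff.1 hy) _ h5 i)
    obtain ⟨i, hi⟩ : ∃ i, b i ≠ 0 := by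
      by_contra hcon
      push Not at hcon
      apply h2
      rw [hb]
      simp [hcon]
    have hev : ev a = μ i := by
      have := hb' i
      rw [mul_comm] at this
      exact (mul_right_cancel₀ hi this).symm
    refine ⟨i, hev, b i, hi, ?_⟩
    rw [hb]
    refine Finset.sum_eq_single i (fun j _ hij => ?_) (by simp)
    have h5 := hb' j
    by_contra h6
    have h7 : b j ≠ 0 := fun h => h6 (by rw [h, zero_smul])
    apply hij
    apply hinj
    rw [mul_comm] at h5
    rw [mul_right_cancel₀ h7 h5, hev]
  choose π hπ using key
  refine ⟨π, fun a b hab => h.2.1 ?_, hπ⟩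
  rw [(hπ a).1, (hπ b).1, hab]

end SimpleEigensystems

end

section

/-! ### Correctness of simultaneous diagonalization -/

section SimDiagCorrectness

variable {𝕜 : Type*} [RCLike 𝕜] {ι κ : Type*} [Fintype ι] [Fintype κ]
  [DecidableEq ι] [DecidableEq κ]

theorem contract_transpose {k : ℕ} (T : Fin k → Matrix ι κ 𝕜) (f : Fin k → 𝕜) :
    contract (fun l => (T l).transpose) f = (contract T f).transpose := by
  simp [contract, Matrix.transpose_sum]

/-- The rank of the product is at most that of the diagonal factor, which is the number of non-zero
entries of `D`. This recovers the genericity of the functionals from the rank that the algorithm has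
found. -/
theorem eigenvalue_ne_zero_of_rank {r : ℕ} {ρ : Type*} [Fintype ρ] {A : Matrix ρ (Fin r) 𝕜}
    {B : Matrix (Fin r) ρ 𝕜} {D : Fin r → 𝕜} (h : (A * Matrix.diagonal D * B).rank = r) (i : Fin r) :
    D i ≠ 0 := by
  classical
  intro hi
  have h1 : r ≤ (Matrix.diagonal D).rank := by
    conv_lhs => rw [← h]
    exact (Matrix.rank_mul_le_left _ _).trans (Matrix.rank_mul_le_right _ _)
  rw [Matrix.rank_diagonal] at h1
  have h2 := Fintype.card_subtype_lt (p := fun i => D i ≠ 0) (x := i) (by simpa using hi)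
  rw [Fintype.card_fin] at h2
  omega

/-- A generalized inverse `G` of `T(g) = Y D_g W` satisfies `W G Y = D_g⁻¹`, whence `T(f) G Y = Y
D_f D_g⁻¹`. Of the Penrose conditions only `A G A = A` enters. -/
theorem mulVec_of_decomp {k r : ℕ} {T : Fin k → Matrix ι κ 𝕜} {f g : Fin k → 𝕜}
    {z : Fin r → Fin k → 𝕜} {y : Fin r → ι → 𝕜} {w : Fin r → κ → 𝕜}
    (hT : ∀ l a b, T l a b = ∑ i, z i l * y i a * w i b) (hy : LinearIndependent 𝕜 y)
    (hw : LinearIndependent 𝕜 w) (hg : ∀ i, g ⬝ᵥ z i ≠ 0) {G : Matrix κ ι 𝕜}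
    (hG : contract T g * G * contract T g = contract T g) (i : Fin r) :
    (contract T f * G).mulVec (y i) = (f ⬝ᵥ z i / g ⬝ᵥ z i) • y i := by
  have h1 := mul_mul_eq_diagonal_inv hy hw hg (contract_eq_of_decomp hT g) hG
  have h2 : contract T f * G * (Matrix.of y).transpose =
      (Matrix.of y).transpose * Matrix.diagonal fun i => f ⬝ᵥ z i / g ⬝ᵥ z i := by
    rw [contract_eq_of_decomp hT f]
    simp only [Matrix.mul_assoc] at h1 ⊢
    rw [h1, Matrix.diagonal_mul_diagonal]
    simp only [div_eq_mul_inv]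
    rfl
  funext a
  have h3 := congrFun (congrFun h2 a) i
  rw [Matrix.mul_diagonal, Matrix.transpose_apply] at h3
  rw [Pi.smul_apply, smul_eq_mul, mul_comm]
  exact h3

namespace Diagonalizes

variable {k r : ℕ} {T : Fin k → Matrix ι κ 𝕜} {f g : Fin k → 𝕜} {z : Fin r → Fin k → 𝕜}
  {y : Fin r → ι → 𝕜} {w : Fin r → κ → 𝕜}

/-- Exchanging the last two modes along with `f` and `g` turns the eigenvalue problem for the `w i`
into that for the `y i`, with inverted eigenvalues, so that both are treated by the same lemmas. -/
theorem swap (h : Diagonalizes T f g z y w) :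
    Diagonalizes (fun l => (T l).transpose) g f z w y where
  decomp l a b := by
    rw [Matrix.transpose_apply, h.decomp]
    exact Finset.sum_congr rfl fun i _ => by ring
  left := h.right
  right := h.left
  ne_zero := h.ne_zero'
  ne_zero' := h.ne_zero
  injective i j hij := h.injective (by simpa only [inv_div] using congrArg (·⁻¹) hij)

theorem mulVec (h : Diagonalizes T f g z y w) {G : Matrix κ ι 𝕜}
    (hG : contract T g * G * contract T g = contract T g) (i : Fin r) :
    (contract T f * G).mulVec (y i) = (f ⬝ᵥ z i / g ⬝ᵥ z i) • y i :=
  mulVec_of_decomp h.decomp h.left h.right h.ne_zero' hG i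

theorem exists_factor (h : Diagonalizes T f g z y w) (G : Matrix κ ι 𝕜) :
    ∃ X, contract T f * G = (Matrix.of y).transpose * X := by
  rw [contract_eq_of_decomp h.decomp f]
  exact ⟨Matrix.diagonal (fun i => f ⬝ᵥ z i) * Matrix.of w * G, by
    simp only [Matrix.mul_assoc]; rfl⟩

theorem eq_perm (h : Diagonalizes T f g z y w) {G : Matrix κ ι 𝕜}
    (hG : contract T g * G * contract T g = contract T g) {r' : ℕ} {ev : Fin r' → 𝕜}
    {v : Fin r' → ι → 𝕜} (hv : IsSimpleEigensystem (contract T f * G) ev v) :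
    r' = r ∧ ∃ π : Fin r' → Fin r, Function.Injective π ∧
      ∀ a, ev a = f ⬝ᵥ z (π a) / g ⬝ᵥ z (π a) ∧ ∃ c : 𝕜, c ≠ 0 ∧ v a = c • y (π a) := by
  obtain ⟨X, hX⟩ := h.exists_factor G
  exact hv.eq_perm h.left (fun i => div_ne_zero (h.ne_zero i) (h.ne_zero' i)) h.injective hX
    (h.mulVec hG)

theorem isSimpleEigensystem (h : Diagonalizes T f g z y w) {G : Matrix κ ι 𝕜}
    (hG : contract T g * G * contract T g = contract T g) {π : Fin r → Fin r}
    (hπ : Function.Injective π) :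
    IsSimpleEigensystem (contract T f * G) (fun a => f ⬝ᵥ z (π a) / g ⬝ᵥ z (π a))
      fun a => y (π a) := by
  obtain ⟨X, hX⟩ := h.exists_factor G
  have hne := fun i => div_ne_zero (h.ne_zero i) (h.ne_zero' i)
  exact ⟨rank_eq_of_mul_eq h.left hne hX (h.mulVec hG), fun a b hab => hπ (h.injective hab),
    fun a => ⟨hne _, h.left.ne_zero _, h.mulVec hG _⟩⟩

theorem transpose_mul (F : Matrix κ ι 𝕜) : (F * contract T g).transpose =
    contract (fun l => (T l).transpose) g * F.transpose := by
  rw [Matrix.transpose_mul, contract_transpose]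

theorem transpose_generalized {F : Matrix κ ι 𝕜}
    (hF : contract T f * F * contract T f = contract T f) :
    contract (fun l => (T l).transpose) f * F.transpose * contract (fun l => (T l).transpose) f =
      contract (fun l => (T l).transpose) f := by
  rw [contract_transpose]
  conv_rhs => rw [← hF]
  simp only [Matrix.transpose_mul, Matrix.mul_assoc]

/-- Common analysis of the last two outcomes of simultaneous diagonalization. -/
theorem contractRight_eq (h : Diagonalizes T f g z y w) {F G : Matrix κ ι 𝕜}
    (hF : contract T f * F * contract T f = contract T f)
    (hG : contract T g * G * contract T g = contract T g)
    {r' : ℕ} {ev : Fin r' → 𝕜} {v : Fin r' → ι → 𝕜} {w' : Fin r' → κ → 𝕜}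
    (hM : IsSimpleEigensystem (contract T f * G) ev v)
    (hN : IsSimpleEigensystem (F * contract T g).transpose (fun a => (ev a)⁻¹) w')
    {H : Fin r' → ι → κ → 𝕜}
    (hdual : ∀ a b, ∑ i, ∑ j, H a i j * (v b i * w' b j) = if a = b then 1 else 0) :
    r' = r ∧ ∃ π : Fin r' → Fin r, Function.Injective π ∧ ∀ a, ∃ c e : 𝕜, c ≠ 0 ∧ e ≠ 0 ∧
      v a = c • y (π a) ∧ w' a = e • w (π a) ∧
      contractRight T (H a) = (c * e)⁻¹ • z (π a) := by
  obtain ⟨rfl, π, hπ, h1⟩ := h.eq_perm hG hM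
  rw [transpose_mul] at hN
  obtain ⟨-, π', hπ', h2⟩ := h.swap.eq_perm (transpose_generalized hF) hN
  -- The eigenvectors on the two sides are matched through reciprocal eigenvalues. Since the
  -- quotients are distinct, the two permutations coincide.
  have hππ : ∀ a, π' a = π a := by
    intro a
    have h3 := (h2 a).1
    rw [(h1 a).1] at h3
    apply h.injective
    simpa only [inv_div, inv_inv] using (congrArg (·⁻¹) h3).symm
  refine ⟨rfl, π, hπ, fun a => ?_⟩
  choose ev_eq c hc hv using h1
  choose ev_eq' e he hw using h2
  refine ⟨c a, e a, hc a, he a, hv a, by rw [← hππ]; exact hw a, ?_⟩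
  have hbij : Function.Bijective π := Finite.injective_iff_bijective.1 hπ
  funext l
  -- The decomposition is rewritten in terms of the rescaled eigenvectors, after which duality of
  -- `H` leaves one term.
  calc contractRight T (H a) l
      = ∑ i, ∑ j, H a i j * ∑ b, z (π b) l * y (π b) i * w (π b) j := by
        simp only [contractRight, h.decomp]
        refine Finset.sum_congr rfl fun i _ => Finset.sum_congr rfl fun j _ => ?_
        rw [← hbij.sum_comp]
    _ = ∑ b, z (π b) l * (c b * e b)⁻¹ * ∑ i, ∑ j, H a i j * (v b i * w' b j) := by
        simp only [Finset.mul_sum]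
        rw [Finset.sum_comm (s := Finset.univ (α := Fin r')) (t := Finset.univ (α := ι))]
        refine Finset.sum_congr rfl fun i _ => ?_
        rw [Finset.sum_comm]
        refine Finset.sum_congr rfl fun b _ => Finset.sum_congr rfl fun j _ => ?_
        rw [hv, hw, hππ]
        have := hc b
        have := he b
        simp only [Pi.smul_apply, smul_eq_mul]
        field_simp
    _ = _ := by
        simp only [hdual, mul_ite, mul_one, mul_zero, Finset.sum_ite_eq, Finset.mem_univ, if_true]
        rw [Pi.smul_apply, smul_eq_mul, mul_comm]

/-- Simultaneous diagonalization succeeds, and finds the terms of the decomposition. -/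
theorem simDiag_eq (h : Diagonalizes T f g z y w) (hz : LinearIndependent 𝕜 z)
    {o : SimDiagOutput 𝕜 ι κ k} (ho : SimDiag T f g o) :
    ∃ (x : Fin r → Fin k → 𝕜) (v : Fin r → ι → 𝕜) (w' : Fin r → κ → 𝕜) (π : Fin r → Fin r),
      o = .decomposition r x v w' ∧ Function.Injective π ∧
      ∀ i l a b, x i l * v i a * w' i b = z (π i) l * y (π i) a * w (π i) b := by
  cases ho with
  | noEigensystem G hG hM =>
    exact absurd (h.isSimpleEigensystem hG.1 Function.injective_id) (hM _ _ _)
  | notReciprocal F G hF hG r' ev v hM hN =>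
    obtain ⟨rfl, π, hπ, h1⟩ := h.eq_perm hG.1 hM
    refine absurd ?_ (hN fun a => w (π a))
    rw [transpose_mul]
    convert h.swap.isSimpleEigensystem (transpose_generalized hF.1) hπ using 2 with a
    rw [(h1 a).1, inv_div]
  | parallel F G hF hG r' ev v w' hM hN H hdual a b hab hpar =>
    obtain ⟨rfl, π, hπ, h1⟩ := h.contractRight_eq hF.1 hG.1 hM hN hdual
    obtain ⟨c, e, hc, he, -, -, h2⟩ := h1 a
    obtain ⟨c', e', -, -, -, -, h3⟩ := h1 b
    rw [h2, h3] at hpar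
    obtain ⟨t, ht⟩ := Submodule.mem_span_singleton.1 hpar
    rw [smul_smul] at ht
    obtain ⟨L, hL⟩ := exists_dual_family hz
    have h4 := congrArg (L (π a) ⬝ᵥ ·) ht
    simp [hL, hπ.ne hab, hc, he] at h4
  | success F G hF hG r' ev v w' hM hN H hdual hpar =>
    obtain ⟨rfl, π, hπ, h1⟩ := h.contractRight_eq hF.1 hG.1 hM hN hdual
    refine ⟨_, _, _, π, rfl, hπ, fun i l a b => ?_⟩
    obtain ⟨c, e, hc, he, h2, h3, h4⟩ := h1 i
    rw [h2, h3, h4]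
    simp only [Pi.smul_apply, smul_eq_mul]
    field_simp

end Diagonalizes

/-- If simultaneous diagonalization outputs a decomposition of the tensor then the genericity
conditions are satisfied. -/
theorem diagonalizes_of_simDiag {k r : ℕ} {T : Fin k → Matrix ι κ 𝕜} {f g : Fin k → 𝕜}
    {x : Fin r → Fin k → 𝕜} {v : Fin r → ι → 𝕜} {w : Fin r → κ → 𝕜}
    (h : SimDiag T f g (.decomposition r x v w))
    (hT : ∀ l a b, T l a b = ∑ i, x i l * v i a * w i b) : Diagonalizes T f g x v w := by
  cases h with
  | success F G hF hG r ev v w hM hN H hdual hpar =>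
    -- The matrix `T(f) T(g)^+` has rank `r` and factors through the diagonal matrix of the numbers
    -- `f · x_i`; the second matrix gives the same for `g`.
    have hf : ∀ i, f ⬝ᵥ contractRight T (H i) ≠ 0 := by
      refine fun i => eigenvalue_ne_zero_of_rank (D := fun i => f ⬝ᵥ contractRight T (H i))
        (A := (Matrix.of v).transpose)
        (B := Matrix.of w * G) ?_ i
      refine Eq.trans ?_ hM.1
      rw [contract_eq_of_decomp hT f, Matrix.mul_assoc _ _ G]
    have hg : ∀ i, g ⬝ᵥ contractRight T (H i) ≠ 0 := by
      refine fun i => eigenvalue_ne_zero_of_rank (D := fun i => g ⬝ᵥ contractRight T (H i))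
        (A := F * (Matrix.of v).transpose)
        (B := Matrix.of w) ?_ i
      refine Eq.trans ?_ hN.1
      rw [contract_eq_of_decomp hT g, Matrix.rank_transpose]
      simp only [Matrix.mul_assoc]
    have hv := hM.linearIndependent
    have hw := hN.linearIndependent
    refine ⟨hT, hv, hw, hf, hg, ?_⟩
    have hev : ∀ i, f ⬝ᵥ contractRight T (H i) / g ⬝ᵥ contractRight T (H i) = ev i := by
      intro i
      have h1 := mulVec_of_decomp (f := f) hT hv hw hg hG.1 i
      rw [(hM.2.2 i).2.2] at h1
      exact (smul_left_injective 𝕜 (hM.2.2 i).2.1 h1).symm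
    intro i j hij
    simp only [hev] at hij
    exact hM.2.1 hij

theorem exists_dual_functionals {r : ℕ} {v : Fin r → ι → 𝕜} {w : Fin r → κ → 𝕜}
    (hv : LinearIndependent 𝕜 v) (hw : LinearIndependent 𝕜 w) : ∃ H : Fin r → ι → κ → 𝕜,
      ∀ a b, ∑ i, ∑ j, H a i j * (v b i * w b j) = if a = b then 1 else 0 := by
  obtain ⟨L, hL⟩ := exists_dual_family hv
  obtain ⟨L', hL'⟩ := exists_dual_family hw
  refine ⟨fun a i j => L a i * L' a j, fun a b => ?_⟩
  have : ∑ i, ∑ j, (L a i * L' a j) * (v b i * w b j) = (L a ⬝ᵥ v b) * (L' a ⬝ᵥ w b) := by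
    simp only [dotProduct, Finset.sum_mul_sum]
    exact Finset.sum_congr rfl fun i _ => Finset.sum_congr rfl fun j _ => by ring
  rw [this, hL, hL']
  split_ifs <;> simp

/-- The relation describing the possible outputs is never empty. This is needed to certify "Fail" as
an admissible output. -/
theorem exists_simDiag {k : ℕ} (T : Fin k → Matrix ι κ 𝕜) (f g : Fin k → 𝕜) :
    ∃ o, SimDiag T f g o := by
  obtain ⟨F, hF⟩ := exists_isMoorePenrose (contract T f)
  obtain ⟨G, hG⟩ := exists_isMoorePenrose (contract T g)
  by_cases hM : ∃ (r : ℕ) (ev : Fin r → 𝕜) (v : Fin r → ι → 𝕜),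
      IsSimpleEigensystem (contract T f * G) ev v
  swap
  · exact ⟨_, .noEigensystem G hG fun r ev v h => hM ⟨r, ev, v, h⟩⟩
  obtain ⟨r, ev, v, hM⟩ := hM
  by_cases hN : ∃ w : Fin r → κ → 𝕜,
      IsSimpleEigensystem (F * contract T g).transpose (fun a => (ev a)⁻¹) w
  swap
  · exact ⟨_, .notReciprocal F G hF hG r ev v hM fun w h => hN ⟨w, h⟩⟩
  obtain ⟨w, hN⟩ := hN
  obtain ⟨H, hH⟩ := exists_dual_functionals hM.linearIndependent hN.linearIndependent
  by_cases hpar : ∃ a b, a ≠ b ∧ contractRight T (H a) ∈ Submodule.span 𝕜 {contractRight T (H b)}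
  · obtain ⟨a, b, hab, hpar⟩ := hpar
    exact ⟨_, .parallel F G hF hG r ev v w hM hN H hH a b hab hpar⟩
  · push Not at hpar
    exact ⟨_, .success F G hF hG r ev v w hM hN H hH hpar⟩

end SimDiagCorrectness

/-! ### Power pencils and their recovery -/

section AlgorithmCorrectness

variable {𝕜 : Type*} [RCLike 𝕜] {n d : ℕ}

theorem flatten_smul_prodTensor {k : ℕ} (hd : 1 ≤ d) (z : Fin k → 𝕜) (y : Fin n → 𝕜) (l : Fin k)
    (a : Fin n) (b : Fin (d - 1) → Fin n) :
    flatten (fun l => z l • prodTensor fun _ : Fin d => y) l a b =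
      z l * y a * prodTensor (fun _ : Fin (d - 1) => y) b := by
  obtain ⟨e, rfl⟩ : ∃ e, d = e + 1 := ⟨d - 1, by omega⟩
  simp only [flatten, Matrix.of_apply, Pi.smul_apply, smul_eq_mul, prodTensor, Fin.prod_univ_succ,
    mul_assoc]
  rfl

theorem flatten_injective {k : ℕ} (hd : 1 ≤ d) {P Q : Fin k → (Fin d → Fin n) → 𝕜}
    (h : ∀ l a b, flatten P l a b = flatten Q l a b) : P = Q := by
  obtain ⟨e, rfl⟩ : ∃ e, d = e + 1 := ⟨d - 1, by omega⟩
  funext l x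
  have h1 := h l (x 0) fun i => x i.succ
  simp only [flatten, Matrix.of_apply] at h1
  convert h1 using 2 <;>
  · funext i
    refine Fin.cases ?_ (fun i => ?_) i
    · simp
    · simp

/-- The tensors `P_l` are the combinations `∑ z_i(l) y_i^{⊗d}` of powers of linearly independent
vectors, and the functionals `f` and `g` are generic with respect to the coefficients. -/
def IsPowerPencil {k : ℕ} (P : Fin k → (Fin d → Fin n) → 𝕜) (f g : Fin k → 𝕜)
    (z : Fin k → Fin k → 𝕜) (y : Fin k → Fin n → 𝕜) : Prop :=
  LinearIndependent 𝕜 z ∧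
    Diagonalizes (flatten P) f g z y fun i => prodTensor fun _ : Fin (d - 1) => y i

variable {k : ℕ} {P : Fin k → (Fin d → Fin n) → 𝕜} {f g : Fin k → 𝕜} {z : Fin k → Fin k → 𝕜}
  {y : Fin k → Fin n → 𝕜}

/-- As `d ≥ 2`, the powers with exponent `d - 1` are still linearly independent, so the flattened
tensor has independent families in both of its last two modes. -/
theorem isPowerPencil_of (hd : 2 ≤ d) (hP : ∀ l, P l = ∑ i, z i l • prodTensor fun _ => y i)
    (hz : LinearIndependent 𝕜 z) (hy : LinearIndependent 𝕜 y) (hf : ∀ i, f ⬝ᵥ z i ≠ 0)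
    (hg : ∀ i, g ⬝ᵥ z i ≠ 0) (hfg : Function.Injective fun i => f ⬝ᵥ z i / g ⬝ᵥ z i) :
    IsPowerPencil P f g z y := by
  refine ⟨hz, fun l a b => ?_, hy, linearIndependent_prodTensor (by omega) hy, hf, hg, hfg⟩
  simp only [← flatten_smul_prodTensor (by omega : 1 ≤ d)]
  simp [flatten, hP]

theorem IsPowerPencil.eq (hd : 2 ≤ d) (h : IsPowerPencil P f g z y) (l : Fin k) :
    P l = ∑ i, z i l • prodTensor fun _ => y i := by
  have h1 : P = fun l => ∑ i, z i l • prodTensor fun _ : Fin d => y i := by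
    refine flatten_injective (by omega) fun l a b => ?_
    rw [h.2.decomp]
    simp only [← flatten_smul_prodTensor (by omega : 1 ≤ d)]
    simp [flatten]
  exact congrFun h1 l

/-- The span of the tensors of a power pencil is the span of the powers. -/
theorem IsPowerPencil.span_eq (hd : 2 ≤ d) (h : IsPowerPencil P f g z y) :
    Submodule.span 𝕜 (Set.range P) =
      Submodule.span 𝕜 (Set.range fun i => prodTensor fun _ : Fin d => y i) := by
  apply le_antisymm <;> rw [Submodule.span_le]
  · rintro _ ⟨l, rfl⟩
    rw [SetLike.mem_coe, h.eq hd]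
    exact Submodule.sum_mem _ fun i _ =>
      Submodule.smul_mem _ _ (Submodule.subset_span ⟨i, rfl⟩)
  · rintro _ ⟨j, rfl⟩
    obtain ⟨L, hL⟩ := exists_dual_family h.1
    have h1 : (prodTensor fun _ : Fin d => y j) = ∑ l, L j l • P l := by
      simp only [h.eq hd, Finset.smul_sum, smul_smul]
      rw [Finset.sum_comm]
      simp only [← Finset.sum_smul]
      have h2 : ∀ i, ∑ l, L j l * z i l = if j = i then 1 else 0 := hL j
      simp [h2]
    rw [SetLike.mem_coe]
    simp only
    rw [h1]
    exact Submodule.sum_mem _ fun i _ => Submodule.smul_mem _ _ (Submodule.subset_span ⟨i, rfl⟩)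

/-- The run that takes the `y i` and their powers as eigenvectors outputs the points in the given
order and scaling. Therefore the program may present its own choice of representatives. -/
theorem IsPowerPencil.exists_simDiag (hd : 2 ≤ d) (h : IsPowerPencil P f g z y) :
    ∃ o, SimDiag (flatten P) f g o ∧ IsPowerDecomposition P o y := by
  obtain ⟨F, hF⟩ := exists_isMoorePenrose (contract (flatten P) f)
  obtain ⟨G, hG⟩ := exists_isMoorePenrose (contract (flatten P) g)
  obtain ⟨hz, hD⟩ := h
  set w : Fin k → (Fin (d - 1) → Fin n) → 𝕜 := fun i => prodTensor fun _ : Fin (d - 1) => y i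
  have hM := hD.isSimpleEigensystem hG.1 Function.injective_id
  have hN : IsSimpleEigensystem (F * contract (flatten P) g).transpose
      (fun a => (f ⬝ᵥ z a / g ⬝ᵥ z a)⁻¹) w := by
    rw [Diagonalizes.transpose_mul]
    convert hD.swap.isSimpleEigensystem (Diagonalizes.transpose_generalized hF.1)
      Function.injective_id using 2 with a
    · rw [inv_div, id]
    · rfl
  obtain ⟨L, hL⟩ := exists_dual_family hD.left
  obtain ⟨H, hH⟩ := exists_dual_functionals hD.left hD.right
  have hpar : ∀ a b, a ≠ b → contractRight (flatten P) (H a) ∉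
      Submodule.span 𝕜 {contractRight (flatten P) (H b)} := by
    intro a b hab hmem
    obtain ⟨x, v, w', π, ho, -⟩ :=
      hD.simDiag_eq hz (.parallel F G hF hG k _ _ _ hM hN H hH a b hab hmem)
    cases ho
  refine ⟨_, .success F G hF hG k _ _ _ hM hN H hH hpar, ?_⟩
  obtain ⟨-, π, hπ, hc⟩ := hD.contractRight_eq hF.1 hG.1 hM hN hH
  have hx : ∀ i l a b, contractRight (flatten P) (H i) l * y i a * w i b =
      z i l * y i a * w i b := by
    intro i l a b
    obtain ⟨c, e, hc, he, h1, h2, h3⟩ := hc i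
    -- The chosen eigenvectors are the `y i` themselves, so independence excludes any other
    -- permutation.
    have hi : π i = i := by
      by_contra hne
      have := congrArg (L (π i) ⬝ᵥ ·) h1
      simp [hL, hne] at this
      exact hc this.symm
    rw [hi] at h1 h2 h3
    rw [h3]
    have h4 : y i a = c * y i a := congrFun h1 a
    have h5 : w i b = e * w i b := congrFun h2 b
    conv_lhs => rw [h4, h5]
    simp only [Pi.smul_apply, smul_eq_mul]
    field_simp
  refine ⟨_, _, _, rfl, fun l a b => ?_, z, hz, hD.left, fun i l a b => ?_⟩
  · rw [hD.decomp]
    exact Finset.sum_congr rfl fun i _ => (hx i l a b).symm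
  · exact (hx i l a b).trans (flatten_smul_prodTensor (by omega) (z i) (y i) l a b).symm

/-- In contrast to `IsPowerPencil.exists_simDiag` this concerns an arbitrary run, which may list the
terms in another order and distribute scalar factors differently. -/
theorem IsPowerPencil.isPowerDecomposition (hd : 2 ≤ d) (h : IsPowerPencil P f g z y)
    {o : SimDiagOutput 𝕜 (Fin n) (Fin (d - 1) → Fin n) k} (ho : SimDiag (flatten P) f g o) :
    ∃ π : Equiv.Perm (Fin k), IsPowerDecomposition P o fun i => y (π i) := by
  obtain ⟨x, v, w, π, rfl, hπ, hx⟩ := h.2.simDiag_eq h.1 ho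
  have hbij := Finite.injective_iff_bijective.1 hπ
  refine ⟨Equiv.ofBijective π hbij, x, v, w, rfl, fun l a b => ?_, fun i => z (π i),
    h.1.comp π hπ, h.2.left.comp π hπ, fun i l a b => ?_⟩
  · rw [h.2.decomp]
    simp only [hx]
    exact (hbij.sum_comp fun i => z i l * y i a * prodTensor (fun _ : Fin (d - 1) => y i) b).symm
  · rw [hx]
    exact (flatten_smul_prodTensor (by omega) (z (π i)) (y (π i)) l a b).symm

/-- A successful run makes `f` and `g` generic for its own vectors `x i`. Since `x_i ⊗ v_i ⊗ w_i`
and `z_i ⊗ y_i^{⊗d}` are the same non-zero rank-one tensors, the vectors `x i` and `z i` are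
proportional as far as `f` and `g` can see, and genericity carries over to the `z i`. -/
theorem exists_isPowerPencil (hd : 2 ≤ d)
    {o : SimDiagOutput 𝕜 (Fin n) (Fin (d - 1) → Fin n) k} (ho : SimDiag (flatten P) f g o)
    (hy : IsPowerDecomposition P o y) : ∃ z, IsPowerPencil P f g z y := by
  obtain ⟨x, v, w, rfl, hdec, z, hz, hyi, hx⟩ := hy
  have hD := diagonalizes_of_simDiag ho hdec
  have hx' : ∀ i l a b, x i l * v i a * w i b =
      z i l * y i a * prodTensor (fun _ : Fin (d - 1) => y i) b := fun i l a b => by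
    rw [hx]
    exact flatten_smul_prodTensor (by omega) (z i) (y i) l a b
  have hdec' : ∀ l a b, flatten P l a b =
      ∑ i, z i l * y i a * prodTensor (fun _ : Fin (d - 1) => y i) b := fun l a b => by
    rw [hdec]
    exact Finset.sum_congr rfl fun i _ => hx' i l a b
  have hc : ∀ (c : Fin k → 𝕜) i a b, (c ⬝ᵥ x i) * (v i a * w i b) =
      (c ⬝ᵥ z i) * (y i a * prodTensor (fun _ : Fin (d - 1) => y i) b) := by
    intro c i a b
    simp only [dotProduct, Finset.sum_mul]
    refine Finset.sum_congr rfl fun l _ => ?_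
    have := hx' i l a b
    rw [mul_assoc, ← mul_assoc (x i l), this]
    ring
  have hne : ∀ i, ∃ a b, v i a * w i b ≠ 0 := by
    intro i
    obtain ⟨a, ha⟩ := Function.ne_iff.1 (hD.left.ne_zero i)
    obtain ⟨b, hb⟩ := Function.ne_iff.1 (hD.right.ne_zero i)
    exact ⟨a, b, mul_ne_zero ha hb⟩
  have hne' : ∀ (c : Fin k → 𝕜) i, c ⬝ᵥ x i ≠ 0 → c ⬝ᵥ z i ≠ 0 := by
    intro c i h1 h2
    obtain ⟨a, b, hab⟩ := hne i
    have := hc c i a b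
    rw [h2, zero_mul] at this
    exact mul_ne_zero h1 hab this
  have hratio : ∀ i, f ⬝ᵥ z i / g ⬝ᵥ z i = f ⬝ᵥ x i / g ⬝ᵥ x i := by
    intro i
    obtain ⟨a, b, hab⟩ := hne i
    have h1 := hc f i a b
    have h2 := hc g i a b
    have h3 := hD.ne_zero' i
    have h4 := hne' g i h3
    rw [div_eq_div_iff h4 h3]
    set t := y i a * prodTensor (fun _ : Fin (d - 1) => y i) b
    have ht : t ≠ 0 := fun ht => by
      rw [ht, mul_zero] at h2
      exact mul_ne_zero h3 hab h2
    apply mul_right_cancel₀ (mul_ne_zero hab ht)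
    linear_combination (g ⬝ᵥ z i * t) * (-h1) + (f ⬝ᵥ z i * t) * h2
  refine ⟨z, hz, hdec', hyi, linearIndependent_prodTensor (by omega) hyi,
    fun i => hne' f i (hD.ne_zero i), fun i => hne' g i (hD.ne_zero' i), ?_⟩
  simp only [hratio]
  exact hD.injective

/-! ### The outputs of the algorithm -/

variable {R : ℕ} {rnd : RandomTape 𝕜} {out : Output 𝕜 n}

theorem IsPowerPencil.algorithm1 (hd : 2 ≤ d) (hk : 0 < k) (hkR : k ≤ R)
    (h : IsPowerPencil P (rnd k).1 (rnd k).2 z y) : Algorithm1 R P rnd (.points k y) := by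
  obtain ⟨o, ho, hy⟩ := h.exists_simDiag hd
  exact .points hk hkR o ho y hy

/-- If `k` is not too large, some run of simultaneous diagonalization exists, and a power
decomposition in its output would produce a power pencil. -/
theorem algorithm1_fail (hd : 2 ≤ d) (hk : 0 < k)
    (h : ∀ z y, ¬ IsPowerPencil P (rnd k).1 (rnd k).2 z y) : Algorithm1 R P rnd .fail := by
  rcases lt_or_ge R k with hkR | hkR
  · exact .tooLarge hkR
  · obtain ⟨o, ho⟩ := exists_simDiag (flatten P) (rnd k).1 (rnd k).2
    refine .noDecomposition hk hkR o ho fun y hy => ?_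
    obtain ⟨z, hz⟩ := exists_isPowerPencil hd ho hy
    exact h z y hz

/-- Two lists of powers which span the same space agree up to order and scale. -/
theorem exists_perm_of_span_eq (hd : 2 ≤ d) {y y' : Fin k → Fin n → 𝕜}
    (hy : LinearIndependent 𝕜 y) (hy' : LinearIndependent 𝕜 y')
    (h : ∀ i, (prodTensor fun _ : Fin d => y' i) ∈
      Submodule.span 𝕜 (Set.range fun i => prodTensor fun _ : Fin d => y i)) :
    ∃ π : Equiv.Perm (Fin k), ∀ i, ∃ c : 𝕜, c ≠ 0 ∧ y' i = c • y (π i) := by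
  have h1 : ∀ i, ∃ j, ∃ c : 𝕜, c ≠ 0 ∧ y' i = c • y j := by
    intro i
    obtain h0 | ⟨j, c, hc⟩ := parallel_of_power_mem_span hd hy (h i)
    · exact absurd h0 (hy'.ne_zero i)
    · refine ⟨j, c, fun h0 => hy'.ne_zero i ?_, hc⟩
      rw [hc, h0, zero_smul]
  choose π c hc hπ using h1
  have hinj : Function.Injective π := by
    intro i j hij
    by_contra hne
    obtain ⟨L, hL⟩ := exists_dual_family hy'
    have h2 : y' i = (c i * (c j)⁻¹) • y' j := by
      rw [hπ i, hπ j, smul_smul, hij, mul_assoc, inv_mul_cancel₀ (hc j), mul_one]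
    have h3 := congrArg (L i ⬝ᵥ ·) h2
    simp [hL, hne] at h3
  exact ⟨Equiv.ofBijective π (Finite.injective_iff_bijective.1 hinj), fun i => ⟨c i, hc i, hπ i⟩⟩

/-- If the tensors form a power pencil, then the algorithm finds the points. -/
theorem IsPowerPencil.eq_points (hd : 2 ≤ d) (hk : 0 < k) (hkR : k ≤ R)
    (h : IsPowerPencil P (rnd k).1 (rnd k).2 z y) (hout : Algorithm1 R P rnd out) :
    ∃ y', out = .points k y' ∧
      ∃ π : Equiv.Perm (Fin k), ∀ i, ∃ c : 𝕜, c ≠ 0 ∧ y' i = c • y (π i) := by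
  cases hout with
  | trivial hk' => omega
  | tooLarge hkR' => omega
  | points _ _ o ho y' hy' =>
    obtain ⟨z', hz'⟩ := exists_isPowerPencil hd ho hy'
    refine ⟨y', rfl, exists_perm_of_span_eq hd h.2.left hz'.2.left fun i => ?_⟩
    rw [← h.span_eq hd, hz'.span_eq hd]
    exact Submodule.subset_span ⟨i, rfl⟩
  | noDecomposition _ _ o ho hy' =>
    obtain ⟨π, hπ⟩ := h.isPowerDecomposition hd ho
    exact absurd hπ (hy' _)

variable {p : ℕ} {F : Fin p → MvPolynomial (Fin n) 𝕜} {u : Fin R → Fin n → 𝕜}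

/-- The points whose powers lie in the search space are those of the intersection. -/
theorem power_mem_searchSpace (hd : 2 ≤ d) (hF : ∀ i, (F i).IsHomogeneous d) (x : Fin n → 𝕜) :
    (prodTensor fun _ : Fin d => x) ∈ searchSpace d F u ↔
      x ∈ (Submodule.span 𝕜 (Set.range u) : Set (Fin n → 𝕜)) ∩ zeroSet (Set.range F) := by
  rw [mem_searchSpace]
  refine and_congr ⟨fun h => ?_, fun h => ?_⟩ ?_
  · by_contra hx
    -- A functional that vanishes on `U` but not at `x`: its `d`-th tensor power annihilates
    -- `U^{⊗d}` but not `x^{⊗d}`.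
    obtain ⟨φ, hφ, hφU⟩ := Submodule.exists_le_ker_of_notMem hx
    obtain ⟨ψ, hψ⟩ : ∃ ψ : Fin n → 𝕜, ∀ v, φ v = ψ ⬝ᵥ v :=
      ⟨_, fun v => (LinearMap.pi_apply_eq_sum_univ φ v).trans
        (Finset.sum_congr rfl fun i _ => mul_comm _ _)⟩
    have h1 : ∀ t ∈ Submodule.span 𝕜 {t | ∃ x : Fin d → Fin n → 𝕜,
        (∀ k, x k ∈ Submodule.span 𝕜 (Set.range u)) ∧ t = prodTensor x},
        (prodTensor fun _ => ψ) ⬝ᵥ t = 0 := by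
      intro t ht
      induction ht using Submodule.span_induction with
      | mem t ht =>
        obtain ⟨v, hv, rfl⟩ := ht
        rw [prodTensor_dotProduct_prodTensor]
        refine Finset.prod_eq_zero (Finset.mem_univ (⟨0, by omega⟩ : Fin d)) ?_
        rw [← hψ]
        exact hφU (hv _)
      | zero => simp
      | add s t _ _ hs ht => rw [dotProduct_add, hs, ht, add_zero]
      | smul c t _ ht => rw [dotProduct_smul, ht, smul_zero]
    have h2 := h1 _ h.1
    rw [prodTensor_dotProduct_prodTensor, ← hψ, Finset.prod_const] at h2
    exact hφ (eq_zero_of_pow_eq_zero h2)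
  · refine ⟨Submodule.subset_span ⟨_, fun _ => h, rfl⟩, fun π a => ?_⟩
    simp only [prodTensor, Function.comp_apply]
    exact Equiv.prod_comp π fun k => x (a k)
  · simp only [zeroSet, Set.mem_ofPred_eq, Set.forall_mem_range]
    exact forall_congr' fun j => by rw [eval_eq_pairing (hF j)]

/-- Membership in the intersection is a statement about powers in the search space, to which
`parallel_of_power_mem_span` applies. Both the soundness of the output and the description of the
generic intersection follow from this. -/
theorem exactlyUpToScale_of_searchSpace_eq (hd : 2 ≤ d) (hF : ∀ i, (F i).IsHomogeneous d)
    {s : ℕ} {y : Fin s → Fin n → 𝕜}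
    (hy : LinearIndependent 𝕜 y)
    (hspan : searchSpace d F u =
      Submodule.span 𝕜 (Set.range fun i => prodTensor fun _ : Fin d => y i)) :
    ExactlyUpToScale (𝕜 := 𝕜)
      ((Submodule.span 𝕜 (Set.range u) : Set (Fin n → 𝕜)) ∩ zeroSet (Set.range F)) y := by
  obtain ⟨L, hL⟩ := exists_dual_family hy
  refine ⟨fun i => ⟨?_, hy.ne_zero i⟩, fun i j hij c hc => ?_, fun x hx => ?_⟩
  · rw [← power_mem_searchSpace hd hF, hspan]
    exact Submodule.subset_span ⟨i, rfl⟩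
  · have := congrArg (L i ⬝ᵥ ·) hc
    simp [hL, hij] at this
  · rw [← power_mem_searchSpace hd hF, hspan] at hx
    exact parallel_of_power_mem_span hd hy hx

theorem IsPowerPencil.exactlyUpToScale (hd : 2 ≤ d) (hF : ∀ i, (F i).IsHomogeneous d)
    (hP : IsSearchBasis F u P) (h : IsPowerPencil P f g z y) :
    ExactlyUpToScale (𝕜 := 𝕜)
      ((Submodule.span 𝕜 (Set.range u) : Set (Fin n → 𝕜)) ∩ zeroSet (Set.range F)) y :=
  exactlyUpToScale_of_searchSpace_eq hd hF h.2.left (hP.2.symm.trans (h.span_eq hd))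

/-- Every output other than "Fail" is correct. -/
theorem algorithm1_sound (hd : 2 ≤ d) (hF : ∀ i, (F i).IsHomogeneous d)
    (hP : IsSearchBasis F u P) (hout : Algorithm1 R P rnd out) :
    out.Sound ((Submodule.span 𝕜 (Set.range u) : Set (Fin n → 𝕜)) ∩ zeroSet (Set.range F)) := by
  cases hout with
  | trivial hk =>
    subst hk
    refine Set.eq_singleton_iff_unique_mem.2 ⟨⟨zero_mem _, ?_⟩, fun x hx => ?_⟩
    · rintro _ ⟨j, rfl⟩
      rw [MvPolynomial.eval_zero, MvPolynomial.constantCoeff_eq]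
      exact (hF j).coeff_eq_zero (by simp; omega)
    -- The search space is zero, so `x^{⊗d} = 0`; its entry at a constant index tuple is the `d`-th
    -- power of a coordinate of `x`.
    · rw [← power_mem_searchSpace hd hF, ← hP.2, Set.range_eq_empty, Submodule.span_empty,
        Submodule.mem_bot] at hx
      funext a
      have := congrFun hx fun _ => a
      simpa [prodTensor, show d ≠ 0 by omega] using this
  | tooLarge => exact True.intro
  | points _ _ o ho y' hy' =>
    obtain ⟨z', hz'⟩ := exists_isPowerPencil hd ho hy'
    exact hz'.exactlyUpToScale hd hF hP
  | noDecomposition => exact True.intro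

end AlgorithmCorrectness

end

section

/-! ### The matrix handed to the oracle -/

section Pencil

variable {𝕜 : Type*} [RCLike 𝕜] {ι κ : Type*} [Fintype ι] [Fintype κ]
  [DecidableEq ι] [DecidableEq κ]

/-- `q` is an orthogonal family of vectors of the form `T(g) c_j`, and `M` is the matrix that takes
it to the family of the vectors `q'_j = T(f) c_j`. -/
structure IsPencilMatrix {k r : ℕ} (T : Fin k → Matrix ι κ 𝕜) (f g : Fin k → 𝕜)
    (q q' : Fin r → ι → 𝕜) (M : Matrix (Fin r) (Fin r) 𝕜) : Prop where
  orthogonal : ∀ i j, i ≠ j → star (q i) ⬝ᵥ q j = 0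
  ne_zero : ∀ i, star (q i) ⬝ᵥ q i ≠ 0
  exists_coeff : ∀ j, ∃ c : κ → 𝕜, q j = (contract T g).mulVec c ∧ q' j = (contract T f).mulVec c
  quot : ∀ i j, M i j = star (q i) ⬝ᵥ q' j / star (q i) ⬝ᵥ q i

variable {k r : ℕ} {T : Fin k → Matrix ι κ 𝕜} {f g : Fin k → 𝕜} {q q' : Fin r → ι → 𝕜}
  {M : Matrix (Fin r) (Fin r) 𝕜}

theorem IsPencilMatrix.linearIndependent (h : IsPencilMatrix T f g q q' M) :
    LinearIndependent 𝕜 q := by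
  rw [Fintype.linearIndependent_iff]
  intro c hc i
  have := congrArg (star (q i) ⬝ᵥ ·) hc
  simp only [dotProduct_sum, dotProduct_smul, dotProduct_zero] at this
  rw [Finset.sum_eq_single i (fun j _ hji => by rw [h.orthogonal i j hji.symm, smul_zero])
    (by simp)] at this
  simpa [h.ne_zero i] using this

/-- Coefficients with respect to an orthogonal family are quotients of inner products, so `M` equals
the coefficient matrix of any expansion of the `q' j`. -/
theorem IsPencilMatrix.eq (h : IsPencilMatrix T f g q q' M) {X : Matrix (Fin r) (Fin r) 𝕜}
    (hX : ∀ j, q' j = ∑ l, X l j • q l) : M = X := by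
  ext i j
  rw [h.quot, hX, dotProduct_sum, Finset.sum_eq_single i (fun l _ hl => by
    rw [dotProduct_smul, h.orthogonal i l hl.symm, smul_zero]) (by simp), dotProduct_smul,
    smul_eq_mul, mul_div_cancel_right₀ _ (h.ne_zero i)]

theorem contract_mulVec {z : Fin r → Fin k → 𝕜} {y : Fin r → ι → 𝕜} {w : Fin r → κ → 𝕜}
    (h : ∀ l a b, T l a b = ∑ i, z i l * y i a * w i b) (f : Fin k → 𝕜) (c : κ → 𝕜) :
    (contract T f).mulVec c = ∑ i, ((f ⬝ᵥ z i) * (w i ⬝ᵥ c)) • y i := by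
  rw [contract_eq_of_decomp h f, ← Matrix.mulVec_mulVec, ← Matrix.mulVec_mulVec]
  funext a
  rw [Matrix.mulVec, dotProduct]
  simp only [Matrix.mulVec_diagonal, Finset.sum_apply, Pi.smul_apply, smul_eq_mul,
    Matrix.transpose_apply, Matrix.of_apply]
  refine Finset.sum_congr rfl fun i _ => ?_
  rw [show (Matrix.of w).mulVec c i = w i ⬝ᵥ c from rfl]
  ring

/-- This justifies the first rejection of the program: if the rank of `T(g)` differs from `k`, there
is no power pencil. -/
theorem rank_contract {z : Fin r → Fin k → 𝕜} {y : Fin r → ι → 𝕜} {w : Fin r → κ → 𝕜}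
    (h : ∀ l a b, T l a b = ∑ i, z i l * y i a * w i b) (hy : LinearIndependent 𝕜 y)
    (hw : LinearIndependent 𝕜 w) (hg : ∀ i, g ⬝ᵥ z i ≠ 0) : (contract T g).rank = r := by
  apply le_antisymm
  · rw [contract_eq_of_decomp h g]
    exact (Matrix.rank_mul_le_right _ _).trans (by simpa using (Matrix.of w).rank_le_card_height)
  · obtain ⟨L, hL⟩ := exists_dual_family hw
    have hle : Submodule.span 𝕜 (Set.range y) ≤ LinearMap.range (contract T g).mulVecLin := by
      rw [Submodule.span_le]
      rintro _ ⟨i, rfl⟩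
      refine ⟨(g ⬝ᵥ z i)⁻¹ • L i, ?_⟩
      rw [Matrix.mulVecLin_apply, Matrix.mulVec_smul, contract_mulVec h]
      simp only [dotProduct_comm (w _), hL, mul_ite, mul_one, mul_zero, ite_smul, zero_smul,
        Finset.sum_ite_eq, Finset.mem_univ, if_true]
      rw [smul_smul, inv_mul_cancel₀ (hg i), one_smul]
    have := Submodule.finrank_mono hle
    rwa [finrank_span_eq_card hy, Fintype.card_fin] at this

variable {z : Fin r → Fin k → 𝕜} {y : Fin r → ι → 𝕜} {w : Fin r → κ → 𝕜}

/-- The pencil matrix is similar to the diagonal matrix of the quotients. -/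
theorem IsPencilMatrix.exists_similar (h : IsPencilMatrix T f g q q' M)
    (hD : Diagonalizes T f g z y w) : ∃ C : Matrix (Fin r) (Fin r) 𝕜, IsUnit C ∧
      C * M = Matrix.diagonal (fun i => f ⬝ᵥ z i / g ⬝ᵥ z i) * C ∧
      ∀ j, q j = ∑ i, ((g ⬝ᵥ z i) * C i j) • y i := by
  choose c hc hc' using h.exists_coeff
  -- In the basis `y` the families `q` and `q'` have the coefficient matrices `D_g C` and `D_f C`.
  -- The invertible `C` therefore conjugates `M` to `D_f D_g⁻¹`.
  set C : Matrix (Fin r) (Fin r) 𝕜 := Matrix.of fun i j => w i ⬝ᵥ c j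
  have hq : ∀ j, q j = ∑ i, ((g ⬝ᵥ z i) * C i j) • y i := fun j => by
    rw [hc, contract_mulVec hD.decomp]; rfl
  have hq' : ∀ j, q' j = ∑ i, ((f ⬝ᵥ z i) * C i j) • y i := fun j => by
    rw [hc', contract_mulVec hD.decomp]; rfl
  have hC : IsUnit C := by
    rw [← Matrix.mulVec_injective_iff_isUnit]
    intro a b hab
    have h1 : ∀ a : Fin r → 𝕜, ∑ j, a j • q j = ∑ i, ((g ⬝ᵥ z i) * C.mulVec a i) • y i := by
      intro a
      simp only [hq, Finset.smul_sum]
      rw [Finset.sum_comm]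
      refine Finset.sum_congr rfl fun i _ => ?_
      simp only [smul_smul, ← Finset.sum_smul, Matrix.mulVec, dotProduct, Finset.mul_sum]
      congr 1
      exact Finset.sum_congr rfl fun j _ => by ring
    have h2 := h.linearIndependent.fintypeLinearCombination_injective
    apply h2
    simp only [Fintype.linearCombination_apply]
    rw [h1, h1, hab]
  refine ⟨C, hC, ?_, hq⟩
  obtain ⟨u, hu⟩ := hC
  have hinv : C * (↑u⁻¹ : Matrix (Fin r) (Fin r) 𝕜) = 1 := by rw [← hu]; exact u.mul_inv
  set X := (↑u⁻¹ : Matrix (Fin r) (Fin r) 𝕜) *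
    (Matrix.diagonal (fun i => f ⬝ᵥ z i / g ⬝ᵥ z i) * C) with hX
  have hCX : C * X = Matrix.diagonal (fun i => f ⬝ᵥ z i / g ⬝ᵥ z i) * C := by
    rw [hX, ← Matrix.mul_assoc, hinv, Matrix.one_mul]
  rw [h.eq (X := X) ?_, hCX]
  intro j
  simp only [hq, hq', Finset.smul_sum]
  rw [Finset.sum_comm]
  refine Finset.sum_congr rfl fun i _ => ?_
  simp only [smul_smul, ← Finset.sum_smul]
  congr 1
  have h1 := congrFun (congrFun hCX i) j
  rw [Matrix.mul_apply, Matrix.diagonal_mul] at h1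
  have h2 := hD.ne_zero' i
  calc f ⬝ᵥ z i * C i j = g ⬝ᵥ z i * (f ⬝ᵥ z i / g ⬝ᵥ z i * C i j) := by field_simp
    _ = _ := by
      rw [← h1, Finset.mul_sum]
      exact Finset.sum_congr rfl fun l _ => by ring

/-- A diagonalization of the pencil matrix yields the vectors `y i`. -/
theorem IsPencilMatrix.diagonalization (h : IsPencilMatrix T f g q q' M)
    (hD : Diagonalizes T f g z y w) {ev : Fin r → 𝕜} {V : Matrix (Fin r) (Fin r) 𝕜}
    (hV : IsUnit V) (hMV : M * V = V * Matrix.diagonal ev) :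
    (∀ i, ev i ≠ 0) ∧ Function.Injective ev ∧ ∀ i, ∃ j, ∃ c : 𝕜, ∑ l, V l i • q l = c • y j := by
  obtain ⟨C, hC, hCM, hq⟩ := h.exists_similar hD
  have hCV : IsUnit (C * V) := hC.mul hV
  have h1 : Matrix.diagonal (fun i => f ⬝ᵥ z i / g ⬝ᵥ z i) * (C * V) =
      (C * V) * Matrix.diagonal ev := by
    rw [← Matrix.mul_assoc, ← hCM, Matrix.mul_assoc, hMV, Matrix.mul_assoc]
  -- The matrix `C * V` intertwines two diagonal matrices, the first of which has distinct entries,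
  -- so each of its columns has only one non-zero entry.
  have h2 : ∀ i j, (f ⬝ᵥ z i / g ⬝ᵥ z i) * (C * V) i j = (C * V) i j * ev j := by
    intro i j
    have := congrFun (congrFun h1 i) j
    rwa [Matrix.diagonal_mul, Matrix.mul_diagonal] at this
  have h3 : ∀ i j, (C * V) i j ≠ 0 → ev j = f ⬝ᵥ z i / g ⬝ᵥ z i := fun i j hne => by
    have := h2 i j
    rw [mul_comm] at this
    exact (mul_left_cancel₀ hne this).symm
  have h4 : ∀ j, ∃ i, (C * V) i j ≠ 0 := by
    intro j
    by_contra hcon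
    push Not at hcon
    have h5 : (C * V).mulVec (Pi.single j 1) = (C * V).mulVec 0 := by
      funext i
      simp [hcon]
    have := congrFun (Matrix.mulVec_injective_iff_isUnit.2 hCV h5) j
    simp at this
  choose π hπ using h4
  have hev : ∀ j, ev j = f ⬝ᵥ z (π j) / g ⬝ᵥ z (π j) := fun j => h3 _ _ (hπ j)
  have hz : ∀ i j, i ≠ π j → (C * V) i j = 0 := by
    intro i j hij
    by_contra hne
    exact hij (hD.injective ((h3 i j hne).symm.trans (hev j)))
  -- Two columns supported in the same row would be linearly dependent, in contradiction to the
  -- invertibility of `C * V`.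
  have hπinj : Function.Injective π := by
    intro a b hab
    by_contra hne
    have h5 : (C * V).mulVec (Pi.single a ((C * V) (π b) b)) =
        (C * V).mulVec (Pi.single b ((C * V) (π a) a)) := by
      funext i
      simp only [Matrix.mulVec_single, Pi.smul_apply, MulOpposite.smul_eq_mul_unop,
        MulOpposite.unop_op, Matrix.col_apply]
      by_cases hi : i = π a
      · rw [← hab, hi, mul_comm]
      · rw [hz i a hi, hz i b (by rwa [← hab]), zero_mul, zero_mul]
    have := congrFun (Matrix.mulVec_injective_iff_isUnit.2 hCV h5) a
    rw [Pi.single_eq_same, Pi.single_eq_of_ne hne] at this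
    exact hπ b this
  refine ⟨fun j => ?_, fun a b hab => ?_, fun j => ⟨π j, (g ⬝ᵥ z (π j)) * (C * V) (π j) j, ?_⟩⟩
  · rw [hev]
    exact div_ne_zero (hD.ne_zero _) (hD.ne_zero' _)
  · rw [hev, hev] at hab
    exact hπinj (hD.injective hab)
  · simp only [hq, Finset.smul_sum]
    rw [Finset.sum_comm]
    have h5 : ∀ i, ∑ l, V l j • ((g ⬝ᵥ z i) * C i l) • y i = ((g ⬝ᵥ z i) * (C * V) i j) • y i := by
      intro i
      simp only [smul_smul, ← Finset.sum_smul, Matrix.mul_apply, Finset.mul_sum]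
      congr 1
      exact Finset.sum_congr rfl fun l _ => by ring
    simp only [h5]
    refine Finset.sum_eq_single _ (fun i _ hi => ?_) (by simp)
    rw [hz i j hi, mul_zero, zero_smul]

/-- The pencil matrix is diagonalizable. -/
theorem IsPencilMatrix.exists_diagonalization (h : IsPencilMatrix T f g q q' M)
    (hD : Diagonalizes T f g z y w) : ∃ (ev : Fin r → 𝕜) (V : Matrix (Fin r) (Fin r) 𝕜),
      IsUnit V ∧ M * V = V * Matrix.diagonal ev := by
  obtain ⟨C, ⟨u, rfl⟩, hCM, -⟩ := h.exists_similar hD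
  refine ⟨fun i => f ⬝ᵥ z i / g ⬝ᵥ z i, (↑u⁻¹ : Matrix (Fin r) (Fin r) 𝕜), u⁻¹.isUnit, ?_⟩
  rw [Units.mul_inv_eq_iff_eq_mul, Matrix.mul_assoc, ← hCM, ← Matrix.mul_assoc, u.inv_mul,
    Matrix.one_mul]

/-- If a diagonalization of the pencil matrix with distinct non-zero eigenvalues yields vectors
`y i` that occur in a decomposition of the tensor, then the functionals are generic. -/
theorem IsPencilMatrix.diagonalizes (h : IsPencilMatrix T f g q q' M) {ev : Fin r → 𝕜}
    {V : Matrix (Fin r) (Fin r) 𝕜} (hMV : M * V = V * Matrix.diagonal ev)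
    (hev : ∀ i, ev i ≠ 0) (hinj : Function.Injective ev) (hy : ∀ i, y i = ∑ l, V l i • q l)
    (hT : ∀ l a b, T l a b = ∑ i, z i l * y i a * w i b) (hyi : LinearIndependent 𝕜 y)
    (hw : LinearIndependent 𝕜 w) : Diagonalizes T f g z y w := by
  choose c hc hc' using h.exists_coeff
  set C : Matrix (Fin r) (Fin r) 𝕜 := Matrix.of fun i j => w i ⬝ᵥ c j
  have hq : ∀ j, q j = ∑ i, ((g ⬝ᵥ z i) * C i j) • y i := fun j => by
    rw [hc, contract_mulVec hT]; rfl
  have hq' : ∀ j, q' j = ∑ i, ((f ⬝ᵥ z i) * C i j) • y i := fun j => by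
    rw [hc', contract_mulVec hT]; rfl
  -- Expanding `y j` in terms of the `q l`, and these in terms of the `y i`, gives `D_g C V = 1`.
  have hg : ∀ i j, (g ⬝ᵥ z i) * (C * V) i j = if i = j then 1 else 0 := by
    intro i j
    have h1 : y j = ∑ i, ((g ⬝ᵥ z i) * (C * V) i j) • y i := by
      conv_lhs => rw [hy]
      simp only [hq, Finset.smul_sum]
      rw [Finset.sum_comm]
      refine Finset.sum_congr rfl fun i _ => ?_
      simp only [smul_smul, ← Finset.sum_smul, Matrix.mul_apply, Finset.mul_sum]
      congr 1
      exact Finset.sum_congr rfl fun l _ => by ring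
    obtain ⟨L, hL⟩ := exists_dual_family hyi
    have := congrArg (L i ⬝ᵥ ·) h1
    simpa [hL, dotProduct_sum] using this.symm
  -- The same expansion for `q'` identifies `M` with `V D_f C`. Together with `M V = V diag(ev)`
  -- this yields `D_f C V = diag(ev)`, so the eigenvalues are the quotients.
  have hM : M = V * (Matrix.diagonal (fun i => f ⬝ᵥ z i) * C) := by
    refine h.eq fun j => ?_
    rw [hq' j]
    simp only [hy, Finset.smul_sum]
    rw [Finset.sum_comm]
    refine Finset.sum_congr rfl fun l _ => ?_
    simp only [smul_smul, ← Finset.sum_smul]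
    rw [Matrix.mul_apply]
    congr 1
    exact Finset.sum_congr rfl fun i _ => by rw [Matrix.diagonal_mul]; ring
  have hVu : ∃ W, W * V = 1 := by
    refine ⟨Matrix.diagonal (fun i => g ⬝ᵥ z i) * C, ?_⟩
    ext i j
    rw [Matrix.mul_assoc, Matrix.diagonal_mul, hg, Matrix.one_apply]
  obtain ⟨W, hW⟩ := hVu
  have hf : Matrix.diagonal (fun i => f ⬝ᵥ z i) * (C * V) = Matrix.diagonal ev := by
    have := congrArg (W * ·) hMV
    simp only [hM, ← Matrix.mul_assoc, hW, Matrix.one_mul] at this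
    rw [← this, Matrix.mul_assoc]
  have hf' : ∀ i, (f ⬝ᵥ z i) * (C * V) i i = ev i := fun i => by
    have := congrFun (congrFun hf i) i
    rwa [Matrix.diagonal_mul, Matrix.diagonal_apply_eq] at this
  have hg' : ∀ i, (g ⬝ᵥ z i) * (C * V) i i = 1 := fun i => by simpa using hg i i
  have hratio : ∀ i, f ⬝ᵥ z i / g ⬝ᵥ z i = ev i := fun i => by
    have h1 := hf' i
    have h2 := hg' i
    rw [div_eq_iff (left_ne_zero_of_mul_eq_one h2), ← h1, mul_assoc, mul_comm _ (g ⬝ᵥ z i), h2,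
      mul_one]
  refine ⟨hT, hyi, hw, fun i hi => hev i ?_, fun i => left_ne_zero_of_mul_eq_one (hg' i), ?_⟩
  · rw [← hf', hi, zero_mul]
  · simpa only [hratio] using hinj

end Pencil

/-! ### From the tables of the machine to the pencil -/

section PencilTables

variable {𝕜 : Type*} [RCLike 𝕜] {n d k k' : ℕ} {f g : ℕ → 𝕜} {P G H Q M : ℕ → ℕ → 𝕜} {e : ℕ → ℕ}

/-- The first tensor factor belongs to the lowest digit, hence entry `(a, b)` of the flattening
stands in column `n * b + a`. -/
theorem flatten_tensorOfRow (hd : 1 ≤ d) (P : Fin k → ℕ → 𝕜) (l : Fin k) (a : Fin n)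
    (b : Fin (d - 1) → Fin n) : flatten (fun l => tensorOfRow n d (P l)) l a b =
      P l (n * (finFunctionFinEquiv b : ℕ) + a) := by
  obtain ⟨c, rfl⟩ : ∃ c, d = c + 1 := ⟨d - 1, by omega⟩
  rw [flatten, Matrix.of_apply, tensorOfRow, finFunctionFinEquiv_apply, finFunctionFinEquiv_apply,
    Fin.sum_univ_succ, Finset.mul_sum, add_comm]
  congr 2
  · refine Finset.sum_congr rfl fun i _ => ?_
    simp [pow_succ]
    ring
  · simp

/-- The vectors of the form `(T(g) c, T(f) c)` are closed under linear combinations and include the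
rows of `G`, so all orthogonalized rows are of this form. The non-zero ones among their first halves
form a basis of the range of `T(g)`. -/
theorem pencilTables_isPencilMatrix (h : Loop.PencilTables n d k k' f g P G H Q M e) (hd : 1 ≤ d)
    {T : Fin k → (Fin d → Fin n) → 𝕜} (hT : ∀ l, T l = tensorOfRow n d (P l)) :
    k' = (contract (flatten T) fun l : Fin k => g l).rank ∧
    (k' = k → IsPencilMatrix (flatten T) (fun l : Fin k => f l) (fun l : Fin k => g l)
      (fun i : Fin k => Loop.trunc n (Q i)) (fun i : Fin k => Loop.trunc n fun c => Q i (n + c))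
      (Matrix.of fun i j => M i j)) := by
  have hcon : ∀ (F : ℕ → 𝕜) (a : Fin n) (b : Fin (d - 1) → Fin n),
      contract (flatten T) (fun l : Fin k => F l) a b =
        ∑ l ∈ Finset.range k, F l * P l (n * (finFunctionFinEquiv b : ℕ) + a) := by
    intro F a b
    rw [contract, Matrix.sum_apply, Finset.sum_range]
    refine Finset.sum_congr rfl fun l _ => ?_
    rw [Matrix.smul_apply, smul_eq_mul, show T = fun l : Fin k => tensorOfRow n d (P l) from funext hT,
      flatten_tensorOfRow hd]
  have hmem : ∀ x ∈ Submodule.span 𝕜 ((fun i => Loop.trunc (n + n) (G i)) '' Set.Iio (n ^ (d - 1))),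
      ∃ c : (Fin (d - 1) → Fin n) → 𝕜,
        (∀ a : Fin n, x (Fin.castAdd n a) = (contract (flatten T) fun l : Fin k => g l).mulVec c a) ∧
        ∀ a : Fin n, x (Fin.natAdd n a) =
          (contract (flatten T) fun l : Fin k => f l).mulVec c a := by
    intro x hx
    induction hx using Submodule.span_induction with
    | mem x hx =>
      obtain ⟨i, hi, rfl⟩ := hx
      have hi' : i < n ^ (d - 1) := hi
      refine ⟨Pi.single (finFunctionFinEquiv.symm ⟨i, hi'⟩) 1, fun a => ?_, fun a => ?_⟩
      · rw [Matrix.mulVec_single_one, Matrix.col_apply, hcon, Equiv.apply_symm_apply]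
        exact h.left i hi' a a.2
      · rw [Matrix.mulVec_single_one, Matrix.col_apply, hcon, Equiv.apply_symm_apply]
        exact h.right i hi' a a.2
    | zero => exact ⟨0, by simp⟩
    | add x y _ _ hx hy =>
      obtain ⟨c, h1, h2⟩ := hx
      obtain ⟨c', h1', h2'⟩ := hy
      exact ⟨c + c', fun a => by rw [Matrix.mulVec_add, Pi.add_apply, Pi.add_apply, h1, h1'],
        fun a => by rw [Matrix.mulVec_add, Pi.add_apply, Pi.add_apply, h2, h2']⟩
    | smul t x _ hx =>
      obtain ⟨c, h1, h2⟩ := hx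
      exact ⟨t • c, fun a => by rw [Matrix.mulVec_smul, Pi.smul_apply, Pi.smul_apply, h1],
        fun a => by rw [Matrix.mulVec_smul, Pi.smul_apply, Pi.smul_apply, h2]⟩
  have hQ : ∀ i < k', ∀ c < n + n, Q i c = H (e i) c := h.compact.eq
  have hne : ∀ i < k', ∀ j < k', i ≠ j → e i ≠ e j := by
    intro i hi j hj hij
    rcases lt_or_gt_of_ne hij with h' | h'
    · exact (h.compact.strictMono j hj i h').ne
    · exact (h.compact.strictMono i hi j h').ne'
  have hip : ∀ i < k', ∀ j < k', Loop.ip n (Q i) (Q j) = Loop.ip n (H (e i)) (H (e j)) :=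
    fun i hi j hj => Loop.ip_congr (le_refl n) (fun c hc => hQ i hi c (by omega))
      fun c hc => hQ j hj c (by omega)
  have horth : ∀ i < k', ∀ j < k', i ≠ j → Loop.ip n (Q i) (Q j) = 0 := fun i hi j hj hij => by
    rw [hip i hi j hj]
    exact h.gs.orthogonal' (h.compact.lt i hi) (h.compact.lt j hj) (hne i hi j hj hij)
  have hne0 : ∀ i < k', Loop.ip n (Q i) (Q i) ≠ 0 := fun i hi => by
    rw [hip i hi i hi]
    exact h.compact.ne_zero i hi
  constructor
  · have hind := Loop.linearIndependent_of_ip (C := n) (Q := fun l : Fin k' => Q l)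
      (fun i j hij => horth i i.2 j j.2 (by simpa [Fin.ext_iff] using hij)) fun i => hne0 i i.2
    have hspan : Submodule.span 𝕜 (Set.range fun i : Fin k' => Loop.trunc n (Q i)) =
        LinearMap.range (contract (flatten T) fun l : Fin k => g l).mulVecLin := by
      have h1 : Submodule.span 𝕜 (Set.range fun i : Fin k' => Loop.trunc n (Q i)) =
          Submodule.span 𝕜 ((fun i => Loop.trunc n (H i)) '' Set.Iio (n ^ (d - 1))) := by
        apply le_antisymm <;> rw [Submodule.span_le]
        · rintro _ ⟨i, rfl⟩
          exact Submodule.subset_span ⟨e i, h.compact.lt i i.2,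
            funext fun c => (hQ i i.2 c (by omega)).symm⟩
        · rintro _ ⟨i, hi, rfl⟩
          by_cases hz : Loop.ip n (H i) (H i) = 0
          · have : Loop.trunc n (H i) = 0 := funext fun c => Loop.eq_zero_of_ip_self hz c c.2
            simp only [this]
            exact zero_mem _
          · obtain ⟨l, hl, rfl⟩ := h.compact.surj i hi hz
            exact Submodule.subset_span ⟨⟨l, hl⟩, funext fun c => hQ l hl c (by omega)⟩
      have h2 : ∀ G : ℕ → ℕ → 𝕜, ((fun i => Loop.trunc n (G i)) '' Set.Iio (n ^ (d - 1))) =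
          (LinearMap.funLeft 𝕜 𝕜 (Fin.castAdd n : Fin n → Fin (n + n))) ''
            ((fun i => Loop.trunc (n + n) (G i)) '' Set.Iio (n ^ (d - 1))) := by
        intro G
        rw [Set.image_image]
        rfl
      rw [h1, h2, ← Submodule.map_span, h.gs.span_eq le_rfl, Submodule.map_span, ← h2,
        Matrix.range_mulVecLin]
      congr 1
      ext x
      simp only [Set.mem_image, Set.mem_Iio, Set.mem_range]
      have hcol : ∀ b : Fin (d - 1) → Fin n, Loop.trunc n (G (finFunctionFinEquiv b : ℕ)) =
          (contract (flatten T) fun l : Fin k => g l).col b := by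
        intro b
        funext a
        rw [Matrix.col_apply, hcon]
        exact h.left _ (Fin.is_lt _) a a.2
      constructor
      · rintro ⟨i, hi, rfl⟩
        refine ⟨finFunctionFinEquiv.symm ⟨i, hi⟩, ?_⟩
        rw [← hcol, Equiv.apply_symm_apply]
      · rintro ⟨b, rfl⟩
        exact ⟨_, Fin.is_lt _, hcol b⟩
    have := finrank_span_eq_card hind
    rw [hspan, Fintype.card_fin] at this
    exact this.symm
  · rintro rfl
    refine ⟨fun i j hij => ?_, fun i => ?_, fun j => ?_, fun i j => ?_⟩
    · rw [← Loop.ip_eq_dotProduct]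
      exact horth i i.2 j j.2 (by simpa [Fin.ext_iff] using hij)
    · rw [← Loop.ip_eq_dotProduct]
      exact hne0 i i.2
    · have h1 : Loop.trunc (n + n) (H (e j)) ∈
          Submodule.span 𝕜 ((fun i => Loop.trunc (n + n) (G i)) '' Set.Iio (n ^ (d - 1))) := by
        rw [← h.gs.span_eq le_rfl]
        exact Submodule.subset_span ⟨_, h.compact.lt j j.2, rfl⟩
      obtain ⟨c, h2, h3⟩ := hmem _ h1
      refine ⟨c, funext fun a => ?_, funext fun a => ?_⟩
      · rw [← h2]
        exact hQ j j.2 a (by omega)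
      · rw [← h3]
        exact hQ j j.2 (n + a) (by omega)
    · rw [Matrix.of_apply, h.quot i i.2 j j.2, Loop.ip_eq_dotProduct, Loop.ip_eq_dotProduct]

end PencilTables

end

section

/-! ### The acceptance test characterizes power pencils -/

section PencilCheck

variable {𝕜 : Type*} [RCLike 𝕜] {n d k p R : ℕ} {P : Fin k → (Fin d → Fin n) → 𝕜}
  {f g : Fin k → 𝕜} {q q' : Fin k → Fin n → 𝕜} {M : Matrix (Fin k) (Fin k) 𝕜}
  {F : Fin p → MvPolynomial (Fin n) 𝕜} {u : Fin R → Fin n → 𝕜}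

/-- A form of degree `d` is determined by its coefficients at the contents of the `n ^ d` index
tuples. The bound keeps the number of forms below the loop bound used for the running time. -/
theorem card_le_of_linearIndependent_homogeneous (hF : ∀ i, (F i).IsHomogeneous d)
    (hind : LinearIndependent 𝕜 F) : p ≤ n ^ d := by
  have h : LinearIndependent 𝕜 fun (i : Fin p) (a : Fin d → Fin n) => (F i).coeff (content a) := by
    rw [Fintype.linearIndependent_iff] at hind ⊢
    intro c hc
    apply hind
    ext α
    rw [MvPolynomial.coeff_sum, MvPolynomial.coeff_zero]
    simp only [MvPolynomial.coeff_smul, smul_eq_mul]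
    by_cases hα : α.degree = d
    · obtain ⟨a, rfl⟩ := exists_content_eq hα
      have := congrFun hc a
      simpa using this
    · refine Finset.sum_eq_zero fun i _ => ?_
      by_contra hne
      exact hα (degree_of_mem_support (hF i) (right_ne_zero_of_mul hne))
  have := h.fintype_card_le_finrank
  simpa using this

theorem power_mem_of_smul_mem {W : Submodule 𝕜 ((Fin d → Fin n) → 𝕜)} {x y : Fin n → 𝕜} {c : 𝕜}
    (hx : x = c • y) (hy : (prodTensor fun _ => y) ∈ W) : (prodTensor fun _ : Fin d => x) ∈ W := by
  have : (prodTensor fun _ : Fin d => x) = c ^ d • prodTensor fun _ => y := by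
    funext a
    simp [prodTensor, hx, Finset.prod_mul_distrib]
  rw [this]
  exact W.smul_mem _ hy

/-- A basis of a space is expressed through another one by independent families of coefficients. -/
theorem exists_coeff_of_span_eq {ι : Type*} [Fintype ι] [DecidableEq ι] {P Y : Fin k → ι → 𝕜}
    (hY : LinearIndependent 𝕜 Y)
    (h : Submodule.span 𝕜 (Set.range Y) = Submodule.span 𝕜 (Set.range P)) :
    ∃ z : Fin k → Fin k → 𝕜, LinearIndependent 𝕜 z ∧ ∀ l, P l = ∑ i, z i l • Y i := by
  have hz : ∀ l, ∃ c : Fin k → 𝕜, ∑ i, c i • Y i = P l := fun l =>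
    (Submodule.mem_span_range_iff_exists_fun 𝕜).1 (h ▸ Submodule.subset_span ⟨l, rfl⟩)
  choose z hz using hz
  have hL : ∀ i, ∃ c : Fin k → 𝕜, ∑ l, c l • P l = Y i := fun i =>
    (Submodule.mem_span_range_iff_exists_fun 𝕜).1 (h ▸ Submodule.subset_span ⟨i, rfl⟩)
  choose L hL using hL
  refine ⟨fun i l => z l i, linearIndependent_of_dual_family (L := L) fun i j => ?_,
    fun l => (hz l).symm⟩
  have h1 : ∑ j, (L i ⬝ᵥ fun l => z l j) • Y j = Y i := by
    rw [← hL]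
    simp only [← hz, Finset.smul_sum]
    rw [Finset.sum_comm]
    simp only [smul_smul, ← Finset.sum_smul, dotProduct]
  obtain ⟨A, hA⟩ := exists_dual_family hY
  have := congrArg (A j ⬝ᵥ ·) h1
  simpa [dotProduct_sum, hA, eq_comm] using this

/-- If the tensors form a power pencil then every diagonalization of the pencil matrix passes the
checks. -/
theorem IsPowerPencil.check {z : Fin k → Fin k → 𝕜} {y : Fin k → Fin n → 𝕜}
    (h : IsPowerPencil P f g z y) (hd : 2 ≤ d) (hP : IsSearchBasis F u P)
    (hM : IsPencilMatrix (flatten P) f g q q' M) {ev : Fin k → 𝕜} {V : Matrix (Fin k) (Fin k) 𝕜}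
    (hV : IsUnit V) (hMV : M * V = V * Matrix.diagonal ev) :
    (∀ i, ev i ≠ 0) ∧ Function.Injective ev ∧
      ∀ i, (prodTensor fun _ => ∑ l, V l i • q l) ∈ searchSpace d F u := by
  obtain ⟨h1, h2, h3⟩ := hM.diagonalization h.2 hV hMV
  refine ⟨h1, h2, fun i => ?_⟩
  obtain ⟨j, c, hc⟩ := h3 i
  refine power_mem_of_smul_mem hc ?_
  rw [← hP.2, h.span_eq hd]
  exact Submodule.subset_span ⟨j, rfl⟩

/-- If a diagonalization of the pencil matrix passes the checks then the tensors form a power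
pencil. -/
theorem exists_isPowerPencil_of_check (hd : 2 ≤ d) (hP : IsSearchBasis F u P)
    (hM : IsPencilMatrix (flatten P) f g q q' M) {ev : Fin k → 𝕜} {V : Matrix (Fin k) (Fin k) 𝕜}
    (hV : IsUnit V) (hMV : M * V = V * Matrix.diagonal ev) (hev : ∀ i, ev i ≠ 0)
    (hinj : Function.Injective ev)
    (hmem : ∀ i, (prodTensor fun _ => ∑ l, V l i • q l) ∈ searchSpace d F u) :
    ∃ z, IsPowerPencil P f g z fun i => ∑ l, V l i • q l := by
  set y : Fin k → Fin n → 𝕜 := fun i => ∑ l, V l i • q l with hy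
  have hyi : LinearIndependent 𝕜 y := by
    have hq := Fintype.linearIndependent_iff.1 hM.linearIndependent
    rw [Fintype.linearIndependent_iff]
    intro c hc
    have h1 : V.mulVec c = V.mulVec 0 := by
      funext l
      rw [Matrix.mulVec_zero]
      refine hq (V.mulVec c) ?_ l
      rw [← hc]
      simp only [hy, Finset.smul_sum]
      rw [Finset.sum_comm]
      refine Finset.sum_congr rfl fun l _ => ?_
      simp only [smul_smul, ← Finset.sum_smul]
      congr 1
      exact (Finset.sum_congr rfl fun i _ => mul_comm (V l i) (c i) :
        ∑ i, V l i * c i = ∑ i, c i * V l i)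
    exact congrFun (Matrix.mulVec_injective_iff_isUnit.2 hV h1)
  have hpow := linearIndependent_prodTensor (d := d) (by omega) hyi
  -- Since the search space has dimension `k`, the `k` independent powers in it span it.
  have hspan : Submodule.span 𝕜 (Set.range fun i => prodTensor fun _ : Fin d => y i) =
      Submodule.span 𝕜 (Set.range P) := by
    refine Submodule.eq_of_le_of_finrank_eq ?_ ?_
    · rw [Submodule.span_le, hP.2]
      rintro _ ⟨i, rfl⟩
      exact hmem i
    · rw [finrank_span_eq_card hpow, finrank_span_eq_card hP.1]
  obtain ⟨z, hzi, hz⟩ := exists_coeff_of_span_eq hpow hspan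
  have hdec : ∀ l a b, flatten P l a b =
      ∑ i, z i l * y i a * prodTensor (fun _ : Fin (d - 1) => y i) b := by
    intro l a b
    simp only [← flatten_smul_prodTensor (by omega : 1 ≤ d)]
    simp [flatten, hz]
  exact ⟨z, hzi, hM.diagonalizes hMV hev hinj (fun _ => rfl) hdec hyi
    (linearIndependent_prodTensor (by omega) hyi)⟩

end PencilCheck

/-! ### The program -/

/-- Report failure. -/
def failProgram : Program := .setReg 0 (.const 2)

/-- Check the candidates for the points, and output them. -/
def reportProgram : Program :=
  .seq Loop.verifyStage.toProgram <| .ifLt (.const 0) (.reg 13) failProgram <|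
    .seq (.setReg 1 (.reg 11)) (.setReg 0 (.const 1))

/-- Diagonalize the pencil. -/
def pencilProgram : Program :=
  .seq Loop.pencilStage.toProgram <| .ifLt (.reg 12) (.reg 11) failProgram <|
    .ifLt (.reg 11) (.reg 12) failProgram <| .seq (.diag 17 18 19 14 (.reg 11)) <|
      .ifLt (.const 0) (.reg 14) reportProgram failProgram

/-- A program for computing `U ∩ X`. -/
def searchProgram : Program :=
  .seq Loop.predStage.toProgram <| .seq Loop.sizeStage.toProgram <|
    .seq Loop.searchStage.toProgram <| .ifLt (.const 0) (.reg 11)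
      (.ifLt (.reg 3) (.reg 11) failProgram pencilProgram) (.setReg 0 (.const 0))

/-- The side conditions of `Loop.exec_toProgram` are combined into one Boolean, which is evaluated
for each concrete stage. -/
theorem exec_stage {𝕜 : Type*} [RCLike 𝕜] (O : DiagOracle 𝕜) (B : ℕ) (l : List ℕ) (P : Loop)
    (hP : (P.wf && P.bounds.all (fun b => b ∈ l) && l.all fun x => !P.wreg x) = true)
    (m : Memory 𝕜) (hm : ∀ x ∈ l, m.reg x ≤ B) :
    ∃ t ≤ P.cost B, Exec O P.toProgram m (P.run m) t 0 := by
  simp only [Bool.and_eq_true, List.all_eq_true, decide_eq_true_eq, Bool.not_eq_true'] at hP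
  exact Loop.exec_toProgram O B {x | x ∈ l} P hP.1.1 hP.1.2 hP.2 m hm

/-! ### No stage writes to the bounds of its loops -/

section StageChecks

open Loop

theorem predStage_check : (predStage.wf && predStage.bounds.all (fun b => b ∈ ([] : List ℕ)) &&
    ([] : List ℕ).all fun x => !predStage.wreg x) = true := by decide

theorem sizeStage_check : (sizeStage.wf && sizeStage.bounds.all (fun b => b ∈ [0, 6]) &&
    [0, 6].all fun x => !sizeStage.wreg x) = true := by decide

theorem searchStage_check : (searchStage.wf &&
    searchStage.bounds.all (fun b => b ∈ [0, 1, 2, 4, 5, 6, 7, 8]) &&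
    [0, 1, 2, 4, 5, 6, 7, 8].all fun x => !searchStage.wreg x) = true := by decide

theorem pencilStage_check : (pencilStage.wf &&
    pencilStage.bounds.all (fun b => b ∈ [0, 4, 5, 10, 11]) &&
    [0, 4, 5, 10, 11].all fun x => !pencilStage.wreg x) = true := by decide

theorem verifyStage_check : (verifyStage.wf &&
    verifyStage.bounds.all (fun b => b ∈ [0, 1, 5, 9, 11]) &&
    [0, 1, 5, 9, 11].all fun x => !verifyStage.wreg x) = true := by decide

end StageChecks

end

section

/-! ### The program returns an admissible output of the algorithm -/

section ProgramCorrectness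

variable {𝕜 : Type*} [RCLike 𝕜] {n d p R : ℕ}

open Loop

/-- The memory after the search stage. -/
def searchMemory (d : ℕ) (f : Fin p → MvPolynomial (Fin n) 𝕜) (u : Fin R → Fin n → 𝕜)
    (rnd : RandomTape 𝕜) : Memory 𝕜 :=
  searchStage.run (sizeStage.run (predStage.run (initialMemory d f u rnd)))

variable {f : Fin p → MvPolynomial (Fin n) 𝕜} {u : Fin R → Fin n → 𝕜}

theorem sizes_initial (hd : 2 ≤ d) (rnd : RandomTape 𝕜) :
    Sizes n d p R (sizeStage.run (predStage.run (initialMemory d f u rnd))) :=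
  sizeStage_run (by omega) rfl rfl rfl rfl

theorem scell_initial (rnd : RandomTape 𝕜) :
    (sizeStage.run (predStage.run (initialMemory d f u rnd))).scell =
      (initialMemory d f u rnd).scell := by
  funext t
  rw [(run_agree sizeStage _).scell t rfl, (run_agree predStage _).scell t rfl]

theorem searchMemory_scell {t : ℕ} (ht : searchStage.ws t = false) (rnd : RandomTape 𝕜) :
    (searchMemory d f u rnd).scell t = (initialMemory d f u rnd).scell t := by
  rw [searchMemory, (run_agree searchStage _).scell t ht, scell_initial]

/-- The outcome of the search stage does not depend on the random choices. -/
theorem searchMemory_eq (rnd rnd' : RandomTape 𝕜) :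
    (searchMemory d f u rnd).reg = (searchMemory d f u rnd').reg ∧
      (searchMemory d f u rnd).scell 10 = (searchMemory d f u rnd').scell 10 := by
  have h0 : Same (fun t => t != 2 && t != 3) (initialMemory d f u rnd)
      (initialMemory d f u rnd') := by
    refine ⟨rfl, rfl, fun t ht => ?_⟩
    simp only [Bool.and_eq_true, bne_iff_ne] at ht
    funext i j
    simp only [initialMemory, if_neg ht.1, if_neg ht.2]
  have h1 := Same.run searchStage (by decide) (Same.run sizeStage (by decide)
    (Same.run predStage (by decide) h0))
  exact ⟨h1.reg, h1.scell 10 rfl⟩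

theorem searchMemory_spec (hn : 2 ≤ n) (hd : 2 ≤ d) (hR : R ≤ n) (rnd : RandomTape 𝕜) :
    Sizes n d p R (searchMemory d f u rnd) ∧ Digits n d (searchMemory d f u rnd) ∧
    (IsSearchBasis f u fun l : Fin ((searchMemory d f u rnd).reg 11) =>
      tensorOfRow n d ((searchMemory d f u rnd).scell 10 l)) ∧
    ∀ t, (∀ i < n ^ d + p, star (trunc (n ^ d) ((searchMemory d f u rnd).scell 9 i)) ⬝ᵥ t = 0) ↔
      rowEquiv 𝕜 n d t ∈ searchSpace d f u := by
  have hicell : ∀ x i, (sizeStage.run (predStage.run (initialMemory d f u rnd))).icell 2 x i = 0 := by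
    intro x i
    rw [(run_agree sizeStage _).icell 2 rfl, (run_agree predStage _).icell 2 rfl]
    rfl
  obtain ⟨h1, h2, A, B, A', e, h3⟩ := searchStage_run hn (by omega) (sizes_initial hd rnd) hicell
  have hco : ∀ j : Fin p, ∀ a : Fin d → Fin n,
      (sizeStage.run (predStage.run (initialMemory d f u rnd))).scell 0 j (finFunctionFinEquiv a) =
        (f j).coeff (content a) := by
    intro j a
    rw [scell_initial]
    simp only [initialMemory, if_true]
    rw [dif_pos ⟨j.2, Fin.is_lt _⟩]
    congr 2
    exact finFunctionFinEquiv.symm_apply_apply a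
  have hus : ∀ i j : Fin n,
      (sizeStage.run (predStage.run (initialMemory d f u rnd))).scell 1 i j =
        if hi : (i : ℕ) < R then u ⟨i, hi⟩ j else 0 := by
    intro i j
    rw [scell_initial]
    simp [initialMemory]
  exact ⟨h1, h2, searchTables_isSearchBasis h3 hR hco hus, searchTables_mem_iff h3 hR hco hus⟩

theorem diag_some {O : DiagOracle 𝕜} {m : Memory 𝕜} {k : ℕ} {ev : Fin k → 𝕜}
    {V : Matrix (Fin k) (Fin k) 𝕜} (h : O k (m.block 17 k) = some (ev, V)) :
    (∀ x, x ≠ 14 → (m.diag O 17 18 19 14 k).reg x = m.reg x) ∧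
    (m.diag O 17 18 19 14 k).reg 14 = 1 ∧ (m.diag O 17 18 19 14 k).icell = m.icell ∧
    (∀ t, t ≠ 18 → t ≠ 19 → (m.diag O 17 18 19 14 k).scell t = m.scell t) ∧
    (∀ j : Fin k, (m.diag O 17 18 19 14 k).scell 18 0 j = ev j) ∧
    ∀ l i : Fin k, (m.diag O 17 18 19 14 k).scell 19 l i = V l i := by
  have hm : m.diag O 17 18 19 14 k =
      ((m.setBlock 18 (Matrix.of fun (_ : Fin 1) j => ev j)).setBlock 19 V).setReg 14 1 := by
    rw [Memory.diag, h]
  rw [hm]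
  refine ⟨fun x hx => ?_, ?_, rfl, fun t h1 h2 => ?_, fun j => ?_, fun l i => ?_⟩
  · simp [Memory.setReg, Memory.setBlock, hx]
  · simp [Memory.setReg]
  · funext a b
    simp [Memory.setReg, Memory.setBlock, h1, h2]
  · simp [Memory.setReg, Memory.setBlock]
  · simp [Memory.setReg, Memory.setBlock]

theorem diag_none {O : DiagOracle 𝕜} {m : Memory 𝕜} {k : ℕ} (h : O k (m.block 17 k) = none) :
    (m.diag O 17 18 19 14 k).reg 14 = 0 := by
  rw [Memory.diag, h]
  simp [Memory.setReg]

theorem exec_fail (O : DiagOracle 𝕜) (m : Memory 𝕜) :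
    ∃ m', Exec O failProgram m m' 2 0 ∧ m'.output n = .fail :=
  ⟨_, .setReg _ _ _, by simp [Memory.output, Memory.setReg, IExpr.eval]⟩

theorem output_points {m : Memory 𝕜} {k : ℕ} (h0 : m.reg 0 = 1) (h1 : m.reg 1 = k)
    {y : Fin k → Fin n → 𝕜} (hy : ∀ i j, m.scell 0 (i : Fin k) (j : Fin n) = y i j) :
    m.output n = .points k y := by
  subst h1
  rw [Memory.output, if_neg (by omega), if_pos h0]
  congr 1
  funext i j
  exact hy i j

variable {k : ℕ} {P : Fin k → (Fin d → Fin n) → 𝕜} {rnd : RandomTape 𝕜}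

/-- The test is passed if and only if the data form a power pencil: passing it turns the candidates
into one, and any pencil, whatever its vectors, would make the diagonalization pass. So both answers
are admissible. -/
theorem reportProgram_exec (hn : 2 ≤ n) (hd : 2 ≤ d) (hkR : k ≤ R) (hk : 0 < k)
    (hP : IsSearchBasis f u P) {O : DiagOracle 𝕜} {m : Memory 𝕜} {B : ℕ} (hS : Sizes n d p R m)
    (hD : Digits n d m) (h11 : m.reg 11 = k) (hB : ∀ x ∈ [0, 1, 5, 9, 11], m.reg x ≤ B)
    (h9 : ∀ t, (∀ i < n ^ d + p, star (trunc (n ^ d) (m.scell 9 i)) ⬝ᵥ t = 0) ↔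
      rowEquiv 𝕜 n d t ∈ searchSpace d f u)
    {q q' : Fin k → Fin n → 𝕜} {M : Matrix (Fin k) (Fin k) 𝕜}
    (hM : IsPencilMatrix (flatten P) (rnd k).1 (rnd k).2 q q' M) {ev : Fin k → 𝕜}
    {V : Matrix (Fin k) (Fin k) 𝕜} (hV : IsUnit V) (hMV : M * V = V * Matrix.diagonal ev)
    (hev : ∀ i : Fin k, m.scell 18 0 i = ev i) (hVm : ∀ l i : Fin k, m.scell 19 l i = V l i)
    (hq : ∀ (l : Fin k) (a : Fin n), m.scell 14 l a = q l a) :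
    ∃ m' t, Exec O reportProgram m m' t 0 ∧ t ≤ verifyStage.cost B + 10 ∧
      Algorithm1 R P rnd (m'.output n) := by
  set Y : ℕ → ℕ → 𝕜 := fun i a => ∑ l ∈ Finset.range k, m.scell 19 l i * m.scell 14 l a with hYdef
  obtain ⟨r11, r0, rchk⟩ := verifyStage_run hS hD h11 (Y := Y) (fun _ _ _ _ => rfl) hn
  set y : Fin k → Fin n → 𝕜 := fun i => ∑ l, V l i • q l with hydef
  have hY : ∀ (i : Fin k) (a : Fin n), Y i a = y i a := by
    intro i a
    simp only [hYdef, hydef, Finset.sum_range, Finset.sum_apply, Pi.smul_apply, smul_eq_mul, hVm, hq]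
  have hmem : ∀ i : Fin k, (∀ r < n ^ d + p, ∑ x ∈ Finset.range (n ^ d), star (m.scell 9 r x) *
      ∏ t ∈ Finset.range d, Y i (dig n x t) = 0) ↔
        (prodTensor fun _ => y i) ∈ searchSpace d f u := by
    intro i
    rw [← (rowEquiv 𝕜 n d).apply_symm_apply (prodTensor fun _ => y i), ← h9]
    refine forall₂_congr fun r _ => ?_
    rw [star_trunc_dotProduct, LinearEquiv.apply_symm_apply, sum_range_eq_sum_digits]
    simp only [prod_range_dig, prodTensor, hY]
  have hchk : (verifyStage.run m).reg 13 = 0 ↔ (∀ i, ev i ≠ 0) ∧ Function.Injective ev ∧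
      ∀ i, (prodTensor fun _ => y i) ∈ searchSpace d f u := by
    rw [rchk]
    refine and_congr ⟨fun h i => ?_, fun h i hi => ?_⟩ (and_congr ⟨fun h i j hij => ?_,
      fun h i hi j hj hij => ?_⟩ ⟨fun h i => (hmem i).1 (h i i.2), fun h i hi => (hmem ⟨i, hi⟩).2 (h _)⟩)
    · rw [← hev]; exact h i i.2
    · have := h ⟨i, hi⟩
      rwa [← hev] at this
    · by_contra hne
      rw [← hev, ← hev] at hij
      rcases lt_or_gt_of_ne hne with h' | h'
      · exact h i i.2 j j.2 h' hij
      · exact h j j.2 i i.2 h' hij.symm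
    · intro heq
      have := @h ⟨i, hi⟩ ⟨j, hj⟩ (by rw [← hev, ← hev]; exact heq)
      simp only [Fin.mk.injEq] at this
      omega
  obtain ⟨t, ht, hexec⟩ := exec_stage O B _ verifyStage verifyStage_check m hB
  by_cases h13 : (verifyStage.run m).reg 13 = 0
  · obtain ⟨hev', hinj, hmem'⟩ := hchk.1 h13
    obtain ⟨z, hz⟩ := exists_isPowerPencil_of_check hd hP hM hV hMV hev' hinj hmem'
    refine ⟨_, _, .seq hexec (.ifLtFalse (by simp [IExpr.eval, h13])
      (.seq (.setReg _ _ _) (.setReg _ _ _))), by simp only [IExpr.size]; omega, ?_⟩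
    rw [output_points (k := k) (y := y)]
    · exact hz.algorithm1 hd hk hkR
    · simp [Memory.setReg, IExpr.eval]
    · simp [Memory.setReg, IExpr.eval, r11]
    · intro i j
      rw [← hY]
      exact r0 i i.2 j j.2
  · obtain ⟨m', hm', hout⟩ := exec_fail (n := n) O (verifyStage.run m)
    refine ⟨_, _, .seq hexec (.ifLtTrue (by simp only [IExpr.eval]; omega) hm'),
      by simp only [IExpr.size]; omega, ?_⟩
    rw [hout]
    refine algorithm1_fail hd hk fun z y' hz => h13 (hchk.2 ?_)
    exact hz.check hd hP hM hV hMV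

/-- Failure is reported if the rank of `T(g)` is not `k`, if the oracle refuses the matrix, or if
the test is not passed; each of these excludes a power pencil. The summand `B * B` pays for the
single oracle call, on a matrix of size `k ≤ B`. -/
theorem pencilProgram_exec (hn : 2 ≤ n) (hd : 2 ≤ d) (hkR : k ≤ R) (hk : 0 < k)
    (hP : IsSearchBasis f u P) {O : DiagOracle 𝕜} (hO : O.Valid) {m : Memory 𝕜} {B : ℕ}
    (hS : Sizes n d p R m) (hD : Digits n d m) (h11 : m.reg 11 = k)
    (hB : ∀ x ∈ [0, 1, 4, 5, 9, 10, 11], m.reg x ≤ B)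
    (hPm : ∀ l : Fin k, P l = tensorOfRow n d (m.scell 10 l))
    (h9 : ∀ t, (∀ i < n ^ d + p, star (trunc (n ^ d) (m.scell 9 i)) ⬝ᵥ t = 0) ↔
      rowEquiv 𝕜 n d t ∈ searchSpace d f u)
    (h2 : ∀ l : Fin k, m.scell 2 k l = (rnd k).1 l) (h3 : ∀ l : Fin k, m.scell 3 k l = (rnd k).2 l) :
    ∃ m' t, ∃ q ≤ 1, Exec O pencilProgram m m' t q ∧
      t ≤ pencilStage.cost B + verifyStage.cost B + B * B + 30 ∧
      Algorithm1 R P rnd (m'.output n) := by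
  have hag := run_agree pencilStage m
  obtain ⟨hS', G, H, e, hpt⟩ := pencilStage_run hn (by omega) hS hD h11
  have hD' := hD.agree hag (by decide)
  obtain ⟨hk', hM⟩ := pencilTables_isPencilMatrix hpt (by omega) hPm
  simp only [h2, h3] at hk' hM
  have hr11 : (pencilStage.run m).reg 11 = k := (hag.reg 11 rfl).trans h11
  obtain ⟨t₁, ht₁, hexec⟩ := exec_stage O B _ pencilStage pencilStage_check m
    (fun x hx => hB x (by revert x; decide))
  have hkB : k ≤ B := h11 ▸ hB 11 (by decide)
  have hfail : ¬ (∃ z y, IsPowerPencil P (rnd k).1 (rnd k).2 z y) →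
      Algorithm1 R P rnd .fail := fun h =>
    algorithm1_fail hd hk fun z y hz => h ⟨z, y, hz⟩
  by_cases hkk : (pencilStage.run m).reg 12 = k
  swap
  · have hf : Algorithm1 R P rnd .fail := by
      refine hfail ?_
      rintro ⟨z, y, hz⟩
      exact hkk (hk'.trans (rank_contract hz.2.decomp hz.2.left hz.2.right hz.2.ne_zero'))
    obtain ⟨m', hm', hout⟩ := exec_fail (n := n) O (pencilStage.run m)
    rcases lt_or_gt_of_ne hkk with h' | h'
    · exact ⟨_, _, _, by omega, .seq hexec (.ifLtTrue (by simp only [IExpr.eval]; omega) hm'),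
        by simp only [IExpr.size]; omega, hout ▸ hf⟩
    · exact ⟨_, _, _, by omega, .seq hexec (.ifLtFalse (by simp only [IExpr.eval]; omega)
        (.ifLtTrue (by simp only [IExpr.eval]; omega) hm')),
        by simp only [IExpr.size]; omega, hout ▸ hf⟩
  have hM' := hM hkk
  have hdiag := Exec.diag (O := O) 17 18 19 14 (.reg 11) (pencilStage.run m)
  have hkB2 : k * k ≤ B * B := Nat.mul_le_mul hkB hkB
  have heval : (IExpr.reg 11).eval (pencilStage.run m) = k := hr11
  rw [heval] at hdiag
  have hvalid := hO k ((pencilStage.run m).block 17 k)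
  rcases hOk : O k ((pencilStage.run m).block 17 k) with _ | ⟨ev, V⟩
  · rw [hOk] at hvalid
    have hf : Algorithm1 R P rnd .fail := by
      refine hfail ?_
      rintro ⟨z, y, hz⟩
      exact hvalid (hM'.exists_diagonalization hz.2)
    have h14 := diag_none hOk
    obtain ⟨m', hm', hout⟩ := exec_fail (n := n) O ((pencilStage.run m).diag O 17 18 19 14 k)
    exact ⟨_, _, _, by omega, .seq hexec (.ifLtFalse (by simp only [IExpr.eval]; omega)
      (.ifLtFalse (by simp only [IExpr.eval]; omega) (.seq hdiag
        (.ifLtFalse (by simp only [IExpr.eval]; omega) hm')))),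
        by simp only [IExpr.size]; omega, hout ▸ hf⟩
  · rw [hOk] at hvalid
    obtain ⟨d1, d2, d3, d4, d5, d6⟩ := diag_some hOk
    set m₃ := (pencilStage.run m).diag O 17 18 19 14 k
    have hS₃ : Sizes n d p R m₃ := by
      constructor <;> rw [d1 _ (by decide)]
      exacts [hS'.r0, hS'.r1, hS'.r2, hS'.r3, hS'.r4, hS'.r5, hS'.r6, hS'.r7, hS'.r8, hS'.r9, hS'.r10]
    have hD₃ : Digits n d m₃ := ⟨fun x hx k hk => by rw [d3]; exact hD'.digit x hx k hk,
      fun b hb => by rw [d3]; exact hD'.mul b hb⟩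
    obtain ⟨m', t, hm', ht, hout⟩ := reportProgram_exec (rnd := rnd) (O := O) (m := m₃) (B := B) hn hd
      hkR hk hP hS₃ hD₃ ((d1 11 (by decide)).trans hr11) (fun x hx => by
        have hx14 : x ≠ 14 := by revert x; decide
        have hxw : pencilStage.wreg x = false := by revert x; decide
        rw [d1 x hx14, hag.reg x hxw]
        exact hB x (by revert x; decide)) (by
        rw [d4 9 (by decide) (by decide), hag.scell 9 rfl]
        exact h9) hM' hvalid.1 hvalid.2 d5 d6 (fun l a => by
        rw [d4 14 (by decide) (by decide)]
        rfl)
    exact ⟨_, _, _, by omega, .seq hexec (.ifLtFalse (by simp only [IExpr.eval]; omega)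
      (.ifLtFalse (by simp only [IExpr.eval]; omega) (.seq hdiag
        (.ifLtTrue (by simp only [IExpr.eval]; omega) hm')))),
        by simp only [IExpr.size]; omega, hout⟩

end ProgramCorrectness

end

section

open Loop

section

variable {𝕜 : Type*} [RCLike 𝕜] {n d p R k : ℕ} {f : Fin p → MvPolynomial (Fin n) 𝕜}
  {u : Fin R → Fin n → 𝕜} {P : Fin k → (Fin d → Fin n) → 𝕜}

theorem searchProgram_exec (hn : 2 ≤ n) (hd : 2 ≤ d) (hR : R ≤ n) (rnd : RandomTape 𝕜)
    (h11 : (searchMemory d f u rnd).reg 11 = k)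
    (hPm : ∀ l : Fin k, P l = tensorOfRow n d ((searchMemory d f u rnd).scell 10 l))
    (hP : IsSearchBasis f u P) {O : DiagOracle 𝕜} (hO : O.Valid) {B : ℕ}
    (hB : n ^ d + p + n ^ d ≤ B) :
    ∃ m' t, ∃ q ≤ 1, Exec O searchProgram (initialMemory d f u rnd) m' t q ∧
      t ≤ predStage.cost B + sizeStage.cost B + searchStage.cost B + pencilStage.cost B +
        verifyStage.cost B + B * B + 50 ∧ Algorithm1 R P rnd (m'.output n) := by
  have hn1 : n ≤ n ^ d := Nat.le_self_pow (by omega) n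
  have hd1 : d ≤ n ^ d := (Nat.lt_pow_self (by omega)).le
  have hn4 : n ^ (d - 1) ≤ n ^ d := Nat.pow_le_pow_right (by omega) (by omega)
  obtain ⟨hS, hD, -, h9⟩ := searchMemory_spec (f := f) (u := u) hn hd hR rnd
  obtain ⟨t₁, ht₁, e₁⟩ := exec_stage O B _ predStage predStage_check (initialMemory d f u rnd) (by simp)
  have hS₀ : Sizes n d p R (sizeStage.run (predStage.run (initialMemory d f u rnd))) :=
    sizes_initial hd rnd
  obtain ⟨t₂, ht₂, e₂⟩ := exec_stage O B _ sizeStage sizeStage_check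
    (predStage.run (initialMemory d f u rnd)) (by
      have h0 := hS₀.r0
      have h6 := hS₀.r6
      rw [(run_agree sizeStage _).reg 0 rfl] at h0
      rw [(run_agree sizeStage _).reg 6 rfl] at h6
      simp only [List.mem_cons, List.not_mem_nil, or_false, forall_eq_or_imp, forall_eq]
      omega)
  obtain ⟨t₃, ht₃, e₃⟩ := exec_stage O B _ searchStage searchStage_check
    (sizeStage.run (predStage.run (initialMemory d f u rnd))) (by
      obtain ⟨r0, r1, r2, r3, r4, r5, r6, r7, r8, r9, r10⟩ := hS₀
      simp only [List.mem_cons, List.not_mem_nil, or_false, forall_eq_or_imp, forall_eq]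
      omega)
  rw [show searchStage.run (sizeStage.run (predStage.run (initialMemory d f u rnd))) =
    searchMemory d f u rnd from rfl] at e₃
  have h2 : ∀ l : Fin k, (searchMemory d f u rnd).scell 2 k l = (rnd k).1 l := by
    rw [searchMemory_scell rfl]
    intro l
    simp [initialMemory]
  have h3 : ∀ l : Fin k, (searchMemory d f u rnd).scell 3 k l = (rnd k).2 l := by
    rw [searchMemory_scell rfl]
    intro l
    simp [initialMemory]
  generalize searchMemory d f u rnd = m at *
  obtain ⟨r0, r1, r2, r3, r4, r5, r6, r7, r8, r9, r10⟩ := id hS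
  rcases Nat.eq_zero_or_pos k with hk0 | hk0
  · refine ⟨_, _, _, ?_, .seq e₁ (.seq e₂ (.seq e₃ (.ifLtFalse (by simp only [IExpr.eval]; omega)
      (.setReg _ _ _)))), by simp only [IExpr.size]; omega, ?_⟩
    · omega
    · rw [show Memory.output n (m.setReg 0 _) = Output.trivial from by
        simp [Memory.output, Memory.setReg, IExpr.eval]]
      exact .trivial hk0
  · rcases lt_or_ge R k with hkR | hkR
    · obtain ⟨m', hm', hout⟩ := exec_fail (n := n) O m
      refine ⟨_, _, _, ?_, .seq e₁ (.seq e₂ (.seq e₃ (.ifLtTrue (by simp only [IExpr.eval]; omega)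
        (.ifLtTrue (by simp only [IExpr.eval]; omega) hm')))),
        by simp only [IExpr.size]; omega, ?_⟩
      · omega
      · rw [hout]
        exact .tooLarge hkR
    · have hB' : ∀ x ∈ [0, 1, 4, 5, 9, 10, 11], m.reg x ≤ B := by
        simp only [List.mem_cons, List.not_mem_nil, or_false, forall_eq_or_imp, forall_eq]
        omega
      obtain ⟨m', t, q, hq, hm', ht, hout⟩ := pencilProgram_exec (rnd := rnd) (B := B) hn hd hkR hk0
        hP hO hS hD h11 hB' hPm h9 h2 h3
      refine ⟨_, _, _, ?_, .seq e₁ (.seq e₂ (.seq e₃ (.ifLtTrue (by simp only [IExpr.eval]; omega)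
        (.ifLtFalse (by simp only [IExpr.eval]; omega) hm')))),
        by simp only [IExpr.size]; omega, hout⟩
      omega

end

/-- The program executes the algorithm within the stated resources. -/
theorem searchProgram_halts (𝕜 : Type*) [RCLike 𝕜] : ∃ C : ℕ,
    ∀ (n d p R : ℕ) (f : Fin p → MvPolynomial (Fin n) 𝕜) (u : Fin R → Fin n → 𝕜),
      2 ≤ n → 2 ≤ d → (∀ i, (f i).IsHomogeneous d) → LinearIndependent 𝕜 f →
      LinearIndependent 𝕜 u →
      ∃ (k : ℕ) (P : Fin k → (Fin d → Fin n) → 𝕜), IsSearchBasis f u P ∧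
        ∀ (rnd : RandomTape 𝕜) (O : DiagOracle 𝕜), O.Valid →
          HaltsWithin O searchProgram (n ^ (C * d)) 1 d f u rnd (Algorithm1 R P rnd) := by
  obtain ⟨c₁, hc₁⟩ := exists_cost_le predStage
  obtain ⟨c₂, hc₂⟩ := exists_cost_le sizeStage
  obtain ⟨c₃, hc₃⟩ := exists_cost_le searchStage
  obtain ⟨c₄, hc₄⟩ := exists_cost_le pencilStage
  obtain ⟨c₅, hc₅⟩ := exists_cost_le verifyStage
  refine ⟨2 * (c₁ + c₂ + c₃ + c₄ + c₅ + 2 + 1), fun n d p R f u hn hd hf hfi hu => ?_⟩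
  have hR : R ≤ n := by simpa using hu.fintype_card_le_finrank
  have hp := card_le_of_linearIndependent_homogeneous hf hfi
  -- A bound for all loops: the sizes of the arrays are at most `3 * n ^ d`, and `n ^ d ≥ 4`.
  obtain ⟨B, hB⟩ : ∃ B, B = n ^ (2 * d) := ⟨_, rfl⟩
  have hBsq : B = n ^ d * n ^ d := by rw [hB, two_mul, pow_add]
  have hnd : 4 ≤ n ^ d := (by norm_num : 4 = 2 ^ 2).le.trans
    ((Nat.pow_le_pow_left hn 2).trans (Nat.pow_le_pow_right (by omega) hd))
  have hB4 : 4 * n ^ d ≤ B := by rw [hBsq]; exact Nat.mul_le_mul_right _ hnd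
  have hn1 : n ≤ n ^ d := Nat.le_self_pow (by omega) n
  have hd1 : d ≤ n ^ d := (Nat.lt_pow_self (by omega)).le
  have hn4 : n ^ (d - 1) ≤ n ^ d := Nat.pow_le_pow_right (by omega) (by omega)
  have hB2 : 2 ≤ B := by omega
  have hcost : ∀ {P : Loop} {c : ℕ}, (∀ B, 2 ≤ B → P.cost B ≤ B ^ c) →
      c ≤ c₁ + c₂ + c₃ + c₄ + c₅ + 2 → P.cost B ≤ B ^ (c₁ + c₂ + c₃ + c₄ + c₅ + 2) :=
    fun h hc => (h B hB2).trans (Nat.pow_le_pow_right (by omega) hc)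
  have hk₁ := hcost hc₁ (by omega)
  have hk₂ := hcost hc₂ (by omega)
  have hk₃ := hcost hc₃ (by omega)
  have hk₄ := hcost hc₄ (by omega)
  have hk₅ := hcost hc₅ (by omega)
  have hBB : B * B ≤ B ^ (c₁ + c₂ + c₃ + c₄ + c₅ + 2) := by
    rw [← sq]; exact Nat.pow_le_pow_right (by omega) (by omega)
  have hB16 : 16 * 16 ≤ B * B := Nat.mul_le_mul (by omega) (by omega)
  -- There are five stages, the oracle call and the additive constant, and `7 ≤ B`.
  have htotal : 7 * B ^ (c₁ + c₂ + c₃ + c₄ + c₅ + 2) ≤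
      n ^ (2 * (c₁ + c₂ + c₃ + c₄ + c₅ + 2 + 1) * d) := by
    have : n ^ (2 * (c₁ + c₂ + c₃ + c₄ + c₅ + 2 + 1) * d) =
        B * B ^ (c₁ + c₂ + c₃ + c₄ + c₅ + 2) := by
      rw [hB, ← pow_mul, ← pow_add]
      congr 1
      ring
    rw [this]
    exact Nat.mul_le_mul_right _ (by omega)
  -- The basis is taken from the run with the zero tape; by `searchMemory_eq` it is the same for all
  -- tapes, as the order of quantifiers requires.
  obtain ⟨-, -, hbasis, -⟩ := searchMemory_spec (f := f) (u := u) hn hd hR 0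
  refine ⟨_, _, hbasis, fun rnd O hO => ?_⟩
  obtain ⟨hreg, htab⟩ := searchMemory_eq (f := f) (u := u) (d := d) rnd 0
  obtain ⟨m', t, q, hq, hm', ht, hout⟩ := searchProgram_exec (B := B) hn hd hR rnd (by rw [hreg])
    (fun l => by rw [htab]) hbasis hO (by omega)
  exact ⟨m', t, q, hm', by omega, hq, hout⟩

end

section

/-! ### Random functionals are generic almost surely -/

section RandomChoices

variable {𝕜 : Type*} [RCLike 𝕜] [MeasurableSpace 𝕜] [BorelSpace 𝕜]

theorem ae_dotProduct_ne_zero {k : ℕ} {σ : Measure (Fin k → 𝕜)}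
    (hσ : ∀ W : Submodule 𝕜 (Fin k → 𝕜), W ≠ ⊤ → σ W = 0) {x : Fin k → 𝕜} (hx : x ≠ 0) :
    ∀ᵐ f ∂σ, f ⬝ᵥ x ≠ 0 := by
  let φ : (Fin k → 𝕜) →ₗ[𝕜] 𝕜 :=
    { toFun := fun f => f ⬝ᵥ x
      map_add' := fun f g => add_dotProduct f g x
      map_smul' := fun c f => smul_dotProduct c f x }
  have h : LinearMap.ker φ ≠ ⊤ := by
    intro h
    obtain ⟨i, hi⟩ := Function.ne_iff.1 hx
    have h1 : Pi.single i (1 : 𝕜) ∈ LinearMap.ker φ := h ▸ Submodule.mem_top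
    have h2 : Pi.single i (1 : 𝕜) ⬝ᵥ x = 0 := h1
    rw [single_one_dotProduct] at h2
    exact hi h2
  have h3 := hσ _ h
  rw [ae_iff]
  convert h3 using 2
  ext f
  simp only [not_not]
  rfl

/-- For fixed `f` with `f · z_i ≠ 0`, the `g` that produce equal quotients at `i` and `j` annihilate
`(f · z_i) z_j - (f · z_j) z_i`, which is non-zero by independence. They lie in a proper subspace,
and Fubini's theorem applies. -/
theorem ae_generic {k : ℕ} {σ : Measure (Fin k → 𝕜)} [IsProbabilityMeasure σ]
    (hσ : ∀ W : Submodule 𝕜 (Fin k → 𝕜), W ≠ ⊤ → σ W = 0) {ι : Type*} [Fintype ι] [DecidableEq ι]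
    {z : ι → Fin k → 𝕜} (hz : LinearIndependent 𝕜 z) :
    ∀ᵐ r ∂(σ.prod σ), (∀ i, r.1 ⬝ᵥ z i ≠ 0) ∧ (∀ i, r.2 ⬝ᵥ z i ≠ 0) ∧
      Function.Injective fun i => r.1 ⬝ᵥ z i / r.2 ⬝ᵥ z i := by
  have h0 : ∀ᵐ f ∂σ, ∀ i, f ⬝ᵥ z i ≠ 0 :=
    ae_all_iff.2 fun i => ae_dotProduct_ne_zero hσ (hz.ne_zero i)
  have h1 : ∀ᵐ r ∂(σ.prod σ), ∀ i, r.1 ⬝ᵥ z i ≠ 0 := Measure.quasiMeasurePreserving_fst.ae h0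
  have h2 : ∀ᵐ r ∂(σ.prod σ), ∀ i, r.2 ⬝ᵥ z i ≠ 0 := Measure.quasiMeasurePreserving_snd.ae h0
  have h3 : ∀ᵐ r ∂(σ.prod σ), ∀ i j, i ≠ j →
      (r.1 ⬝ᵥ z i) * (r.2 ⬝ᵥ z j) ≠ (r.1 ⬝ᵥ z j) * (r.2 ⬝ᵥ z i) := by
    refine ae_all_iff.2 fun i => ae_all_iff.2 fun j => ?_
    by_cases hij : i = j
    · exact Filter.Eventually.of_forall fun r h => absurd hij h
    have hmeas : MeasurableSet {r : (Fin k → 𝕜) × (Fin k → 𝕜) |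
        i ≠ j → (r.1 ⬝ᵥ z i) * (r.2 ⬝ᵥ z j) ≠ (r.1 ⬝ᵥ z j) * (r.2 ⬝ᵥ z i)} := by
      have : {r : (Fin k → 𝕜) × (Fin k → 𝕜) |
        i ≠ j → (r.1 ⬝ᵥ z i) * (r.2 ⬝ᵥ z j) ≠ (r.1 ⬝ᵥ z j) * (r.2 ⬝ᵥ z i)} =
        {r | (r.1 ⬝ᵥ z i) * (r.2 ⬝ᵥ z j) = (r.1 ⬝ᵥ z j) * (r.2 ⬝ᵥ z i)}ᶜ := by
        ext r; simp [hij]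
      rw [this]
      refine (measurableSet_eq_fun ?_ ?_).compl <;>
      · simp only [dotProduct]
        fun_prop
    rw [Measure.ae_prod_iff_ae_ae hmeas]
    filter_upwards [h0] with f hf
    have hne : (f ⬝ᵥ z i) • z j - (f ⬝ᵥ z j) • z i ≠ 0 := by
      intro h
      obtain ⟨L, hL⟩ := exists_dual_family hz
      have h4 := congrArg (L j ⬝ᵥ ·) h
      simp [hL, Ne.symm hij] at h4
      exact hf i h4
    filter_upwards [ae_dotProduct_ne_zero hσ hne] with g hg _ heq
    apply hg
    rw [dotProduct_sub, dotProduct_smul, dotProduct_smul, smul_eq_mul, smul_eq_mul, heq, sub_self]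
  filter_upwards [h1, h2, h3] with r h1 h2 h3
  refine ⟨h1, h2, fun i j hij => ?_⟩
  by_contra hne
  rw [div_eq_div_iff (h2 i) (h2 j)] at hij
  exact h3 i j hne hij

variable {n d p R s : ℕ} {f : Fin p → MvPolynomial (Fin n) 𝕜} {u : Fin R → Fin n → 𝕜}
  {y : Fin s → Fin n → 𝕜} {σ : ∀ k : ℕ, Measure (Fin k → 𝕜)} [∀ k, IsProbabilityMeasure (σ k)]

/-- If the search space is spanned by the powers of linearly independent vectors then the algorithm
finds them with probability one. -/
theorem ae_recovers (hd : 2 ≤ d) (hsR : s ≤ R) (hy : LinearIndependent 𝕜 y)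
    (hspan : searchSpace d f u = Submodule.span 𝕜 (Set.range fun i => prodTensor fun _ => y i))
    (hσ : ∀ (k : ℕ) (W : Submodule 𝕜 (Fin k → 𝕜)), W ≠ ⊤ → σ k W = 0) {k : ℕ}
    {P : Fin k → (Fin d → Fin n) → 𝕜} (hP : IsSearchBasis f u P) :
    ∀ᵐ rnd ∂(tapeLaw σ), ∀ out : Output 𝕜 n, Algorithm1 R P rnd out → out.Recovers y := by
  have hpow := linearIndependent_prodTensor (d := d) (by omega) hy
  -- Both families are bases of the search space.
  obtain rfl : k = s := by
    have h1 := finrank_span_eq_card hP.1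
    rw [hP.2, hspan, finrank_span_eq_card hpow] at h1
    simpa using h1.symm
  rcases Nat.eq_zero_or_pos k with hk | hk
  · refine Filter.Eventually.of_forall fun rnd out hout => Or.inl ⟨hk, ?_⟩
    cases hout <;> first | rfl | omega
  obtain ⟨z, hz, hPz⟩ := exists_coeff_of_span_eq hpow (hspan.symm.trans hP.2.symm)
  have h1 : ∀ᵐ rnd ∂(tapeLaw σ), (∀ i, (rnd k).1 ⬝ᵥ z i ≠ 0) ∧ (∀ i, (rnd k).2 ⬝ᵥ z i ≠ 0) ∧
      Function.Injective fun i => (rnd k).1 ⬝ᵥ z i / (rnd k).2 ⬝ᵥ z i :=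
    (measurePreserving_eval_infinitePi (fun k => (σ k).prod (σ k)) k).quasiMeasurePreserving.ae
      (ae_generic (hσ k) hz)
  filter_upwards [h1] with rnd ⟨h1, h2, h3⟩ out hout
  obtain ⟨y', rfl, hy'⟩ := (isPowerPencil_of hd hPz hz hy h1 h2 h3).eq_points hd hk hsR hout
  exact Or.inr ⟨hk, y', rfl, hy'⟩

end RandomChoices

end

section

/-! ### Symmetric tensors as polynomials in linear forms -/

section LinearForms

variable {𝕜 : Type*} [Field 𝕜] {n d : ℕ}

open MvPolynomial

/-- The linear form with coefficient vector `x`. -/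
def linForm {A : Type*} [CommSemiring A] (x : Fin n → A) : MvPolynomial (Fin n) A := ∑ i, C (x i) * X i

theorem prod_linForm {A : Type*} [CommSemiring A] (x : Fin d → Fin n → A) :
    ∏ k, linForm (x k) = ∑ b : Fin d → Fin n, C (∏ k, x k (b k)) * monomial (content b) 1 := by
  simp only [linForm, Finset.prod_univ_sum, Fintype.piFinset_univ, Finset.prod_mul_distrib]
  refine Finset.sum_congr rfl fun b _ => ?_
  rw [map_prod, content, monomial_sum_one]
  rfl

theorem linForm_pow {A : Type*} [CommSemiring A] (x : Fin n → A) :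
    linForm x ^ d = ∑ b : Fin d → Fin n, C (∏ k, x (b k)) * monomial (content b) 1 := by
  rw [← prod_linForm, Finset.prod_const, Finset.card_univ, Fintype.card_fin]

theorem isHomogeneous_linForm (x : Fin n → 𝕜) : (linForm x).IsHomogeneous 1 :=
  IsHomogeneous.sum _ _ _ fun i _ => by
    simpa using (isHomogeneous_C (Fin n) (x i)).mul (isHomogeneous_X 𝕜 i)

theorem degree_content (b : Fin d → Fin n) : (content b).degree = d := by
  rw [content, map_sum]
  simp

theorem isHomogeneous_monomial_content (b : Fin d → Fin n) :
    (monomial (content b) (1 : 𝕜)).IsHomogeneous d :=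
  isHomogeneous_monomial _ (degree_content b)

theorem homogeneousSubmodule_eq_span (n d : ℕ) : homogeneousSubmodule (Fin n) 𝕜 d =
    Submodule.span 𝕜 (Set.range fun b : Fin d → Fin n => monomial (content b) (1 : 𝕜)) := by
  apply le_antisymm
  · intro g hg
    rw [mem_homogeneousSubmodule] at hg
    rw [g.as_sum]
    refine Submodule.sum_mem _ fun α hα => ?_
    obtain ⟨b, rfl⟩ := exists_content_eq (degree_of_mem_support hg (mem_support_iff.1 hα))
    rw [← mul_one (coeff (content b) g), ← smul_eq_mul, ← smul_monomial]
    exact Submodule.smul_mem _ _ (Submodule.subset_span ⟨b, rfl⟩)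
  · rw [Submodule.span_le]
    rintro _ ⟨b, rfl⟩
    exact isHomogeneous_monomial_content b

instance finiteDimensional_homogeneousSubmodule :
    FiniteDimensional 𝕜 (homogeneousSubmodule (Fin n) 𝕜 d) := by
  rw [homogeneousSubmodule_eq_span]
  exact FiniteDimensional.span_of_finite 𝕜 (Set.finite_range _)

/-- Words are counted instead of monomials. The cruder bound is multiplicative in the degree, which
is what makes the dimension count of the induction close. -/
theorem finrank_homogeneousSubmodule_le :
    Module.finrank 𝕜 (homogeneousSubmodule (Fin n) 𝕜 d) ≤ n ^ d := by
  rw [homogeneousSubmodule_eq_span]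
  exact (finrank_range_le_card _).trans (by simp)

theorem formTensor_add (g h : MvPolynomial (Fin n) 𝕜) :
    formTensor d (g + h) = formTensor d g + formTensor d h := by
  funext a
  simp [formTensor, add_div]

theorem formTensor_smul (c : 𝕜) (g : MvPolynomial (Fin n) 𝕜) :
    formTensor d (c • g) = c • formTensor d g := by
  funext a
  simp [formTensor, mul_div_assoc]

variable (𝕜 n d) in
/-- The symmetric tensor of a form, as a linear map. -/
def formTensorHom : MvPolynomial (Fin n) 𝕜 →ₗ[𝕜] ((Fin d → Fin n) → 𝕜) where
  toFun := formTensor d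
  map_add' := formTensor_add
  map_smul' := formTensor_smul

/-- Products of linear forms correspond to symmetrized products of vectors, so `S^d(U)` becomes the
space of forms of degree `d` in the linear forms that belong to `U`. -/
theorem formTensor_prod_linForm (x : Fin d → Fin n → 𝕜) :
    formTensor d (∏ k, linForm (x k)) = symmetrize 𝕜 n d (prodTensor x) := by
  classical
  funext a
  rw [formTensor, prod_linForm, coeff_sum]
  simp only [coeff_C_mul, coeff_monomial, symmetrize, LinearMap.coe_mk, AddHom.coe_mk, prodTensor]
  rw [Finset.sum_div]
  refine Finset.sum_congr rfl fun b _ => ?_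
  by_cases hab : content a = content b
  · rw [if_pos hab.symm, if_pos hab, mul_one, div_mul_eq_mul_div, one_mul]
    rfl
  · rw [if_neg (Ne.symm hab), if_neg hab]
    simp

theorem prodTensor_const_mem (x : Fin n → 𝕜) :
    (prodTensor fun _ : Fin d => x) ∈ symmetricTensors 𝕜 n d := fun π a =>
  Equiv.prod_comp π fun k => x (a k)

theorem formTensor_linForm_pow [CharZero 𝕜] (x : Fin n → 𝕜) :
    formTensor d (linForm x ^ d) = prodTensor fun _ => x := by
  have := formTensor_prod_linForm (d := d) fun _ => x
  rw [Finset.prod_const, Finset.card_univ, Fintype.card_fin,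
    symmetrize_of_mem (prodTensor_const_mem x)] at this
  exact this

/-- No non-zero form of degree `e` vanishes identically on `Z`. -/
def NonVanishing (e : ℕ) (Z : Set (Fin n → 𝕜)) : Prop :=
  ∀ g : MvPolynomial (Fin n) 𝕜, g.IsHomogeneous e → (∀ x ∈ Z, eval x g = 0) → g = 0

/-- A form of smaller degree that vanishes on `Z` is multiplied by a power of a coordinate. -/
theorem NonVanishing.mono {e e' : ℕ} {Z : Set (Fin n → 𝕜)} (hn : 0 < n) (h : NonVanishing e' Z)
    (hee : e ≤ e') : NonVanishing e Z := by
  intro g hg hZ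
  have h1 : X ⟨0, hn⟩ ^ (e' - e) * g = 0 := by
    refine h _ ?_ fun x hx => by rw [map_mul, hZ x hx, mul_zero]
    have h2 := ((isHomogeneous_X 𝕜 (⟨0, hn⟩ : Fin n)).pow (e' - e)).mul hg
    rwa [show 1 * (e' - e) + e = e' by omega] at h2
  exact (mul_eq_zero.1 h1).resolve_left (pow_ne_zero _ (X_ne_zero _))

/-- If no form of degree `e` vanishes on `Z` then the powers of the linear forms from `Z` span the
forms of degree `e`. -/
theorem NonVanishing.span_eq [CharZero 𝕜] {e : ℕ} {Z : Set (Fin n → 𝕜)} (h : NonVanishing e Z) :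
    Submodule.span 𝕜 ((fun x => linForm x ^ e) '' Z) = homogeneousSubmodule (Fin n) 𝕜 e := by
  classical
  apply le_antisymm
  · rw [Submodule.span_le]
    rintro _ ⟨x, -, rfl⟩
    simpa using (isHomogeneous_linForm x).pow e
  · by_contra hle
    obtain ⟨g₀, hg₀, hg₀'⟩ := SetLike.not_le_iff_exists.1 hle
    obtain ⟨φ, hφ, hφZ⟩ := Submodule.exists_le_ker_of_notMem hg₀'
    -- The form dual to the functional `φ`: its value at `x` is `φ (linForm x ^ e)`, so it vanishes
    -- on `Z`. Its coefficients are the values of `φ` on monomials times multiplicities, which are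
    -- non-zero in characteristic zero.
    set G : MvPolynomial (Fin n) 𝕜 :=
      ∑ b : Fin e → Fin n, C (φ (monomial (content b) 1)) * monomial (content b) 1 with hG
    have hG0 : G = 0 := by
      refine h _ (IsHomogeneous.sum _ _ _ fun b _ => ?_) fun x hx => ?_
      · simpa using (isHomogeneous_C (Fin n) (φ (monomial (content b) 1))).mul
          (isHomogeneous_monomial_content b)
      · have h1 : φ (linForm x ^ e) = 0 := hφZ (Submodule.subset_span ⟨x, hx, rfl⟩)
        rw [linForm_pow, map_sum] at h1
        rw [hG, map_sum, ← h1]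
        refine Finset.sum_congr rfl fun b _ => ?_
        have h2 : eval x (monomial (content b) (1 : 𝕜)) = ∏ k, x (b k) := by
          rw [content, monomial_sum_one, map_prod]
          exact Finset.prod_congr rfl fun k _ => eval_X (b k)
        rw [map_mul, eval_C, h2, ← smul_eq_C_mul, map_smul φ, smul_eq_mul, mul_comm]
    apply hφ
    have h2 : ∀ g ∈ homogeneousSubmodule (Fin n) 𝕜 e, φ g = 0 := by
      intro g hg
      rw [homogeneousSubmodule_eq_span] at hg
      induction hg using Submodule.span_induction with
      | mem g hg =>
        obtain ⟨a, rfl⟩ := hg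
        have h3 := congrArg (coeff (content a)) hG0
        rw [hG, coeff_sum, coeff_zero] at h3
        have h4 : ∀ b : Fin e → Fin n, coeff (content a)
            (C (φ (monomial (content b) 1)) * monomial (content b) (1 : 𝕜)) =
            if content b = content a then φ (monomial (content a) 1) else 0 := by
          intro b
          rw [coeff_C_mul, coeff_monomial]
          split_ifs with hab
          · rw [hab, mul_one]
          · rw [mul_zero]
        simp only [h4] at h3
        rw [← Finset.sum_filter, Finset.sum_const, nsmul_eq_mul] at h3
        refine (mul_eq_zero.1 h3).resolve_left ?_
        exact_mod_cast (contentMult_pos a).ne'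
      | zero => simp
      | add x y _ _ hx hy => rw [map_add, hx, hy, add_zero]
      | smul c x _ hx => rw [map_smul, hx, smul_zero]
    exact h2 _ hg₀

end LinearForms

end

section

/-! ### Dimension modulo a subspace -/

section Codimension

variable {𝕜 M N : Type*} [Field 𝕜] [AddCommGroup M] [Module 𝕜 M] [AddCommGroup N] [Module 𝕜 N]

/-- The dimension of `A` modulo `K`. -/
def dimMod (K A : Submodule 𝕜 M) : ℕ := Module.finrank 𝕜 (A.map K.mkQ)

theorem dimMod_le_finrank (K A : Submodule 𝕜 M) [FiniteDimensional 𝕜 A] :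
    dimMod K A ≤ Module.finrank 𝕜 A :=
  Submodule.finrank_map_le _ _

theorem dimMod_mono (K : Submodule 𝕜 M) {A B : Submodule 𝕜 M} [FiniteDimensional 𝕜 B] (h : A ≤ B) :
    dimMod K A ≤ dimMod K B :=
  Submodule.finrank_mono (Submodule.map_mono h)

/-- Enlarging `K` by `B` kills only those classes of elements of `A` that are represented by
elements of `B`. -/
theorem dimMod_le_add (K A B : Submodule 𝕜 M) [FiniteDimensional 𝕜 A] [FiniteDimensional 𝕜 B] :
    dimMod K A ≤ dimMod (K ⊔ B) A + dimMod K B := by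
  set π : M ⧸ K →ₗ[𝕜] M ⧸ (K ⊔ B) := Submodule.factor le_sup_left
  have hπ : ∀ m, π (K.mkQ m) = (K ⊔ B).mkQ m := fun m => Submodule.factor_mk _ m
  have h := LinearMap.finrank_range_add_finrank_ker (π.domRestrict (A.map K.mkQ))
  have h1 : (LinearMap.range (π.domRestrict (A.map K.mkQ))) = A.map (K ⊔ B).mkQ := by
    rw [LinearMap.range_domRestrict, ← Submodule.map_comp]
    congr 1
  have h2 : Module.finrank 𝕜 (LinearMap.ker (π.domRestrict (A.map K.mkQ))) ≤ dimMod K B := by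
    rw [← Submodule.finrank_map_subtype_eq]
    apply Submodule.finrank_mono
    rintro _ ⟨⟨_, m, hm, rfl⟩, hker, rfl⟩
    rw [SetLike.mem_coe, LinearMap.mem_ker, LinearMap.domRestrict_apply, hπ,
      Submodule.mkQ_apply, Submodule.Quotient.mk_eq_zero] at hker
    obtain ⟨k, hk, b, hb, rfl⟩ := Submodule.mem_sup.1 hker
    refine ⟨b, hb, ?_⟩
    simp [hk]
  rw [h1] at h
  rw [dimMod, ← h, dimMod]
  omega

/-- The quotient by the preimage of `K` embeds into the quotient by `K`. -/
theorem dimMod_comap (f : M →ₗ[𝕜] N) (K : Submodule 𝕜 N) (A : Submodule 𝕜 M) :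
    dimMod (K.comap f) A = dimMod K (A.map f) := by
  have hinj : Function.Injective ((K.comap f).mapQ K f le_rfl) := by
    rw [← LinearMap.ker_eq_bot, Submodule.ker_mapQ]
    simp [Submodule.mkQ_map_self]
  rw [dimMod, dimMod, (Submodule.equivMapOfInjective _ hinj _).finrank_eq, ← Submodule.map_comp,
    ← Submodule.map_comp, Submodule.mapQ_mkQ]

theorem dimMod_finset_sup_le {ι : Type*} (K : Submodule 𝕜 M) (A : ι → Submodule 𝕜 M)
    [∀ i, FiniteDimensional 𝕜 (A i)] (s : Finset ι) :
    dimMod K (s.sup A) ≤ ∑ i ∈ s, dimMod K (A i) := by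
  classical
  induction s using Finset.induction_on with
  | empty => simp [dimMod]
  | insert i s hi ih =>
    rw [Finset.sup_insert, Finset.sum_insert hi, dimMod, Submodule.map_sup]
    exact (Submodule.finrank_add_le_finrank_add_finrank _ _).trans (Nat.add_le_add_left ih _)

end Codimension

/-! ### Properties that hold off a hypersurface -/

section Generic

open MvPolynomial

variable {𝕜 : Type*} [Field 𝕜] {σ : Type*}

/-- Two polynomials which do not vanish identically on `W` do not vanish simultaneously at some point
of `W`. -/
def PolyIrreducible (W : Set (σ → 𝕜)) : Prop :=
  W.Nonempty ∧ ∀ g h : MvPolynomial σ 𝕜, (∃ x ∈ W, eval x g ≠ 0) → (∃ x ∈ W, eval x h ≠ 0) →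
    ∃ x ∈ W, eval x g ≠ 0 ∧ eval x h ≠ 0

/-- The property `P` holds outside the zero set of a polynomial which does not vanish identically on
`W`. -/
def HoldsOff (W : Set (σ → 𝕜)) (P : (σ → 𝕜) → Prop) : Prop :=
  ∃ g : MvPolynomial σ 𝕜, (∃ x ∈ W, eval x g ≠ 0) ∧ ∀ x, eval x g ≠ 0 → P x

theorem HoldsOff.mono {W : Set (σ → 𝕜)} {P Q : (σ → 𝕜) → Prop} (h : HoldsOff W P)
    (hPQ : ∀ x, P x → Q x) : HoldsOff W Q := by
  obtain ⟨g, hg, hP⟩ := h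
  exact ⟨g, hg, fun x hx => hPQ x (hP x hx)⟩

theorem HoldsOff.exists {W : Set (σ → 𝕜)} {P : (σ → 𝕜) → Prop} (h : HoldsOff W P) :
    ∃ x ∈ W, P x := by
  obtain ⟨g, ⟨x, hx, hgx⟩, hP⟩ := h
  exact ⟨x, hx, hP x hgx⟩

theorem HoldsOff.and {W : Set (σ → 𝕜)} (hW : PolyIrreducible W) {P Q : (σ → 𝕜) → Prop}
    (hP : HoldsOff W P) (hQ : HoldsOff W Q) : HoldsOff W fun x => P x ∧ Q x := by
  obtain ⟨g, hg, hgP⟩ := hP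
  obtain ⟨h, hh, hhQ⟩ := hQ
  obtain ⟨x, hx, h1, h2⟩ := hW.2 g h hg hh
  refine ⟨g * h, ⟨x, hx, by rw [map_mul]; exact mul_ne_zero h1 h2⟩, fun y hy => ?_⟩
  rw [map_mul] at hy
  exact ⟨hgP y (left_ne_zero_of_mul hy), hhQ y (right_ne_zero_of_mul hy)⟩

theorem holdsOff_of_forall {W : Set (σ → 𝕜)} (hW : PolyIrreducible W) {P : (σ → 𝕜) → Prop}
    (h : ∀ x, P x) : HoldsOff W P := by
  obtain ⟨x, hx⟩ := hW.1
  exact ⟨1, ⟨x, hx, by simp⟩, fun y _ => h y⟩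

theorem holdsOff_forall {W : Set (σ → 𝕜)} (hW : PolyIrreducible W) {κ : Type*} (s : Finset κ)
    {P : κ → (σ → 𝕜) → Prop} (h : ∀ k ∈ s, HoldsOff W (P k)) :
    HoldsOff W fun x => ∀ k ∈ s, P k x := by
  classical
  induction s using Finset.induction_on with
  | empty => exact holdsOff_of_forall hW (by simp)
  | insert k s _ ih =>
    refine ((h k (Finset.mem_insert_self k s)).and hW
      (ih fun j hj => h j (Finset.mem_insert_of_mem hj))).mono ?_
    rintro x ⟨h1, h2⟩ j hj
    rcases Finset.mem_insert.1 hj with rfl | hj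
    exacts [h1, h2 j hj]

/-- The product of the sets `Z i`, in the space of tuples. -/
def tupleProduct {R n : ℕ} (Z : Fin R → Set (Fin n → 𝕜)) : Set (Fin R × Fin n → 𝕜) :=
  {w | ∀ i, (fun a => w (i, a)) ∈ Z i}

/-- Start with a tuple at which `g` does not vanish and another one for `h`, and make them agree in
one entry after the other. With the remaining entries frozen, `g` and `h` become polynomials in one
vector, and irreducibility of that factor provides a common choice. -/
theorem polyIrreducible_tupleProduct {R n : ℕ} {Z : Fin R → Set (Fin n → 𝕜)}
    (hZ : ∀ i, PolyIrreducible (Z i)) : PolyIrreducible (tupleProduct Z) := by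
  classical
  refine ⟨?_, fun g h hg hh => ?_⟩
  · choose v hv using fun i => (hZ i).1
    exact ⟨Function.uncurry v, hv⟩
  · let subst : (Fin R → Fin n → 𝕜) → Fin R → MvPolynomial (Fin R × Fin n) 𝕜 →
        MvPolynomial (Fin n) 𝕜 := fun v i p =>
      aeval (fun ja : Fin R × Fin n => if ja.1 = i then X ja.2 else C (v ja.1 ja.2)) p
    have hsubst : ∀ v i p z, eval z (subst v i p) =
        eval (Function.uncurry (Function.update v i z)) p := by
      intro v i p z
      induction p using MvPolynomial.induction_on with
      | C a => simp [subst]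
      | add p q hp hq =>
        simp only [subst, map_add] at hp hq ⊢
        rw [hp, hq]
      | mul_X p ja hp =>
        simp only [subst, map_mul, aeval_X, eval_X] at hp ⊢
        rw [hp]
        congr 1
        obtain ⟨j, a⟩ := ja
        by_cases hji : j = i
        · subst hji
          simp [Function.uncurry]
        · simp [hji, Function.uncurry]
    have key : ∀ s : Finset (Fin R), ∃ v v' : Fin R → Fin n → 𝕜, (∀ i, v i ∈ Z i) ∧
        (∀ i, v' i ∈ Z i) ∧ (∀ i ∈ s, v i = v' i) ∧ eval (Function.uncurry v) g ≠ 0 ∧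
        eval (Function.uncurry v') h ≠ 0 := by
      intro s
      induction s using Finset.induction_on with
      | empty =>
        obtain ⟨w, hw, hgw⟩ := hg
        obtain ⟨w', hw', hhw'⟩ := hh
        exact ⟨Function.curry w, Function.curry w', hw, hw', by simp, by simpa using hgw,
          by simpa using hhw'⟩
      | insert i s _ ih =>
        obtain ⟨v, v', hv, hv', hvv, hgv, hhv⟩ := ih
        obtain ⟨z, hz, h1, h2⟩ := (hZ i).2 (subst v i g) (subst v' i h)
          ⟨v i, hv i, by rwa [hsubst, Function.update_eq_self]⟩
          ⟨v' i, hv' i, by rwa [hsubst, Function.update_eq_self]⟩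
        rw [hsubst] at h1 h2
        have hupd : ∀ v : Fin R → Fin n → 𝕜, (∀ j, v j ∈ Z j) →
            ∀ j, Function.update v i z j ∈ Z j := by
          intro v hv j
          by_cases hji : j = i
          · subst hji
            simpa using hz
          · rw [Function.update_of_ne hji]
            exact hv j
        refine ⟨_, _, hupd v hv, hupd v' hv', fun j hj => ?_, h1, h2⟩
        by_cases hji : j = i
        · subst hji
          simp
        · rw [Function.update_of_ne hji, Function.update_of_ne hji]
          exact hvv j ((Finset.mem_insert.1 hj).resolve_left hji)
    obtain ⟨v, v', hv, -, hvv, h1, h2⟩ := key Finset.univ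
    obtain rfl : v = v' := funext fun i => hvv i (Finset.mem_univ i)
    exact ⟨Function.uncurry v, hv, h1, h2⟩

/-- Linear independence modulo `K` of the specializations of a finite family of polynomials with
parameters is an open condition. -/
theorem holdsOff_linearIndependent {τ ι : Type*} [Finite ι] (K : Submodule 𝕜 (MvPolynomial τ 𝕜))
    {W : Set (σ → 𝕜)} (w : ι → MvPolynomial τ (MvPolynomial σ 𝕜))
    (h : ∃ x ∈ W, LinearIndependent 𝕜 fun i => K.mkQ (map (eval x) (w i))) :
    HoldsOff W fun x => LinearIndependent 𝕜 fun i => K.mkQ (map (eval x) (w i)) := by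
  classical
  obtain ⟨_⟩ := nonempty_fintype ι
  obtain ⟨x₀, hx₀, hLI⟩ := h
  obtain ⟨L, hL⟩ := LinearMap.exists_leftInverse_of_injective
    (Fintype.linearCombination 𝕜 fun i => K.mkQ (map (eval x₀) (w i)))
    (LinearMap.ker_eq_bot.2 hLI.fintypeLinearCombination_injective)
  let φ : ι → MvPolynomial τ 𝕜 →ₗ[𝕜] 𝕜 := fun i => LinearMap.proj i ∘ₗ L ∘ₗ K.mkQ
  -- The matrix of the family in coordinates given by a left inverse at the good point `x₀`. It
  -- specializes to the identity at `x₀`, and independence holds wherever its determinant does not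
  -- vanish.
  let m : Matrix ι ι (MvPolynomial σ 𝕜) := Matrix.of fun i j =>
    ∑ α ∈ (w j).support, coeff α (w j) * C (φ i (monomial α 1))
  have hm : ∀ x i j, eval x (m i j) = φ i (map (eval x) (w j)) := by
    intro x i j
    conv_rhs => rw [(w j).as_sum]
    simp only [m, Matrix.of_apply, map_sum, map_mul, eval_C, map_monomial]
    refine Finset.sum_congr rfl fun α _ => ?_
    rw [← smul_eq_mul, ← map_smul, smul_monomial, smul_eq_mul, mul_one]
  have hdet : ∀ x, eval x m.det = (Matrix.of fun i j => φ i (map (eval x) (w j))).det := by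
    intro x
    rw [RingHom.map_det]
    congr 1
    ext i j
    exact hm x i j
  refine ⟨m.det, ⟨x₀, hx₀, ?_⟩, fun x hx => ?_⟩
  · rw [hdet]
    have h1 : (Matrix.of fun i j => φ i (map (eval x₀) (w j))) = 1 := by
      ext i j
      have h2 := congrFun (LinearMap.congr_fun hL (Pi.single j 1)) i
      rw [LinearMap.comp_apply, Fintype.linearCombination_apply_single, one_smul] at h2
      simp only [Matrix.of_apply, φ, LinearMap.comp_apply, LinearMap.proj_apply, h2]
      simp [Matrix.one_apply, Pi.single_apply]
    rw [h1, Matrix.det_one]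
    exact one_ne_zero
  · rw [hdet] at hx
    have h1 := Matrix.linearIndependent_cols_of_det_ne_zero hx
    exact LinearIndependent.of_comp L h1

end Generic

end

section

/-! ### Openness of the conditions on the tuple -/

section Avoidance

open MvPolynomial

variable {𝕜 : Type*} [Field 𝕜] {n d R : ℕ}

theorem map_linForm {A B : Type*} [CommSemiring A] [CommSemiring B] (f : A →+* B) (y : Fin n → A) :
    map f (linForm y) = linForm fun a => f (y a) := by
  simp [linForm]

theorem homogeneousSubmodule_add_le {e m : ℕ} {B : Submodule 𝕜 (MvPolynomial (Fin n) 𝕜)}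
    (h : ∀ g ∈ homogeneousSubmodule (Fin n) 𝕜 e, ∀ g' ∈ homogeneousSubmodule (Fin n) 𝕜 m, g * g' ∈ B) :
    homogeneousSubmodule (Fin n) 𝕜 (e + m) ≤ B := by
  rw [homogeneousSubmodule_eq_span, Submodule.span_le]
  rintro _ ⟨b, rfl⟩
  have hb : content b = content (fun k => b (Fin.castAdd m k)) + content fun k => b (Fin.natAdd e k) := by
    simp only [content]
    rw [Fin.sum_univ_add]
  dsimp only
  rw [hb, ← mul_one (1 : 𝕜), ← monomial_mul]
  exact h _ (isHomogeneous_monomial_content _) _ (isHomogeneous_monomial_content _)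

/-- Averaging: some point of `Z` achieves a proportional share of the dimension modulo `K`. -/
theorem exists_le_dimMod [CharZero 𝕜] {e m r : ℕ} (K : Submodule 𝕜 (MvPolynomial (Fin n) 𝕜))
    {Z : Set (Fin n → 𝕜)} (hn : 0 < n) (hZ : NonVanishing e Z) (hr : 0 < r)
    (h : n ^ e * r ≤ dimMod K (homogeneousSubmodule (Fin n) 𝕜 (e + m))) :
    ∃ x ∈ Z, r ≤ dimMod K
      ((homogeneousSubmodule (Fin n) 𝕜 m).map (LinearMap.mulLeft 𝕜 (linForm x ^ e))) := by
  by_contra! hcon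
  have hspan := hZ.span_eq
  have hfin : Module.Finite 𝕜 (Submodule.span 𝕜 ((fun x => linForm x ^ e) '' Z)) := by
    rw [hspan]
    infer_instance
  -- A basis of the forms of degree `e` is selected among the powers of the linear forms from `Z`;
  -- it has at most `n ^ e` members.
  obtain ⟨f, hf, hfs, -⟩ := Submodule.exists_fun_fin_finrank_span_eq 𝕜 ((fun x => linForm x ^ e) '' Z)
  choose x hx hxf using hf
  replace hfs := hfs.trans hspan
  have hN : Module.finrank 𝕜 (Submodule.span 𝕜 ((fun x => linForm x ^ e) '' Z)) ≤ n ^ e := by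
    rw [hspan]
    exact finrank_homogeneousSubmodule_le
  have hle : homogeneousSubmodule (Fin n) 𝕜 (e + m) ≤ Finset.univ.sup fun i =>
      (homogeneousSubmodule (Fin n) 𝕜 m).map (LinearMap.mulLeft 𝕜 (linForm (x i) ^ e)) := by
    refine homogeneousSubmodule_add_le fun g hg g' hg' => ?_
    rw [← hfs] at hg
    induction hg using Submodule.span_induction with
    | mem g hg =>
      obtain ⟨i, rfl⟩ := hg
      refine Finset.le_sup (f := fun i => (homogeneousSubmodule (Fin n) 𝕜 m).map
        (LinearMap.mulLeft 𝕜 (linForm (x i) ^ e))) (Finset.mem_univ i) ⟨g', hg', ?_⟩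
      rw [LinearMap.mulLeft_apply, ← hxf i]
    | zero => rw [zero_mul]; exact zero_mem _
    | add g₁ g₂ _ _ h1 h2 => rw [add_mul]; exact add_mem h1 h2
    | smul c g _ h1 => rw [smul_mul_assoc]; exact Submodule.smul_mem _ c h1
  -- If every share were at most `r - 1`, then the total dimension modulo `K` would be at most `n ^
  -- e * (r - 1)`.
  have h1 := (h.trans (dimMod_mono K hle)).trans (dimMod_finset_sup_le K _ _)
  have h2 := h1.trans (Finset.sum_le_card_nsmul _ _ (r - 1) fun i _ => Nat.le_sub_one_of_lt (hcon _ (hx i)))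
  rw [Finset.card_univ, Fintype.card_fin, smul_eq_mul] at h2
  have h3 := h2.trans (Nat.mul_le_mul_right (r - 1) hN)
  have h4 := Nat.le_of_mul_le_mul_left h3 (pow_pos hn e)
  omega

/-- Lower semicontinuity of the rank: generators that are independent modulo `K` at one point remain
so wherever a certain determinant does not vanish. -/
theorem holdsOff_le_dimMod {e m r : ℕ} (K : Submodule 𝕜 (MvPolynomial (Fin n) 𝕜))
    {Z : Set (Fin n → 𝕜)} (h : ∃ x ∈ Z, r ≤ dimMod K
      ((homogeneousSubmodule (Fin n) 𝕜 m).map (LinearMap.mulLeft 𝕜 (linForm x ^ e)))) :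
    HoldsOff Z fun x => r ≤ dimMod K
      ((homogeneousSubmodule (Fin n) 𝕜 m).map (LinearMap.mulLeft 𝕜 (linForm x ^ e))) := by
  have hspan : ∀ x : Fin n → 𝕜, ((homogeneousSubmodule (Fin n) 𝕜 m).map
      (LinearMap.mulLeft 𝕜 (linForm x ^ e))).map K.mkQ = Submodule.span 𝕜 (Set.range
        fun b : Fin m → Fin n => K.mkQ (linForm x ^ e * monomial (content b) 1)) := by
    intro x
    rw [homogeneousSubmodule_eq_span, Submodule.map_span, Submodule.map_span, ← Set.range_comp,
      ← Set.range_comp]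
    rfl
  obtain ⟨x, hx, hr⟩ := h
  have hfin : ∀ x : Fin n → 𝕜, Module.Finite 𝕜 (Submodule.span 𝕜 (Set.range
      fun b : Fin m → Fin n => K.mkQ (linForm x ^ e * monomial (content b) 1))) := fun x =>
    FiniteDimensional.span_of_finite 𝕜 (Set.finite_range _)
  obtain ⟨f, hf, -, hLI⟩ := Submodule.exists_fun_fin_finrank_span_eq 𝕜 (Set.range
    fun b : Fin m → Fin n => K.mkQ (linForm x ^ e * monomial (content b) 1))
  choose b hb using hf
  have hmap : ∀ (y : Fin n → 𝕜) (b : Fin m → Fin n), map (eval y)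
      (linForm (fun a => X a) ^ e * monomial (content b) (1 : MvPolynomial (Fin n) 𝕜)) =
      linForm y ^ e * monomial (content b) 1 := by
    intro y b
    rw [map_mul, map_pow, map_linForm, map_monomial, map_one]
    simp only [eval_X]
  have key := holdsOff_linearIndependent K (W := Z)
    (fun i => linForm (fun a => X a) ^ e * monomial (content (b i)) (1 : MvPolynomial (Fin n) 𝕜))
    ⟨x, hx, by
      simp only [hmap]
      rw [show f = _ from funext fun i => (hb i).symm] at hLI
      exact hLI⟩
  refine key.mono fun y hy => ?_
  simp only [hmap] at hy
  have h1 := finrank_span_eq_card hy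
  rw [Fintype.card_fin] at h1
  rw [dimMod, hspan] at hr ⊢
  refine (hr.trans h1.ge).trans (Submodule.finrank_mono (Submodule.span_mono ?_))
  rintro _ ⟨i, rfl⟩
  exact ⟨b i, rfl⟩

theorem holdsOff_pow_notMem (K : Submodule 𝕜 (MvPolynomial (Fin n) 𝕜))
    {Z : Set (Fin n → 𝕜)} (h : ∃ x ∈ Z, linForm x ^ d ∉ K) :
    HoldsOff Z fun x => linForm x ^ d ∉ K := by
  have hmap : ∀ x : Fin n → 𝕜, map (eval x)
      (linForm (fun a => (X a : MvPolynomial (Fin n) 𝕜)) ^ d) = linForm x ^ d := by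
    intro x
    rw [map_pow, map_linForm]
    simp only [eval_X]
  have hiff : ∀ x : Fin n → 𝕜, (LinearIndependent 𝕜 fun _ : Unit => K.mkQ (map (eval x)
      (linForm (fun a => (X a : MvPolynomial (Fin n) 𝕜)) ^ d))) ↔ linForm x ^ d ∉ K := by
    intro x
    rw [linearIndependent_unique_iff, hmap, Submodule.mkQ_apply, ne_eq,
      Submodule.Quotient.mk_eq_zero]
  refine (holdsOff_linearIndependent K (W := Z) (fun _ : Unit => _)
    ?_).mono fun x => (hiff x).1
  obtain ⟨x, hx, hxK⟩ := h
  exact ⟨x, hx, (hiff x).2 hxK⟩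

/-- A form of degree `d` in the linear forms of the vectors `v i` lies in `K` only if it is a
combination of the `d`-th powers of the planted ones. -/
def Avoids (K : Submodule 𝕜 (MvPolynomial (Fin n) 𝕜)) (d : ℕ) (planted : Fin R → Prop)
    (v : Fin R → Fin n → 𝕜) : Prop :=
  ∀ q : MvPolynomial (Fin R) 𝕜, q.IsHomogeneous d → aeval (fun i => linForm (v i)) q ∈ K →
    ∀ α, (∀ i, planted i → α ≠ Finsupp.single i d) → coeff α q = 0

theorem finite_degree_eq (R d : ℕ) : {α : Fin R →₀ ℕ | α.degree = d}.Finite :=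
  (Set.finite_range fun b : Fin d → Fin R => content b).subset fun _ hα => exists_content_eq hα

/-- Planted powers lie in `K` and disappear in the quotient. What remains is independence of the
other monomials in the linear forms, a condition to which `holdsOff_linearIndependent` applies. -/
theorem avoids_iff {K : Submodule 𝕜 (MvPolynomial (Fin n) 𝕜)} {planted : Fin R → Prop}
    {v : Fin R → Fin n → 𝕜} (hv : ∀ i, planted i → linForm (v i) ^ d ∈ K) :
    Avoids K d planted v ↔ LinearIndependent 𝕜 fun α : {α : Fin R →₀ ℕ // α.degree = d ∧
      ∀ i, planted i → α ≠ Finsupp.single i d} => K.mkQ (∏ i, linForm (v i) ^ (α : Fin R →₀ ℕ) i) := by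
  classical
  have hfin : {α : Fin R →₀ ℕ | α.degree = d ∧ ∀ i, planted i → α ≠ Finsupp.single i d}.Finite :=
    (finite_degree_eq R d).subset fun α hα => hα.1
  have : Fintype {α : Fin R →₀ ℕ // α.degree = d ∧ ∀ i, planted i → α ≠ Finsupp.single i d} :=
    hfin.fintype
  have hmon : ∀ (α : Fin R →₀ ℕ) (c : 𝕜), K.mkQ (aeval (fun i => linForm (v i)) (monomial α c)) =
      c • K.mkQ (∏ i, linForm (v i) ^ α i) := by
    intro α c
    rw [aeval_monomial, ← map_smul, Algebra.smul_def, Finsupp.prod_fintype _ _ fun i => pow_zero _]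
  rw [Fintype.linearIndependent_iff]
  constructor
  · intro h c hc α
    set q : MvPolynomial (Fin R) 𝕜 := ∑ α : {α : Fin R →₀ ℕ // α.degree = d ∧
      ∀ i, planted i → α ≠ Finsupp.single i d}, monomial (α : Fin R →₀ ℕ) (c α) with hq
    have h1 := h q (IsHomogeneous.sum _ _ _ fun α _ => isHomogeneous_monomial _ α.2.1) ?_ α α.2.2
    · rw [hq, coeff_sum, Finset.sum_eq_single α] at h1
      · simpa using h1
      · intro β _ hβ
        rw [coeff_monomial, if_neg fun h => hβ (Subtype.ext h)]
      · simp
    · rw [← Submodule.Quotient.mk_eq_zero, ← Submodule.mkQ_apply, hq, map_sum, map_sum]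
      simp only [hmon]
      exact hc
  · intro h q hq hqK α hα
    by_contra hne
    have hdeg := degree_of_mem_support hq hne
    refine hne (h (fun α => coeff (α : Fin R →₀ ℕ) q) ?_ ⟨α, hdeg, hα⟩)
    have h1 : K.mkQ (aeval (fun i => linForm (v i)) q) = 0 := by
      rwa [Submodule.mkQ_apply, Submodule.Quotient.mk_eq_zero]
    rw [q.as_sum, map_sum, map_sum] at h1
    simp only [hmon] at h1
    rw [← Finset.sum_subtype hfin.toFinset (fun α => by rw [Set.Finite.mem_toFinset]; rfl)
      fun α => coeff α q • K.mkQ (∏ i, linForm (v i) ^ α i), ← h1]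
    -- The two index sets are compared inside their union: the extra terms have coefficient zero on
    -- one side and are planted powers, which are zero modulo `K`, on the other.
    refine (Finset.sum_subset (Finset.subset_union_left (s₂ := q.support)) ?_).trans
      (Finset.sum_subset (Finset.subset_union_right (s₁ := hfin.toFinset)) ?_).symm
    rotate_left
    · intro β _ hβ
      rw [notMem_support_iff.1 hβ, zero_smul]
    · intro β hβ hβ'
      rcases Finset.mem_union.1 hβ with h2 | h2
      · exact absurd h2 hβ'
      · have h3 : ∃ i, planted i ∧ β = Finsupp.single i d := by
          by_contra! hcon
          exact hβ' (hfin.mem_toFinset.2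
            ⟨degree_of_mem_support hq (mem_support_iff.1 h2), hcon⟩)
        obtain ⟨i, hi, rfl⟩ := h3
        have h4 : ∏ j, linForm (v j) ^ (Finsupp.single i d) j = linForm (v i) ^ d := by
          rw [Finset.prod_eq_single i]
          · simp
          · intro j _ hj
            rw [Finsupp.single_eq_of_ne hj, pow_zero]
          · simp
        rw [h4, Submodule.mkQ_apply, (Submodule.Quotient.mk_eq_zero K).2 (hv i hi), smul_zero]

/-- Non-vanishing of the polynomial also allows tuples outside the product of the `Z i`. For these
the planted powers need not lie in `K`, so this has to be a hypothesis of the property. -/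
theorem holdsOff_avoids {K : Submodule 𝕜 (MvPolynomial (Fin n) 𝕜)} {planted : Fin R → Prop}
    {Z : Fin R → Set (Fin n → 𝕜)} (hZ : ∀ i, planted i → ∀ x ∈ Z i, linForm x ^ d ∈ K)
    (h : ∃ v, (∀ i, v i ∈ Z i) ∧ Avoids K d planted v) :
    HoldsOff (tupleProduct Z) fun w => (∀ i, planted i → linForm (Function.curry w i) ^ d ∈ K) →
      Avoids K d planted (Function.curry w) := by
  have hfin : Finite {α : Fin R →₀ ℕ // α.degree = d ∧ ∀ i, planted i → α ≠ Finsupp.single i d} :=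
    ((finite_degree_eq R d).subset fun α hα => hα.1 :
      {α : Fin R →₀ ℕ | α.degree = d ∧ ∀ i, planted i → α ≠ Finsupp.single i d}.Finite).to_subtype
  have hmap : ∀ (w : Fin R × Fin n → 𝕜) (α : Fin R →₀ ℕ), map (eval w)
      (∏ i, linForm (fun a => (X (i, a) : MvPolynomial (Fin R × Fin n) 𝕜)) ^ α i) =
      ∏ i, linForm (Function.curry w i) ^ α i := by
    intro w α
    simp only [map_prod, map_pow, map_linForm, eval_X]
    rfl
  have key := holdsOff_linearIndependent K (W := tupleProduct Z)
    (fun α : {α : Fin R →₀ ℕ // α.degree = d ∧ ∀ i, planted i → α ≠ Finsupp.single i d} =>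
      ∏ i, linForm (fun a => (X (i, a) : MvPolynomial (Fin R × Fin n) 𝕜)) ^ (α : Fin R →₀ ℕ) i) (by
      obtain ⟨v, hv, hA⟩ := h
      refine ⟨Function.uncurry v, hv, ?_⟩
      simp only [hmap]
      exact (avoids_iff fun i hi => hZ i hi _ (hv i)).1 hA)
  refine key.mono fun w hw hK => (avoids_iff hK).2 ?_
  simp only [hmap] at hw
  exact hw

theorem aeval_cons_eq_sum {A : Type*} [CommRing A] [Algebra 𝕜 A] (a : A) (b : Fin R → A)
    {q : MvPolynomial (Fin (R + 1)) 𝕜} (hq : q.totalDegree ≤ d) :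
    aeval (Fin.cons a b : Fin (R + 1) → A) q =
      ∑ e ∈ Finset.range (d + 1), a ^ e * aeval b ((finSuccEquiv 𝕜 R q).coeff e) := by
  have h1 : aeval (Fin.cons a b : Fin (R + 1) → A) q =
      (finSuccEquiv 𝕜 R q).eval₂ (aeval b : MvPolynomial (Fin R) 𝕜 →ₐ[𝕜] A).toRingHom a := by
    clear hq
    induction q using MvPolynomial.induction_on with
    | C c => simp [finSuccEquiv_apply]
    | add p q hp hq => rw [map_add, map_add, Polynomial.eval₂_add, hp, hq]
    | mul_X p i hp =>
      rw [map_mul, map_mul, Polynomial.eval₂_mul, hp, aeval_X]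
      congr 1
      refine Fin.cases ?_ (fun j => ?_) i
      · simp [finSuccEquiv_X_zero]
      · simp [finSuccEquiv_X_succ]
  rw [h1, Polynomial.eval₂_eq_sum_range' _ (n := d + 1)]
  · exact Finset.sum_congr rfl fun e _ => mul_comm _ _
  · rw [natDegree_finSuccEquiv]
    exact Nat.lt_succ_of_le ((degreeOf_le_totalDegree q 0).trans hq)

end Avoidance

end

section

/-! ### The induction on the number of vectors -/

section Avoidance

open MvPolynomial

variable {𝕜 : Type*} [Field 𝕜] {n d R : ℕ}

theorem term_mem_of_sum_mem {M : Type*} [AddCommGroup M] [Module 𝕜 M] {K B : Submodule 𝕜 M}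
    {T : ℕ → M} {e : ℕ} (he : e ≤ d) (h : ∑ j ∈ Finset.range (d + 1), T j ∈ K)
    (hlt : ∀ j < e, T j ∈ K) (hgt : ∀ j, e < j → j ≤ d → T j ∈ B) : T e ∈ K ⊔ B := by
  have hmem : e ∈ Finset.range (d + 1) := Finset.mem_range.2 (by omega)
  rw [← Finset.add_sum_erase _ _ hmem] at h
  rw [← add_sub_cancel_right (T e) (∑ j ∈ (Finset.range (d + 1)).erase e, T j)]
  refine sub_mem (Submodule.mem_sup_left h) (sum_mem fun j hj => ?_)
  rw [Finset.mem_erase, Finset.mem_range] at hj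
  rcases lt_or_gt_of_ne hj.1 with hje | hje
  · exact Submodule.mem_sup_left (hlt j hje)
  · exact Submodule.mem_sup_right (hgt j hje (by omega))

theorem isHomogeneous_aeval_linForm {q : MvPolynomial (Fin R) 𝕜} (hq : q.IsHomogeneous d)
    (v : Fin R → Fin n → 𝕜) : (aeval (fun i => linForm (v i)) q).IsHomogeneous d := by
  rw [q.as_sum, map_sum]
  refine IsHomogeneous.sum _ _ _ fun α hα => ?_
  have hdeg := degree_of_mem_support hq (mem_support_iff.1 hα)
  rw [aeval_monomial, Finsupp.prod_fintype _ _ fun i => pow_zero _, algebraMap_eq]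
  have h1 := (isHomogeneous_C (Fin n) (coeff α q)).mul (IsHomogeneous.prod Finset.univ
    (fun i => linForm (v i) ^ α i) (fun i => 1 * α i) fun i _ => (isHomogeneous_linForm (v i)).pow (α i))
  rw [zero_add] at h1
  simp only [one_mul] at h1
  rwa [← Finsupp.degree_eq_sum, hdeg] at h1

/-- The forms of degree `d - e` that are multiplied into `K`, modulo `ℓ ^ (e + 1)`, by `ℓ ^ e`. -/
def residual (K : Submodule 𝕜 (MvPolynomial (Fin n) 𝕜)) (d : ℕ) (x : Fin n → 𝕜) (e : ℕ) :
    Submodule 𝕜 (MvPolynomial (Fin n) 𝕜) :=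
  (K ⊔ (homogeneousSubmodule (Fin n) 𝕜 (d - e - 1)).map
    (LinearMap.mulLeft 𝕜 (linForm x ^ (e + 1)))).comap (LinearMap.mulLeft 𝕜 (linForm x ^ e))

/-- If the tail avoids all residual spaces and `v₀` itself is either planted or general, then the
whole tuple avoids `K`. -/
theorem avoids_cons {K : Submodule 𝕜 (MvPolynomial (Fin n) 𝕜)} {planted : Fin (R + 1) → Prop}
    {x : Fin n → 𝕜} {v : Fin R → Fin n → 𝕜} (hx : ¬ planted 0 → linForm x ^ d ∉ K)
    (hv : ∀ i : Fin R, planted i.succ → linForm (v i) ^ d ∈ K)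
    (h : ∀ e ∈ Finset.range d, Avoids (residual K d x e) (d - e)
      (fun i : Fin R => e = 0 ∧ planted i.succ) v) :
    Avoids K d planted (Fin.cons x v : Fin (R + 1) → Fin n → 𝕜) := by
  intro q hq hqK
  set c : ℕ → MvPolynomial (Fin R) 𝕜 := fun e => (finSuccEquiv 𝕜 R q).coeff e with hc
  have hcoeff : ∀ e α, coeff α (c e) = coeff (α.cons e) q := fun e α =>
    finSuccEquiv_coeff_coeff α q e
  set T : ℕ → MvPolynomial (Fin n) 𝕜 := fun e => linForm x ^ e * aeval (fun i => linForm (v i)) (c e)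
    with hT
  have hsum : ∑ e ∈ Finset.range (d + 1), T e ∈ K := by
    rw [← aeval_cons_eq_sum _ _ hq.totalDegree_le]
    have h1 : (Fin.cons (linForm x) fun i => linForm (v i) : Fin (R + 1) → MvPolynomial (Fin n) 𝕜) =
        fun i => linForm ((Fin.cons x v : Fin (R + 1) → Fin n → 𝕜) i) :=
      funext (Fin.cases rfl fun _ => rfl)
    rwa [h1]
  have hchom : ∀ e ≤ d, (c e).IsHomogeneous (d - e) := fun e he =>
    hq.finSuccEquiv_coeff_isHomogeneous e (d - e) (by omega)
  have hTmem : ∀ e ≤ d, ∀ j, e ≤ j → j ≤ d → T j ∈ (homogeneousSubmodule (Fin n) 𝕜 (d - e)).map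
      (LinearMap.mulLeft 𝕜 (linForm x ^ e)) := by
    intro e he j hej hjd
    refine ⟨linForm x ^ (j - e) * aeval (fun i => linForm (v i)) (c j), ?_, ?_⟩
    · have h1 := ((isHomogeneous_linForm x).pow (j - e)).mul
        (isHomogeneous_aeval_linForm (hchom j hjd) v)
      rwa [show 1 * (j - e) + (d - j) = d - e by omega] at h1
    · rw [LinearMap.mulLeft_apply, ← mul_assoc, ← pow_add, Nat.add_sub_cancel' hej]
  -- The terms below `e` lie in `K` and those above are divisible by `ℓ ^ (e + 1)`. Hence the
  -- coefficient at `ℓ ^ e` falls into the residual space, which the tail avoids.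
  have key : ∀ e < d, (∀ α, (∀ i : Fin R, e = 0 ∧ planted i.succ → α ≠ Finsupp.single i (d - e)) →
      coeff α (c e) = 0) ∧ T e ∈ K := by
    intro e
    induction e using Nat.strong_induction_on with
    | h e ih =>
      intro hed
      have h1 := term_mem_of_sum_mem (e := e) hed.le hsum (fun j hj => (ih j hj (hj.trans hed)).2)
        fun j hj hjd => hTmem (e + 1) hed j hj hjd
      have h2 : ∀ α, (∀ i : Fin R, e = 0 ∧ planted i.succ → α ≠ Finsupp.single i (d - e)) →
          coeff α (c e) = 0 :=
        h e (Finset.mem_range.2 hed) (c e) (hchom e hed.le) h1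
      refine ⟨h2, ?_⟩
      simp only [hT]
      rw [(c e).as_sum, map_sum, Finset.mul_sum]
      refine sum_mem fun α hα => ?_
      -- Only pure powers of planted vectors can survive, and only for `e = 0`. They lie in `K`, so
      -- the term may be discarded before the next one is treated.
      have h3 : ∃ i : Fin R, (e = 0 ∧ planted i.succ) ∧ α = Finsupp.single i (d - e) := by
        by_contra! hcon
        exact mem_support_iff.1 hα (h2 α hcon)
      obtain ⟨i, ⟨rfl, hi⟩, rfl⟩ := h3
      rw [pow_zero, one_mul, Nat.sub_zero, aeval_monomial, Finsupp.prod_single_index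
        (h := fun i k => linForm (v i) ^ k) (pow_zero _), ← Algebra.smul_def]
      exact K.smul_mem _ (hv i hi)
  intro α hα
  by_contra hne
  have hdeg := degree_of_mem_support hq hne
  have hcons : α = (Finsupp.tail α).cons (α 0) := (Finsupp.cons_tail α).symm
  have hne' : coeff (Finsupp.tail α) (c (α 0)) ≠ 0 := by rwa [hcoeff, ← hcons]
  have hle : α 0 ≤ d := hdeg ▸ Finsupp.le_degree 0 α
  rcases hle.lt_or_eq with hlt | heq
  · refine hne' ((key (α 0) hlt).1 _ ?_)
    rintro i ⟨h0, hi⟩ htail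
    refine hα i.succ hi ?_
    rw [hcons, htail, h0, Nat.sub_zero]
    ext j
    refine Fin.cases ?_ (fun j => ?_) j
    · rw [Finsupp.cons_zero, Finsupp.single_eq_of_ne (Fin.succ_ne_zero i).symm]
    · rw [Finsupp.cons_succ]
      simp [Finsupp.single_apply]
  · have h0 : α = Finsupp.single 0 d := by
      ext j
      by_cases hj : j = 0
      · rw [hj, heq, Finsupp.single_eq_same]
      · rw [Finsupp.single_eq_of_ne hj]
        have h1 : α.degree = ∑ i, α i := Finsupp.degree_eq_sum α
        rw [hdeg, ← Finset.add_sum_erase _ _ (Finset.mem_univ 0), heq] at h1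
        have h2 := Finset.single_le_sum (f := fun i => α i) (fun i _ => Nat.zero_le _)
          (Finset.mem_erase.2 ⟨hj, Finset.mem_univ j⟩)
        omega
    have hpl : ¬ planted 0 := fun hp => hα 0 hp h0
    -- All lower terms lie in `K`, so the remaining multiple of `ℓ ^ d` does as well, although `ℓ ^
    -- d` is not in `K` for a vector that is not planted.
    have h1 := term_mem_of_sum_mem (B := ⊥) le_rfl hsum (fun j hj => (key j hj).2)
      fun j hj hjd => absurd hj hjd.not_gt
    rw [sup_bot_eq] at h1
    have h2 : c d = C (coeff 0 (c d)) := by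
      have := hchom d le_rfl
      rw [Nat.sub_self] at this
      exact totalDegree_eq_zero_iff_eq_C.1 (Nat.le_zero.1 this.totalDegree_le)
    have h3 : coeff 0 (c d) ≠ 0 := by
      have h4 : Finsupp.tail α = 0 := by
        rw [h0]
        ext j
        simp [Finsupp.tail_apply]
      rwa [heq, h4] at hne'
    simp only [hT] at h1
    rw [h2, aeval_C, algebraMap_eq, mul_comm, ← smul_eq_C_mul] at h1
    exact hx hpl ((K.smul_mem_iff h3).1 h1)

/-- The codimension of the residual space is the dimension of `ℓ^e S_{d-e}` modulo `K + ℓ^{e+1}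
S_{d-e-1}`. Compared with the dimension modulo `K`, at most `dim S_{d-e-1} ≤ n^{d-e-1}` is lost. -/
theorem le_dimMod_residual {K : Submodule 𝕜 (MvPolynomial (Fin n) 𝕜)} {x : Fin n → 𝕜} {e r : ℕ}
    (h : r + n ^ (d - e - 1) ≤ dimMod K ((homogeneousSubmodule (Fin n) 𝕜 (d - e)).map
      (LinearMap.mulLeft 𝕜 (linForm x ^ e)))) :
    r ≤ dimMod (residual K d x e) (homogeneousSubmodule (Fin n) 𝕜 (d - e)) := by
  rw [residual, dimMod_comap]
  have h1 := h.trans (dimMod_le_add K _ ((homogeneousSubmodule (Fin n) 𝕜 (d - e - 1)).map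
    (LinearMap.mulLeft 𝕜 (linForm x ^ (e + 1)))))
  have h2 := (dimMod_le_finrank K ((homogeneousSubmodule (Fin n) 𝕜 (d - e - 1)).map
    (LinearMap.mulLeft 𝕜 (linForm x ^ (e + 1))))).trans
    ((Submodule.finrank_map_le _ _).trans finrank_homogeneousSubmodule_le)
  omega

/-- If `K` has codimension at least `R * n ^ (d - 1)` among the forms of degree `d`, then a general
tuple avoids `K`. -/
theorem exists_avoids [CharZero 𝕜] (hn : 0 < n) (R : ℕ) : ∀ (d : ℕ), 1 ≤ d →
    ∀ (K : Submodule 𝕜 (MvPolynomial (Fin n) 𝕜)) (planted : Fin R → Prop)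
    (Z : Fin R → Set (Fin n → 𝕜)), (∀ i, PolyIrreducible (Z i)) →
    (∀ i, NonVanishing (d - 1) (Z i)) → (∀ i, ¬ planted i → NonVanishing d (Z i)) →
    (∀ i, planted i → ∀ x ∈ Z i, linForm x ^ d ∈ K) →
    R * n ^ (d - 1) ≤ dimMod K (homogeneousSubmodule (Fin n) 𝕜 d) →
    ∃ v, (∀ i, v i ∈ Z i) ∧ Avoids K d planted v := by
  -- The degree and the space `K` stay universally quantified, because the tail has to avoid
  -- residual spaces in all lower degrees.
  induction R with
  | zero =>
    intro d hd K planted Z _ _ _ _ _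
    refine ⟨fun i => i.elim0, fun i => i.elim0, fun q hq _ α _ => ?_⟩
    by_contra hne
    have h1 := degree_of_mem_support hq hne
    rw [Subsingleton.elim α 0, map_zero] at h1
    omega
  | succ R ih =>
    intro d hd K planted Z hZ hZ1 hZ2 hpl hdim
    -- The first vector shall achieve its share of the dimension for all `e` between `1` and `d -
    -- 1`; for `e = 0` this is the hypothesis. The power `e = d` matters only for a vector that is
    -- not planted, so forms of degree `d - 1` suffice for the planted ones.
    have hx : ∃ x ∈ Z 0, (∀ e ∈ Finset.Icc 1 (d - 1), (R + 1) * n ^ (d - e - 1) ≤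
        dimMod K ((homogeneousSubmodule (Fin n) 𝕜 (d - e)).map
          (LinearMap.mulLeft 𝕜 (linForm x ^ e)))) ∧ (¬ planted 0 → linForm x ^ d ∉ K) := by
      refine HoldsOff.exists (HoldsOff.and (hZ 0) (holdsOff_forall (hZ 0) _ fun e he => ?_) ?_)
      · rw [Finset.mem_Icc] at he
        refine holdsOff_le_dimMod K (exists_le_dimMod K hn ((hZ1 0).mono hn he.2)
          (Nat.mul_pos R.succ_pos (pow_pos hn _)) ?_)
        rw [Nat.add_sub_cancel' (by omega : e ≤ d)]
        refine le_trans (le_of_eq ?_) hdim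
        rw [mul_left_comm, ← pow_add]
        congr 2
        omega
      · by_cases hp : planted 0
        · exact holdsOff_of_forall (hZ 0) fun x h => absurd hp h
        · refine (holdsOff_pow_notMem K ?_).mono fun x h _ => h
          by_contra! hcon
          have h1 : homogeneousSubmodule (Fin n) 𝕜 d ≤ K := by
            rw [← (hZ2 0 hp).span_eq, Submodule.span_le]
            rintro _ ⟨x, hx, rfl⟩
            exact hcon x hx
          have h2 : dimMod K (homogeneousSubmodule (Fin n) 𝕜 d) = 0 := by
            rw [dimMod, LinearMap.le_ker_iff_map.1 (by rwa [Submodule.ker_mkQ]),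
              finrank_bot]
          have h3 : 0 < (R + 1) * n ^ (d - 1) := Nat.mul_pos R.succ_pos (pow_pos hn _)
          omega
    obtain ⟨x, hx0, hxdim, hxK⟩ := hx
    -- The induction hypothesis provides one tail for each `e`; by openness and irreducibility a
    -- single tail serves all of them.
    have htail : ∃ w ∈ tupleProduct fun i : Fin R => Z i.succ, ∀ e ∈ Finset.range d,
        (∀ i : Fin R, e = 0 ∧ planted i.succ →
          linForm (Function.curry w i) ^ (d - e) ∈ residual K d x e) →
        Avoids (residual K d x e) (d - e) (fun i : Fin R => e = 0 ∧ planted i.succ)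
          (Function.curry w) := by
      refine HoldsOff.exists (holdsOff_forall (polyIrreducible_tupleProduct fun i => hZ i.succ) _
        fun e he => ?_)
      rw [Finset.mem_range] at he
      have hplanted : ∀ i : Fin R, e = 0 ∧ planted i.succ → ∀ y ∈ Z i.succ,
          linForm y ^ (d - e) ∈ residual K d x e := by
        rintro i ⟨rfl, hi⟩ y hy
        rw [residual, Submodule.mem_comap, LinearMap.mulLeft_apply, pow_zero, one_mul]
        exact Submodule.mem_sup_left (hpl _ hi y hy)
      refine holdsOff_avoids hplanted (ih (d - e) (by omega) _ _ _ (fun i => hZ i.succ)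
        (fun i => (hZ1 i.succ).mono hn (by omega)) (fun i hi => ?_) hplanted
        (le_dimMod_residual ?_))
      · rcases Nat.eq_zero_or_pos e with rfl | he0
        · exact hZ2 i.succ fun hp => hi ⟨rfl, hp⟩
        · exact (hZ1 i.succ).mono hn (by omega)
      -- Of the `R + 1` units of size `n ^ (d - e - 1)`, one is given up in passing to the residual
      -- space.
      · rw [← Nat.succ_mul]
        rcases Nat.eq_zero_or_pos e with rfl | he0
        · have h1 : LinearMap.mulLeft 𝕜 (linForm x ^ 0) = LinearMap.id := by
            rw [pow_zero, LinearMap.mulLeft_one]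
          rw [h1, Submodule.map_id]
          exact hdim
        · exact hxdim e (Finset.mem_Icc.2 ⟨he0, by omega⟩)
    obtain ⟨w, hw, hwA⟩ := htail
    refine ⟨Fin.cons x (Function.curry w), Fin.cases hx0 hw, avoids_cons hxK
      (fun i hi => hpl _ hi _ (hw i)) fun e he => hwA e he ?_⟩
    rintro i ⟨rfl, hi⟩
    rw [residual, Submodule.mem_comap, LinearMap.mulLeft_apply, pow_zero, one_mul]
    exact Submodule.mem_sup_left (hpl _ hi _ (hw i))

end Avoidance

end

section

/-! ### Irreducible components and genericity -/

section Components

open MvPolynomial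

variable {𝕜 : Type*} [Field 𝕜] {σ : Type*}

theorem isOpen_zariski_ne_zero (g : MvPolynomial σ 𝕜) :
    IsOpen[zariski σ 𝕜] {x | eval x g ≠ 0} := by
  refine ⟨{g}, ?_⟩
  ext x
  simp [zeroSet]

theorem exists_eval_ne_zero_of_isOpen {U : Set (σ → 𝕜)} (hU : IsOpen[zariski σ 𝕜] U) {x : σ → 𝕜}
    (hx : x ∈ U) : ∃ g : MvPolynomial σ 𝕜, eval x g ≠ 0 ∧ ∀ y, eval y g ≠ 0 → y ∈ U := by
  obtain ⟨S, hS⟩ : ∃ S, Uᶜ = zeroSet S := hU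
  have h1 : x ∉ zeroSet S := by
    rw [← hS]
    simpa using hx
  simp only [zeroSet, Set.mem_ofPred_eq, not_forall] at h1
  obtain ⟨g, hg, hgx⟩ := h1
  refine ⟨g, hgx, fun y hy => ?_⟩
  by_contra hyU
  have h2 : y ∈ Uᶜ := hyU
  rw [hS] at h2
  exact hy (h2 g hg)

theorem polyIrreducible_of_isIrreducible {Z : Set (σ → 𝕜)}
    (hZ : @IsIrreducible _ (zariski σ 𝕜) Z) : PolyIrreducible Z :=
  ⟨hZ.1, fun g h hg hh =>
    hZ.2 _ _ (isOpen_zariski_ne_zero g) (isOpen_zariski_ne_zero h) hg hh⟩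

theorem polyIrreducible_univ [Infinite 𝕜] : PolyIrreducible (Set.univ : Set (σ → 𝕜)) := by
  refine ⟨⟨0, trivial⟩, fun g h hg hh => ?_⟩
  by_contra! hcon
  have h1 : g * h = 0 := MvPolynomial.funext fun x => by
    rw [map_mul, map_zero, mul_eq_zero]
    exact or_iff_not_imp_left.2 fun hx => hcon x trivial hx
  rcases mul_eq_zero.1 h1 with rfl | rfl
  · simp at hg
  · simp at hh

theorem nonVanishing_univ [Infinite 𝕜] {n : ℕ} (e : ℕ) :
    NonVanishing e (Set.univ : Set (Fin n → 𝕜)) := fun g _ hg =>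
  MvPolynomial.funext fun x => by rw [hg x trivial, map_zero]

/-- Every point of a set lies on an irreducible component. -/
theorem exists_isComponent {X : Set (σ → 𝕜)} {x : σ → 𝕜} (hx : x ∈ X) :
    ∃ Z, x ∈ Z ∧ IsComponent X Z := by
  let _ : TopologicalSpace (σ → 𝕜) := zariski σ 𝕜
  obtain ⟨Z, hxZ, hZ⟩ := zorn_subset_nonempty {Z : Set (σ → 𝕜) | IsIrreducible Z ∧ Z ⊆ X}
    -- The union of a chain of irreducible sets is irreducible, as two open sets that meet it
    -- already meet a common member.
    (fun c hc hcc hne => by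
      refine ⟨⋃₀ c, ⟨⟨?_, ?_⟩, Set.sUnion_subset fun Z hZ => (hc hZ).2⟩,
        fun Z hZ => Set.subset_sUnion_of_mem hZ⟩
      · obtain ⟨Z, hZ⟩ := hne
        exact (hc hZ).1.1.mono (Set.subset_sUnion_of_mem hZ)
      · rintro u v hu hv ⟨y, ⟨p, hp, hyp⟩, hyu⟩ ⟨z, ⟨q, hq, hzq⟩, hzv⟩
        rcases hcc.total hp hq with hpq | hqp
        · obtain ⟨w, hw, hwuv⟩ := (hc hq).1.2 u v hu hv ⟨y, hpq hyp, hyu⟩ ⟨z, hzq, hzv⟩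
          exact ⟨w, ⟨q, hq, hw⟩, hwuv⟩
        · obtain ⟨w, hw, hwuv⟩ := (hc hp).1.2 u v hu hv ⟨y, hyp, hyu⟩ ⟨z, hqp hzq, hzv⟩
          exact ⟨w, ⟨p, hp, hw⟩, hwuv⟩)
    {x} ⟨isIrreducible_singleton, Set.singleton_subset_iff.2 hx⟩
  exact ⟨Z, hxZ (Set.mem_singleton x), hZ⟩

/-- A property is generic if every point of `Y` lies on an irreducible subset of `Y` on which the
property holds off the zero set of a polynomial. -/
theorem generically_of_holdsOff {R n : ℕ} {Y : Set (Fin R → Fin n → 𝕜)}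
    {P : (Fin R → Fin n → 𝕜) → Prop}
    (h : ∀ v ∈ Y, ∃ W, PolyIrreducible W ∧ Function.uncurry v ∈ W ∧
      W ⊆ Function.uncurry '' Y ∧ HoldsOff W fun w => Function.curry w ∈ Y → P (Function.curry w)) :
    Generically Y P := by
  -- All polynomials off whose zero sets the property holds. The open set is where at least one of
  -- them does not vanish, so it does not depend on the choice of components.
  set H : Set (MvPolynomial (Fin R × Fin n) 𝕜) :=
    {g | ∀ w, eval w g ≠ 0 → Function.curry w ∈ Y → P (Function.curry w)} with hH
  refine ⟨(zeroSet H)ᶜ, ⟨H, compl_compl _⟩, ?_, fun v hv hvO => ?_⟩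
  · rintro _ ⟨v, hv, rfl⟩
    rw [@mem_closure_iff _ (zariski (Fin R × Fin n) 𝕜)]
    intro U hU hvU
    obtain ⟨g₀, hg₀, hgU⟩ := exists_eval_ne_zero_of_isOpen hU hvU
    obtain ⟨W, hW, hvW, hWY, g, hg, hgP⟩ := h v hv
    obtain ⟨w, hw, h1, h2⟩ := hW.2 g₀ g ⟨_, hvW, hg₀⟩ hg
    exact ⟨w, hgU w h1, hWY hw, fun hwH => h2 (hwH g hgP)⟩
  · simp only [Set.mem_compl_iff, zeroSet, Set.mem_ofPred_eq, not_forall] at hvO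
    obtain ⟨g, hg, hgv⟩ := hvO
    exact hg (Function.uncurry v) hgv hv

end Components

/-! ### The search space in terms of forms -/

section Search

open MvPolynomial

variable {𝕜 : Type*} [Field 𝕜] [CharZero 𝕜] {n d p R s : ℕ}

/-- The forms, regarded as symmetric tensors, that are orthogonal to all `f j`. -/
def orthogonalForms (d : ℕ) (f : Fin p → MvPolynomial (Fin n) 𝕜) :
    Submodule 𝕜 (MvPolynomial (Fin n) 𝕜) where
  carrier := {g | ∀ j, pairing d (f j) (formTensor d g) = 0}
  add_mem' := fun {a b} ha hb j => by
    have h1 := ha j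
    have h2 := hb j
    simp only [pairing] at h1 h2 ⊢
    simp only [formTensor_add a b, Pi.add_apply, mul_add, Finset.sum_add_distrib, h1, h2, add_zero]
  zero_mem' := fun j => by simp [pairing, formTensor]
  smul_mem' := fun c g hg j => by
    have h1 := hg j
    simp only [pairing] at h1 ⊢
    simp only [formTensor_smul c g, Pi.smul_apply, smul_eq_mul, mul_left_comm _ c, ← Finset.mul_sum,
      h1, mul_zero]

theorem mem_orthogonalForms {f : Fin p → MvPolynomial (Fin n) 𝕜} {g : MvPolynomial (Fin n) 𝕜} :
    g ∈ orthogonalForms d f ↔ ∀ j, pairing d (f j) (formTensor d g) = 0 := Iff.rfl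

theorem linForm_pow_mem_orthogonalForms {f : Fin p → MvPolynomial (Fin n) 𝕜}
    (hf : ∀ i, (f i).IsHomogeneous d) {x : Fin n → 𝕜} :
    linForm x ^ d ∈ orthogonalForms d f ↔ x ∈ zeroSet (Set.range f) := by
  simp only [mem_orthogonalForms, formTensor_linForm_pow, eval_eq_pairing (hf _), zeroSet,
    Set.forall_mem_range, Set.mem_ofPred_eq]

/-- Pairing with the `f j` maps the forms of degree `d` onto `𝕜^p`: a functional that vanishes on
the image would, evaluated on powers of linear forms, give a linear relation between the `f j` as
functions. -/
theorem le_dimMod_orthogonalForms {f : Fin p → MvPolynomial (Fin n) 𝕜}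
    (hf : ∀ i, (f i).IsHomogeneous d) (hLI : LinearIndependent 𝕜 f) :
    p ≤ dimMod (orthogonalForms d f) (homogeneousSubmodule (Fin n) 𝕜 d) := by
  let Λ : MvPolynomial (Fin n) 𝕜 →ₗ[𝕜] Fin p → 𝕜 := LinearMap.pi fun j =>
    (Fintype.linearCombination 𝕜 (formTensor d (f j))).comp (formTensorHom 𝕜 n d)
  have hΛ : ∀ g j, Λ g j = pairing d (f j) (formTensor d g) := by
    intro g j
    simp only [Λ, LinearMap.pi_apply, LinearMap.comp_apply, Fintype.linearCombination_apply,
      smul_eq_mul, pairing]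
    exact Finset.sum_congr rfl fun a _ => mul_comm _ _
  have hker : orthogonalForms d f ≤ LinearMap.ker Λ := fun g hg =>
    LinearMap.mem_ker.2 (funext fun j => by rw [hΛ]; exact hg j)
  have htop : (homogeneousSubmodule (Fin n) 𝕜 d).map Λ = ⊤ := by
    by_contra hne
    obtain ⟨φ, hφ, hφW⟩ := Submodule.exists_le_ker_of_lt_top _ (lt_top_iff_ne_top.2 hne)
    have hφ' : ∀ y : Fin p → 𝕜, φ y = ∑ j, φ (Pi.single j 1) * y j := by
      intro y
      conv_lhs => rw [← Finset.univ_sum_single y, map_sum]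
      refine Finset.sum_congr rfl fun j _ => ?_
      rw [mul_comm, ← smul_eq_mul, ← map_smul, ← Pi.single_smul, smul_eq_mul, mul_one]
    have h1 : ∑ j, φ (Pi.single j 1) • f j = 0 := by
      refine MvPolynomial.funext fun x => ?_
      have h2 : φ (Λ (linForm x ^ d)) = 0 :=
        hφW ⟨_, by simpa using (isHomogeneous_linForm x).pow d, rfl⟩
      rw [hφ'] at h2
      simp only [hΛ, formTensor_linForm_pow, eval_eq_pairing (hf _)] at h2
      simpa [smul_eval] using h2
    have h2 := Fintype.linearIndependent_iff.1 hLI _ h1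
    refine hφ (LinearMap.ext fun y => ?_)
    rw [hφ', LinearMap.zero_apply]
    exact Finset.sum_eq_zero fun j _ => by rw [h2 j, zero_mul]
  have h1 : ((homogeneousSubmodule (Fin n) 𝕜 d).map (orthogonalForms d f).mkQ).map
      ((orthogonalForms d f).liftQ Λ hker) = ⊤ := by
    rw [← Submodule.map_comp, Submodule.liftQ_mkQ, htop]
  have h2 := Submodule.finrank_map_le ((orthogonalForms d f).liftQ Λ hker)
    ((homogeneousSubmodule (Fin n) 𝕜 d).map (orthogonalForms d f).mkQ)
  rw [h1, finrank_top, Module.finrank_fin_fun] at h2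
  exact h2

/-- The coefficients of `t` in the symmetrized products of the `v i` are collected in a form `q` in
`R` variables, to which the definition of `Avoids` applies. -/
theorem exists_form_of_mem_searchSpace {f : Fin p → MvPolynomial (Fin n) 𝕜} {v : Fin R → Fin n → 𝕜}
    {t : (Fin d → Fin n) → 𝕜} (ht : t ∈ searchSpace d f v) :
    ∃ q : MvPolynomial (Fin R) 𝕜, q.IsHomogeneous d ∧
      aeval (fun i => linForm (v i)) q ∈ orthogonalForms d f ∧
      t = formTensor d (aeval (fun i => linForm (v i)) q) := by
  rw [mem_searchSpace, symPower_eq_span] at ht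
  obtain ⟨c, hc⟩ := (Submodule.mem_span_range_iff_exists_fun 𝕜).1 ht.1
  have h1 : t = formTensor d (aeval (fun i => linForm (v i))
      (∑ b : Fin d → Fin R, c b • monomial (content b) (1 : 𝕜))) := by
    change t = formTensorHom 𝕜 n d _
    rw [← hc, map_sum, map_sum]
    refine Finset.sum_congr rfl fun b _ => ?_
    rw [map_smul, map_smul, ← formTensor_prod_linForm, content, monomial_sum_one, map_prod]
    congr 2
    exact Finset.prod_congr rfl fun k _ => (aeval_X (fun i => linForm (v i)) (b k)).symm
  refine ⟨_, IsHomogeneous.sum _ _ _ fun b _ => ?_, ?_, h1⟩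
  · exact Submodule.smul_mem (homogeneousSubmodule (Fin R) 𝕜 d) _ (isHomogeneous_monomial_content b)
  · rw [mem_orthogonalForms, ← h1]
    exact ht.2

theorem searchSpace_congr {f : Fin p → MvPolynomial (Fin n) 𝕜} {u v : Fin R → Fin n → 𝕜}
    (h : Submodule.span 𝕜 (Set.range u) = Submodule.span 𝕜 (Set.range v)) :
    searchSpace d f u = searchSpace d f v := by
  rw [searchSpace, searchSpace, h]

/-- A tuple that avoids the forms orthogonal to `f` is linearly independent. -/
theorem Avoids.linearIndependent (hd : 2 ≤ d) {K : Submodule 𝕜 (MvPolynomial (Fin n) 𝕜)}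
    {planted : Fin R → Prop} {v : Fin R → Fin n → 𝕜} (h : Avoids K d planted v)
    (hv : ∀ i, v i ≠ 0) : LinearIndependent 𝕜 v := by
  rw [Fintype.linearIndependent_iff]
  intro c hc j
  have hne : ∀ i ≠ j, c i = 0 := by
    intro i hij
    -- A linear relation is multiplied by `X j ^ (d - 1)` to reach degree `d`. For `i ≠ j` the
    -- coefficient `c i` stands at a monomial that is not a pure `d`-th power, because `d ≥ 2`;
    -- hence it vanishes.
    set q : MvPolynomial (Fin R) 𝕜 := X j ^ (d - 1) * ∑ i, C (c i) * X i with hq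
    have h1 : q.IsHomogeneous d := by
      have h2 : (∑ i, C (c i) * X i : MvPolynomial (Fin R) 𝕜).IsHomogeneous 1 :=
        isHomogeneous_linForm c
      have h3 := ((isHomogeneous_X 𝕜 j).pow (d - 1)).mul h2
      rwa [show 1 * (d - 1) + 1 = d by omega] at h3
    have h2 : aeval (fun i => linForm (v i)) q = 0 := by
      have h3 : (∑ i, C (c i) * linForm (v i) : MvPolynomial (Fin n) 𝕜) = linForm (∑ i, c i • v i) := by
        simp only [linForm, Finset.mul_sum, ← mul_assoc, ← C_mul]
        rw [Finset.sum_comm]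
        refine Finset.sum_congr rfl fun a _ => ?_
        rw [← Finset.sum_mul, ← map_sum]
        simp
      have h4 : linForm (0 : Fin n → 𝕜) = 0 := by simp [linForm]
      rw [hq, map_mul, map_sum]
      simp only [map_mul, aeval_C, aeval_X, algebraMap_eq]
      rw [h3, hc, h4, mul_zero]
    have h3 := h q h1 (by rw [h2]; exact zero_mem K)
      (Finsupp.single j (d - 1) + Finsupp.single i 1) ?_
    · rw [hq, X_pow_eq_monomial, add_comm, add_comm (Finsupp.single i 1), coeff_monomial_mul, one_mul, coeff_sum,
        Finset.sum_eq_single i] at h3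
      · simpa [coeff_C_mul] using h3
      · intro k _ hk
        rw [coeff_C_mul, coeff_X, if_neg fun h => hk (Finsupp.single_left_injective one_ne_zero h), mul_zero]
      · simp
    · rintro k - hk
      have h4 := DFunLike.congr_fun hk i
      have h5 := DFunLike.congr_fun hk j
      simp only [Finsupp.add_apply, Finsupp.single_apply, if_neg hij, if_neg hij.symm, if_true] at h4 h5
      split_ifs at h4 h5 with h6 h7 <;> omega
  rw [Finset.sum_eq_single j (fun i _ hij => by rw [hne i hij, zero_smul]) (by simp)] at hc
  exact (smul_eq_zero.1 hc).resolve_right (hv j)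

/-- If the tuple avoids the forms orthogonal to `f` then the search space is spanned by the powers of
the planted vectors. -/
theorem Avoids.searchSpace_eq {f : Fin p → MvPolynomial (Fin n) 𝕜}
    (hf : ∀ i, (f i).IsHomogeneous d) (hs : s ≤ R) {v : Fin R → Fin n → 𝕜}
    (hv : v ∈ plantedTuples (zeroSet (Set.range f)) R s)
    (h : Avoids (orthogonalForms d f) d (fun i : Fin R => (i : ℕ) < s) v) :
    searchSpace d f v = Submodule.span 𝕜
      (Set.range fun i : Fin s => prodTensor fun _ : Fin d => v (Fin.castLE hs i)) := by
  apply le_antisymm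
  · intro t ht
    obtain ⟨q, hq, hqK, rfl⟩ := exists_form_of_mem_searchSpace ht
    change formTensorHom 𝕜 n d _ ∈ _
    rw [q.as_sum, map_sum, map_sum]
    refine sum_mem fun α hα => ?_
    have h1 : ∃ i : Fin R, (i : ℕ) < s ∧ α = Finsupp.single i d := by
      by_contra! hcon
      exact mem_support_iff.1 hα (h q hq hqK α hcon)
    obtain ⟨i, hi, rfl⟩ := h1
    rw [aeval_monomial, Finsupp.prod_single_index (h := fun i k => linForm (v i) ^ k) (pow_zero _),
      ← Algebra.smul_def, map_smul]
    refine Submodule.smul_mem _ _ (Submodule.subset_span ⟨⟨i, hi⟩, ?_⟩)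
    exact (formTensor_linForm_pow (v i)).symm
  · rw [Submodule.span_le]
    rintro _ ⟨i, rfl⟩
    rw [SetLike.mem_coe, mem_searchSpace]
    refine ⟨⟨Submodule.subset_span ⟨_, fun _ => Submodule.subset_span ⟨Fin.castLE hs i, rfl⟩, rfl⟩,
      prodTensor_const_mem _⟩, fun j => ?_⟩
    rw [eval_eq_pairing (hf j)]
    exact hv _ i.2 _ ⟨j, rfl⟩

end Search

/-! ### The generic search space -/

section Genericity

open MvPolynomial

variable {𝕜 : Type*} [RCLike 𝕜] {n d p R s : ℕ}

/-- The binomial coefficient is `(n + d - 1) / d!` times the rising product `n (n + 1) ⋯ (n + d -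
2)`, and that product is at least `n ^ (d - 1)`. -/
theorem mul_pow_le_of_le {δ : ℝ} (hd : 2 ≤ d)
    (hp : (p : ℝ) = δ * ((n + d - 1).choose d : ℝ))
    (hR : (R : ℝ) ≤ 1 / (d.factorial : ℝ) * δ * ((n : ℝ) + d - 1)) : R * n ^ (d - 1) ≤ p := by
  obtain ⟨e, rfl⟩ : ∃ e, d = e + 1 := ⟨d - 1, by omega⟩
  have hfac : (0 : ℝ) < (e + 1).factorial := by exact_mod_cast Nat.factorial_pos _
  have h1 : ((e + 1).factorial : ℝ) * ((n + (e + 1) - 1).choose (e + 1) : ℝ) =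
      ((n : ℝ) + e) * n.ascFactorial e := by
    have := Nat.ascFactorial_eq_factorial_mul_choose' n (e + 1)
    rw [Nat.ascFactorial_succ] at this
    exact_mod_cast this.symm
  have h2 : (n : ℝ) ^ e ≤ n.ascFactorial e := by
    exact_mod_cast Nat.pow_succ_le_ascFactorial n e
  have h3 : ((n + (e + 1) - 1).choose (e + 1) : ℝ) =
      1 / ((e + 1).factorial : ℝ) * (((n : ℝ) + e) * n.ascFactorial e) := by
    rw [← h1]
    field_simp
  have h4 : ((R * n ^ (e + 1 - 1) : ℕ) : ℝ) ≤ (p : ℝ) := by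
    rw [hp, h3, Nat.cast_mul, Nat.cast_pow, Nat.add_sub_cancel]
    calc (R : ℝ) * (n : ℝ) ^ e
        ≤ (1 / ((e + 1).factorial : ℝ) * δ * ((n : ℝ) + (e + 1 : ℕ) - 1)) * n.ascFactorial e :=
          mul_le_mul hR h2 (by positivity) ((Nat.cast_nonneg R).trans hR)
      _ = _ := by push_cast; ring
  exact_mod_cast h4

/-- For a generic tuple with `s` planted vectors, the tuple is linearly independent and the space
searched by the algorithm is spanned by the powers of the planted vectors. -/
theorem generically_searchSpace_eq (hn : 0 < n) (hd : 2 ≤ d) {f : Fin p → MvPolynomial (Fin n) 𝕜}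
    (hf : ∀ i, (f i).IsHomogeneous d) (hLI : LinearIndependent 𝕜 f) (hs : s ≤ R)
    (hX : s ≠ 0 → NonDegenerate (d - 1) (zeroSet (Set.range f))) (hp : R * n ^ (d - 1) ≤ p) :
    Generically (plantedTuples (zeroSet (Set.range f)) R s) fun v => LinearIndependent 𝕜 v ∧
      searchSpace d f v = Submodule.span 𝕜
        (Set.range fun i : Fin s => prodTensor fun _ : Fin d => v (Fin.castLE hs i)) := by
  classical
  refine generically_of_holdsOff fun v₀ hv₀ => ?_
  -- A component of `X` through the given point for the planted entries, the whole space for the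
  -- others.
  have hZ : ∀ i : Fin R, ∃ Z : Set (Fin n → 𝕜), v₀ i ∈ Z ∧ PolyIrreducible Z ∧
      NonVanishing (d - 1) Z ∧ (¬ (i : ℕ) < s → NonVanishing d Z) ∧
      ((i : ℕ) < s → Z ⊆ zeroSet (Set.range f)) := by
    intro i
    by_cases hi : (i : ℕ) < s
    · obtain ⟨Z, hvZ, hZ⟩ := exists_isComponent (hv₀ i hi)
      exact ⟨Z, hvZ, polyIrreducible_of_isIrreducible hZ.prop.1, hX (by omega) Z hZ,
        fun h => absurd hi h, fun _ => hZ.prop.2⟩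
    · exact ⟨Set.univ, trivial, polyIrreducible_univ, nonVanishing_univ _,
        fun _ => nonVanishing_univ _, fun h => absurd h hi⟩
  choose Z hvZ hirr hnv hnv' hZX using hZ
  have hpl : ∀ i : Fin R, (i : ℕ) < s → ∀ x ∈ Z i, linForm x ^ d ∈ orthogonalForms d f :=
    fun i hi x hx => (linForm_pow_mem_orthogonalForms hf).2 (hZX i hi hx)
  have hW := polyIrreducible_tupleProduct hirr
  refine ⟨tupleProduct Z, hW, hvZ, fun w hw => ⟨Function.curry w, fun i hi => hZX i hi (hw i),
    Function.uncurry_curry w⟩, ?_⟩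
  have h1 := holdsOff_avoids hpl (exists_avoids hn R d (by omega) (orthogonalForms d f) _ Z hirr hnv
    hnv' hpl (hp.trans (le_dimMod_orthogonalForms hf hLI)))
  have h2 : HoldsOff (tupleProduct Z) fun w => ∀ i ∈ (Finset.univ : Finset (Fin R)),
      Function.curry w i ≠ 0 := by
    refine holdsOff_forall hW _ fun i _ => ?_
    have h3 : ∃ x ∈ Z i, x ⟨0, hn⟩ ≠ 0 := by
      by_contra! hcon
      -- If the first coordinate vanished on `Z i`, then so would its power of degree `d - 1`, in
      -- which no form vanishes there.
      have h4 : (X ⟨0, hn⟩ ^ (d - 1) : MvPolynomial (Fin n) 𝕜) = 0 := by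
        refine hnv i _ (by simpa using (isHomogeneous_X 𝕜 (⟨0, hn⟩ : Fin n)).pow (d - 1))
          fun x hx => ?_
        rw [map_pow, eval_X, hcon x hx, zero_pow (by omega)]
      exact pow_ne_zero _ (X_ne_zero _) h4
    obtain ⟨x, hx, hx0⟩ := h3
    refine ⟨X (i, ⟨0, hn⟩), ⟨Function.uncurry (Function.update v₀ i x), fun j => ?_, ?_⟩,
      fun w hw h0 => ?_⟩
    · rcases eq_or_ne j i with rfl | hji
      · simpa [Function.uncurry] using hx
      · simpa [Function.uncurry, Function.update_of_ne hji] using hvZ j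
    · simpa [Function.uncurry] using hx0
    · rw [eval_X] at hw
      exact hw (congrFun h0 ⟨0, hn⟩)
  refine (h1.and hW h2).mono fun w hw hwY => ?_
  have h3 := hw.1 fun i hi => (linForm_pow_mem_orthogonalForms hf).2 (hwY i hi)
  exact ⟨h3.linearIndependent hd fun i => hw.2 i (Finset.mem_univ i), h3.searchSpace_eq hf hs hwY⟩

end Genericity

end

end ConicIntersection

end

/-! ### Resources, soundness and the genericity guarantee combined -/

theorem theorem1p1 (𝕜 : Type*) [RCLike 𝕜] [MeasurableSpace 𝕜] [BorelSpace 𝕜] :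
    ∃ (prog : Program) (C K : ℕ),
      -- `prog` implements the algorithm on all inputs in time `n ^ O(d)`, with `O(1)` oracle calls
      (∀ (n d p R : ℕ) (f : Fin p → MvPolynomial (Fin n) 𝕜) (u : Fin R → Fin n → 𝕜),
        2 ≤ n → 2 ≤ d → (∀ i, (f i).IsHomogeneous d) → LinearIndependent 𝕜 f →
        LinearIndependent 𝕜 u →
        ∃ (k : ℕ) (P : Fin k → (Fin d → Fin n) → 𝕜), IsSearchBasis f u P ∧
          ∀ (rnd : RandomTape 𝕜) (O : DiagOracle 𝕜), O.Valid →
            HaltsWithin O prog (n ^ (C * d)) K d f u rnd (Algorithm1 R P rnd)) ∧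
      -- every output of the algorithm other than "Fail" is correct
      (∀ (n d p R : ℕ) (f : Fin p → MvPolynomial (Fin n) 𝕜) (u : Fin R → Fin n → 𝕜),
        2 ≤ d → (∀ i, (f i).IsHomogeneous d) → LinearIndependent 𝕜 u →
        ∀ (k : ℕ) (P : Fin k → (Fin d → Fin n) → 𝕜), IsSearchBasis f u P →
          ∀ (rnd : RandomTape 𝕜) (out : Output 𝕜 n), Algorithm1 R P rnd out →
            out.Sound ((Submodule.span 𝕜 (Set.range u) : Set (Fin n → 𝕜)) ∩
              zeroSet (Set.range f))) ∧
      -- the genericity guarantee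
      (∀ (n d p R s : ℕ) (δ : ℝ) (X : Set (Fin n → 𝕜)) (f : Fin p → MvPolynomial (Fin n) 𝕜),
        0 < n → 2 ≤ d → 0 < δ → δ < 1 → (p : ℝ) = δ * ((n + d - 1).choose d : ℝ) →
        (∀ i, (f i).IsHomogeneous d) → LinearIndependent 𝕜 f → X = zeroSet (Set.range f) →
        (R : ℝ) ≤ 1 / (d.factorial : ℝ) * δ * ((n : ℝ) + d - 1) →
        ∀ hs : s ≤ R, (s ≠ 0 → NonDegenerate (d - 1) X) →
        Generically (plantedTuples X R s) fun v =>
          LinearIndependent 𝕜 v ∧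
          ExactlyUpToScale (𝕜 := 𝕜)
            ((Submodule.span 𝕜 (Set.range v) : Set (Fin n → 𝕜)) ∩ X)
            (fun i : Fin s => v (Fin.castLE hs i)) ∧
          ∀ u : Fin R → Fin n → 𝕜, LinearIndependent 𝕜 u →
            Submodule.span 𝕜 (Set.range u) = Submodule.span 𝕜 (Set.range v) →
            -- the functionals are drawn from any law without mass on proper subspaces,
            -- for instance the uniform spherical measure
            ∀ (σ : ∀ k : ℕ, Measure (Fin k → 𝕜)) [∀ k, IsProbabilityMeasure (σ k)],
              (∀ (k : ℕ) (W : Submodule 𝕜 (Fin k → 𝕜)), W ≠ ⊤ → σ k W = 0) →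
              (∀ (k : ℕ) (P : Fin k → (Fin d → Fin n) → 𝕜), IsSearchBasis f u P →
                ∀ᵐ rnd ∂(tapeLaw σ), ∀ out : Output 𝕜 n, Algorithm1 R P rnd out →
                  out.Recovers fun i : Fin s => v (Fin.castLE hs i)) ∧
              (∀ᵐ rnd ∂(tapeLaw σ), ∀ O : DiagOracle 𝕜, O.Valid →
                HaltsWithin O prog (n ^ (C * d)) K d f u rnd
                  (Output.Recovers fun i : Fin s => v (Fin.castLE hs i)))) := by
  obtain ⟨C, hC⟩ := searchProgram_halts 𝕜
  refine ⟨searchProgram, C, 1, hC, fun n d p R f u hd hf hu k P hP rnd out hout =>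
    algorithm1_sound hd hf hP hout, ?_⟩
  rintro n d p R s δ X f hn hd hδ hδ1 hp hf hLI rfl hR hs hX
  -- For `n = 1` the binomial coefficient is `1`, and `p = δ` would be an integer strictly between
  -- `0` and `1`.
  have hn2 : 2 ≤ n := by
    by_contra hlt
    obtain rfl : n = 1 := by omega
    rw [Nat.add_sub_cancel_left, Nat.choose_self, Nat.cast_one, mul_one] at hp
    have h0 : 0 < p := by exact_mod_cast hp.symm ▸ hδ
    have h1 : p < 1 := by exact_mod_cast hp.symm ▸ hδ1
    omega
  obtain ⟨O, hO, hdense, hgen⟩ :=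
    generically_searchSpace_eq hn hd hf hLI hs hX (mul_pow_le_of_le hd hp hR)
  refine ⟨O, hO, hdense, fun v hv hvO => ?_⟩
  obtain ⟨hvLI, hspan⟩ := hgen v hv hvO
  have hy : LinearIndependent 𝕜 fun i : Fin s => v (Fin.castLE hs i) :=
    hvLI.comp _ (Fin.castLE_injective hs)
  refine ⟨hvLI, exactlyUpToScale_of_searchSpace_eq hd hf hy hspan, fun u hu huv σ _ hσ => ?_⟩
  have hspan' := (searchSpace_congr huv).trans hspan
  refine ⟨fun k P hP => ae_recovers hd hs hy hspan' hσ hP, ?_⟩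
  obtain ⟨k, P, hP, hhalt⟩ := hC n d p R f u hn2 hd hf hLI hu
  -- The output of the program is an admissible output of the algorithm, so it is correct on the
  -- same event of probability one, whatever valid oracle is used.
  filter_upwards [ae_recovers hd hs hy hspan' hσ hP] with rnd hrnd O hO
  obtain ⟨m, t, q, hexec, ht, hq, hout⟩ := hhalt rnd O hO
  exact ⟨m, t, q, hexec, ht, hq, hrnd _ hout⟩
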